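/- **Setting.** Let $\Omega\subset\mathbb R^2$ be an open convex polygon, let $\Gamma\subset\Omega$ be a simple closed $C^{1,1}$ curve separating $\Omega$ into subdomains $\Omega^+$ and $\Omega^-$, and let $\alpha=\alpha^\pm$, $\beta=\beta^\pm$ on $\Omega^\pm$ with positive constants $\alpha^\pm,\beta^\pm$. Let $\mathcal T_h$ be a conforming triangulation of $\Omega$. An element $K$ is an interface element ($K\in\mathcal T_h^i$) if $|K\cap\Omega^+|>0$ and $|K\cap\Omega^-|>0$, and a non-interface element ($K\in\mathcal T_h^n$) otherwise. For every $K\in\mathcal T_h^i$ assume that $\Gamma\cap\partial K$ consists of two distinct points $\mathbf b_1,\mathbf b_2$ on two different edges and that $\Gamma\not\subset K$. The line through $\mathbf b_1,\mathbf b_2$ divides $K$ into $K_h^+$ and $K_h^-$ (one of them possibly empty), labelled so that the area on which the labels agree with $\Omega^\pm$ is at least the area obtained with the opposite labels. Put $\alpha_h=\alpha^\pm$, $\beta_h=\beta^\pm$ on $K_h^\pm$ for $K\in\mathcal T_h^i$; on $K\in\mathcal T_h^n$ let $\alpha_h,\beta_h$ be the constant values of $\alpha,\beta$. Let $\mathcal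 N_K$ be the set of vertices of $K$, together with $\mathbf b_1,\mathbf b_2$ if $K\in\mathcal T_h^i$; let $\mathcal E_K$ be the set of segments into which $\mathcal N_K$ cuts the edges of $K$; let $\mathcal N_h=\bigcup_K\mathcal N_K$ and $\mathcal E_h=\bigcup_K\mathcal E_K$. Let $\mathbf t$ be the counterclockwise unit tangent on $\partial K$ and $\operatorname{curl}\mathbf v=\partial_1v_2-\partial_2v_1$. **Continuous spaces.** With $K^\pm=K\cap\Omega^\pm$ and $\mathbf H^1(\operatorname{curl};D)=\{\mathbf u\in\mathbf H(\operatorname{curl};D):\operatorname{curl}\mathbf u\in H^1(D)\}$: * $H^2(\beta;\mathcal T_h)$ is the set of $u\in H^1(\Omega)$ such that $u\in H^2(K)$ for $K\in\mathcal T_h^n$, and $u\in H^2(K^\pm)$, $\beta\nabla u\in\mathbf H(\operatorname{div};K)$ for $K\in\mathcal T_h^i$; * $\mathbf H^1(\operatorname{curl},\alpha,\beta;\mathcal T_h)$ is the set of $\mathbf u\in\mathbf H(\operatorname{curl};\Omega)$ such that $\mathbf u\in\mathbf H^1(\operatorname{curl};K)$ for $K\in\mathcal T_h^n$, and $\mathbf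 u\in\mathbf H^1(\operatorname{curl};K^\pm)$, $\beta\mathbf u\in\mathbf H(\operatorname{div};K)$, $\alpha\operatorname{curl}\mathbf u\in H^1(K)$ for $K\in\mathcal T_h^i$. **Discrete spaces.** * $V_h^n$ is the set of $v\in H^1(\Omega)$ that are affine on each $K\in\mathcal T^n_h$ and satisfy, on each $K\in\mathcal T^i_h$, $\operatorname{div}(\beta_h\nabla v)=0$ weakly in $K$, with trace on $\partial K$ continuous and affine on each $e\in\mathcal E_K$; * $\mathbf V_h^e$ is the set of $\mathbf v\in\mathbf H(\operatorname{curl};\Omega)$ that are of lowest order Nédélec form $(a-cx_2,\;b+cx_1)$ on each $K\in\mathcal T_h^n$ and satisfy, on each $K\in\mathcal T_h^i$, $\operatorname{div}(\beta_h\mathbf v)=0$ weakly in $K$, $\alpha_h\operatorname{curl}\mathbf v$ constant on $K$, and $\mathbf v\cdot\mathbf t$ constant on each $e\in\mathcal E_K$; * $Q_h^{\alpha_h}$ is the set of $q$ that are constant on each $K\in\mathcal T_h^n$ and satisfy, on each $K\in\mathcal T_h^i$, $q=c^\pm$ on $K_h^\pm$ with constants $\alpha^+c^+=\alpha^-c^-$.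 **Maps.** For continuous $u$, $I_h^nu\in V_h^n$ is defined by $(I_h^nu)(\mathbf x)=u(\mathbf x)$ for all $\mathbf x\in\mathcal N_h$. For $\mathbf u\in\mathbf H(\operatorname{curl};\Omega)$ whose tangential trace on $\partial K$ is an integrable function for each $K$ (below: "$\mathbf u$ has edge moments"), $I_h^e\mathbf u\in\mathbf V_h^e$ is defined by $\int_eI_h^e\mathbf u\cdot\mathbf t\,ds=\int_e\mathbf u\cdot\mathbf t\,ds$ for all $e\in\mathcal E_h$. For $z\in L^2(\Omega)$, $\pi_h^{\alpha_h}z\in Q_h^{\alpha_h}$ is defined by $(\alpha_h\,\pi_h^{\alpha_h}z,v)_K=(\alpha_hz,v)_K$ for all $K$ and all $v\in Q_h^{\alpha_h}|_K$. **Lemma.** The diagram linking the continuous sequence to the discrete sequence commutes: 1. If $u\in H^2(\beta;\mathcal T_h)$ is continuous on $\overline\Omega$ and $\nabla u$ has edge moments, then $I_h^nu$ and $I_h^e\nabla u$ exist, are unique, and $$I_h^e\nabla u=\nabla I_h^nu .$$ 2. If $\mathbf u\in\mathbf H^1(\operatorname{curl},\alpha,\beta;\mathcal T_h)$ has edge moments,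 then $I_h^e\mathbf u$ and $\pi_h^{\alpha_h}\operatorname{curl}\mathbf u$ exist, are unique, and $$\operatorname{curl}I_h^e\mathbf u=\pi_h^{\alpha_h}\operatorname{curl}\mathbf u .$$ -/

import Mathlib

noncomputable section

namespace IVE

open MeasureTheory Set

open scoped ContDiff

/-- The Euclidean plane; the coordinates `x₁, x₂` are `x 0, x 1`. -/
abbrev Plane : Type := EuclideanSpace ℝ (Fin 2)

/-- The scalar cross product `a × b`. -/
def cross (a b : Plane) : ℝ := a 0 * b 1 - a 1 * b 0

/-! ### Sobolev spaces through weak derivatives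

Functions are representatives; every notion below depends only on the class modulo equality
almost everywhere on the open set `D`. -/

/-- Classical partial derivative in direction `i`, only applied to smooth functions. -/
def pd (i : Fin 2) (φ : Plane → ℝ) (x : Plane) : ℝ :=
  fderiv ℝ φ x (EuclideanSpace.single i 1)

/-- `φ ∈ C_c^∞(D)`. -/
def IsTest (D : Set Plane) (φ : Plane → ℝ) : Prop :=
  ContDiff ℝ ∞ φ ∧ HasCompactSupport φ ∧ tsupport φ ⊆ D

/-- Equality almost everywhere on `D`. -/
def EqAE {F : Type} (D : Set Plane) (f g : Plane → F) : Prop :=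
  ∀ᵐ x ∂(volume.restrict D), f x = g x

/-- `f ∈ L²(D)`, for scalar and for vector valued `f`. -/
def MemL2 {F : Type} [NormedAddCommGroup F] (D : Set Plane) (f : Plane → F) : Prop :=
  MemLp f 2 (volume.restrict D)

/-- `u ∈ H¹(D)` with weak gradient `∇u = G`. -/
def IsWeakGrad (D : Set Plane) (u : Plane → ℝ) (G : Plane → Plane) : Prop :=
  MemL2 D u ∧ MemL2 D G ∧ ∀ φ, IsTest D φ → ∀ i,
    ∫ x in D, u x * pd i φ x = -∫ x in D, G x i * φ x

/-- `v ∈ H(curl; D)` with weak curl `∂₁v₂ - ∂₂v₁ = c`. -/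
def IsWeakCurl (D : Set Plane) (v : Plane → Plane) (c : Plane → ℝ) : Prop :=
  MemL2 D v ∧ MemL2 D c ∧ ∀ φ, IsTest D φ →
    ∫ x in D, c x * φ x = ∫ x in D, (v x 0 * pd 1 φ x - v x 1 * pd 0 φ x)

/-- `v ∈ H(div; D)` with weak divergence `∂₁v₁ + ∂₂v₂ = d`. -/
def IsWeakDiv (D : Set Plane) (v : Plane → Plane) (d : Plane → ℝ) : Prop :=
  MemL2 D v ∧ MemL2 D d ∧ ∀ φ, IsTest D φ →
    ∫ x in D, d x * φ x = -∫ x in D, (v x 0 * pd 0 φ x + v x 1 * pd 1 φ x)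

/-- `H¹(D)`. -/
def MemH1 (D : Set Plane) (u : Plane → ℝ) : Prop := ∃ G, IsWeakGrad D u G

/-- `H²(D)`. -/
def MemH2 (D : Set Plane) (u : Plane → ℝ) : Prop :=
  ∃ G, IsWeakGrad D u G ∧ ∀ i, MemH1 D (fun x => G x i)

/-- `H(curl; D)`. -/
def MemHcurl (D : Set Plane) (v : Plane → Plane) : Prop := ∃ c, IsWeakCurl D v c

/-- `H(div; D)`. -/
def MemHdiv (D : Set Plane) (v : Plane → Plane) : Prop := ∃ d, IsWeakDiv D v d

/-- `H¹(curl; D)`: fields in `H(curl; D)` whose curl is in `H¹(D)`. -/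
def MemH1curl (D : Set Plane) (v : Plane → Plane) : Prop :=
  ∃ c, IsWeakCurl D v c ∧ MemH1 D c

/-! ### Triangles, boundary integrals and traces -/

/-- The closed triangle with vertices `a 0, a 1, a 2`. -/
def tri (a : Fin 3 → Plane) : Set Plane := convexHull ℝ (range a)

/-- The open triangle with vertices `a 0, a 1, a 2`. -/
def openTri (a : Fin 3 → Plane) : Set Plane := interior (tri a)

/-- `∫_e f ds` over the segment `e` from `p` to `q`. -/
def edgeInt (p q : Plane) (f : Plane → ℝ) : ℝ :=
  dist p q * ∫ s in (0 : ℝ)..1, f (AffineMap.lineMap p q s)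

/-- `f` is integrable along the segment from `p` to `q`. -/
def EdgeIntegrable (p q : Plane) (f : Plane → ℝ) : Prop :=
  IntervalIntegrable (fun s : ℝ => f (AffineMap.lineMap p q s)) volume 0 1

/-- The unit normal to the right of the direction from `p` to `q`; this is the outward normal when
the boundary is traversed counterclockwise. -/
def rightNormal (p q : Plane) : Plane :=
  (dist p q)⁻¹ • !₂[q 1 - p 1, -(q 0 - p 0)]

/-- For `v ∈ H¹` of the triangle with counterclockwise vertices `a`, the integrable function `g` on
the boundary is the trace of `v`:
`∫_K (v div Φ + ∇v · Φ) dx = ∫_{∂K} g Φ · n ds` for all smooth vector fields `Φ`. -/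
def IsTrace (a : Fin 3 → Plane) (v : Plane → ℝ) (g : Plane → ℝ) : Prop :=
  (∀ i, EdgeIntegrable (a i) (a (i + 1)) g) ∧
  ∃ G, IsWeakGrad (openTri a) v G ∧ ∀ Φ : Plane → Plane, ContDiff ℝ ∞ Φ →
    ∫ x in openTri a, (v x * (pd 0 (fun y => Φ y 0) x + pd 1 (fun y => Φ y 1) x)
        + (G x 0 * Φ x 0 + G x 1 * Φ x 1))
      = ∑ i, edgeInt (a i) (a (i + 1)) (fun x =>
          g x * (Φ x 0 * rightNormal (a i) (a (i + 1)) 0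
            + Φ x 1 * rightNormal (a i) (a (i + 1)) 1))

/-- For `v ∈ H(curl)` of the triangle with counterclockwise vertices `a`, the integrable function
`g` on the boundary is the tangential trace `v · t`, with `t` the counterclockwise unit tangent:
`∫_K (curl v φ - v · (∂₂φ, -∂₁φ)) dx = ∫_{∂K} g φ ds` for all smooth `φ`. -/
def IsTangTrace (a : Fin 3 → Plane) (v : Plane → Plane) (g : Plane → ℝ) : Prop :=
  (∀ i, EdgeIntegrable (a i) (a (i + 1)) g) ∧
  ∃ c, IsWeakCurl (openTri a) v c ∧ ∀ φ : Plane → ℝ, ContDiff ℝ ∞ φ →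
    ∫ x in openTri a, (c x * φ x - (v x 0 * pd 1 φ x - v x 1 * pd 0 φ x))
      = ∑ i, edgeInt (a i) (a (i + 1)) (fun x => g x * φ x)

/-! ### The interface and the background mesh -/

/-- `Γ` is a simple closed curve of class `C^{1,1}`. -/
def IsC11ClosedCurve (Γ : Set Plane) : Prop :=
  ∃ γ : ℝ → Plane, ContDiff ℝ 1 γ ∧ (∃ C, LipschitzWith C (deriv γ)) ∧ (∀ t, deriv γ t ≠ 0) ∧
    Function.Periodic γ 1 ∧ InjOn γ (Ico 0 1) ∧ range γ = Γ

/-- An interface problem together with an unfitted triangulation.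

* `Ω` is a convex polygon (open, convex, and its closure is a finite union of triangles), which the
  `C^{1,1}` closed curve `Γ ⊆ Ω` separates into the subdomains `Ωp = Ω⁺` and `Ωm = Ω⁻`.
* `αp, αm, βp, βm` are the values `α⁺, α⁻, β⁺, β⁻` of the coefficients.
* The triangles `vert K`, `K : Fin N`, with vertices listed counterclockwise, form a conforming
  triangulation of `Ω`.
* If both subdomains overlap `K` in positive area, then `Γ` meets `∂K` in exactly two points
  `cutA K`, `cutB K`, lying on two different edges, and `Γ` leaves `K` there. They are named such
  that the part of `K` to the left of the line from `cutA K` to `cutB K`, which is going to be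
  `K_h⁺`, and the part to the right, which is going to be `K_h⁻`, match `Ω⁺` and `Ω⁻` with respect
  to the area of overlap at least as well as with the opposite labels. -/
structure InterfaceMesh where
  Ω : Set Plane
  Ωp : Set Plane
  Ωm : Set Plane
  Γ : Set Plane
  isOpen_Ω : IsOpen Ω
  convex_Ω : Convex ℝ Ω
  isOpen_Ωp : IsOpen Ωp
  isOpen_Ωm : IsOpen Ωm
  isConnected_Ωp : IsConnected Ωp
  isConnected_Ωm : IsConnected Ωm
  disjoint_sub : Disjoint Ωp Ωm
  union_sub : Ωp ∪ Ωm = Ω \ Γ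
  Γ_subset : Γ ⊆ Ω
  Γ_curve : IsC11ClosedCurve Γ
  Γ_frontier_p : Γ ⊆ frontier Ωp
  Γ_frontier_m : Γ ⊆ frontier Ωm
  αp : ℝ
  αm : ℝ
  βp : ℝ
  βm : ℝ
  αp_pos : 0 < αp
  αm_pos : 0 < αm
  βp_pos : 0 < βp
  βm_pos : 0 < βm
  N : ℕ
  vert : Fin N → Fin 3 → Plane
  ccw : ∀ K, 0 < cross (vert K 1 - vert K 0) (vert K 2 - vert K 0)
  cover : closure Ω = ⋃ K, tri (vert K)
  distinct : ∀ K L, K ≠ L → range (vert K) ≠ range (vert L)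
  conforming : ∀ K L, K ≠ L →
    tri (vert K) ∩ tri (vert L) ⊆ convexHull ℝ (range (vert K) ∩ range (vert L))
  cutA : Fin N → Plane
  cutB : Fin N → Plane
  cut : ∀ K, 0 < volume (tri (vert K) ∩ Ωp) → 0 < volume (tri (vert K) ∩ Ωm) →
    cutA K ≠ cutB K ∧ Γ ∩ frontier (tri (vert K)) = {cutA K, cutB K} ∧
    (∃ i j, i ≠ j ∧ cutA K ∈ segment ℝ (vert K i) (vert K (i + 1)) ∧
      cutB K ∈ segment ℝ (vert K j) (vert K (j + 1))) ∧
    ¬ Γ ⊆ tri (vert K)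
  label : ∀ K, 0 < volume (tri (vert K) ∩ Ωp) → 0 < volume (tri (vert K) ∩ Ωm) →
    volume ({x ∈ openTri (vert K) | 0 < cross (cutB K - cutA K) (x - cutA K)} ∩ Ωm)
      + volume ({x ∈ openTri (vert K) | cross (cutB K - cutA K) (x - cutA K) < 0} ∩ Ωp)
    ≤ volume ({x ∈ openTri (vert K) | 0 < cross (cutB K - cutA K) (x - cutA K)} ∩ Ωp)
      + volume ({x ∈ openTri (vert K) | cross (cutB K - cutA K) (x - cutA K) < 0} ∩ Ωm)

namespace InterfaceMesh

variable (M : InterfaceMesh)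

/-- The open element `K`. -/
def el (K : Fin M.N) : Set Plane := openTri (M.vert K)

/-- `K` is an interface element. -/
def IsInterface (K : Fin M.N) : Prop :=
  0 < volume (tri (M.vert K) ∩ M.Ωp) ∧ 0 < volume (tri (M.vert K) ∩ M.Ωm)

/-- `K_h⁺`, for an interface element `K`. -/
def elp (K : Fin M.N) : Set Plane :=
  {x ∈ M.el K | 0 < cross (M.cutB K - M.cutA K) (x - M.cutA K)}

/-- `K_h⁻`, for an interface element `K`. -/
def elm (K : Fin M.N) : Set Plane :=
  {x ∈ M.el K | cross (M.cutB K - M.cutA K) (x - M.cutA K) < 0}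

/-- `Ω_h⁺`: the union of the `K_h⁺` and of the non-interface elements in `Ω⁺`. -/
def Ωhp : Set Plane :=
  {x | ∃ K, (M.IsInterface K ∧ x ∈ M.elp K) ∨
    (¬ M.IsInterface K ∧ 0 < volume (tri (M.vert K) ∩ M.Ωp) ∧ x ∈ M.el K)}

open Classical in
/-- The coefficient `α`. -/
def α (x : Plane) : ℝ := if x ∈ M.Ωp then M.αp else M.αm

open Classical in
/-- The coefficient `β`. -/
def β (x : Plane) : ℝ := if x ∈ M.Ωp then M.βp else M.βm

open Classical in
/-- The coefficient `α_h`. -/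
def αh (x : Plane) : ℝ := if x ∈ M.Ωhp then M.αp else M.αm

open Classical in
/-- The coefficient `β_h`. -/
def βh (x : Plane) : ℝ := if x ∈ M.Ωhp then M.βp else M.βm

/-- `N_K`: the vertices of `K`, and its two cut points if `K` is an interface element. -/
def nodes (K : Fin M.N) : Set Plane :=
  {x | x ∈ range (M.vert K) ∨ (M.IsInterface K ∧ (x = M.cutA K ∨ x = M.cutB K))}

/-- `E_K`: the segments into which the nodes of `K` cut its three edges, each given by its
end points in counterclockwise order. -/
def edges (K : Fin M.N) : Set (Plane × Plane) :=
  {e | e.1 ∈ M.nodes K ∧ e.2 ∈ M.nodes K ∧ e.1 ≠ e.2 ∧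
    (∃ i, e.1 ∈ segment ℝ (M.vert K i) (M.vert K (i + 1)) ∧
      e.2 ∈ segment ℝ (M.vert K i) (M.vert K (i + 1)) ∧
      SameRay ℝ (e.2 - e.1) (M.vert K (i + 1) - M.vert K i)) ∧
    ∀ r ∈ M.nodes K, r ∉ openSegment ℝ e.1 e.2}

/-! ### The spaces of the continuous sequence -/

/-- `H²(β; T_h)`. -/
def MemH2β (u : Plane → ℝ) : Prop :=
  MemH1 M.Ω u ∧
  (∀ K, ¬ M.IsInterface K → MemH2 (M.el K) u) ∧
  (∀ K, M.IsInterface K →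
    MemH2 (M.el K ∩ M.Ωp) u ∧ MemH2 (M.el K ∩ M.Ωm) u ∧
    ∃ G, IsWeakGrad (M.el K) u G ∧ MemHdiv (M.el K) (fun x => M.β x • G x))

/-- `H¹(curl, α, β; T_h)`. -/
def MemH1curlαβ (u : Plane → Plane) : Prop :=
  MemHcurl M.Ω u ∧
  (∀ K, ¬ M.IsInterface K → MemH1curl (M.el K) u) ∧
  (∀ K, M.IsInterface K →
    MemH1curl (M.el K ∩ M.Ωp) u ∧ MemH1curl (M.el K ∩ M.Ωm) u ∧
    MemHdiv (M.el K) (fun x => M.β x • u x) ∧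
    ∃ c, IsWeakCurl (M.el K) u c ∧ MemH1 (M.el K) (fun x => M.α x * c x))

/-! ### The immersed virtual element spaces -/

/-- `V^n_h(K)` on an interface element. That `div (β_h ∇v) = 0` holds weakly across `Γ^K_h` for
`v ∈ H¹(K)` contains the two jump conditions on `Γ^K_h`. -/
def MemVnLoc (K : Fin M.N) (v : Plane → ℝ) : Prop :=
  ∃ (G : Plane → Plane) (g : Plane → ℝ), IsWeakGrad (M.el K) v G ∧
    IsWeakDiv (M.el K) (fun x => M.βh x • G x) (fun _ => 0) ∧
    IsTrace (M.vert K) v g ∧ ContinuousOn g (frontier (tri (M.vert K))) ∧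
    ∀ e ∈ M.edges K, ∀ s ∈ Icc (0 : ℝ) 1,
      g (AffineMap.lineMap e.1 e.2 s) = (1 - s) * g e.1 + s * g e.2

/-- `V^n_h`, as a subspace of `H¹(Ω)`. -/
def MemVn (v : Plane → ℝ) : Prop :=
  MemH1 M.Ω v ∧
  (∀ K, M.IsInterface K → M.MemVnLoc K v) ∧
  (∀ K, ¬ M.IsInterface K → ∃ a b c : ℝ, EqAE (M.el K) v (fun x => a + b * x 0 + c * x 1))

/-- `V^e_h(K)` on an interface element. -/
def MemVeLoc (K : Fin M.N) (v : Plane → Plane) : Prop :=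
  (∃ c, IsWeakCurl (M.el K) v c ∧ ∃ c₀ : ℝ, EqAE (M.el K) (fun x => M.αh x * c x) (fun _ => c₀)) ∧
  IsWeakDiv (M.el K) (fun x => M.βh x • v x) (fun _ => 0) ∧
  ∃ g, IsTangTrace (M.vert K) v g ∧
    ∀ e ∈ M.edges K, ∃ r : ℝ, ∀ x ∈ openSegment ℝ e.1 e.2, g x = r

/-- `V^e_h`; on non-interface elements the fields are in the lowest order Nédélec space. -/
def MemVe (v : Plane → Plane) : Prop :=
  MemHcurl M.Ω v ∧
  (∀ K, M.IsInterface K → M.MemVeLoc K v) ∧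
  (∀ K, ¬ M.IsInterface K → ∃ a b c : ℝ,
    EqAE (M.el K) v (fun x => !₂[a - c * x 1, b + c * x 0]))

/-- `Q^{α_h}_h(K)`; this is `ℙ₀(K)` on a non-interface element. -/
def MemQLoc (K : Fin M.N) (q : Plane → ℝ) : Prop :=
  (M.IsInterface K → ∃ cp cm : ℝ, M.αp * cp = M.αm * cm ∧
    EqAE (M.elp K) q (fun _ => cp) ∧ EqAE (M.elm K) q (fun _ => cm)) ∧
  (¬ M.IsInterface K → ∃ c : ℝ, EqAE (M.el K) q (fun _ => c))

/-! ### The vertical maps of the diagram -/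

/-- `v = I^n_h u`: the function `v ∈ V^n_h` has the nodal values of `u`. -/
def IsNodalInterp (u v : Plane → ℝ) : Prop :=
  M.MemVn v ∧ ∀ K, ∃ g, IsTrace (M.vert K) v g ∧
    ContinuousOn g (frontier (tri (M.vert K))) ∧ ∀ x ∈ M.nodes K, g x = u x

/-- `u` is smooth enough for its edge moments `∫_e u · t ds` to make sense: its tangential trace
on the boundary of each element is an integrable function. -/
def HasEdgeMoments (u : Plane → Plane) : Prop :=
  ∀ K, ∃ g, IsTangTrace (M.vert K) u g

/-- `w = I^e_h u`: the field `w ∈ V^e_h` has the edge moments of `u`. -/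
def IsEdgeInterp (u w : Plane → Plane) : Prop :=
  M.MemVe w ∧ ∀ K, ∃ g gw, IsTangTrace (M.vert K) u g ∧ IsTangTrace (M.vert K) w gw ∧
    ∀ e ∈ M.edges K, edgeInt e.1 e.2 gw = edgeInt e.1 e.2 g

/-- `q = π^{α_h}_h z`: on every element, `q` is the projection of `z` onto `Q^{α_h}_h(K)` with
respect to the inner product `(α_h ·, ·)_K`. -/
def IsProj (z q : Plane → ℝ) : Prop :=
  ∀ K, M.MemQLoc K q ∧ ∀ v, M.MemQLoc K v →
    ∫ x in M.el K, M.αh x * q x * v x = ∫ x in M.el K, M.αh x * z x * v x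

end InterfaceMesh

end IVE

end

/-! On one element everything is governed by Stokes' theorem: the integral of a curl over `K` is the
sum of the edge moments (`IsTangTrace.flux`). The local space of `MemQLoc` is the line spanned by
`1/α_h` (`memQLoc_iff`), so the projection of `z` is the multiple of `1/α_h` that has the same
integral as `z` (`isProj_iff`). The curl of an edge interpolant of `u` is a multiple of `1/α_h` as
well, and equality of edge moments gives it the integral of `curl u`; this is the second identity
(`IsEdgeInterp.curl`). For the first identity, the gradient of the nodal interpolant is curl free,
is divergence free after multiplication by `β_h`, and has an edgewise constant tangential trace,
being the derivative of an edgewise affine function. Its moment over an edge is a difference of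
nodal values of `u`, and so is that of `∇u`. It is therefore an edge interpolant of `∇u`
(`IsNodalInterp.isEdgeInterp_grad`), and uniqueness of edge interpolants concludes.

Uniqueness: a local edge field `d` with vanishing moments has zero tangential trace and, by Stokes,
zero curl. Its extension by zero is then curl free in the whole plane, and the mollifications of the
extension are gradients of potentials that are constant off a slightly larger triangle. After
shrinking they are gradients of test functions, hence orthogonal to every weakly divergence free
field (`orthogonal_of_curl_free`); so the integral of `β_h |d|²` vanishes.

Existence: continuous piecewise affine boundary values extend to a Lipschitz function, which is
corrected by a function of zero trace obtained from an orthogonal projection onto the closure of the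
gradients of test functions (`exists_trace_zero_correction`). For edge fields, an explicit field
first supplies the piecewise constant curl, with the factor dictated by Stokes; the tangential data
that remain have zero circulation and are the derivative of a closed function on the boundary
(`exists_local_field`).

Gluing: local solutions form a global one if their traces match on common sides, for which
neighbours have to cut a common side at the same point. If the element across a cut side were not an
interface element, `Γ` would stay in `K` near that cut point; meeting the boundary of `K` in only
one other point, it would be contained in `K`, which is excluded (`Nbr.isInterface`). The tangential
traces of a global field from both sides of a common side cancel (`Nbr.tangTrace_eq`).

Traces are defined by Green's formulas. The facts needed about them are that they are unique, that a
continuous `H¹` function is its own trace (`isTrace_of_continuousOn`, by contraction and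
mollification), and that the tangential trace of a gradient is the derivative of the trace along the
sides (`isTangTrace_grad`, `trace_eq_primitive`). -/

noncomputable section

namespace IVE

open MeasureTheory Set

open scoped ContDiff

/-! ### Barycentric coordinates -/

/-- Twice the signed area of the triangle with vertices `a 0, a 1, a 2`. -/
def area2 (a : Fin 3 → Plane) : ℝ := cross (a 1 - a 0) (a 2 - a 0)

/-- The barycentric coordinates of a point with respect to the vertices of a triangle. -/
def bary (a : Fin 3 → Plane) (i : Fin 3) (x : Plane) : ℝ :=
  cross (a (i + 2) - a (i + 1)) (x - a (i + 1)) / area2 a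

/-- The point with parameter `s` on the side of a triangle from `a i` to `a (i + 1)`. -/
abbrev side (a : Fin 3 → Plane) (i : Fin 3) (s : ℝ) : Plane :=
  AffineMap.lineMap (a i) (a (i + 1)) s

theorem fin3_cases (i : Fin 3) : i = 0 ∨ i = 1 ∨ i = 2 := by
  fin_cases i <;> simp

theorem fin3_add : (0 : Fin 3) + 1 = 1 ∧ (1 : Fin 3) + 1 = 2 ∧ (2 : Fin 3) + 1 = 0 ∧
    (0 : Fin 3) + 2 = 2 ∧ (1 : Fin 3) + 2 = 0 ∧ (2 : Fin 3) + 2 = 1 := by decide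

theorem fin3_add_one_one (i : Fin 3) : i + 1 + 1 = i + 2 := by
  rcases fin3_cases i with rfl | rfl | rfl <;> rfl

theorem fin3_add_one_two (i : Fin 3) : i + 1 + 2 = i := by
  rcases fin3_cases i with rfl | rfl | rfl <;> rfl

theorem fin3_add_two_one (i : Fin 3) : i + 2 + 1 = i := by
  rcases fin3_cases i with rfl | rfl | rfl <;> rfl

theorem fin3_eq (i j : Fin 3) : j = i ∨ j = i + 1 ∨ j = i + 2 := by
  rcases fin3_cases i with rfl | rfl | rfl <;> rcases fin3_cases j with rfl | rfl | rfl <;> decide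

theorem fin3_ne (i : Fin 3) : i ≠ i + 1 ∧ i ≠ i + 2 ∧ i + 1 ≠ i + 2 := by
  rcases fin3_cases i with rfl | rfl | rfl <;> decide

theorem sum_fin3 {E : Type*} [AddCommGroup E] (f : Fin 3 → E) (i : Fin 3) :
    ∑ j, f j = f i + f (i + 1) + f (i + 2) := by
  rw [Fin.sum_univ_three]
  obtain ⟨h1, h2, h3, h4, h5, h6⟩ := fin3_add
  rcases fin3_cases i with rfl | rfl | rfl
  · rw [h1, h4]
  · rw [h2, h5]; abel
  · rw [h3, h6]; abel

theorem plane_ext {x y : Plane} (h0 : x 0 = y 0) (h1 : x 1 = y 1) : x = y := by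
  ext i; fin_cases i <;> assumption

theorem lineMap_coord (p q : Plane) (s : ℝ) (i : Fin 2) :
    (AffineMap.lineMap p q s : Plane) i = (1 - s) * p i + s * q i := by
  simp [AffineMap.lineMap_apply]; ring

section Bary

variable {a : Fin 3 → Plane}

theorem area2_rot (i : Fin 3) : cross (a (i + 1) - a i) (a (i + 2) - a i) = area2 a := by
  obtain ⟨h1, h2, h3, h4, h5, h6⟩ := fin3_add
  rcases fin3_cases i with rfl | rfl | rfl
  · rw [h1, h4]; rfl
  · rw [h2, h5]; simp [area2, cross]; ring
  · rw [h3, h6]; simp [area2, cross]; ring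

theorem bary_lineMap (i : Fin 3) (p q : Plane) (s : ℝ) :
    bary a i (AffineMap.lineMap p q s) = (1 - s) * bary a i p + s * bary a i q := by
  simp only [bary, cross, PiLp.sub_apply, lineMap_coord]; ring

variable (ha : 0 < area2 a)
include ha

theorem bary_self (i : Fin 3) : bary a i (a i) = 1 := by
  rw [bary, div_eq_one_iff_eq ha.ne', ← area2_rot i]
  simp [cross]; ring

omit ha in
theorem bary_next (i : Fin 3) : bary a i (a (i + 1)) = 0 := by
  simp [bary, cross]

omit ha in
theorem bary_prev (i : Fin 3) : bary a i (a (i + 2)) = 0 := by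
  simp [bary, cross]; left; ring

theorem bary_sum (i : Fin 3) (x : Plane) :
    bary a i x + bary a (i + 1) x + bary a (i + 2) x = 1 := by
  simp only [bary, fin3_add_one_one, fin3_add_one_two, fin3_add_two_one,
    show i + 2 + 2 = i + 1 by rcases fin3_cases i with rfl | rfl | rfl <;> rfl]
  rw [← add_div, ← add_div, div_eq_one_iff_eq ha.ne', ← area2_rot i]
  simp [cross]; ring

theorem bary_comb (i : Fin 3) (x : Plane) :
    x = bary a i x • a i + bary a (i + 1) x • a (i + 1) + bary a (i + 2) x • a (i + 2) := by
  have h := ha.ne'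
  rw [← area2_rot i] at h
  apply plane_ext <;>
  · simp only [bary, fin3_add_one_one, fin3_add_one_two, fin3_add_two_one,
      show i + 2 + 2 = i + 1 by rcases fin3_cases i with rfl | rfl | rfl <;> rfl, ← area2_rot i,
      PiLp.add_apply, PiLp.smul_apply, smul_eq_mul]
    rw [div_mul_eq_mul_div, div_mul_eq_mul_div, div_mul_eq_mul_div, ← add_div, ← add_div,
      eq_div_iff h]
    simp [cross]; ring

omit ha in
theorem bary_affine (i : Fin 3) : ∃ c w₀ w₁ : ℝ, ∀ x, bary a i x = c + w₀ * x 0 + w₁ * x 1 := by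
  refine ⟨-(((a (i + 2)) 0 - (a (i + 1)) 0) * (a (i + 1)) 1
    - ((a (i + 2)) 1 - (a (i + 1)) 1) * (a (i + 1)) 0) / area2 a,
    -((a (i + 2)) 1 - (a (i + 1)) 1) / area2 a, ((a (i + 2)) 0 - (a (i + 1)) 0) / area2 a, ?_⟩
  intro x
  simp [bary, cross]; ring

omit ha in
theorem bary_contDiff (i : Fin 3) : ContDiff ℝ ∞ (bary a i) := by
  obtain ⟨c, w₀, w₁, h⟩ := bary_affine (a := a) i
  rw [funext h]; fun_prop

omit ha in
theorem bary_continuous (i : Fin 3) : Continuous (bary a i) := (bary_contDiff i).continuous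

omit ha in
theorem bary_comb_apply (i : Fin 3) {ι : Type*} (s : Finset ι) (w : ι → ℝ) (z : ι → Plane)
    (hw : ∑ j ∈ s, w j = 1) : bary a i (∑ j ∈ s, w j • z j) = ∑ j ∈ s, w j * bary a i (z j) := by
  obtain ⟨c, w₀, w₁, h⟩ := bary_affine (a := a) i
  simp only [h, WithLp.ofLp_sum, Finset.sum_apply, WithLp.ofLp_smul, Pi.smul_apply, smul_eq_mul,
    mul_add, Finset.sum_add_distrib, ← Finset.sum_mul, hw, one_mul, Finset.mul_sum]
  congr 1
  · congr 1; apply Finset.sum_congr rfl; intros; ring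
  · apply Finset.sum_congr rfl; intros; ring

omit ha in
theorem tri_convex : Convex ℝ (tri a) := convex_convexHull ℝ _

omit ha in
theorem tri_compact : IsCompact (tri a) := (finite_range a).isCompact_convexHull ℝ

omit ha in
theorem vertex_mem (i : Fin 3) : a i ∈ tri a := subset_convexHull ℝ _ (mem_range_self i)

omit ha in
theorem side_mem {i : Fin 3} {s : ℝ} (hs : s ∈ Icc (0 : ℝ) 1) : side a i s ∈ tri a := by
  apply (tri_convex (a := a)).segment_subset (vertex_mem i) (vertex_mem (i + 1))
  rw [segment_eq_image_lineMap]
  exact mem_image_of_mem _ hs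

theorem mem_tri_iff {x : Plane} : x ∈ tri a ↔ ∀ i, 0 ≤ bary a i x := by
  constructor
  · intro hx i
    have hc : Convex ℝ {x | 0 ≤ bary a i x} := by
      intro x hx y hy s t hs ht hst
      have := bary_comb_apply (a := a) i (Finset.univ : Finset (Fin 2)) ![s, t] ![x, y]
        (by simpa using hst)
      simp only [Fin.sum_univ_two, Matrix.cons_val_zero, Matrix.cons_val_one] at this
      simp only [mem_ofPred_eq] at hx hy ⊢
      rw [this]; positivity
    refine convexHull_min ?_ hc hx
    rintro _ ⟨j, rfl⟩
    rcases fin3_eq i j with rfl | rfl | rfl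
    · simp [bary_self ha]
    · simp [bary_next]
    · simp [bary_prev]
  · intro h
    rw [bary_comb ha 0 x]
    have hs := bary_sum ha 0 x
    have := tri_convex.sum_mem (t := (Finset.univ : Finset (Fin 3))) (w := fun i => bary a i x)
      (z := a) (fun i _ => h i) (by rw [sum_fin3 _ 0]; exact hs) (fun i _ => vertex_mem i)
    rwa [sum_fin3 _ 0] at this

/-- At an interior point with vanishing `i`-th coordinate, a small step away from the vertex `a i`
would remain in the triangle and make that coordinate negative. Conversely, strict positivity is an
open condition. -/
theorem mem_openTri_iff {x : Plane} : x ∈ openTri a ↔ ∀ i, 0 < bary a i x := by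
  constructor
  · intro hx i
    have h0 : 0 ≤ bary a i x := mem_tri_iff ha |>.1 (interior_subset hx) i
    rcases h0.lt_or_eq with h | h
    · exact h
    exfalso
    have hcont : Continuous fun t : ℝ => (AffineMap.lineMap x (a i) t : Plane) := by fun_prop
    have hn : ∀ᶠ t : ℝ in nhds 0, (AffineMap.lineMap x (a i) t : Plane) ∈ tri a := by
      have : (AffineMap.lineMap x (a i) (0 : ℝ) : Plane) = x := by simp
      apply hcont.continuousAt.eventually
      beta_reduce
      rw [this]
      exact mem_interior_iff_mem_nhds.1 hx
    obtain ⟨ε, hε, hball⟩ := Metric.eventually_nhds_iff.1 hn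
    have h1 := mem_tri_iff ha |>.1 (hball (y := -(ε / 2)) (by
      rw [dist_zero_right, norm_neg, Real.norm_eq_abs, abs_of_pos (by linarith)]; linarith)) i
    rw [bary_lineMap, ← h, bary_self ha] at h1
    linarith
  · intro h
    have ho : IsOpen {x | ∀ i, 0 < bary a i x} := by
      simp only [ofPred_forall]
      exact isOpen_iInter_of_finite fun i => isOpen_lt continuous_const (bary_continuous i)
    exact interior_maximal (fun y hy => (mem_tri_iff ha).2 fun i => (hy i).le) ho h

omit ha in
theorem openTri_subset : openTri a ⊆ tri a := interior_subset

omit ha in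
theorem openTri_open : IsOpen (openTri a) := isOpen_interior

omit ha in
omit ha in
theorem openTri_meas : MeasurableSet (openTri a) := openTri_open.measurableSet

theorem mem_frontier_iff {x : Plane} :
    x ∈ frontier (tri a) ↔ (∀ i, 0 ≤ bary a i x) ∧ ∃ i, bary a i x = 0 := by
  rw [tri_compact.isClosed.frontier_eq, mem_sdiff, mem_tri_iff ha,
    show interior (tri a) = openTri a from rfl, mem_openTri_iff ha]
  constructor
  · rintro ⟨h1, h2⟩
    push Not at h2
    obtain ⟨i, hi⟩ := h2
    exact ⟨h1, i, le_antisymm hi (h1 i)⟩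
  · rintro ⟨h1, i, hi⟩
    exact ⟨h1, fun h => (h i).ne' hi⟩

/-- The barycentre. -/
theorem exists_mem_openTri : ∃ x, x ∈ openTri a := by
  refine ⟨∑ i : Fin 3, (1 / 3 : ℝ) • a i, (mem_openTri_iff ha).2 fun i => ?_⟩
  rw [bary_comb_apply i _ _ _ (by simp), sum_fin3 _ i, bary_self ha, bary_next, bary_prev]
  norm_num

theorem openTri_volume_pos : 0 < volume (openTri a) :=
  openTri_open.measure_pos _ (exists_mem_openTri ha)

omit ha in
theorem tri_volume_lt : volume (tri a) < ⊤ := tri_compact.measure_lt_top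

omit ha in
theorem openTri_volume_lt : volume (openTri a) < ⊤ :=
  (measure_mono openTri_subset).trans_lt tri_volume_lt

omit ha in
theorem frontier_null : volume (frontier (tri a)) = 0 := tri_convex.addHaar_frontier _

theorem side_bary (i : Fin 3) (s : ℝ) : bary a i (side a i s) = 1 - s ∧
    bary a (i + 1) (side a i s) = s ∧ bary a (i + 2) (side a i s) = 0 := by
  have h1 := bary_prev (a := a) (i + 1)
  have h2 := bary_next (a := a) (i + 2)
  have h3 := bary_prev (a := a) (i + 2)
  rw [fin3_add_one_two] at h1
  rw [fin3_add_two_one] at h2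
  rw [show i + 2 + 2 = i + 1 by rcases fin3_cases i with rfl | rfl | rfl <;> rfl] at h3
  simp [side, bary_lineMap, bary_self ha, bary_next, h1, h2, h3]

theorem eq_side_of_bary {i : Fin 3} {x : Plane} (h : bary a (i + 2) x = 0) :
    x = side a i (bary a (i + 1) x) := by
  have h1 := bary_comb ha i x
  have h2 := bary_sum ha i x
  rw [h] at h1 h2
  rw [side, AffineMap.lineMap_apply_module]
  conv_lhs => rw [h1]
  rw [show bary a i x = 1 - bary a (i + 1) x by linarith]
  simp

theorem mem_frontier_iff_side {x : Plane} :
    x ∈ frontier (tri a) ↔ ∃ i, ∃ s ∈ Icc (0 : ℝ) 1, x = side a i s := by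
  rw [mem_frontier_iff ha]
  constructor
  · rintro ⟨h, j, hj⟩
    have h2 : bary a (j + 1 + 2) x = 0 := by rw [fin3_add_one_two]; exact hj
    refine ⟨j + 1, bary a (j + 1 + 1) x, ⟨h _, ?_⟩, eq_side_of_bary ha h2⟩
    have := bary_sum ha (j + 1) x
    have := h (j + 1)
    linarith
  · rintro ⟨i, s, hs, rfl⟩
    obtain ⟨h1, h2, h3⟩ := side_bary ha i s
    refine ⟨fun j => ?_, i + 2, h3⟩
    rcases fin3_eq i j with rfl | rfl | rfl
    · rw [h1]; linarith [hs.2]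
    · rw [h2]; exact hs.1
    · rw [h3]

theorem vertex_ne (i : Fin 3) : a i ≠ a (i + 1) := by
  intro h
  have := bary_self ha i
  rw [h, bary_next] at this
  exact zero_ne_one this

theorem vertex_injective : Function.Injective a := by
  intro i j hij
  rcases fin3_eq i j with rfl | rfl | rfl
  · rfl
  · exact absurd hij (vertex_ne ha i)
  · have := vertex_ne ha (i + 2)
    rw [fin3_add_two_one] at this
    exact absurd hij.symm this

end Bary

end IVE

end

noncomputable section

namespace IVE

open MeasureTheory Set

open scoped ContDiff

/-! ### The divergence theorem on a triangle -/

theorem fderiv_eq_pd (f : Plane → ℝ) (x u : Plane) :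
    fderiv ℝ f x u = u 0 * pd 0 f x + u 1 * pd 1 f x := by
  have hu : u = u 0 • EuclideanSpace.single (0 : Fin 2) (1 : ℝ)
      + u 1 • EuclideanSpace.single (1 : Fin 2) (1 : ℝ) := by
    apply plane_ext <;> simp
  conv_lhs => rw [hu]
  rw [map_add, map_smul, map_smul]; rfl

/-- The identification of `ℝ × ℝ` with the plane. -/
def planeEquiv : ℝ × ℝ ≃ᵐ Plane :=
  (MeasurableEquiv.finTwoArrow (α := ℝ)).symm.trans (MeasurableEquiv.toLp 2 (Fin 2 → ℝ))

theorem planeEquiv_preserving : MeasurePreserving planeEquiv volume volume :=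
  (PiLp.volume_preserving_toLp (Fin 2)).comp ((volume_preserving_finTwoArrow ℝ).symm _)

/-- The point with affine coordinates `s, t` with respect to the vertex `a 0`. -/
def triPoint (a : Fin 3 → Plane) (s t : ℝ) : Plane := a 0 + s • (a 1 - a 0) + t • (a 2 - a 0)

/-- The affine map from the reference triangle onto the triangle with vertices `a`. -/
def triMap (a : Fin 3 → Plane) (y : Plane) : Plane := triPoint a (y 0) (y 1)

/-- The linear part of `triMap`. -/
def triLin (a : Fin 3 → Plane) : Plane →L[ℝ] Plane :=
  (EuclideanSpace.proj (𝕜 := ℝ) (0 : Fin 2)).smulRight (a 1 - a 0)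
    + (EuclideanSpace.proj (𝕜 := ℝ) (1 : Fin 2)).smulRight (a 2 - a 0)

theorem triMap_hasFDerivAt (a : Fin 3 → Plane) (y : Plane) :
    HasFDerivAt (triMap a) (triLin a) y := by
  have : triMap a = fun y => a 0 + triLin a y := by
    funext y; simp [triMap, triPoint, triLin, add_assoc]
  rw [this]
  exact (triLin a).hasFDerivAt.const_add (a 0)

theorem triLin_det (a : Fin 3 → Plane) : (triLin a).det = area2 a := by
  rw [ContinuousLinearMap.det, ← LinearMap.det_toMatrix (EuclideanSpace.basisFun (Fin 2) ℝ).toBasis,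
    Matrix.det_fin_two]
  simp [LinearMap.toMatrix_apply, triLin, area2, cross]
  ring

theorem bary_triPoint {a : Fin 3 → Plane} (ha : 0 < area2 a) (s t : ℝ) :
    bary a 0 (triPoint a s t) = 1 - s - t ∧ bary a 1 (triPoint a s t) = s ∧
      bary a 2 (triPoint a s t) = t := by
  obtain ⟨h1, h2, h3, h4, h5, h6⟩ := fin3_add
  have h := ha.ne'
  unfold area2 cross at h
  simp only [bary, h1, h2, h3, h4, h5, h6]
  refine ⟨?_, ?_, ?_⟩ <;>
  · rw [div_eq_iff ha.ne']
    simp [cross, triPoint, area2]; ring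

theorem triMap_image {a : Fin 3 → Plane} (ha : 0 < area2 a) :
    triMap a '' {y | 0 < y 0 ∧ 0 < y 1 ∧ y 0 + y 1 < 1} = openTri a := by
  ext x
  rw [mem_openTri_iff ha]
  constructor
  · rintro ⟨y, ⟨h0, h1, h2⟩, rfl⟩ i
    obtain ⟨e0, e1, e2⟩ := bary_triPoint ha (y 0) (y 1)
    rcases fin3_cases i with rfl | rfl | rfl <;> simp only [triMap] <;> linarith
  · intro h
    have hs := bary_sum ha 0 x
    have hc := bary_comb ha 0 x
    obtain ⟨h1, h2, h3, h4, h5, h6⟩ := fin3_add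
    rw [h1, h4] at hs hc
    refine ⟨!₂[bary a 1 x, bary a 2 x], ⟨by simpa using h 1, by simpa using h 2, ?_⟩, ?_⟩
    · have := h 0
      simp; linarith
    · conv_rhs => rw [hc]
      rw [show bary a 0 x = 1 - bary a 1 x - bary a 2 x by linarith]
      simp only [triMap, triPoint]
      simp only [Matrix.cons_val_zero, Matrix.cons_val_one]
      module

theorem triMap_injOn {a : Fin 3 → Plane} (ha : 0 < area2 a) (s : Set Plane) :
    InjOn (triMap a) s := by
  intro y _ z _ h
  obtain ⟨-, e1, e2⟩ := bary_triPoint ha (y 0) (y 1)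
  obtain ⟨-, f1, f2⟩ := bary_triPoint ha (z 0) (z 1)
  have h' : triPoint a (y 0) (y 1) = triPoint a (z 0) (z 1) := h
  rw [h'] at e1 e2
  exact plane_ext (e1.symm.trans f1) (e2.symm.trans f2)

/-- The open reference triangle in `ℝ × ℝ`. -/
def refTri : Set (ℝ × ℝ) := {p | 0 < p.1 ∧ 0 < p.2 ∧ p.1 + p.2 < 1}

theorem refTri_open : IsOpen refTri := by
  have h1 : IsOpen {p : ℝ × ℝ | 0 < p.1} := isOpen_lt continuous_const continuous_fst
  have h2 : IsOpen {p : ℝ × ℝ | 0 < p.2} := isOpen_lt continuous_const continuous_snd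
  have h3 : IsOpen {p : ℝ × ℝ | p.1 + p.2 < 1} :=
    isOpen_lt (continuous_fst.add continuous_snd) continuous_const
  exact h1.inter (h2.inter h3)

theorem integral_openTri {a : Fin 3 → Plane} (ha : 0 < area2 a) (g : Plane → ℝ) :
    ∫ x in openTri a, g x = area2 a * ∫ p in refTri, g (triPoint a p.1 p.2) := by
  have hm : MeasurableSet {y : Plane | 0 < y 0 ∧ 0 < y 1 ∧ y 0 + y 1 < 1} := by
    have : Measurable fun y : Plane => y 0 := by fun_prop
    have h' : Measurable fun y : Plane => y 1 := by fun_prop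
    exact (measurableSet_lt measurable_const this).inter
      ((measurableSet_lt measurable_const h').inter
        (measurableSet_lt (this.add h') measurable_const))
  rw [← triMap_image ha, integral_image_eq_integral_abs_det_fderiv_smul volume hm
    (fun x _ => (triMap_hasFDerivAt a x).hasFDerivWithinAt) (triMap_injOn ha _)]
  simp only [triLin_det, abs_of_pos ha, smul_eq_mul]
  rw [integral_const_mul,
    ← planeEquiv_preserving.setIntegral_preimage_emb planeEquiv.measurableEmbedding]
  rfl

theorem refTri_integrableOn {h : ℝ × ℝ → ℝ} (hh : Continuous h) : IntegrableOn h refTri := by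
  have : IntegrableOn h (Icc (0 : ℝ) 1 ×ˢ Icc (0 : ℝ) 1) :=
    hh.continuousOn.integrableOn_compact (isCompact_Icc.prod isCompact_Icc)
  refine this.mono_set ?_
  rintro ⟨x, y⟩ ⟨h1, h2, h3⟩
  replace h1 : 0 < x := h1
  replace h2 : 0 < y := h2
  replace h3 : x + y < 1 := h3
  exact ⟨⟨h1.le, by linarith⟩, ⟨h2.le, by linarith⟩⟩

/-- The section is empty unless `x` lies in `(0, 1)`, and at `x = 1` both sides vanish. The
reference triangle is symmetric, so this serves both orders of integration. -/
theorem refTri_section (k : ℝ → ℝ) (x : ℝ) :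
    ∫ y, {y : ℝ | 0 < x ∧ 0 < y ∧ x + y < 1}.indicator k y
      = (Ioc (0 : ℝ) 1).indicator (fun x => ∫ y in (0 : ℝ)..(1 - x), k y) x := by
  by_cases hx : x ∈ Ioc (0 : ℝ) 1
  · rw [indicator_of_mem hx, intervalIntegral.integral_of_le (by linarith [hx.2]),
      integral_Ioc_eq_integral_Ioo, ← integral_indicator measurableSet_Ioo,
      show {y : ℝ | 0 < x ∧ 0 < y ∧ x + y < 1} = Ioo 0 (1 - x) from ?_]
    ext y
    simp only [mem_ofPred_eq, mem_Ioo]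
    constructor
    · rintro ⟨_, h1, h2⟩; exact ⟨h1, by linarith⟩
    · rintro ⟨h1, h2⟩; exact ⟨hx.1, h1, by linarith⟩
  · rw [indicator_of_notMem hx]
    have : {y : ℝ | 0 < x ∧ 0 < y ∧ x + y < 1} = ∅ := by
      ext y
      simp only [mem_ofPred_eq, mem_empty_iff_false, iff_false]
      rintro ⟨h1, h2, h3⟩
      exact hx ⟨h1, by linarith⟩
    simp [this]

theorem refTri_fubini {h : ℝ × ℝ → ℝ} (hh : Continuous h) :
    ∫ p in refTri, h p = ∫ x in (0 : ℝ)..1, ∫ y in (0 : ℝ)..(1 - x), h (x, y) := by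
  have hi := (integrable_indicator_iff refTri_open.measurableSet).2 (refTri_integrableOn hh)
  rw [← integral_indicator refTri_open.measurableSet, Measure.volume_eq_prod, integral_prod _ hi,
    intervalIntegral.integral_of_le zero_le_one, ← integral_indicator measurableSet_Ioc]
  congr 1
  funext x
  exact refTri_section (fun y => h (x, y)) x

theorem refTri_fubini_symm {h : ℝ × ℝ → ℝ} (hh : Continuous h) :
    ∫ p in refTri, h p = ∫ y in (0 : ℝ)..1, ∫ x in (0 : ℝ)..(1 - y), h (x, y) := by
  have hi := (integrable_indicator_iff refTri_open.measurableSet).2 (refTri_integrableOn hh)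
  rw [← integral_indicator refTri_open.measurableSet, Measure.volume_eq_prod,
    integral_prod_symm _ hi,
    intervalIntegral.integral_of_le zero_le_one, ← integral_indicator measurableSet_Ioc]
  congr 1
  funext y
  refine Eq.trans ?_ (refTri_section (fun x => h (x, y)) y)
  congr 1
  funext x
  simp only [indicator, refTri, mem_ofPred_eq]
  congr 1
  apply propext
  constructor
  · rintro ⟨h1, h2, h3⟩; exact ⟨h2, h1, by linarith⟩
  · rintro ⟨h1, h2, h3⟩; exact ⟨h2, h1, by linarith⟩

theorem triPoint_contDiff (a : Fin 3 → Plane) : ContDiff ℝ ∞ fun p : ℝ × ℝ => triPoint a p.1 p.2 := by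
  unfold triPoint; fun_prop

theorem pd_contDiff {f : Plane → ℝ} (hf : ContDiff ℝ ∞ f) (i : Fin 2) : ContDiff ℝ ∞ (pd i f) :=
  (hf.fderiv_right (m := ∞) (by simp)).clm_apply contDiff_const

theorem edgeInt_rightNormal {p q : Plane} (hpq : p ≠ q) (g : Plane → ℝ) (i : Fin 2) :
    edgeInt p q (fun x => g x * rightNormal p q i)
      = (if i = 0 then q 1 - p 1 else -(q 0 - p 0)) * ∫ s in (0 : ℝ)..1,
          g (AffineMap.lineMap p q s) := by
  have hd : dist p q ≠ 0 := dist_ne_zero.2 hpq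
  simp only [edgeInt]
  rw [intervalIntegral.integral_mul_const]
  fin_cases i <;> simp [rightNormal] <;> field_simp

/-- Integrating first in the direction of the derivative, the fundamental theorem of calculus leaves
the values at the two ends of each section, which run through two sides of the triangle. -/
theorem integral_pd_fst {a : Fin 3 → Plane} {f : Plane → ℝ} (hf : ContDiff ℝ ∞ f) :
    ∫ p in refTri, fderiv ℝ f (triPoint a p.1 p.2) (a 1 - a 0)
      = ∫ t in (0 : ℝ)..1, (f (triPoint a (1 - t) t) - f (triPoint a 0 t)) := by
  have hc := triPoint_contDiff a
  have hcd : Continuous fun p : ℝ × ℝ => fderiv ℝ f (triPoint a p.1 p.2) (a 1 - a 0) :=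
    ((hf.continuous_fderiv (by simp)).comp hc.continuous).clm_apply continuous_const
  rw [refTri_fubini_symm hcd]
  congr 1
  funext t
  apply intervalIntegral.integral_eq_sub_of_hasDerivAt (f := fun s => f (triPoint a s t))
  · intro s _
    have h1 : HasDerivAt (fun s => triPoint a s t) (a 1 - a 0) s := by
      have := (((hasDerivAt_id s).smul_const (a 1 - a 0)).const_add (a 0)).add_const
        (t • (a 2 - a 0))
      simpa [triPoint] using this
    exact ((hf.differentiable (by simp)) _).hasFDerivAt.comp_hasDerivAt s h1
  · apply Continuous.intervalIntegrable
    exact ((hf.continuous_fderiv (by simp)).comp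
      (hc.continuous.comp (by fun_prop : Continuous fun s : ℝ => (s, t)))).clm_apply
        continuous_const

theorem integral_pd_snd {a : Fin 3 → Plane} {f : Plane → ℝ} (hf : ContDiff ℝ ∞ f) :
    ∫ p in refTri, fderiv ℝ f (triPoint a p.1 p.2) (a 2 - a 0)
      = ∫ t in (0 : ℝ)..1, (f (triPoint a t (1 - t)) - f (triPoint a t 0)) := by
  have hc := triPoint_contDiff a
  have hcd : Continuous fun p : ℝ × ℝ => fderiv ℝ f (triPoint a p.1 p.2) (a 2 - a 0) :=
    ((hf.continuous_fderiv (by simp)).comp hc.continuous).clm_apply continuous_const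
  rw [refTri_fubini hcd]
  congr 1
  funext t
  apply intervalIntegral.integral_eq_sub_of_hasDerivAt (f := fun s => f (triPoint a t s))
  · intro s _
    have h1 : HasDerivAt (fun s => triPoint a t s) (a 2 - a 0) s := by
      have := ((hasDerivAt_id s).smul_const (a 2 - a 0)).const_add (a 0 + t • (a 1 - a 0))
      simpa [triPoint] using this
    exact ((hf.differentiable (by simp)) _).hasFDerivAt.comp_hasDerivAt s h1
  · apply Continuous.intervalIntegrable
    exact ((hf.continuous_fderiv (by simp)).comp
      (hc.continuous.comp (by fun_prop : Continuous fun s : ℝ => (t, s)))).clm_apply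
        continuous_const

/-- The divergence theorem on a triangle. -/
theorem integral_pd_openTri {a : Fin 3 → Plane} (ha : 0 < area2 a) {f : Plane → ℝ}
    (hf : ContDiff ℝ ∞ f) (i : Fin 2) :
    ∫ x in openTri a, pd i f x
      = ∑ j, edgeInt (a j) (a (j + 1)) (fun x => f x * rightNormal (a j) (a (j + 1)) i) := by
  have hc := (triPoint_contDiff a).continuous
  have hcf := hf.continuous
  obtain ⟨h1, h2, h3, h4, h5, h6⟩ := fin3_add
  rw [integral_openTri ha, sum_fin3 _ 0]
  simp only [h1, h4, h2, h3]
  have n0 := vertex_ne ha 0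
  have n1 := vertex_ne ha 1
  have n2 := vertex_ne ha 2
  rw [h1] at n0; rw [h2] at n1; rw [h3] at n2
  rw [edgeInt_rightNormal n0, edgeInt_rightNormal n1, edgeInt_rightNormal n2]
  have s0 : ∀ s : ℝ, (AffineMap.lineMap (a 0) (a 1) s : Plane) = triPoint a s 0 := by
    intro s; simp only [AffineMap.lineMap_apply_module, triPoint]; module
  have s1 : ∀ s : ℝ, (AffineMap.lineMap (a 1) (a 2) s : Plane) = triPoint a (1 - s) s := by
    intro s; simp only [AffineMap.lineMap_apply_module, triPoint]; module
  have s2 : ∀ s : ℝ, (AffineMap.lineMap (a 2) (a 0) s : Plane) = triPoint a 0 (1 - s) := by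
    intro s; simp only [AffineMap.lineMap_apply_module, triPoint]; module
  simp only [s0, s1, s2]
  have c0 : Continuous fun s : ℝ => f (triPoint a s 0) := by unfold triPoint; fun_prop
  have c1 : Continuous fun s : ℝ => f (triPoint a (1 - s) s) := by unfold triPoint; fun_prop
  have c1' : Continuous fun s : ℝ => f (triPoint a s (1 - s)) := by unfold triPoint; fun_prop
  have c2 : Continuous fun s : ℝ => f (triPoint a 0 s) := by unfold triPoint; fun_prop
  have r1 : ∫ s in (0 : ℝ)..1, f (triPoint a s (1 - s))
      = ∫ s in (0 : ℝ)..1, f (triPoint a (1 - s) s) := by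
    have := intervalIntegral.integral_comp_sub_left (a := 0) (b := 1)
      (fun s : ℝ => f (triPoint a (1 - s) s)) 1
    simpa using this
  have r2 : ∫ s in (0 : ℝ)..1, f (triPoint a 0 (1 - s))
      = ∫ s in (0 : ℝ)..1, f (triPoint a 0 s) := by
    have := intervalIntegral.integral_comp_sub_left (a := 0) (b := 1)
      (fun s : ℝ => f (triPoint a 0 s)) 1
    simpa using this
  have e1 := integral_pd_fst (a := a) hf
  have e2 := integral_pd_snd (a := a) hf
  rw [intervalIntegral.integral_sub (c1.intervalIntegrable _ _) (c2.intervalIntegrable _ _)] at e1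
  rw [intervalIntegral.integral_sub (c1'.intervalIntegrable _ _) (c0.intervalIntegrable _ _),
    r1] at e2
  rw [r2]
  have hi : ∀ u : Plane, IntegrableOn (fun p : ℝ × ℝ => fderiv ℝ f (triPoint a p.1 p.2) u) refTri :=
    fun u => refTri_integrableOn (((hf.continuous_fderiv (by simp)).comp hc).clm_apply
      continuous_const)
  -- By Cramer's rule, `area2 a` times a coordinate vector is a combination of the two side vectors
  -- issuing from `a 0`, so `area2 a * pd i f` is a combination of the two derivatives integrated
  -- above.
  have key : ∀ c d : ℝ, ∫ p in refTri, (c * fderiv ℝ f (triPoint a p.1 p.2) (a 1 - a 0)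
      + d * fderiv ℝ f (triPoint a p.1 p.2) (a 2 - a 0)) = c * _ + d * _ := fun c d => by
    rw [integral_add ((hi _).const_mul c) ((hi _).const_mul d), integral_const_mul,
      integral_const_mul, e1, e2]
  rw [← integral_const_mul]
  rcases (by fin_cases i <;> simp : i = 0 ∨ i = 1) with rfl | rfl
  · have := key ((a 2) 1 - (a 0) 1) (-((a 1) 1 - (a 0) 1))
    rw [show (fun p : ℝ × ℝ => area2 a * pd 0 f (triPoint a p.1 p.2)) = fun p =>
      ((a 2) 1 - (a 0) 1) * fderiv ℝ f (triPoint a p.1 p.2) (a 1 - a 0)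
      + (-((a 1) 1 - (a 0) 1)) * fderiv ℝ f (triPoint a p.1 p.2) (a 2 - a 0) from ?_, this]
    · simp only [if_true]; ring
    · funext p
      simp only [fderiv_eq_pd, area2, cross, PiLp.sub_apply]; ring
  · have := key (-((a 2) 0 - (a 0) 0)) ((a 1) 0 - (a 0) 0)
    rw [show (fun p : ℝ × ℝ => area2 a * pd 1 f (triPoint a p.1 p.2)) = fun p =>
      (-((a 2) 0 - (a 0) 0)) * fderiv ℝ f (triPoint a p.1 p.2) (a 1 - a 0)
      + ((a 1) 0 - (a 0) 0) * fderiv ℝ f (triPoint a p.1 p.2) (a 2 - a 0) from ?_, this]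
    · simp only [one_ne_zero, if_false]; ring
    · funext p
      simp only [fderiv_eq_pd, area2, cross, PiLp.sub_apply]; ring

end IVE

end

noncomputable section

namespace IVE

open MeasureTheory Set Filter

open scoped ContDiff Convolution Topology

/-! ### Mollification and dilation -/

/-- Convolution with a normalised bump function. -/
def mol (φ : ContDiffBump (0 : Plane)) (f : Plane → ℝ) : Plane → ℝ :=
  φ.normed volume ⋆[ContinuousLinearMap.lsmul ℝ ℝ, volume] f

variable {φ : ContDiffBump (0 : Plane)} {f g : Plane → ℝ}

theorem mol_apply (φ : ContDiffBump (0 : Plane)) (f : Plane → ℝ) (x : Plane) :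
    mol φ f x = ∫ y, φ.normed volume (x - y) * f y :=
  convolution_lsmul_swap

theorem mol_contDiff (hf : LocallyIntegrable f volume) : ContDiff ℝ ∞ (mol φ f) :=
  φ.hasCompactSupport_normed.contDiff_convolution_left _ φ.contDiff_normed hf

/-- A mollification at `x` is the pairing with this reflected bump. Any weak identity tested with it
becomes a pointwise identity for the mollified function. -/
theorem bump_shift_isTest {D : Set Plane} {x : Plane}
    (hx : Metric.closedBall x φ.rOut ⊆ D) :
    IsTest D (fun y => φ.normed volume (x - y)) := by
  have hs : tsupport (fun y => φ.normed volume (x - y)) ⊆ Metric.closedBall x φ.rOut := by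
    refine closure_minimal ?_ Metric.isClosed_closedBall
    intro y hy
    have : x - y ∈ Function.support (φ.normed (volume : Measure Plane)) := hy
    rw [φ.support_normed_eq, mem_ball_zero_iff] at this
    rw [Metric.mem_closedBall, dist_comm, dist_eq_norm]
    exact this.le
  refine ⟨φ.contDiff_normed.comp (by fun_prop), ?_, hs.trans hx⟩
  exact HasCompactSupport.of_support_subset_isCompact (isCompact_closedBall x φ.rOut)
    (subset_closure.trans hs)

theorem pd_bump_shift (i : Fin 2) (x y : Plane) :
    pd i (fun y => φ.normed volume (x - y)) y = -pd i (φ.normed volume) (x - y) := by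
  have h1 : HasFDerivAt (φ.normed (volume : Measure Plane))
      (fderiv ℝ (φ.normed (volume : Measure Plane)) (x - y)) (x - y) :=
    ((φ.contDiff_normed (n := 1)).differentiable (by simp) _).hasFDerivAt
  have h2 : HasFDerivAt (fun y : Plane => x - y) (-ContinuousLinearMap.id ℝ Plane) y :=
    (hasFDerivAt_id y).const_sub x
  have := (HasFDerivAt.comp y h1 h2).fderiv
  simp only [pd]
  rw [show (fun y => φ.normed volume (x - y)) = (φ.normed volume) ∘ fun y => x - y from rfl, this]
  simp

theorem pd_mol (hf : LocallyIntegrable f volume) (i : Fin 2) (x : Plane) :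
    pd i (mol φ f) x = -∫ y, pd i (fun y => φ.normed volume (x - y)) y * f y := by
  have h := φ.hasCompactSupport_normed.hasFDerivAt_convolution_left
    (ContinuousLinearMap.lsmul ℝ ℝ) (φ.contDiff_normed (μ := volume) (n := 1)) hf x
  have h2 := congrArg (fun L : Plane →L[ℝ] ℝ => L (EuclideanSpace.single i 1)) h.fderiv
  have hint : ConvolutionExistsAt (fderiv ℝ (φ.normed (volume : Measure Plane))) f x
      ((ContinuousLinearMap.lsmul ℝ ℝ).precompL Plane) volume :=
    (φ.hasCompactSupport_normed.fderiv ℝ).convolutionExists_left _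
      ((φ.contDiff_normed (n := 1)).continuous_fderiv (by simp)) hf x
  simp only [pd, mol]
  refine h2.trans ?_
  rw [convolution_eq_swap, ContinuousLinearMap.integral_apply hint.integrable_swap,
    ← integral_neg]
  congr 1
  funext y
  have := pd_bump_shift (φ := φ) i x y
  simp only [pd] at this
  rw [this]
  simp [ContinuousLinearMap.precompL]

/-- Mollification commutes with a weak derivative in `D` only at points whose kernel is supported in
`D`; hence the condition on the ball. -/
theorem pd_mol_of_weak (hf : LocallyIntegrable f volume) {i : Fin 2} {x : Plane} {D : Set Plane}
    (hx : Metric.closedBall x φ.rOut ⊆ D)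
    (hg : ∀ ψ, IsTest D ψ → ∫ y, f y * pd i ψ y = -∫ y, g y * ψ y) :
    pd i (mol φ f) x = mol φ g x := by
  have := hg _ (bump_shift_isTest hx)
  rw [pd_mol hf, mol_apply]
  simp only [mul_comm] at this ⊢
  rw [this, neg_neg]

theorem mol_support (φ : ContDiffBump (0 : Plane)) (f : Plane → ℝ) {x : Plane}
    (hx : mol φ f x ≠ 0) : ∃ y, f y ≠ 0 ∧ dist x y < φ.rOut := by
  obtain ⟨u, hu, v, hv, rfl⟩ := support_convolution_subset _ (show x ∈ Function.support _ from hx)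
  refine ⟨v, hv, ?_⟩
  rw [φ.support_normed_eq, mem_ball_zero_iff] at hu
  simpa [dist_eq_norm] using hu

theorem bump_shift_mul_integrable (φ : ContDiffBump (0 : Plane)) (hf : LocallyIntegrable f volume)
    (x : Plane) : Integrable (fun y => φ.normed volume (x - y) * f y) volume := by
  have h : ConvolutionExistsAt (φ.normed (volume : Measure Plane)) f x
      (ContinuousLinearMap.lsmul ℝ ℝ) volume :=
    φ.hasCompactSupport_normed.convolutionExists_left _ φ.continuous_normed hf x
  exact h.integrable_swap

theorem mol_sub (hf : LocallyIntegrable f volume) (hg : LocallyIntegrable g volume) :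
    mol φ (fun x => f x - g x) = fun x => mol φ f x - mol φ g x := by
  funext x
  have h := fun {f : Plane → ℝ} (hf : LocallyIntegrable f volume) =>
    bump_shift_mul_integrable φ hf x
  rw [mol_apply, mol_apply, mol_apply, ← integral_sub (h hf) (h hg)]
  congr 1; funext y; ring

theorem memLp_two_sq (hf : MemLp f 2 volume) : Integrable (fun x => f x ^ 2) volume :=
  hf.integrable_sq

theorem locallyIntegrable_of_memLp_two (hf : MemLp f 2 volume) : LocallyIntegrable f volume :=
  hf.locallyIntegrable (by norm_num)

/-- Jensen's inequality for the probability density of the bump: the variance of `f` under this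
density is nonnegative. -/
theorem mol_sq_le (hf : MemLp f 2 volume) (x : Plane) :
    mol φ f x ^ 2 ≤ mol φ (fun y => f y ^ 2) x := by
  have hl := locallyIntegrable_of_memLp_two hf
  have h := fun {f : Plane → ℝ} (hf : LocallyIntegrable f volume) =>
    bump_shift_mul_integrable φ hf x
  have h1 := h hl
  have h2 := h (memLp_two_sq hf).locallyIntegrable
  have h0 : Integrable (fun y => φ.normed volume (x - y)) volume :=
    φ.integrable_normed.comp_sub_left x
  have h00 : ∫ y, φ.normed volume (x - y) = 1 := by
    rw [integral_sub_left_eq_self (fun y => φ.normed volume y)]; exact φ.integral_normed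
  set m := mol φ f x with hm
  have hpos : 0 ≤ ∫ y, φ.normed volume (x - y) * (f y - m) ^ 2 :=
    integral_nonneg fun y => mul_nonneg (φ.nonneg_normed _) (sq_nonneg _)
  have heq : ∫ y, φ.normed volume (x - y) * (f y - m) ^ 2
      = mol φ (fun y => f y ^ 2) x - 2 * m * m + m ^ 2 := by
    rw [show (fun y => φ.normed volume (x - y) * (f y - m) ^ 2) = fun y =>
      φ.normed volume (x - y) * f y ^ 2 - 2 * m * (φ.normed volume (x - y) * f y)
        + m ^ 2 * φ.normed volume (x - y) by funext y; ring,
      integral_add (f := fun y => φ.normed volume (x - y) * f y ^ 2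
          - 2 * m * (φ.normed volume (x - y) * f y)) (h2.sub (h1.const_mul _)) (h0.const_mul _),
      integral_sub h2 (h1.const_mul _), integral_const_mul, integral_const_mul, h00,
      ← mol_apply, ← mol_apply, ← hm, mul_one]
  rw [heq] at hpos
  nlinarith

theorem mol_integrable (hf : Integrable f volume) : Integrable (mol φ f) volume :=
  φ.integrable_normed.integrable_convolution _ hf

theorem mol_memLp (hf : MemLp f 2 volume) : MemLp (mol φ f) 2 volume := by
  have hc := (mol_contDiff (φ := φ) (locallyIntegrable_of_memLp_two hf)).continuous
  refine (memLp_two_iff_integrable_sq hc.aestronglyMeasurable).2 ?_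
  refine Integrable.mono' (mol_integrable (φ := φ) (memLp_two_sq hf))
    (hc.pow 2).aestronglyMeasurable ?_
  filter_upwards with x
  rw [Real.norm_of_nonneg (sq_nonneg _)]
  exact mol_sq_le hf x

theorem integral_mol_sq_le (hf : MemLp f 2 volume) : ∫ x, mol φ f x ^ 2 ≤ ∫ x, f x ^ 2 := by
  have h1 : ∫ x, mol φ (fun y => f y ^ 2) x = ∫ x, f x ^ 2 := by
    have := integral_convolution (ContinuousLinearMap.lsmul ℝ ℝ) (μ := (volume : Measure Plane))
      (ν := volume) (f := φ.normed volume) (g := fun y => f y ^ 2) φ.integrable_normed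
      (memLp_two_sq hf)
    rw [φ.integral_normed] at this
    simpa [mol] using this
  rw [← h1]
  exact integral_mono (memLp_two_sq (mol_memLp hf)) (mol_integrable (memLp_two_sq hf))
    fun x => mol_sq_le hf x

theorem integral_dilate (h : Plane → ℝ) (c : Plane) (s : ℝ) :
    ∫ x, h (c + s • (x - c)) = |(s ^ 2)⁻¹| * ∫ x, h x := by
  have h1 := integral_sub_right_eq_self (μ := (volume : Measure Plane))
    (fun x => h (c + s • x)) c
  rw [h1, Measure.integral_comp_smul volume (fun x => h (c + x)) s,
    integral_add_left_eq_self h c]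
  simp

theorem integrable_dilate {h : Plane → ℝ} (hh : Integrable h volume) (c : Plane) {s : ℝ}
    (hs : s ≠ 0) : Integrable (fun x => h (c + s • (x - c))) volume := by
  have h1 : Integrable (fun x => h (c + x)) volume := hh.comp_add_left c
  exact (h1.comp_smul hs).comp_sub_right c

theorem memLp_dilate (hf : Continuous f) (hf2 : MemLp f 2 volume) (c : Plane) {s : ℝ}
    (hs : s ≠ 0) : MemLp (fun x => f (c + s • (x - c))) 2 volume := by
  refine (memLp_two_iff_integrable_sq (hf.comp (by fun_prop)).aestronglyMeasurable).2 ?_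
  exact integrable_dilate (memLp_two_sq hf2) c hs

/-- Young's inequality with a free parameter takes the place of Cauchy–Schwarz and avoids square
roots in the limit argument below. -/
theorem abs_integral_mul_le (hf : MemLp f 2 volume) (hg : MemLp g 2 volume) {δ : ℝ} (hδ : 0 < δ) :
    |∫ x, f x * g x| ≤ (δ * ∫ x, f x ^ 2) + δ⁻¹ * ∫ x, g x ^ 2 := by
  rw [← integral_const_mul, ← integral_const_mul,
    ← integral_add ((memLp_two_sq hf).const_mul _) ((memLp_two_sq hg).const_mul _)]
  refine (abs_integral_le_integral_abs).trans (integral_mono (hf.integrable_mul hg).abs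
    (((memLp_two_sq hf).const_mul _).add ((memLp_two_sq hg).const_mul _)) fun x => ?_)
  simp only
  have h1 : 0 ≤ δ * (|f x| - δ⁻¹ * |g x|) ^ 2 := by positivity
  have h2 : δ * (|f x| - δ⁻¹ * |g x|) ^ 2 = δ * f x ^ 2 + δ⁻¹ * g x ^ 2 - 2 * |f x| * |g x| := by
    rw [← sq_abs (f x), ← sq_abs (g x)]; field_simp; ring
  rw [abs_mul]
  have : 0 ≤ |f x| * |g x| := by positivity
  linarith

theorem exists_continuous_approx (hf : MemLp f 2 volume) {η : ℝ} (hη : 0 < η) :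
    ∃ g : Plane → ℝ, HasCompactSupport g ∧ Continuous g ∧ ∫ x, (f x - g x) ^ 2 ≤ η := by
  obtain ⟨g, h1, h3, h2, hg⟩ := MemLp.exists_hasCompactSupport_eLpNorm_sub_le (p := 2) (by norm_num)
    hf (ε := ENNReal.ofReal (Real.sqrt η)) (by simpa using hη)
  refine ⟨g, h1, h2, ?_⟩
  rw [(hf.sub hg).eLpNorm_eq_integral_rpow_norm (by norm_num) (by norm_num)] at h3
  have h4 := (ENNReal.ofReal_le_ofReal_iff (Real.sqrt_nonneg _)).1 h3
  simp only [ENNReal.toReal_ofNat, Pi.sub_apply, Real.norm_eq_abs, Real.rpow_ofNat, sq_abs] at h4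
  have h5 : (0 : ℝ) ≤ ∫ x, (f x - g x) ^ 2 := integral_nonneg fun x => sq_nonneg _
  rw [show (2 : ℝ)⁻¹ = 1 / 2 by norm_num, ← Real.sqrt_eq_rpow] at h4
  exact (Real.sqrt_le_sqrt_iff hη.le).1 h4

theorem abs_mol_le {M : ℝ} (hf : LocallyIntegrable f volume) {x : Plane}
    (hM : ∀ y, dist y x < φ.rOut → |f y| ≤ M) : |mol φ f x| ≤ M := by
  have h := bump_shift_mul_integrable φ hf x
  have h0 : Integrable (fun y => φ.normed volume (x - y)) volume :=
    φ.integrable_normed.comp_sub_left x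
  have h00 : ∫ y, φ.normed volume (x - y) = 1 := by
    rw [integral_sub_left_eq_self (fun y => φ.normed volume y)]; exact φ.integral_normed
  rw [mol_apply]
  calc |∫ y, φ.normed volume (x - y) * f y| ≤ ∫ y, |φ.normed volume (x - y) * f y| :=
        abs_integral_le_integral_abs
    _ ≤ ∫ y, φ.normed volume (x - y) * M := by
        refine integral_mono h.abs (h0.mul_const M) fun y => ?_
        simp only
        rw [abs_mul, abs_of_nonneg (φ.nonneg_normed _)]
        by_cases hy : dist y x < φ.rOut
        · exact mul_le_mul_of_nonneg_left (hM y hy) (φ.nonneg_normed _)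
        · have : φ.normed (volume : Measure Plane) (x - y) = 0 := by
            rw [← Function.notMem_support, φ.support_normed_eq, mem_ball_zero_iff, ← dist_eq_norm,
              dist_comm]
            exact hy
          simp [this]
    _ = M := by rw [integral_mul_const, h00, one_mul]

theorem tendsto_integral_mol_of_continuous {F : Plane → ℝ} (hF : MemLp F 2 volume)
    (hg : Continuous g) (hgc : HasCompactSupport g) (c : Plane) {s : ℕ → ℝ}
    (hs : Tendsto s atTop (𝓝 1)) {φ : ℕ → ContDiffBump (0 : Plane)}
    (hφ : Tendsto (fun n => (φ n).rOut) atTop (𝓝 0)) :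
    Tendsto (fun n => ∫ x, F x * mol (φ n) g (c + s n • (x - c))) atTop (𝓝 (∫ x, F x * g x)) := by
  have hgl : LocallyIntegrable g volume := hg.locallyIntegrable
  obtain ⟨M, hM⟩ := hgc.exists_bound_of_continuous hg
  have hM0 : 0 ≤ M := (norm_nonneg _).trans (hM 0)
  obtain ⟨R, hR⟩ := hgc.isCompact.isBounded.subset_ball c
  have hn : ∀ᶠ n in atTop, 1 / 2 < s n ∧ (φ n).rOut < 1 :=
    (hs.eventually (lt_mem_nhds (by norm_num))).and (hφ.eventually (gt_mem_nhds (by norm_num)))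
  -- Eventually the dilation factor exceeds `1/2` and the bump radius is below `1`. If `g` lives in
  -- the ball of radius `R` about `c`, the dilated mollifications then live in the ball of radius `2
  -- (R + 1)`.
  refine tendsto_integral_filter_of_dominated_convergence
    (fun x => |F x| * (Metric.closedBall c (2 * (R + 1))).indicator (fun _ => M) x) ?_ ?_ ?_ ?_
  · refine Eventually.of_forall fun n => hF.1.mul ?_
    exact ((mol_contDiff hgl).continuous.comp (by fun_prop)).aestronglyMeasurable
  · filter_upwards [hn] with n hn
    filter_upwards with x
    rw [norm_mul, Real.norm_eq_abs, Real.norm_eq_abs]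
    refine mul_le_mul_of_nonneg_left ?_ (abs_nonneg _)
    by_cases hx : x ∈ Metric.closedBall c (2 * (R + 1))
    · rw [indicator_of_mem hx]
      exact abs_mol_le hgl fun y _ => hM y
    · rw [indicator_of_notMem hx]
      by_contra hne
      have h0 : mol (φ n) g (c + s n • (x - c)) ≠ 0 := fun h => hne (by rw [h, abs_zero])
      obtain ⟨y, hy, hd⟩ := mol_support _ _ h0
      have h1 : dist y c < R := hR (subset_closure hy)
      have h2 : dist (c + s n • (x - c)) c < R + 1 := by
        linarith [dist_triangle (c + s n • (x - c)) y c, hn.2]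
      rw [dist_eq_norm, add_sub_cancel_left, norm_smul, ← dist_eq_norm, Real.norm_eq_abs,
        abs_of_pos (by linarith [hn.1])] at h2
      rw [Metric.mem_closedBall, not_le] at hx
      have h3 : 0 ≤ dist x c := dist_nonneg
      nlinarith [hn.1]
  · have : MemLp ((Metric.closedBall c (2 * (R + 1))).indicator fun _ => M) 2 volume :=
      memLp_indicator_const 2 measurableSet_closedBall M (Or.inr measure_closedBall_lt_top.ne)
    exact hF.abs.integrable_mul this
  · filter_upwards with x
    refine Tendsto.mul tendsto_const_nhds ?_
    refine ContDiffBump.convolution_tendsto_right hφ (Eventually.of_forall fun _ =>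
      hg.aestronglyMeasurable) ((hg.tendsto x).comp tendsto_snd) ?_
    have : Tendsto (fun n => c + s n • (x - c)) atTop (𝓝 (c + (1 : ℝ) • (x - c))) :=
      tendsto_const_nhds.add (hs.smul_const _)
    simpa using this

/-- Weak convergence under simultaneous mollification and dilation. Both operations are bounded on
`L²` uniformly in `n`, so density reduces the claim to continuous functions of compact support. -/
theorem tendsto_integral_mol {F : Plane → ℝ} (hF : MemLp F 2 volume) (hf : MemLp f 2 volume)
    (c : Plane) {s : ℕ → ℝ} (hs : Tendsto s atTop (𝓝 1)) {φ : ℕ → ContDiffBump (0 : Plane)}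
    (hφ : Tendsto (fun n => (φ n).rOut) atTop (𝓝 0)) :
    Tendsto (fun n => ∫ x, F x * mol (φ n) f (c + s n • (x - c))) atTop (𝓝 (∫ x, F x * f x)) := by
  rw [Metric.tendsto_atTop']
  intro ε hε
  set A := ∫ x, F x ^ 2
  have hA : 0 ≤ A := integral_nonneg fun x => sq_nonneg _
  obtain ⟨δ, hδ, hδA⟩ : ∃ δ > 0, δ * A ≤ ε / 8 := by
    refine ⟨ε / (8 * (A + 1)), by positivity, ?_⟩
    rw [div_mul_eq_mul_div, div_le_div_iff₀ (by positivity) (by positivity)]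
    nlinarith
  -- The error is at most `ε/4` from the continuous case, `ε/8 + 4 ε/40` from replacing `f` by `g`
  -- in the mollified term, and `ε/8 + ε/40` from doing so in the limit, in total `5 ε/8`. The
  -- factor `4` bounds the Jacobian of a dilation with `s n > 1/2`.
  obtain ⟨g, hg1, hg2, hg3⟩ := exists_continuous_approx hf (show 0 < δ * (ε / 40) by positivity)
  have hg : MemLp g 2 volume := hg2.memLp_of_hasCompactSupport hg1
  have hfg : MemLp (fun x => f x - g x) 2 volume := hf.sub hg
  have hlf := locallyIntegrable_of_memLp_two hf
  have hlg := locallyIntegrable_of_memLp_two hg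
  set E := ∫ x, (f x - g x) ^ 2
  have hE : 0 ≤ E := integral_nonneg fun x => sq_nonneg _
  have hEδ : δ⁻¹ * E ≤ ε / 40 := by
    rw [inv_mul_le_iff₀ hδ]; exact hg3
  have hT := tendsto_integral_mol_of_continuous hF hg2 hg1 c hs hφ
  rw [Metric.tendsto_atTop'] at hT
  obtain ⟨N, hN⟩ := hT (ε / 4) (by positivity)
  obtain ⟨N', hN'⟩ := eventually_atTop.1 (hs.eventually (lt_mem_nhds (by norm_num : (1 / 2 : ℝ) < 1)))
  refine ⟨max N N', fun n hn => ?_⟩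
  have hn1 := hN n ((le_max_left _ _).trans_lt hn)
  have hn2 := hN' n ((le_max_right _ _).trans hn.le)
  have hs0 : s n ≠ 0 := by linarith
  have hT1 : MemLp (fun x => mol (φ n) f (c + s n • (x - c))) 2 volume :=
    memLp_dilate (mol_contDiff hlf).continuous (mol_memLp hf) c hs0
  have hT2 : MemLp (fun x => mol (φ n) g (c + s n • (x - c))) 2 volume :=
    memLp_dilate (mol_contDiff hlg).continuous (mol_memLp hg) c hs0
  have b1 := abs_integral_mul_le hF (hT1.sub hT2) hδ
  have b2 := abs_integral_mul_le hF hfg hδ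
  have b3 : ∫ x, ((fun x => mol (φ n) f (c + s n • (x - c))) -
      fun x => mol (φ n) g (c + s n • (x - c))) x ^ 2 ≤ 4 * E := by
    have h1 := integral_dilate (fun y => mol (φ n) (fun x => f x - g x) y ^ 2) c (s n)
    rw [mol_sub hlf hlg] at h1
    have h2 := integral_mol_sq_le (φ := φ n) hfg
    rw [mol_sub hlf hlg] at h2
    have h3 : |(s n ^ 2)⁻¹| ≤ 4 := by
      rw [abs_of_nonneg (by positivity), inv_le_comm₀ (by positivity) (by norm_num)]
      nlinarith
    refine h1.le.trans ?_
    exact mul_le_mul h3 h2 (integral_nonneg fun x => sq_nonneg _) (by norm_num)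
  have e1 : ∫ x, F x * ((fun x => mol (φ n) f (c + s n • (x - c))) -
      fun x => mol (φ n) g (c + s n • (x - c))) x = (∫ x, F x * mol (φ n) f (c + s n • (x - c)))
        - ∫ x, F x * mol (φ n) g (c + s n • (x - c)) := by
    rw [← integral_sub (f := fun x => F x * mol (φ n) f (c + s n • (x - c)))
      (g := fun x => F x * mol (φ n) g (c + s n • (x - c)))
      (hF.integrable_mul hT1) (hF.integrable_mul hT2)]
    congr 1; funext x; simp only [Pi.sub_apply]; ring
  have e2 : ∫ x, F x * (f x - g x) = (∫ x, F x * f x) - ∫ x, F x * g x := by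
    rw [← integral_sub (f := fun x => F x * f x) (g := fun x => F x * g x)
      (hF.integrable_mul hf) (hF.integrable_mul hg)]
    congr 1; funext x; ring
  rw [e1] at b1
  rw [e2] at b2
  have b4 : δ⁻¹ * ∫ x, ((fun x => mol (φ n) f (c + s n • (x - c))) -
      fun x => mol (φ n) g (c + s n • (x - c))) x ^ 2 ≤ 4 * (ε / 40) := by
    refine (mul_le_mul_of_nonneg_left b3 (by positivity)).trans ?_
    linarith
  rw [Real.dist_eq] at hn1 ⊢
  rw [abs_le] at b1 b2
  rw [abs_lt] at hn1 ⊢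
  constructor <;> linarith [b1.1, b1.2, b2.1, b2.2, hn1.1, hn1.2]

end IVE

end

noncomputable section

namespace IVE

open MeasureTheory Set Filter

open scoped ContDiff Topology

/-! ### Calculus of weak derivatives -/

section Basic

variable {D : Set Plane}

theorem MemL2.mul_integrable {f g : Plane → ℝ} (hf : MemL2 D f) (hg : MemL2 D g) :
    IntegrableOn (fun x => f x * g x) D :=
  MemLp.integrable_mul hf hg

theorem MemL2.coord {G : Plane → Plane} (hG : MemL2 D G) (i : Fin 2) :
    MemL2 D (fun x => G x i) :=
  (EuclideanSpace.proj (𝕜 := ℝ) i : Plane →L[ℝ] ℝ).comp_memLp' hG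

theorem memL2_of_coord {G : Plane → Plane} (h0 : MemL2 D fun x => G x 0)
    (h1 : MemL2 D fun x => G x 1) : MemL2 D G := by
  have e : G = fun x => G x 0 • (EuclideanSpace.single 0 1 : Plane)
      + G x 1 • (EuclideanSpace.single 1 1 : Plane) := by
    funext x; apply plane_ext <;> simp
  rw [e]
  refine MemLp.add ?_ ?_
  · exact ((ContinuousLinearMap.id ℝ ℝ).smulRight (EuclideanSpace.single 0 1 : Plane)).comp_memLp' h0
  · exact ((ContinuousLinearMap.id ℝ ℝ).smulRight (EuclideanSpace.single 1 1 : Plane)).comp_memLp' h1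

theorem IsTest.memL2 {φ : Plane → ℝ} (hφ : IsTest D φ) : MemL2 D φ :=
  (hφ.1.continuous.memLp_of_hasCompactSupport hφ.2.1).restrict D

theorem IsTest.pd {φ : Plane → ℝ} (hφ : IsTest D φ) (i : Fin 2) : IsTest D (pd i φ) :=
  ⟨pd_contDiff hφ.1 i, hφ.2.1.fderiv_apply ℝ _, (tsupport_fderiv_apply_subset ℝ _).trans hφ.2.2⟩

theorem IsTest.mono {E : Set Plane} (h : D ⊆ E) {φ : Plane → ℝ} (hφ : IsTest D φ) : IsTest E φ :=
  ⟨hφ.1, hφ.2.1, hφ.2.2.trans h⟩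

theorem IsTest.pd_eq_zero {φ : Plane → ℝ} (hφ : IsTest D φ) {x : Plane} (hx : x ∉ D) (i : Fin 2) :
    IVE.pd i φ x = 0 :=
  image_eq_zero_of_notMem_tsupport fun h => hx ((hφ.pd i).2.2 h)

theorem IsTest.eq_zero {φ : Plane → ℝ} (hφ : IsTest D φ) {x : Plane} (hx : x ∉ D) : φ x = 0 :=
  image_eq_zero_of_notMem_tsupport fun h => hx (hφ.2.2 h)

theorem EqAE.symm {F : Type} {f g : Plane → F} (h : EqAE D f g) : EqAE D g f := by
  filter_upwards [h] with x hx using hx.symm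

theorem EqAE.trans {F : Type} {f g k : Plane → F} (h : EqAE D f g) (h' : EqAE D g k) :
    EqAE D f k := by
  filter_upwards [h, h'] with x hx hx' using hx.trans hx'

theorem EqAE.mono {E : Set Plane} (hE : E ⊆ D) {F : Type} {f g : Plane → F} (h : EqAE D f g) :
    EqAE E f g := ae_restrict_of_ae_restrict_of_subset hE h

theorem MemL2.congr {F : Type} [NormedAddCommGroup F] {f g : Plane → F} (hf : MemL2 D f)
    (h : EqAE D f g) : MemL2 D g := MemLp.ae_eq h hf

theorem MemL2.mono {F : Type} [NormedAddCommGroup F] {E : Set Plane} (hE : E ⊆ D) {f : Plane → F}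
    (hf : MemL2 D f) : MemL2 E f := hf.mono_measure (Measure.restrict_mono hE le_rfl)

theorem integral_congr_eqAE {f g : Plane → ℝ} (h : EqAE D f g) :
    ∫ x in D, f x = ∫ x in D, g x := integral_congr_ae h

theorem IsWeakGrad.congr {u u' : Plane → ℝ} {G G' : Plane → Plane} (h : IsWeakGrad D u G)
    (hu : EqAE D u u') (hG : EqAE D G G') : IsWeakGrad D u' G' := by
  refine ⟨h.1.congr hu, h.2.1.congr hG, fun φ hφ i => ?_⟩
  rw [integral_congr_eqAE (f := fun x => u' x * pd i φ x) (g := fun x => u x * pd i φ x),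
    h.2.2 φ hφ i, integral_congr_eqAE (f := fun x => G x i * φ x) (g := fun x => G' x i * φ x)]
  · filter_upwards [hG] with x hx; rw [hx]
  · filter_upwards [hu] with x hx; rw [hx]

theorem IsWeakCurl.congr {v v' : Plane → Plane} {c c' : Plane → ℝ} (h : IsWeakCurl D v c)
    (hv : EqAE D v v') (hc : EqAE D c c') : IsWeakCurl D v' c' := by
  refine ⟨h.1.congr hv, h.2.1.congr hc, fun φ hφ => ?_⟩
  rw [integral_congr_eqAE (f := fun x => c' x * φ x) (g := fun x => c x * φ x),
    h.2.2 φ hφ, integral_congr_eqAE (f := fun x => v x 0 * pd 1 φ x - v x 1 * pd 0 φ x)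
      (g := fun x => v' x 0 * pd 1 φ x - v' x 1 * pd 0 φ x)]
  · filter_upwards [hv] with x hx; rw [hx]
  · filter_upwards [hc] with x hx; rw [hx]

theorem IsWeakDiv.congr {v v' : Plane → Plane} {d : Plane → ℝ} (h : IsWeakDiv D v d)
    (hv : EqAE D v v') : IsWeakDiv D v' d := by
  refine ⟨h.1.congr hv, h.2.1, fun φ hφ => ?_⟩
  rw [h.2.2 φ hφ, integral_congr_eqAE (f := fun x => v x 0 * pd 0 φ x + v x 1 * pd 1 φ x)
      (g := fun x => v' x 0 * pd 0 φ x + v' x 1 * pd 1 φ x)]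
  filter_upwards [hv] with x hx; rw [hx]

theorem setIntegral_test_eq {E : Set Plane} (hD : MeasurableSet D) (h : E ⊆ D) {f : Plane → ℝ}
    (hf : ∀ x, x ∉ E → f x = 0) : ∫ x in D, f x = ∫ x in E, f x :=
  (setIntegral_eq_of_subset_of_forall_sdiff_eq_zero hD h fun x hx => hf x hx.2)

theorem eqAE_of_forall_test (hD : IsOpen D) {f g : Plane → ℝ} (hf : MemL2 D f) (hg : MemL2 D g)
    (h : ∀ φ, IsTest D φ → ∫ x in D, f x * φ x = ∫ x in D, g x * φ x) : EqAE D f g := by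
  have hfg : MemL2 D (f - g) := hf.sub hg
  have hl : LocallyIntegrableOn (f - g) D volume :=
    (locallyIntegrableOn_of_locallyIntegrable_restrict (hfg.locallyIntegrable (by norm_num)))
  have := hD.ae_eq_zero_of_integral_contDiff_smul_eq_zero hl (fun φ h1 h2 h3 => ?_)
  · rw [EqAE, ae_restrict_iff' hD.measurableSet]
    filter_upwards [this] with x hx hxD
    exact sub_eq_zero.1 (hx hxD)
  · have hφ : IsTest D φ := ⟨h1, h2, h3⟩
    have h4 := h φ hφ
    rw [← sub_eq_zero, ← integral_sub (hf.mul_integrable hφ.memL2) (hg.mul_integrable hφ.memL2)] at h4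
    rw [← setIntegral_univ, setIntegral_test_eq MeasurableSet.univ (subset_univ D)]
    · rw [← h4]
      congr 1; funext x; simp only [Pi.sub_apply, smul_eq_mul]; ring
    · intro x hx
      rw [hφ.eq_zero hx, zero_smul]

theorem IsWeakGrad.unique (hD : IsOpen D) {u : Plane → ℝ} {G G' : Plane → Plane}
    (h : IsWeakGrad D u G) (h' : IsWeakGrad D u G') : EqAE D G G' := by
  have key : ∀ i, EqAE D (fun x => G x i) (fun x => G' x i) := fun i => by
    refine eqAE_of_forall_test hD (h.2.1.coord i) (h'.2.1.coord i) fun φ hφ => ?_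
    rw [← neg_inj, ← h.2.2 φ hφ i, ← h'.2.2 φ hφ i]
  filter_upwards [key 0, key 1] with x h0 h1
  exact plane_ext h0 h1

theorem IsWeakCurl.unique (hD : IsOpen D) {v : Plane → Plane} {c c' : Plane → ℝ}
    (h : IsWeakCurl D v c) (h' : IsWeakCurl D v c') : EqAE D c c' :=
  eqAE_of_forall_test hD h.2.1 h'.2.1 fun φ hφ => by rw [h.2.2 φ hφ, h'.2.2 φ hφ]

theorem IsWeakGrad.mono {E : Set Plane} (hD : MeasurableSet D) (hED : E ⊆ D) {u : Plane → ℝ}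
    {G : Plane → Plane} (h : IsWeakGrad D u G) : IsWeakGrad E u G := by
  refine ⟨h.1.mono hED, h.2.1.mono hED, fun φ hφ i => ?_⟩
  rw [← setIntegral_test_eq hD hED, ← setIntegral_test_eq hD hED]
  · exact h.2.2 φ (hφ.mono hED) i
  · intro x hx; rw [hφ.eq_zero hx, mul_zero]
  · intro x hx; rw [hφ.pd_eq_zero hx, mul_zero]

theorem IsWeakCurl.mono {E : Set Plane} (hD : MeasurableSet D) (hED : E ⊆ D) {v : Plane → Plane}
    {c : Plane → ℝ} (h : IsWeakCurl D v c) : IsWeakCurl E v c := by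
  refine ⟨h.1.mono hED, h.2.1.mono hED, fun φ hφ => ?_⟩
  rw [← setIntegral_test_eq hD hED, ← setIntegral_test_eq hD hED]
  · exact h.2.2 φ (hφ.mono hED)
  · intro x hx; rw [hφ.pd_eq_zero hx, hφ.pd_eq_zero hx, mul_zero, mul_zero, sub_zero]
  · intro x hx; rw [hφ.eq_zero hx, mul_zero]

theorem pd_comm {φ : Plane → ℝ} (hφ : ContDiff ℝ ∞ φ) (i j : Fin 2) (x : Plane) :
    pd i (pd j φ) x = pd j (pd i φ) x := by
  have hs : IsSymmSndFDerivAt ℝ φ x := hφ.contDiffAt.isSymmSndFDerivAt (by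
    rw [minSmoothness_of_isRCLikeNormedField]; exact WithTop.coe_le_coe.2 le_top)
  have h2 : ∀ u v : Plane, fderiv ℝ (fun y => fderiv ℝ φ y u) x v = fderiv ℝ (fderiv ℝ φ) x v u := by
    intro u v
    have hd : DifferentiableAt ℝ (fderiv ℝ φ) x :=
      (hφ.fderiv_right (m := ∞) (by simp)).differentiable (by simp) x
    rw [fderiv_clm_apply hd (differentiableAt_const u)]
    simp
  show fderiv ℝ (fun y => fderiv ℝ φ y _) x _ = fderiv ℝ (fun y => fderiv ℝ φ y _) x _
  rw [h2, h2, hs.eq]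

/-- A weak gradient has vanishing weak curl. -/
theorem IsWeakGrad.curl {u : Plane → ℝ} {G : Plane → Plane} (h : IsWeakGrad D u G) :
    IsWeakCurl D G (fun _ => 0) := by
  refine ⟨h.2.1, by simp [MemL2], fun φ hφ => ?_⟩
  have h1 := h.2.2 _ (hφ.pd 1) 0
  have h2 := h.2.2 _ (hφ.pd 0) 1
  rw [integral_sub ((h.2.1.coord 0).mul_integrable (hφ.pd 1).memL2)
    ((h.2.1.coord 1).mul_integrable (hφ.pd 0).memL2)]
  simp only [pd_comm hφ.1 1 0] at h2
  simp only [zero_mul, integral_zero]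
  linarith

theorem IsWeakGrad.add {u u' : Plane → ℝ} {G G' : Plane → Plane} (h : IsWeakGrad D u G)
    (h' : IsWeakGrad D u' G') : IsWeakGrad D (fun x => u x + u' x) (fun x => G x + G' x) := by
  refine ⟨h.1.add h'.1, h.2.1.add h'.2.1, fun φ hφ i => ?_⟩
  have h1 := h.2.2 φ hφ i
  have h2 := h'.2.2 φ hφ i
  simp only [PiLp.add_apply, add_mul]
  rw [integral_add (h.1.mul_integrable (hφ.pd i).memL2) (h'.1.mul_integrable (hφ.pd i).memL2),
    integral_add ((h.2.1.coord i).mul_integrable hφ.memL2)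
      ((h'.2.1.coord i).mul_integrable hφ.memL2), h1, h2]
  ring

theorem IsWeakGrad.smul {u : Plane → ℝ} {G : Plane → Plane} (h : IsWeakGrad D u G) (k : ℝ) :
    IsWeakGrad D (fun x => k * u x) (fun x => k • G x) := by
  refine ⟨h.1.const_mul k, h.2.1.const_smul k, fun φ hφ i => ?_⟩
  have h1 := h.2.2 φ hφ i
  simp only [PiLp.smul_apply, smul_eq_mul, mul_assoc, integral_const_mul, h1]
  ring

theorem IsWeakCurl.add {v v' : Plane → Plane} {c c' : Plane → ℝ} (h : IsWeakCurl D v c)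
    (h' : IsWeakCurl D v' c') : IsWeakCurl D (fun x => v x + v' x) (fun x => c x + c' x) := by
  refine ⟨h.1.add h'.1, h.2.1.add h'.2.1, fun φ hφ => ?_⟩
  have h1 := h.2.2 φ hφ
  have h2 := h'.2.2 φ hφ
  have i1 := ((h.1.coord 0).mul_integrable (hφ.pd 1).memL2).sub
    ((h.1.coord 1).mul_integrable (hφ.pd 0).memL2)
  have i2 := ((h'.1.coord 0).mul_integrable (hφ.pd 1).memL2).sub
    ((h'.1.coord 1).mul_integrable (hφ.pd 0).memL2)
  have e := integral_add i1 i2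
  simp only [Pi.sub_apply] at e
  simp only [add_mul]
  rw [integral_add (h.2.1.mul_integrable hφ.memL2) (h'.2.1.mul_integrable hφ.memL2), h1, h2, ← e]
  congr 1; funext x; simp only [PiLp.add_apply]; ring

theorem IsWeakCurl.smul {v : Plane → Plane} {c : Plane → ℝ} (h : IsWeakCurl D v c) (k : ℝ) :
    IsWeakCurl D (fun x => k • v x) (fun x => k * c x) := by
  refine ⟨h.1.const_smul k, h.2.1.const_mul k, fun φ hφ => ?_⟩
  have h1 := h.2.2 φ hφ
  simp only [mul_assoc, integral_const_mul, h1]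
  rw [← integral_const_mul]
  congr 1; funext x; simp only [PiLp.smul_apply, smul_eq_mul]; ring

theorem IsWeakDiv.add {v v' : Plane → Plane} (h : IsWeakDiv D v fun _ => 0)
    (h' : IsWeakDiv D v' fun _ => 0) : IsWeakDiv D (fun x => v x + v' x) (fun _ => 0) := by
  refine ⟨h.1.add h'.1, h.2.1, fun φ hφ => ?_⟩
  have h1 := h.2.2 φ hφ
  have h2 := h'.2.2 φ hφ
  have i1 := ((h.1.coord 0).mul_integrable (hφ.pd 0).memL2).add
    ((h.1.coord 1).mul_integrable (hφ.pd 1).memL2)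
  have i2 := ((h'.1.coord 0).mul_integrable (hφ.pd 0).memL2).add
    ((h'.1.coord 1).mul_integrable (hφ.pd 1).memL2)
  have e := integral_add i1 i2
  simp only [Pi.add_apply] at e
  simp only [zero_mul, integral_zero] at h1 h2 ⊢
  rw [zero_eq_neg] at h1 h2 ⊢
  rw [h1, h2, add_zero] at e
  rw [← e]
  congr 1; funext x; simp only [PiLp.add_apply]; ring

theorem IsWeakDiv.smul {v : Plane → Plane} (h : IsWeakDiv D v fun _ => 0) (k : ℝ) :
    IsWeakDiv D (fun x => k • v x) (fun _ => 0) := by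
  refine ⟨h.1.const_smul k, h.2.1, fun φ hφ => ?_⟩
  have h1 := h.2.2 φ hφ
  simp only [zero_mul, integral_zero, zero_eq_neg] at h1 ⊢
  rw [show (0 : ℝ) = k * 0 by ring, ← h1, ← integral_const_mul]
  congr 1; funext x; simp only [PiLp.smul_apply, smul_eq_mul]; ring

end Basic

/-! ### Edge integrals and traces -/

section Edge

variable {p q : Plane} {f g : Plane → ℝ}

theorem EdgeIntegrable.mul_continuous (hf : EdgeIntegrable p q f) (hg : Continuous g) :
    EdgeIntegrable p q (fun x => f x * g x) := by
  refine IntervalIntegrable.mul_continuousOn hf (Continuous.continuousOn ?_)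
  fun_prop

theorem EdgeIntegrable.of_continuousOn (hf : ContinuousOn f (segment ℝ p q)) :
    EdgeIntegrable p q f := by
  refine ContinuousOn.intervalIntegrable (hf.comp (Continuous.continuousOn (by fun_prop)) ?_)
  intro s hs
  rw [uIcc_of_le zero_le_one] at hs
  rw [segment_eq_image_lineMap]
  exact mem_image_of_mem _ hs

theorem edgeInt_add (hf : EdgeIntegrable p q f) (hg : EdgeIntegrable p q g) :
    edgeInt p q (fun x => f x + g x) = edgeInt p q f + edgeInt p q g := by
  simp only [edgeInt]
  rw [intervalIntegral.integral_add hf hg, mul_add]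

theorem edgeInt_const_mul (k : ℝ) : edgeInt p q (fun x => k * f x) = k * edgeInt p q f := by
  simp only [edgeInt, intervalIntegral.integral_const_mul]; ring

theorem edgeInt_mul_const (k : ℝ) : edgeInt p q (fun x => f x * k) = edgeInt p q f * k := by
  simp only [edgeInt, intervalIntegral.integral_mul_const]; ring

theorem edgeInt_congr_ae (h : ∀ᵐ s ∂volume.restrict (Ioc (0 : ℝ) 1),
    f (AffineMap.lineMap p q s) = g (AffineMap.lineMap p q s)) : edgeInt p q f = edgeInt p q g := by
  simp only [edgeInt]
  rw [intervalIntegral.integral_of_le zero_le_one, intervalIntegral.integral_of_le zero_le_one,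
    integral_congr_ae h]

theorem EdgeIntegrable.congr_ae (hf : EdgeIntegrable p q f)
    (h : ∀ᵐ s ∂volume.restrict (Ioc (0 : ℝ) 1),
      f (AffineMap.lineMap p q s) = g (AffineMap.lineMap p q s)) : EdgeIntegrable p q g := by
  unfold EdgeIntegrable at hf ⊢
  rw [intervalIntegrable_iff, uIoc_of_le zero_le_one] at hf ⊢
  exact hf.congr h

end Edge

/-- Two functions agree almost everywhere on every side of a triangle. -/
def SideAE (a : Fin 3 → Plane) (f g : Plane → ℝ) : Prop :=
  ∀ i, ∀ᵐ s ∂volume.restrict (Ioc (0 : ℝ) 1), f (side a i s) = g (side a i s)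

/-- Green's formula for scalar test functions. -/
def TraceFormula (a : Fin 3 → Plane) (v : Plane → ℝ) (G : Plane → Plane) (g : Plane → ℝ) : Prop :=
  ∀ φ : Plane → ℝ, ContDiff ℝ ∞ φ → ∀ i,
    ∫ x in openTri a, (v x * pd i φ x + G x i * φ x)
      = ∑ j, edgeInt (a j) (a (j + 1)) (fun x => g x * φ x) * rightNormal (a j) (a (j + 1)) i

/-- Stokes' formula for the tangential trace. -/
def TangFormula (a : Fin 3 → Plane) (v : Plane → Plane) (c : Plane → ℝ) (g : Plane → ℝ) : Prop :=
  ∀ φ : Plane → ℝ, ContDiff ℝ ∞ φ →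
    ∫ x in openTri a, (c x * φ x - (v x 0 * pd 1 φ x - v x 1 * pd 0 φ x))
      = ∑ i, edgeInt (a i) (a (i + 1)) (fun x => g x * φ x)

section Trace

variable {a : Fin 3 → Plane} {v v' : Plane → ℝ} {G G' : Plane → Plane} {g g' : Plane → ℝ}

theorem memL2_of_continuous {F : Type} [NormedAddCommGroup F] {f : Plane → F}
    (hf : ContinuousOn f (tri a)) : MemL2 (openTri a) f := by
  obtain ⟨M, hM⟩ := (tri_compact (a := a)).exists_bound_of_continuousOn hf
  have : IsFiniteMeasure (volume.restrict (openTri a)) :=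
    ⟨by rw [Measure.restrict_apply_univ]; exact openTri_volume_lt⟩
  refine MemLp.of_bound ((hf.mono openTri_subset).aestronglyMeasurable openTri_meas) M ?_
  filter_upwards [ae_restrict_mem openTri_meas] with x hx
  exact hM x (openTri_subset hx)

theorem memL2_smooth {f : Plane → ℝ} (hf : ContDiff ℝ ∞ f) : MemL2 (openTri a) f :=
  memL2_of_continuous hf.continuous.continuousOn

theorem pd_const_zero (i : Fin 2) (x : Plane) : pd i (fun _ => 0) x = 0 := by simp [pd]

/-- Green's formula for vector fields is the sum of two scalar formulas, one for each component;
each of these is the vector formula for a field parallel to a coordinate axis. -/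
theorem isTrace_iff : IsTrace a v g ↔ (∀ i, EdgeIntegrable (a i) (a (i + 1)) g) ∧
    ∃ G, IsWeakGrad (openTri a) v G ∧ TraceFormula a v G g := by
  unfold IsTrace
  refine and_congr_right fun hg => exists_congr fun G => and_congr_right fun hG => ?_
  constructor
  · intro h φ hφ i
    have h1 := h (fun x => φ x • EuclideanSpace.single i 1) (by fun_prop)
    rcases (by fin_cases i <;> simp : i = 0 ∨ i = 1) with rfl | rfl
    · simpa [pd_const_zero, ← mul_assoc, edgeInt_mul_const] using h1
    · simpa [pd_const_zero, ← mul_assoc, edgeInt_mul_const] using h1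
  · intro h Φ hΦ
    have hc : ∀ i, ContDiff ℝ ∞ fun x => Φ x i := fun i => by fun_prop
    have h0 := h _ (hc 0) 0
    have h1 := h _ (hc 1) 1
    have hi : ∀ i, IntegrableOn (fun x => v x * pd i (fun y => Φ y i) x + G x i * Φ x i)
        (openTri a) := fun i =>
      (hG.1.mul_integrable (memL2_smooth (pd_contDiff (hc i) i))).add
        ((hG.2.1.coord i).mul_integrable (memL2_smooth (hc i)))
    have e := integral_add (hi 0) (hi 1)
    rw [h0, h1, ← Finset.sum_add_distrib] at e
    refine Eq.trans ?_ (e.trans ?_)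
    · congr 1; funext x; ring
    · refine Finset.sum_congr rfl fun j _ => ?_
      rw [← edgeInt_mul_const, ← edgeInt_mul_const, ← edgeInt_add]
      · congr 1; funext x; ring
      · exact (hg j).mul_continuous (hc 0).continuous |>.mul_continuous continuous_const
      · exact (hg j).mul_continuous (hc 1).continuous |>.mul_continuous continuous_const

theorem TraceFormula.congr (h : TraceFormula a v G g) (hv : EqAE (openTri a) v v')
    (hG : EqAE (openTri a) G G') : TraceFormula a v' G' g := by
  intro φ hφ i
  rw [← h φ hφ i]
  apply integral_congr_eqAE
  filter_upwards [hv, hG] with x h1 h2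
  rw [h1, h2]

/-- The definition provides the formula for one weak gradient only. Weak gradients are unique almost
everywhere, which transfers it to every other. -/
theorem IsTrace.formula (h : IsTrace a v g) (hG : IsWeakGrad (openTri a) v G) :
    TraceFormula a v G g := by
  obtain ⟨-, G', hG', h'⟩ := isTrace_iff.1 h
  exact h'.congr (Eventually.of_forall fun _ => rfl) (hG'.unique openTri_open hG)

theorem IsTrace.congr (h : IsTrace a v g) (hv : EqAE (openTri a) v v') : IsTrace a v' g := by
  obtain ⟨h1, G, hG, h'⟩ := isTrace_iff.1 h
  exact isTrace_iff.2 ⟨h1, G, hG.congr hv (Eventually.of_forall fun _ => rfl),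
    h'.congr hv (Eventually.of_forall fun _ => rfl)⟩

theorem IsTrace.integrable (h : IsTrace a v g) (i : Fin 3) : EdgeIntegrable (a i) (a (i + 1)) g :=
  h.1 i

theorem IsTrace.congr_side (h : IsTrace a v g) (hg : SideAE a g g') : IsTrace a v g' := by
  obtain ⟨h1, G, hG, h'⟩ := isTrace_iff.1 h
  refine isTrace_iff.2 ⟨fun i => (h1 i).congr_ae (hg i), G, hG, fun φ hφ i => ?_⟩
  rw [h' φ hφ i]
  refine Finset.sum_congr rfl fun j _ => ?_
  congr 1
  apply edgeInt_congr_ae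
  filter_upwards [hg j] with s hs
  rw [hs]

theorem IsTrace.add (h : IsTrace a v g) (h' : IsTrace a v' g') :
    IsTrace a (fun x => v x + v' x) (fun x => g x + g' x) := by
  obtain ⟨h1, G, hG, hf⟩ := isTrace_iff.1 h
  obtain ⟨h1', G', hG', hf'⟩ := isTrace_iff.1 h'
  refine isTrace_iff.2 ⟨fun i => IntervalIntegrable.add (h1 i) (h1' i), _, hG.add hG',
    fun φ hφ i => ?_⟩
  have hi : ∀ {v : Plane → ℝ} {G : Plane → Plane}, IsWeakGrad (openTri a) v G →
      IntegrableOn (fun x => v x * pd i φ x + G x i * φ x) (openTri a) := fun hG =>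
    (hG.1.mul_integrable (memL2_smooth (pd_contDiff hφ i))).add
      ((hG.2.1.coord i).mul_integrable (memL2_smooth hφ))
  have e := integral_add (hi hG) (hi hG')
  rw [hf φ hφ i, hf' φ hφ i, ← Finset.sum_add_distrib] at e
  refine Eq.trans ?_ (e.trans ?_)
  · congr 1; funext x; simp only [PiLp.add_apply]; ring
  · refine Finset.sum_congr rfl fun j _ => ?_
    rw [← add_mul, ← edgeInt_add ((h1 j).mul_continuous hφ.continuous)
      ((h1' j).mul_continuous hφ.continuous)]
    congr 2; funext x; ring

theorem IsTrace.smul (h : IsTrace a v g) (k : ℝ) :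
    IsTrace a (fun x => k * v x) (fun x => k * g x) := by
  obtain ⟨h1, G, hG, hf⟩ := isTrace_iff.1 h
  refine isTrace_iff.2 ⟨fun i => IntervalIntegrable.const_mul (h1 i) k, _, hG.smul k,
    fun φ hφ i => ?_⟩
  have e := congrArg (k * ·) (hf φ hφ i)
  simp only [← integral_const_mul, Finset.mul_sum, ← mul_assoc, ← edgeInt_const_mul] at e
  rw [← e]
  congr 1; funext x; simp only [PiLp.smul_apply, smul_eq_mul]; ring

variable {w w' : Plane → Plane} {c : Plane → ℝ}

theorem IsTangTrace.formula (h : IsTangTrace a w g) (hc : IsWeakCurl (openTri a) w c) :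
    TangFormula a w c g := by
  obtain ⟨-, c', hc', h'⟩ := h
  intro φ hφ
  rw [← h' φ hφ]
  apply integral_congr_eqAE
  filter_upwards [hc.unique openTri_open hc'] with x hx
  rw [hx]

theorem IsTangTrace.congr (h : IsTangTrace a w g) (hw : EqAE (openTri a) w w') :
    IsTangTrace a w' g := by
  obtain ⟨h1, c, hc, h'⟩ := h
  refine ⟨h1, c, hc.congr hw (Eventually.of_forall fun _ => rfl), fun φ hφ => ?_⟩
  rw [← h' φ hφ]
  apply integral_congr_eqAE
  filter_upwards [hw] with x hx
  rw [hx]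

theorem IsTangTrace.congr_side (h : IsTangTrace a w g) (hg : SideAE a g g') :
    IsTangTrace a w g' := by
  obtain ⟨h1, c, hc, h'⟩ := h
  refine ⟨fun i => (h1 i).congr_ae (hg i), c, hc, fun φ hφ => ?_⟩
  rw [h' φ hφ]
  refine Finset.sum_congr rfl fun j _ => ?_
  apply edgeInt_congr_ae
  filter_upwards [hg j] with s hs
  rw [hs]

theorem tang_integrable (hc : IsWeakCurl (openTri a) w c) {φ : Plane → ℝ} (hφ : ContDiff ℝ ∞ φ) :
    IntegrableOn (fun x => c x * φ x - (w x 0 * pd 1 φ x - w x 1 * pd 0 φ x)) (openTri a) :=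
  (hc.2.1.mul_integrable (memL2_smooth hφ)).sub
    (((hc.1.coord 0).mul_integrable (memL2_smooth (pd_contDiff hφ 1))).sub
      ((hc.1.coord 1).mul_integrable (memL2_smooth (pd_contDiff hφ 0))))

theorem IsTangTrace.add (h : IsTangTrace a w g) (h' : IsTangTrace a w' g') :
    IsTangTrace a (fun x => w x + w' x) (fun x => g x + g' x) := by
  obtain ⟨h1, c, hc, hf⟩ := h
  obtain ⟨h1', c', hc', hf'⟩ := h'
  refine ⟨fun i => IntervalIntegrable.add (h1 i) (h1' i), _, hc.add hc', fun φ hφ => ?_⟩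
  have e := integral_add (tang_integrable hc hφ) (tang_integrable hc' hφ)
  rw [hf φ hφ, hf' φ hφ, ← Finset.sum_add_distrib] at e
  refine Eq.trans ?_ (e.trans ?_)
  · congr 1; funext x; simp only [PiLp.add_apply]; ring
  · refine Finset.sum_congr rfl fun j _ => ?_
    rw [← edgeInt_add ((h1 j).mul_continuous hφ.continuous)
      ((h1' j).mul_continuous hφ.continuous)]
    congr 1; funext x; ring

theorem IsTangTrace.smul (h : IsTangTrace a w g) (k : ℝ) :
    IsTangTrace a (fun x => k • w x) (fun x => k * g x) := by
  obtain ⟨h1, c, hc, hf⟩ := h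
  refine ⟨fun i => IntervalIntegrable.const_mul (h1 i) k, _, hc.smul k, fun φ hφ => ?_⟩
  have e := congrArg (k * ·) (hf φ hφ)
  simp only [← integral_const_mul, Finset.mul_sum, ← edgeInt_const_mul, ← mul_assoc] at e
  rw [← e]
  congr 1; funext x; simp only [PiLp.smul_apply, smul_eq_mul]; ring

end Trace

end IVE

end

noncomputable section

namespace IVE

open MeasureTheory Set Filter

open scoped ContDiff Topology

/-! ### Traces of smooth, of continuous, and of Lipschitz functions -/

section Trace

variable {a : Fin 3 → Plane}

theorem side_notMem_openTri (ha : 0 < area2 a) (i : Fin 3) (s : ℝ) : side a i s ∉ openTri a := by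
  intro h
  have := (mem_openTri_iff ha).1 h (i + 2)
  rw [(side_bary ha i s).2.2] at this
  exact lt_irrefl _ this

theorem edgeInt_test_eq_zero (ha : 0 < area2 a) {φ : Plane → ℝ} (hφ : IsTest (openTri a) φ)
    (g : Plane → ℝ) (i : Fin 3) : edgeInt (a i) (a (i + 1)) (fun x => g x * φ x) = 0 := by
  have : ∀ s : ℝ, φ (AffineMap.lineMap (a i) (a (i + 1)) s) = 0 := fun s =>
    hφ.eq_zero (side_notMem_openTri ha i s)
  simp [edgeInt, this]

/-- The classical gradient. -/
def cgrad (f : Plane → ℝ) (x : Plane) : Plane := !₂[pd 0 f x, pd 1 f x]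

theorem cgrad_apply (f : Plane → ℝ) (x : Plane) (i : Fin 2) : cgrad f x i = pd i f x := by
  fin_cases i <;> rfl

theorem cgrad_contDiff {f : Plane → ℝ} (hf : ContDiff ℝ ∞ f) : ContDiff ℝ ∞ (cgrad f) := by
  rw [contDiff_euclidean]
  intro i
  simp only [cgrad_apply]
  exact pd_contDiff hf i

theorem pd_mul {f g : Plane → ℝ} (hf : ContDiff ℝ ∞ f) (hg : ContDiff ℝ ∞ g) (i : Fin 2)
    (x : Plane) : pd i (fun y => f y * g y) x = f x * pd i g x + pd i f x * g x := by
  simp only [pd]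
  rw [fderiv_fun_mul (hf.differentiable (by simp) x) (hg.differentiable (by simp) x)]
  simp; ring

theorem smooth_traceFormula (ha : 0 < area2 a) {f : Plane → ℝ} (hf : ContDiff ℝ ∞ f) :
    TraceFormula a f (cgrad f) f := by
  intro φ hφ i
  have h := integral_pd_openTri ha (hf.mul hφ) i
  simp only [pd_mul hf hφ, edgeInt_mul_const] at h
  simpa only [cgrad_apply] using h

theorem smooth_isWeakGrad (ha : 0 < area2 a) {f : Plane → ℝ} (hf : ContDiff ℝ ∞ f) :
    IsWeakGrad (openTri a) f (cgrad f) := by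
  refine ⟨memL2_smooth hf, memL2_of_continuous (cgrad_contDiff hf).continuous.continuousOn,
    fun φ hφ i => ?_⟩
  have h := smooth_traceFormula ha hf φ hφ.1 i
  simp only [edgeInt_test_eq_zero ha hφ, zero_mul, Finset.sum_const_zero, cgrad_apply] at h
  rw [integral_add ((memL2_smooth hf).mul_integrable (hφ.pd i).memL2)
    ((memL2_smooth (pd_contDiff hf i)).mul_integrable hφ.memL2)] at h
  simp only [cgrad_apply]
  linarith

theorem mol_const (φ : ContDiffBump (0 : Plane)) (k : ℝ) (x : Plane) :
    mol φ (fun _ => k) x = k := by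
  rw [mol_apply, integral_mul_const,
    integral_sub_left_eq_self (fun y => φ.normed volume y), φ.integral_normed, one_mul]

/-- Contraction towards `c`. -/
def contr (c : Plane) (s : ℝ) (x : Plane) : Plane := c + s • (x - c)

theorem contr_eq (c : Plane) (s : ℝ) (x : Plane) : contr c s x = AffineMap.lineMap c x s := by
  simp [contr, AffineMap.lineMap_apply, add_comm]

theorem contr_contDiff (c : Plane) (s : ℝ) : ContDiff ℝ ∞ (contr c s) := by
  unfold contr; fun_prop

theorem pd_contr {f : Plane → ℝ} (hf : ContDiff ℝ ∞ f) (c : Plane) (s : ℝ) (i : Fin 2)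
    (x : Plane) : pd i (fun x => f (contr c s x)) x = s * pd i f (contr c s x) := by
  have h1 : HasFDerivAt (contr c s) (s • ContinuousLinearMap.id ℝ Plane) x :=
    (((hasFDerivAt_id x).sub_const c).const_smul s).const_add c
  have h2 := (((hf.differentiable (by simp)) (contr c s x)).hasFDerivAt.comp x h1).fderiv
  simp only [pd]
  rw [show (fun x => f (contr c s x)) = f ∘ contr c s from rfl, h2]
  simp

/-- Contraction towards an interior point maps the closed triangle to a compact subset of the open
one, which leaves room for the kernel of a mollifier. Contracting and mollifying thus needs values
in the open triangle only and gives functions smooth up to the boundary. -/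
theorem exists_contractions (ha : 0 < area2 a) {c : Plane} (hc : c ∈ openTri a) :
    ∃ (s : ℕ → ℝ) (φ : ℕ → ContDiffBump (0 : Plane)), Tendsto s atTop (𝓝 1) ∧
      Tendsto (fun n => (φ n).rOut) atTop (𝓝 0) ∧
      ∀ n, ∀ x ∈ tri a, Metric.closedBall (contr c (s n) x) (φ n).rOut ⊆ openTri a := by
  -- The second `+ 1` keeps `s 0` positive.
  set s : ℕ → ℝ := fun n => 1 - 1 / ((n : ℝ) + 1 + 1) with hs
  have hs0 : ∀ n, 0 < s n ∧ s n < 1 := fun n => by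
    have h : (0 : ℝ) < (n : ℝ) + 1 := by positivity
    have h1 : 1 / ((n : ℝ) + 1 + 1) < 1 := by rw [div_lt_one (by linarith)]; linarith
    have h2 : 0 < 1 / ((n : ℝ) + 1 + 1) := by positivity
    simp only [hs]
    constructor <;> linarith
  have key : ∀ n, ∃ δ > 0, Metric.cthickening δ (contr c (s n) '' tri a) ⊆ openTri a := fun n => by
    refine IsCompact.exists_cthickening_subset_open
      (tri_compact.image (contr_contDiff c (s n)).continuous) openTri_open ?_
    rintro _ ⟨x, hx, rfl⟩
    rw [mem_openTri_iff ha]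
    intro i
    have h1 := (mem_openTri_iff ha).1 hc i
    have h2 := (mem_tri_iff ha).1 hx i
    rw [contr_eq, bary_lineMap]
    have := hs0 n
    have : 0 < (1 - s n) * bary a i c := mul_pos (by linarith) h1
    have : 0 ≤ s n * bary a i x := mul_nonneg (hs0 n).1.le h2
    linarith
  choose δ hδ hsub using key
  have hr : ∀ n : ℕ, 0 < min (δ n) (1 / ((n : ℝ) + 1)) := fun n =>
    lt_min (hδ n) (by positivity)
  refine ⟨s, fun n => ⟨min (δ n) (1 / ((n : ℝ) + 1)) / 2, min (δ n) (1 / ((n : ℝ) + 1)),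
    half_pos (hr n), half_lt_self (hr n)⟩, ?_, ?_, ?_⟩
  · have h := tendsto_one_div_add_atTop_nhds_zero_nat (𝕜 := ℝ)
    have h2 := (tendsto_const_nhds (x := (1 : ℝ))).sub (h.comp (tendsto_add_atTop_nat 1))
    simpa [hs, Function.comp_def] using h2
  · refine squeeze_zero (fun n => (hr n).le) (fun n => min_le_right _ _)
      (tendsto_one_div_add_atTop_nhds_zero_nat (𝕜 := ℝ))
  · intro n x hx
    refine (Metric.closedBall_subset_closedBall (min_le_left _ _)).trans
      (Subset.trans ?_ (hsub n))
    exact Metric.closedBall_subset_cthickening (mem_image_of_mem _ hx) _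

theorem memLp_indicator {f : Plane → ℝ} (hf : MemL2 (openTri a) f) :
    MemLp ((openTri a).indicator f) 2 volume :=
  (memLp_indicator_iff_restrict openTri_meas).2 hf

theorem integral_indicator_mul (D : Set Plane) (hD : MeasurableSet D) (f g : Plane → ℝ) :
    ∫ x, D.indicator f x * g x = ∫ x in D, f x * g x := by
  rw [← integral_indicator hD]
  congr 1
  funext x
  by_cases hx : x ∈ D <;> simp [hx]

theorem mul_indicator_integral (D : Set Plane) (hD : MeasurableSet D) (f g : Plane → ℝ) :
    ∫ x, D.indicator f x * D.indicator g x = ∫ x in D, f x * g x := by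
  rw [← integral_indicator hD]
  congr 1
  funext x
  by_cases hx : x ∈ D <;> simp [hx]

theorem weak_indicator {f : Plane → ℝ} {G : Plane → Plane}
    (hG : IsWeakGrad (openTri a) f G) (i : Fin 2) (ψ : Plane → ℝ) (hψ : IsTest (openTri a) ψ) :
    ∫ y, (openTri a).indicator f y * pd i ψ y
      = -∫ y, (openTri a).indicator (fun x => G x i) y * ψ y := by
  rw [integral_indicator_mul _ openTri_meas, integral_indicator_mul _ openTri_meas]
  exact hG.2.2 ψ hψ i

/-- A function in `H¹` of a triangle that is continuous up to the boundary is its own trace. -/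
theorem isTrace_of_continuousOn (ha : 0 < area2 a) {f : Plane → ℝ} {G : Plane → Plane}
    (hf : ContinuousOn f (tri a)) (hG : IsWeakGrad (openTri a) f G) : IsTrace a f f := by
  obtain ⟨c, hc⟩ := exists_mem_openTri ha
  obtain ⟨s, φ, hs, hφ, hball⟩ := exists_contractions ha hc
  obtain ⟨M, hM⟩ := (tri_compact (a := a)).exists_bound_of_continuousOn hf
  have hM0 : 0 ≤ M := (norm_nonneg _).trans (hM _ (vertex_mem 0))
  set F := (openTri a).indicator f with hF
  have hF2 : MemLp F 2 volume := memLp_indicator hG.1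
  have hFl := locallyIntegrable_of_memLp_two hF2
  have hFM : ∀ x, |F x| ≤ M := fun x => by
    by_cases hx : x ∈ openTri a
    · rw [hF, indicator_of_mem hx]; exact hM x (openTri_subset hx)
    · rw [hF, indicator_of_notMem hx, abs_zero]; exact hM0
  -- Smooth approximations of `f`, uniformly bounded by `M`. On the closed triangle they see `F`
  -- only inside the open triangle, so their gradients are mollified weak gradients and they
  -- converge pointwise to `f` up to the boundary.
  set v : ℕ → Plane → ℝ := fun n x => mol (φ n) F (contr c (s n) x) with hv
  have hvs : ∀ n, ContDiff ℝ ∞ (v n) := fun n => (mol_contDiff hFl).comp (contr_contDiff c (s n))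
  have hvM : ∀ n x, |v n x| ≤ M := fun n x => abs_mol_le hFl fun y _ => hFM y
  have hpd : ∀ n i, ∀ x ∈ tri a, pd i (v n) x
      = s n * mol (φ n) ((openTri a).indicator fun x => G x i) (contr c (s n) x) := by
    intro n i x hx
    rw [hv, pd_contr (mol_contDiff hFl), pd_mol_of_weak hFl (hball n x hx)
      (weak_indicator hG i)]
  have hlim : ∀ x ∈ tri a, Tendsto (fun n => v n x) atTop (𝓝 (f x)) := by
    intro x hx
    rw [Metric.tendsto_atTop']
    intro ε hε
    obtain ⟨δ, hδ, hd⟩ := Metric.continuousWithinAt_iff.1 (hf x hx) (ε / 2) (half_pos hε)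
    have h1 : Tendsto (fun n => contr c (s n) x) atTop (𝓝 x) := by
      have : Tendsto (fun n => c + s n • (x - c)) atTop (𝓝 (c + (1 : ℝ) • (x - c))) :=
        tendsto_const_nhds.add (hs.smul_const _)
      simpa [contr] using this
    obtain ⟨N, hN⟩ := eventually_atTop.1 ((h1.eventually (Metric.ball_mem_nhds x (half_pos hδ))).and
      (hφ.eventually (gt_mem_nhds (half_pos hδ))))
    refine ⟨N, fun n hn => ?_⟩
    obtain ⟨hn1, hn2⟩ := hN n hn.le
    have e : v n x - f x = mol (φ n) (fun y => F y - f x) (contr c (s n) x) := by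
      rw [mol_sub hFl (locallyIntegrable_const _)]
      simp only [mol_const, hv]
    rw [Real.dist_eq, e]
    refine lt_of_le_of_lt (abs_mol_le (M := ε / 2)
      (hFl.sub (locallyIntegrable_const _)) fun y hy => ?_) (half_lt_self hε)
    have hy' : y ∈ openTri a := hball n x hx (Metric.mem_closedBall.2 hy.le)
    rw [Pi.sub_apply, hF, indicator_of_mem hy', ← Real.dist_eq]
    refine (hd (openTri_subset hy') ?_).le
    have := dist_triangle y (contr c (s n) x) x
    have h3 : dist (contr c (s n) x) x < δ / 2 := hn1
    linarith
  refine isTrace_iff.2 ⟨fun i => EdgeIntegrable.of_continuousOn (hf.mono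
    (tri_convex.segment_subset (vertex_mem i) (vertex_mem (i + 1)))), G, hG, fun ψ hψ i => ?_⟩
  have hψ1 := memLp_indicator (a := a) (memL2_smooth (pd_contDiff hψ i))
  have hψ2 := memLp_indicator (a := a) (memL2_smooth hψ)
  have l1 := tendsto_integral_mol hψ1 hF2 c hs hφ
  have l2 := hs.mul (tendsto_integral_mol hψ2 (memLp_indicator (hG.2.1.coord i)) c hs hφ)
  have l3 := l1.add l2
  rw [mul_indicator_integral _ openTri_meas, mul_indicator_integral _ openTri_meas, one_mul] at l3
  have e1 : ∫ x in openTri a, (f x * pd i ψ x + G x i * ψ x)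
      = (∫ x in openTri a, pd i ψ x * f x) + ∫ x in openTri a, ψ x * G x i := by
    rw [← integral_add ((memL2_smooth (pd_contDiff hψ i)).mul_integrable hG.1)
      ((memL2_smooth hψ).mul_integrable (hG.2.1.coord i))]
    congr 1; funext x; ring
  rw [e1]
  -- The area integrals of the approximations converge weakly. It remains to pass to the limit in
  -- their boundary integrals, by dominated convergence on each side.
  refine tendsto_nhds_unique l3 ?_
  have e2 : ∀ n, (∫ x, (openTri a).indicator (pd i ψ) x * mol (φ n) F (c + s n • (x - c)))
      + s n * ∫ x, (openTri a).indicator ψ x * mol (φ n) ((openTri a).indicator fun x => G x i)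
          (c + s n • (x - c))
      = ∑ j, edgeInt (a j) (a (j + 1)) (fun x => v n x * ψ x) * rightNormal (a j) (a (j + 1)) i := by
    intro n
    rw [← smooth_traceFormula ha (hvs n) ψ hψ i, integral_indicator_mul _ openTri_meas,
      integral_indicator_mul _ openTri_meas, ← integral_const_mul,
      integral_add ((memL2_smooth (hvs n)).mul_integrable (memL2_smooth (pd_contDiff hψ i)))]
    · congr 1
      · congr 1; funext x; simp only [hv, contr]; ring
      · refine setIntegral_congr_fun openTri_meas fun x hx => ?_
        simp only
        rw [cgrad_apply, hpd n i x (openTri_subset hx)]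
        simp only [contr]; ring
    · simp only [cgrad_apply]
      exact (memL2_smooth (pd_contDiff (hvs n) i)).mul_integrable (memL2_smooth hψ)
  simp only [e2]
  refine tendsto_finsetSum _ fun j _ => Tendsto.mul_const _ ?_
  simp only [edgeInt]
  refine Tendsto.const_mul _ ?_
  have hcs : Continuous fun t : ℝ => side a j t := by unfold side; fun_prop
  refine intervalIntegral.tendsto_integral_filter_of_dominated_convergence
    (fun t => M * |ψ (side a j t)|) ?_ ?_ ?_ ?_
  · refine Eventually.of_forall fun n => Continuous.aestronglyMeasurable ?_
    exact ((hvs n).continuous.comp hcs).mul (hψ.continuous.comp hcs)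
  · refine Eventually.of_forall fun n => Eventually.of_forall fun t _ => ?_
    rw [norm_mul, Real.norm_eq_abs, Real.norm_eq_abs]
    exact mul_le_mul_of_nonneg_right (hvM n _) (abs_nonneg _)
  · exact ((hψ.continuous.comp hcs).abs.const_mul M).intervalIntegrable _ _
  · refine Eventually.of_forall fun t ht => Tendsto.mul_const _ (hlim _ ?_)
    rw [uIoc_of_le zero_le_one] at ht
    exact side_mem ⟨ht.1.le, ht.2⟩

/-- The almost everywhere gradient of a Lipschitz function. -/
def lgrad (f : Plane → ℝ) (x : Plane) : Plane :=
  !₂[lineDeriv ℝ f x (EuclideanSpace.single 0 1), lineDeriv ℝ f x (EuclideanSpace.single 1 1)]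

theorem lgrad_apply (f : Plane → ℝ) (x : Plane) (i : Fin 2) :
    lgrad f x i = lineDeriv ℝ f x (EuclideanSpace.single i 1) := by
  fin_cases i <;> rfl

/-- Line derivatives of a Lipschitz function are essentially bounded, hence square integrable on the
triangle, and integration by parts moves them to a compactly supported factor. -/
theorem lipschitz_isWeakGrad {C : NNReal} {f : Plane → ℝ} (hf : LipschitzWith C f) :
    IsWeakGrad (openTri a) f (lgrad f) := by
  have : IsFiniteMeasure (volume.restrict (openTri a)) :=
    ⟨by rw [Measure.restrict_apply_univ]; exact openTri_volume_lt⟩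
  have hm : ∀ i, MemL2 (openTri a) fun x => lgrad f x i := fun i => by
    simp only [lgrad_apply]
    exact (hf.memLp_lineDeriv _).mono_exponent le_top
  refine ⟨memL2_of_continuous hf.continuous.continuousOn, memL2_of_coord (hm 0) (hm 1),
    fun φ hφ i => ?_⟩
  obtain ⟨D, hD⟩ := ContDiff.lipschitzWith_of_hasCompactSupport hφ.2.1 hφ.1 (by simp)
  have h := hf.integral_lineDeriv_mul_eq (μ := volume) hD hφ.2.1 (EuclideanSpace.single i 1)
  have h2 : ∀ x, lineDeriv ℝ φ x (-EuclideanSpace.single i 1) = -pd i φ x := fun x => by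
    rw [(hφ.1.differentiable (by simp) x).lineDeriv_eq_fderiv, map_neg]; rfl
  simp only [h2] at h
  rw [← setIntegral_univ, ← setIntegral_univ (μ := volume) (f := fun x => -pd i φ x * f x),
    setIntegral_test_eq MeasurableSet.univ (subset_univ (openTri a)),
    setIntegral_test_eq MeasurableSet.univ (subset_univ (openTri a))] at h
  · simp only [lgrad_apply, h, ← integral_neg]
    congr 1; funext x; ring
  · intro x hx; rw [hφ.pd_eq_zero hx, neg_zero, zero_mul]
  · intro x hx; rw [hφ.eq_zero hx, mul_zero]

theorem lipschitz_isTrace (ha : 0 < area2 a) {C : NNReal} {f : Plane → ℝ}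
    (hf : LipschitzWith C f) : IsTrace a f f :=
  isTrace_of_continuousOn ha hf.continuous.continuousOn (lipschitz_isWeakGrad hf)

end Trace

end IVE

end

noncomputable section

namespace IVE

open MeasureTheory Set Filter

open scoped ContDiff Topology

/-! ### Functions on the unit interval -/

/-- Integration by parts for absolutely continuous functions; tangential traces are merely
integrable, so their primitives need not be differentiable everywhere. -/
theorem integral_primitive_mul_deriv {τ ψ : ℝ → ℝ} (hτ : IntervalIntegrable τ volume 0 1)
    (hψ : ContDiff ℝ 1 ψ) (k : ℝ) :
    ∫ s in (0 : ℝ)..1, (k + ∫ t in (0 : ℝ)..s, τ t) * deriv ψ s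
      = (k + ∫ t in (0 : ℝ)..1, τ t) * ψ 1 - k * ψ 0 - ∫ s in (0 : ℝ)..1, τ s * ψ s := by
  have h1 : AbsolutelyContinuousOnInterval (fun s => ∫ t in (0 : ℝ)..s, τ t) 0 1 :=
    hτ.absolutelyContinuousOnInterval_intervalIntegral (by simp)
  have h2 : AbsolutelyContinuousOnInterval ψ 0 1 := hψ.contDiffOn.absolutelyContinuousOnInterval
  have h3 := h1.integral_mul_deriv_eq_deriv_mul h2
  have h4 : ∫ s in (0 : ℝ)..1, deriv (fun s => ∫ t in (0 : ℝ)..s, τ t) s * ψ s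
      = ∫ s in (0 : ℝ)..1, τ s * ψ s := by
    apply intervalIntegral.integral_congr_ae
    filter_upwards [hτ.ae_hasDerivAt_integral] with s hs hs'
    rw [(hs (uIoc_subset_uIcc hs') 0 (by simp)).deriv]
  have hd : Continuous (deriv ψ) := hψ.continuous_deriv le_rfl
  have hP : ContinuousOn (fun s => ∫ t in (0 : ℝ)..s, τ t) (uIcc 0 1) := h1.continuousOn
  have h5 : ∫ s in (0 : ℝ)..1, deriv ψ s = ψ 1 - ψ 0 :=
    intervalIntegral.integral_deriv_eq_sub (fun s _ => hψ.differentiable one_ne_zero s)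
      (hd.intervalIntegrable _ _)
  simp only [add_mul]
  have i2 : IntervalIntegrable (fun s => (∫ t in (0 : ℝ)..s, τ t) * deriv ψ s) volume 0 1 :=
    (hP.mul hd.continuousOn).intervalIntegrable
  have i1 : IntervalIntegrable (fun s => k * deriv ψ s) volume 0 1 :=
    (continuous_const.mul hd).intervalIntegrable _ _
  rw [intervalIntegral.integral_add i1 i2,
    intervalIntegral.integral_const_mul, h5, h3, h4]
  simp
  ring

/-- By Weierstrass `f` is uniformly close to a polynomial `p`, and `f` is orthogonal to `p`; the
integral of `f²` is therefore that of `f (f - p)`, which is arbitrarily small. -/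
theorem eqOn_zero_of_moments {f : ℝ → ℝ} (hf : ContinuousOn f (Icc 0 1))
    (h : ∀ n : ℕ, ∫ s in (0 : ℝ)..1, f s * s ^ n = 0) : ∀ s ∈ Icc (0 : ℝ) 1, f s = 0 := by
  have hf' : ContinuousOn f (uIcc 0 1) := by rwa [uIcc_of_le zero_le_one]
  have hp : ∀ p : Polynomial ℝ, ∫ s in (0 : ℝ)..1, f s * p.eval s = 0 := by
    intro p
    simp only [Polynomial.eval_eq_sum_range, Finset.mul_sum]
    rw [intervalIntegral.integral_finsetSum]
    · refine Finset.sum_eq_zero fun n _ => ?_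
      have := congrArg (p.coeff n * ·) (h n)
      simp only [mul_zero, ← intervalIntegral.integral_const_mul] at this
      rw [← this]
      congr 1; funext s; ring
    · intro n _
      exact (hf'.mul (by fun_prop)).intervalIntegrable
  have hsq : ∫ s in (0 : ℝ)..1, f s ^ 2 = 0 := by
    have hnn : 0 ≤ ∫ s in (0 : ℝ)..1, f s ^ 2 :=
      intervalIntegral.integral_nonneg zero_le_one fun s _ => sq_nonneg _
    obtain ⟨M, hM⟩ := (isCompact_Icc (a := (0 : ℝ)) (b := 1)).exists_bound_of_continuousOn hf
    have hM0 : 0 ≤ M := (norm_nonneg _).trans (hM 0 (by simp))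
    refine le_antisymm (le_of_forall_pos_le_add fun ε hε => ?_) hnn
    obtain ⟨p, hpf⟩ := exists_polynomial_near_of_continuousOn 0 1 f hf (ε / (M + 1)) (by positivity)
    have e : ∫ s in (0 : ℝ)..1, f s ^ 2 = ∫ s in (0 : ℝ)..1, f s * (f s - p.eval s) := by
      have e2 : ∀ s, f s * (f s - p.eval s) = f s ^ 2 - f s * p.eval s := fun s => by ring
      simp only [e2]
      rw [intervalIntegral.integral_sub, hp p, sub_zero]
      · exact (hf'.pow 2).intervalIntegrable
      · exact (hf'.mul p.continuous.continuousOn).intervalIntegrable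
    have hb := intervalIntegral.norm_integral_le_of_norm_le_const (a := (0 : ℝ)) (b := 1)
      (f := fun s => f s * (f s - p.eval s)) (C := M * (ε / (M + 1))) (fun s hs => ?_)
    · rw [e, zero_add]
      refine (le_abs_self _).trans (hb.trans ?_)
      rw [sub_zero, abs_one, mul_one, mul_div_assoc', div_le_iff₀ (by positivity)]
      nlinarith
    · rw [uIoc_of_le zero_le_one] at hs
      have hs' : s ∈ Icc (0 : ℝ) 1 := ⟨hs.1.le, hs.2⟩
      rw [norm_mul]
      refine mul_le_mul (hM s hs') ?_ (norm_nonneg _) hM0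
      rw [Real.norm_eq_abs, abs_sub_comm]
      exact (hpf s hs').le
  have hae : f =ᵐ[volume.restrict (Icc 0 1)] fun _ => 0 := by
    rw [intervalIntegral.integral_of_le zero_le_one, ← integral_Icc_eq_integral_Ioc,
      integral_eq_zero_iff_of_nonneg (fun s => sq_nonneg _)
        ((hf.pow 2).integrableOn_compact isCompact_Icc)] at hsq
    filter_upwards [hsq] with s hs
    exact pow_eq_zero_iff (two_ne_zero) |>.1 hs
  exact Measure.eqOn_Icc_of_ae_eq volume zero_ne_one hae hf continuousOn_const

/-- A continuous function on the unit interval with an integrable weak derivative is its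
primitive. -/
theorem eq_primitive_of_weak {k τ : ℝ → ℝ} (hk : ContinuousOn k (Icc 0 1))
    (hτ : IntervalIntegrable τ volume 0 1)
    (h : ∀ η : ℝ → ℝ, ContDiff ℝ ∞ η → ∫ s in (0 : ℝ)..1, τ s * ((1 - s) * s * η s)
      = -∫ s in (0 : ℝ)..1, k s * deriv (fun s => (1 - s) * s * η s) s) :
    ∀ s ∈ Icc (0 : ℝ) 1, k s = k 0 + ∫ t in (0 : ℝ)..s, τ t := by
  have hP : ContinuousOn (fun s => ∫ t in (0 : ℝ)..s, τ t) (Icc 0 1) := by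
    have h1 : AbsolutelyContinuousOnInterval (fun s => ∫ t in (0 : ℝ)..s, τ t) 0 1 :=
      hτ.absolutelyContinuousOnInterval_intervalIntegral (by simp)
    simpa [uIcc_of_le zero_le_one] using h1.continuousOn
  set m : ℝ → ℝ := fun s => k s - ∫ t in (0 : ℝ)..s, τ t with hm
  have hmc : ContinuousOn m (Icc 0 1) := hk.sub hP
  have hmc' : ContinuousOn m (uIcc 0 1) := by rwa [uIcc_of_le zero_le_one]
  have hk' : ContinuousOn k (uIcc 0 1) := by rwa [uIcc_of_le zero_le_one]
  have hP' : ContinuousOn (fun s => ∫ t in (0 : ℝ)..s, τ t) (uIcc 0 1) := by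
    rwa [uIcc_of_le zero_le_one]
  -- The geometric sum `η` is chosen such that `(1 - s) s η(s) = s^(n+1) - s`, an admissible test
  -- function with derivative `(n + 1) s^n - 1`.
  have key : ∀ n : ℕ, ∫ s in (0 : ℝ)..1, m s * ((n + 1) * s ^ n - 1) = 0 := by
    intro n
    set η : ℝ → ℝ := fun s => -∑ j ∈ Finset.range n, s ^ j with hη
    have hηs : ContDiff ℝ ∞ η := by simp only [hη]; fun_prop
    have hζ : (fun s => (1 - s) * s * η s) = fun s => s ^ (n + 1) - s := by
      funext s
      have := mul_neg_geom_sum s n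
      simp only [hη]
      linear_combination -s * this
    have hd : deriv (fun s : ℝ => (1 - s) * s * η s) = fun s : ℝ => ((n : ℝ) + 1) * s ^ n - 1 := by
      rw [hζ]
      funext s
      simp
    have h1 := h η hηs
    have h2 := integral_primitive_mul_deriv hτ (ψ := fun s => (1 - s) * s * η s)
      (by fun_prop) 0
    rw [hd] at h1 h2
    simp only [zero_add, sub_self, zero_mul, mul_zero, sub_zero, zero_sub, h1, neg_neg] at h2
    simp only [hm, sub_mul]
    rw [intervalIntegral.integral_sub, h2, sub_self]
    · exact (hk'.mul (by fun_prop)).intervalIntegrable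
    · exact (hP'.mul (by fun_prop)).intervalIntegrable
  set mb := ∫ s in (0 : ℝ)..1, m s with hmb
  -- By `key`, `m` has the same moments as the constant given by its mean value, so `m` is that
  -- constant.
  have hz := eqOn_zero_of_moments (f := fun s => m s - mb) (hmc.sub continuousOn_const) (by
    intro n
    have h1 := key n
    have e : ∀ s : ℝ, m s * ((n + 1) * s ^ n - 1) = (n + 1) * (m s * s ^ n) - m s := by
      intro s; ring
    simp only [e] at h1
    have i1 : IntervalIntegrable (fun s => m s * s ^ n) volume 0 1 :=
      (hmc'.mul (by fun_prop)).intervalIntegrable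
    rw [intervalIntegral.integral_sub (i1.const_mul _) hmc'.intervalIntegrable,
      intervalIntegral.integral_const_mul, ← hmb] at h1
    simp only [sub_mul]
    rw [intervalIntegral.integral_sub i1 (Continuous.intervalIntegrable (by fun_prop) _ _),
      intervalIntegral.integral_const_mul, integral_pow]
    have hn : (n : ℝ) + 1 ≠ 0 := by positivity
    simp
    field_simp
    linarith)
  intro s hs
  have h1 := hz s hs
  have h0 := hz 0 (by simp)
  simp only [hm, intervalIntegral.integral_same] at h1 h0
  linarith

/-- The weight is the restriction to a side of the boundary test functions `bdryTest`; it vanishes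
only at the end points, so it can be divided out. -/
theorem ae_zero_of_weighted {f : ℝ → ℝ} (hf : IntervalIntegrable f volume 0 1)
    (h : ∀ η : ℝ → ℝ, ContDiff ℝ ∞ η → ∫ s in (0 : ℝ)..1, f s * ((1 - s) * s * η s) = 0) :
    ∀ᵐ s ∂volume.restrict (Ioc (0 : ℝ) 1), f s = 0 := by
  have hi : IntegrableOn (fun s => f s * ((1 - s) * s)) (Ioc 0 1) := by
    have := hf.mul_continuousOn (g := fun s => (1 - s) * s) (by fun_prop)
    rwa [intervalIntegrable_iff, uIoc_of_le zero_le_one] at this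
  have h1 := ae_eq_zero_of_integral_contDiff_smul_eq_zero
    (μ := volume.restrict (Ioc (0 : ℝ) 1)) hi.integrable.locallyIntegrable (fun η hη _ => by
      refine Eq.trans ?_ (h η hη)
      rw [intervalIntegral.integral_of_le zero_le_one]
      congr 1; funext s; simp only [smul_eq_mul]; ring)
  have h2 : ∀ᵐ s ∂volume.restrict (Ioc (0 : ℝ) 1), s ∈ Ioo (0 : ℝ) 1 := by
    rw [← restrict_Ioo_eq_restrict_Ioc]
    exact ae_restrict_mem measurableSet_Ioo
  filter_upwards [h1, h2] with s hs hs'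
  have : (1 - s) * s ≠ 0 := mul_ne_zero (by linarith [hs'.2]) hs'.1.ne'
  exact (mul_eq_zero.1 hs).resolve_right this

/-! ### Uniqueness of traces -/

section Unique

variable {a : Fin 3 → Plane}

/-- A smooth function that vanishes on all sides of a triangle but one. -/
def bdryTest (a : Fin 3 → Plane) (i : Fin 3) (η : ℝ → ℝ) (x : Plane) : ℝ :=
  bary a i x * bary a (i + 1) x * η (bary a (i + 1) x)

theorem bdryTest_contDiff (i : Fin 3) {η : ℝ → ℝ} (hη : ContDiff ℝ ∞ η) :
    ContDiff ℝ ∞ (bdryTest a i η) :=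
  ((bary_contDiff i).mul (bary_contDiff (i + 1))).mul (hη.comp (bary_contDiff (i + 1)))

theorem bdryTest_side (ha : 0 < area2 a) (i : Fin 3) (η : ℝ → ℝ) (s : ℝ) :
    bdryTest a i η (side a i s) = (1 - s) * s * η s := by
  obtain ⟨h1, h2, -⟩ := side_bary ha i s
  simp only [bdryTest, h1, h2]

theorem bdryTest_side_ne (ha : 0 < area2 a) {i j : Fin 3} (hij : j ≠ i) (η : ℝ → ℝ) (s : ℝ) :
    bdryTest a i η (side a j s) = 0 := by
  have h := (side_bary ha j s).2.2
  rcases fin3_eq i j with rfl | rfl | rfl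
  · exact absurd rfl hij
  · rw [fin3_add_one_two] at h
    simp [bdryTest, h]
  · rw [show i + 2 + 2 = i + 1 by rcases fin3_cases i with rfl | rfl | rfl <;> rfl] at h
    simp [bdryTest, h]

/-- Isolates one side in Green's formulas. The factors `k` are `1` for tangential traces and
components of the normals for scalar traces. -/
theorem sum_bdryTest (ha : 0 < area2 a) (i : Fin 3) (η : ℝ → ℝ) (g : Plane → ℝ) (k : Fin 3 → ℝ) :
    ∑ j, edgeInt (a j) (a (j + 1)) (fun x => g x * bdryTest a i η x) * k j
      = dist (a i) (a (i + 1)) * (∫ s in (0 : ℝ)..1, g (side a i s) * ((1 - s) * s * η s)) * k i := by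
  rw [Finset.sum_eq_single i]
  · simp only [edgeInt, bdryTest_side ha]
  · intro j _ hj
    simp [edgeInt, bdryTest_side_ne ha hj]
  · simp

theorem dist_vertex_pos (ha : 0 < area2 a) (i : Fin 3) : 0 < dist (a i) (a (i + 1)) :=
  dist_pos.2 (vertex_ne ha i)

theorem sideAE_of_weighted {g g' : Plane → ℝ}
    (hg : ∀ i, EdgeIntegrable (a i) (a (i + 1)) g) (hg' : ∀ i, EdgeIntegrable (a i) (a (i + 1)) g')
    (h : ∀ i (η : ℝ → ℝ), ContDiff ℝ ∞ η → ∫ s in (0 : ℝ)..1, g (side a i s) * ((1 - s) * s * η s)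
      = ∫ s in (0 : ℝ)..1, g' (side a i s) * ((1 - s) * s * η s)) : SideAE a g g' := by
  intro i
  have := ae_zero_of_weighted (IntervalIntegrable.sub (hg i) (hg' i)) (fun η hη => by
    simp only [sub_mul (g _)]
    rw [intervalIntegral.integral_sub, sub_eq_zero.2 (h i η hη)]
    · exact (hg i).mul_continuousOn (Continuous.continuousOn (by fun_prop))
    · exact (hg' i).mul_continuousOn (Continuous.continuousOn (by fun_prop)))
  filter_upwards [this] with s hs
  exact sub_eq_zero.1 hs

theorem IsTangTrace.unique (ha : 0 < area2 a) {w : Plane → Plane} {g g' : Plane → ℝ}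
    (h : IsTangTrace a w g) (h' : IsTangTrace a w g') : SideAE a g g' := by
  refine sideAE_of_weighted h.1 h'.1 fun i η hη => ?_
  obtain ⟨c, hc, hf⟩ := h.2
  have h1 := hf _ (bdryTest_contDiff (a := a) i hη)
  have h2 := h'.formula hc _ (bdryTest_contDiff (a := a) i hη)
  rw [h1] at h2
  have e := sum_bdryTest ha i η g (fun _ => 1)
  have e' := sum_bdryTest ha i η g' (fun _ => 1)
  simp only [mul_one] at e e'
  rw [e, e'] at h2
  exact mul_left_cancel₀ (dist_vertex_pos ha i).ne' h2

theorem rightNormal_ne {p q : Plane} (h : p ≠ q) : ∃ i, rightNormal p q i ≠ 0 := by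
  by_contra! hc
  have hd : (dist p q)⁻¹ ≠ 0 := inv_ne_zero (dist_ne_zero.2 h)
  have h0 := hc 0
  have h1 := hc 1
  simp only [rightNormal, PiLp.smul_apply, smul_eq_mul, mul_eq_zero, hd, false_or] at h0 h1
  simp at h0 h1
  exact h (plane_ext (by linarith) (by linarith))

theorem IsTrace.unique (ha : 0 < area2 a) {v : Plane → ℝ} {g g' : Plane → ℝ}
    (h : IsTrace a v g) (h' : IsTrace a v g') : SideAE a g g' := by
  refine sideAE_of_weighted h.1 h'.1 fun i η hη => ?_
  obtain ⟨-, G, hG, hf⟩ := isTrace_iff.1 h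
  obtain ⟨k, hk⟩ := rightNormal_ne (vertex_ne ha i)
  have h1 := hf _ (bdryTest_contDiff (a := a) i hη) k
  have h2 := h'.formula hG _ (bdryTest_contDiff (a := a) i hη) k
  rw [h1, sum_bdryTest ha i η g (fun j => rightNormal (a j) (a (j + 1)) k),
    sum_bdryTest ha i η g' (fun j => rightNormal (a j) (a (j + 1)) k)] at h2
  exact mul_left_cancel₀ (dist_vertex_pos ha i).ne' (mul_right_cancel₀ hk h2)

end Unique

/-! ### Tangential traces of gradients -/

section Grad

variable {a : Fin 3 → Plane}

theorem deriv_side {φ : Plane → ℝ} (hφ : ContDiff ℝ ∞ φ) (j : Fin 3) (s : ℝ) :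
    deriv (fun s => φ (side a j s)) s
      = ((a (j + 1)) 0 - (a j) 0) * pd 0 φ (side a j s)
        + ((a (j + 1)) 1 - (a j) 1) * pd 1 φ (side a j s) := by
  have h1 : HasDerivAt (fun s => side a j s) (a (j + 1) - a j) s := AffineMap.hasDerivAt_lineMap
  have h2 := ((hφ.differentiable (by simp) (side a j s)).hasFDerivAt.comp_hasDerivAt s h1).deriv
  rw [show (fun s => φ (side a j s)) = φ ∘ fun s => side a j s from rfl, h2, fderiv_eq_pd]
  rfl

theorem side_contDiff (j : Fin 3) : ContDiff ℝ ∞ fun s : ℝ => side a j s := by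
  simp only [side, AffineMap.lineMap_apply_module]
  fun_prop

/-- Green's formula is applied to the first derivatives of `φ`. The mixed second derivatives cancel,
and the normal components combine with them to the derivative of `φ` along the side. -/
theorem grad_tangFormula (ha : 0 < area2 a) {v : Plane → ℝ} {G : Plane → Plane} {g : Plane → ℝ}
    (hG : IsWeakGrad (openTri a) v G) (hg : IsTrace a v g) {φ : Plane → ℝ} (hφ : ContDiff ℝ ∞ φ) :
    ∫ x in openTri a, (0 * φ x - (G x 0 * pd 1 φ x - G x 1 * pd 0 φ x))
      = -∑ j, ∫ s in (0 : ℝ)..1, g (side a j s) * deriv (fun s => φ (side a j s)) s := by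
  have hs : ∀ i, ContDiff ℝ ∞ (pd i φ) := fun i => pd_contDiff hφ i
  have hf := hg.formula hG
  have h1 := hf _ (hs 1) 0
  have h2 := hf _ (hs 0) 1
  have i0 : ∀ i j k, Integrable (fun x => v x * pd i (pd j φ) x + G x i * pd k φ x)
      (volume.restrict (openTri a)) := fun i j k =>
    (hG.1.mul_integrable (memL2_smooth (pd_contDiff (hs j) i))).add
      ((hG.2.1.coord i).mul_integrable (memL2_smooth (hs k)))
  have e := integral_sub (i0 0 1 1) (i0 1 0 0)
  rw [h1, h2, ← Finset.sum_sub_distrib] at e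
  rw [← neg_inj, neg_neg, ← integral_neg]
  refine Eq.trans ?_ (e.trans ?_)
  · congr 1; funext x
    rw [pd_comm hφ 1 0]; ring
  · refine Finset.sum_congr rfl fun j _ => ?_
    rw [← edgeInt_mul_const, ← edgeInt_mul_const, edgeInt_rightNormal (vertex_ne ha j),
      edgeInt_rightNormal (vertex_ne ha j)]
    simp only [if_true, one_ne_zero, if_false, ← intervalIntegral.integral_const_mul]
    rw [← intervalIntegral.integral_sub]
    · congr 1; funext s
      rw [deriv_side hφ]; simp only [side]; ring
    · exact IntervalIntegrable.const_mul ((hg.integrable j).mul_continuous (hs 1).continuous) _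
    · exact IntervalIntegrable.const_mul ((hg.integrable j).mul_continuous (hs 0).continuous) _

/-- The tangential trace of a gradient is the tangential derivative of the trace. -/
theorem isTangTrace_grad (ha : 0 < area2 a) {v : Plane → ℝ} {G : Plane → Plane} {g τ : Plane → ℝ}
    (hG : IsWeakGrad (openTri a) v G) (hg : IsTrace a v g)
    (hτ : ∀ i, EdgeIntegrable (a i) (a (i + 1)) τ)
    (h : ∀ i, ∀ s ∈ Icc (0 : ℝ) 1, g (side a i s)
      = g (a i) + dist (a i) (a (i + 1)) * ∫ t in (0 : ℝ)..s, τ (side a i t)) :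
    IsTangTrace a G τ := by
  refine ⟨hτ, _, hG.curl, fun φ hφ => ?_⟩
  rw [grad_tangFormula ha hG hg hφ]
  have key : ∀ j, ∫ s in (0 : ℝ)..1, g (side a j s) * deriv (fun s => φ (side a j s)) s
      = (g (a (j + 1)) * φ (a (j + 1)) - g (a j) * φ (a j))
        - edgeInt (a j) (a (j + 1)) (fun x => τ x * φ x) := by
    intro j
    have h1 := integral_primitive_mul_deriv
      (τ := fun s => dist (a j) (a (j + 1)) * τ (side a j s)) (IntervalIntegrable.const_mul (hτ j) _)
      (ψ := fun s => φ (side a j s)) ((hφ.comp (side_contDiff j)).of_le (by simp)) (g (a j))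
    have e1 := h j 1 (by simp)
    simp only [intervalIntegral.integral_const_mul, mul_assoc] at h1
    rw [← e1] at h1
    simp only [side, AffineMap.lineMap_apply_one, AffineMap.lineMap_apply_zero] at h1
    rw [edgeInt, ← h1]
    refine intervalIntegral.integral_congr fun s hs => ?_
    rw [uIcc_of_le zero_le_one] at hs
    beta_reduce
    rw [h j s hs]
  -- The boundary terms of the three integrations by parts telescope around the closed boundary.
  simp only [key, Finset.sum_sub_distrib]
  rw [neg_sub, sub_eq_self, sub_eq_zero]
  simp only [Fin.sum_univ_three]
  obtain ⟨h1, h2, h3, -⟩ := fin3_add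
  rw [h1, h2, h3]; ring

/-- The trace of a function is a primitive of the tangential trace of its gradient. -/
theorem trace_eq_primitive (ha : 0 < area2 a) {v : Plane → ℝ} {G : Plane → Plane} {g τ : Plane → ℝ}
    (hG : IsWeakGrad (openTri a) v G) (hg : IsTrace a v g) (hτ : IsTangTrace a G τ) (i : Fin 3)
    (hgc : ContinuousOn (fun s => g (side a i s)) (Icc 0 1)) :
    ∀ s ∈ Icc (0 : ℝ) 1, g (side a i s)
      = g (a i) + dist (a i) (a (i + 1)) * ∫ t in (0 : ℝ)..s, τ (side a i t) := by
  have h := eq_primitive_of_weak hgc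
    (τ := fun s => dist (a i) (a (i + 1)) * τ (side a i s))
    (IntervalIntegrable.const_mul (hτ.1 i) _) (fun η hη => ?_)
  · intro s hs
    rw [h s hs, intervalIntegral.integral_const_mul]
    simp [side]
  · have h1 := grad_tangFormula ha hG hg (bdryTest_contDiff (a := a) i hη)
    have h2 := hτ.formula hG.curl _ (bdryTest_contDiff (a := a) i hη)
    have e := sum_bdryTest ha i η τ (fun _ => 1)
    simp only [mul_one] at e
    rw [h1, e, Finset.sum_eq_single i] at h2
    · simp only [bdryTest_side ha] at h2
      rw [h2, ← intervalIntegral.integral_const_mul]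
      congr 1; funext s; ring
    · intro j _ hj
      simp [bdryTest_side_ne ha hj]
    · simp

end Grad

end IVE

end

noncomputable section

namespace IVE

open MeasureTheory Set Filter

open scoped ContDiff Topology

/-! ### Curl free fields with vanishing tangential trace -/

section Core

variable {a : Fin 3 → Plane}

theorem exists_bary_eq (ha : 0 < area2 a) (w : Fin 3 → ℝ) (hw : ∑ i, w i = 1) :
    ∃ x, ∀ i, bary a i x = w i := by
  refine ⟨∑ i, w i • a i, fun i => ?_⟩
  rw [bary_comb_apply i _ _ _ hw, sum_fin3 _ i, bary_self ha, bary_next, bary_prev]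
  ring

/-- The complement of the enlarged closed triangle `{x | ∀ i, -δ ≤ bary a i x}`. -/
def outside (a : Fin 3 → Plane) (δ : ℝ) : Set Plane := {x | ∃ i, bary a i x < -δ}

theorem outside_eq (δ : ℝ) : outside a δ
    = ({x | bary a 0 x < -δ} ∪ {x | bary a 1 x < -δ}) ∪ {x | bary a 2 x < -δ} := by
  ext x
  simp only [outside, mem_ofPred_eq, mem_union, Fin.exists_fin_succ]
  simp [or_assoc]

theorem outside_open (δ : ℝ) : IsOpen (outside a δ) := by
  have h : ∀ i, IsOpen {x | bary a i x < -δ} := fun i =>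
    isOpen_lt (bary_continuous i) continuous_const
  rw [outside_eq]
  exact ((h 0).union (h 1)).union (h 2)

/-- A union of three half planes, glued along the points `x` and `y`, each of which has two very
negative barycentric coordinates. Connectedness makes a potential constant off the enlarged
triangle. -/
theorem outside_preconnected (ha : 0 < area2 a) (δ : ℝ) : IsPreconnected (outside a δ) := by
  have h : ∀ i, IsPreconnected {x | bary a i x < -δ} := fun i => by
    apply Convex.isPreconnected
    intro x hx y hy s t hs ht hst
    have := bary_comb_apply (a := a) i (Finset.univ : Finset (Fin 2)) ![s, t] ![x, y]
      (by simpa using hst)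
    simp only [Fin.sum_univ_two, Matrix.cons_val_zero, Matrix.cons_val_one] at this
    simp only [mem_ofPred_eq] at hx hy ⊢
    rw [this]
    have h1 := mul_le_mul_of_nonneg_left hx.le hs
    have h2 := mul_le_mul_of_nonneg_left hy.le ht
    rcases hs.lt_or_eq with hs' | hs'
    · have h3 := mul_lt_mul_of_pos_left hx hs'
      have e : s * -δ + t * -δ = -δ := by rw [← add_mul, hst, one_mul]
      linarith
    · have ht' : t = 1 := by linarith
      rw [← hs', ht']; simpa using hy
  obtain ⟨x, hx⟩ := exists_bary_eq ha ![-(δ + 1), -(δ + 1), 1 + 2 * (δ + 1)]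
    (by simp [Fin.sum_univ_three]; ring)
  obtain ⟨y, hy⟩ := exists_bary_eq ha ![-(δ + 1), 1 + 2 * (δ + 1), -(δ + 1)]
    (by simp [Fin.sum_univ_three]; ring)
  have x0 := hx 0
  have x1 := hx 1
  have y0 := hy 0
  have y2 := hy 2
  simp at x0 x1 y0 y2
  rw [outside_eq]
  refine IsPreconnected.union y (Or.inl ?_) ?_ (IsPreconnected.union x ?_ ?_ (h 0) (h 1)) (h 2)
  · show bary a 0 y < -δ; linarith
  · show bary a 2 y < -δ; linarith
  · show bary a 0 x < -δ; linarith
  · show bary a 1 x < -δ; linarith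

theorem exists_potential {D₀ D₁ : Plane → ℝ} (h0 : ContDiff ℝ ∞ D₀) (h1 : ContDiff ℝ ∞ D₁)
    (hc : ∀ x, pd 1 D₀ x = pd 0 D₁ x) :
    ∃ Ψ : Plane → ℝ, ContDiff ℝ ∞ Ψ ∧ ∀ x, pd 0 Ψ x = D₀ x ∧ pd 1 Ψ x = D₁ x := by
  set om : Plane → Plane →L[ℝ] ℝ := fun x =>
    D₀ x • (EuclideanSpace.proj (𝕜 := ℝ) (0 : Fin 2) : Plane →L[ℝ] ℝ)
      + D₁ x • (EuclideanSpace.proj (𝕜 := ℝ) (1 : Fin 2) : Plane →L[ℝ] ℝ) with hom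
  have oms : ContDiff ℝ ∞ om := by simp only [hom]; fun_prop
  have hd : ∀ x u v, fderiv ℝ om x u v = fderiv ℝ D₀ x u * v 0 + fderiv ℝ D₁ x u * v 1 := by
    intro x u v
    have e0 := (h0.differentiable (by simp) x).hasFDerivAt.smul_const
      (EuclideanSpace.proj (𝕜 := ℝ) (0 : Fin 2) : Plane →L[ℝ] ℝ)
    have e1 := (h1.differentiable (by simp) x).hasFDerivAt.smul_const
      (EuclideanSpace.proj (𝕜 := ℝ) (1 : Fin 2) : Plane →L[ℝ] ℝ)
    have e2 : HasFDerivAt om _ x := e0.add e1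
    rw [e2.fderiv]
    simp
  obtain ⟨Ψ, hΨ⟩ := Convex.exists_forall_hasFDerivAt_of_fderiv_symmetric
    (convex_univ : Convex ℝ (univ : Set Plane)) isOpen_univ
    (oms.differentiable (by simp)).differentiableOn (fun x _ u v => by
      rw [hd, hd, fderiv_eq_pd, fderiv_eq_pd, fderiv_eq_pd, fderiv_eq_pd, hc x]; ring)
  have hf : fderiv ℝ Ψ = om := funext fun x => (hΨ x (mem_univ x)).fderiv
  refine ⟨Ψ, contDiff_infty_iff_fderiv.2
    ⟨fun x => (hΨ x (mem_univ x)).differentiableAt, hf ▸ oms⟩, fun x => ?_⟩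
  simp [pd, hf, hom]

/-- The counterpart of `exists_contractions`: mollifying a function supported in the triangle
enlarges its support slightly, and composition with a dilation of factor `s n > 1` about the
barycentre shrinks it back into the open triangle. -/
theorem exists_enlargements (ha : 0 < area2 a) :
    ∃ (c : Plane) (s δ : ℕ → ℝ) (φ : ℕ → ContDiffBump (0 : Plane)), Tendsto s atTop (𝓝 1) ∧
      (∀ n, 0 < s n) ∧ Tendsto (fun n => (φ n).rOut) atTop (𝓝 0) ∧
      (∀ n, ∀ x ∈ tri a, ∀ y, dist y x < (φ n).rOut → y ∉ outside a (δ n)) ∧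
      (∀ n, ∀ x, contr c (s n) x ∉ outside a (δ n) → x ∈ openTri a) := by
  obtain ⟨c, hc⟩ := exists_bary_eq ha (fun _ => 1 / 3) (by simp)
  set s : ℕ → ℝ := fun n => 1 + 1 / ((n : ℝ) + 1) with hs
  have hs0 : ∀ n : ℕ, 0 < 1 / ((n : ℝ) + 1) := fun n => by positivity
  -- With `s n = 1 + k`, the dilation about the barycentre lowers barycentric coordinates by `k / 3`
  -- after scaling; an enlargement by `k / 6` is only half of that.
  set δ : ℕ → ℝ := fun n => 1 / ((n : ℝ) + 1) / 6 with hδ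
  have hδ0 : ∀ n, 0 < δ n := fun n => by simp only [hδ]; have := hs0 n; positivity
  have key : ∀ n, ∃ r > 0, Metric.cthickening r (tri a) ⊆ {x | ∀ i, -δ n < bary a i x} := fun n => by
    refine IsCompact.exists_cthickening_subset_open tri_compact ?_ ?_
    · simp only [ofPred_forall]
      exact isOpen_iInter_of_finite fun i => isOpen_lt continuous_const (bary_continuous i)
    · intro x hx i
      have := (mem_tri_iff ha).1 hx i
      linarith [hδ0 n]
  choose r hr hsub using key
  have hr' : ∀ n : ℕ, 0 < min (r n) (1 / ((n : ℝ) + 1)) := fun n => lt_min (hr n) (hs0 n)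
  refine ⟨c, s, δ, fun n => ⟨min (r n) (1 / ((n : ℝ) + 1)) / 2, min (r n) (1 / ((n : ℝ) + 1)),
    half_pos (hr' n), half_lt_self (hr' n)⟩, ?_, ?_, ?_, ?_, ?_⟩
  · have h := (tendsto_const_nhds (x := (1 : ℝ))).add
      (tendsto_one_div_add_atTop_nhds_zero_nat (𝕜 := ℝ))
    simpa [hs] using h
  · intro n; simp only [hs]; linarith [hs0 n]
  · exact squeeze_zero (fun n => (hr' n).le) (fun n => min_le_right _ _)
      (tendsto_one_div_add_atTop_nhds_zero_nat (𝕜 := ℝ))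
  · rintro n x hx y hy ⟨i, hi⟩
    have h1 : y ∈ Metric.cthickening (r n) (tri a) :=
      Metric.closedBall_subset_cthickening hx _
        (Metric.mem_closedBall.2 (hy.le.trans (min_le_left _ _)))
    exact lt_asymm hi (hsub n h1 i)
  · intro n x hx
    rw [mem_openTri_iff ha]
    intro i
    have h1 : ¬ bary a i (contr c (s n) x) < -δ n := fun h => hx ⟨i, h⟩
    rw [contr_eq, bary_lineMap, hc, not_lt] at h1
    have h2 := hs0 n
    simp only [hs, hδ] at h1
    set k : ℝ := 1 / ((n : ℝ) + 1)
    by_contra h3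
    push Not at h3
    nlinarith

/-- The condition `hcf` is tested with all smooth functions, not only with those supported in the
triangle. It thus encodes zero curl together with zero tangential trace, and says that the extension
of `d` by zero is curl free in the whole plane. -/
theorem mol_curl_free {d : Plane → Plane} (hd : MemL2 (openTri a) d)
    (hcf : ∀ φ, ContDiff ℝ ∞ φ → ∫ x in openTri a, (d x 0 * pd 1 φ x - d x 1 * pd 0 φ x) = 0)
    (φ : ContDiffBump (0 : Plane)) (x : Plane) :
    pd 1 (mol φ ((openTri a).indicator fun x => d x 0)) x
      = pd 0 (mol φ ((openTri a).indicator fun x => d x 1)) x := by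
  have hl : ∀ i, LocallyIntegrable ((openTri a).indicator fun x => d x i) volume := fun i =>
    locallyIntegrable_of_memLp_two (memLp_indicator (hd.coord i))
  have ht := (bump_shift_isTest (φ := φ) (D := univ) (x := x) (subset_univ _)).1
  have h := hcf _ ht
  rw [integral_sub ((hd.coord 0).mul_integrable (memL2_smooth (pd_contDiff ht 1)))
    ((hd.coord 1).mul_integrable (memL2_smooth (pd_contDiff ht 0)))] at h
  rw [pd_mol (hl 0), pd_mol (hl 1)]
  simp only [mul_comm (pd _ _ _)]
  rw [integral_indicator_mul _ openTri_meas, integral_indicator_mul _ openTri_meas]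
  linarith

/-- A weakly divergence free field is orthogonal to the curl free fields with vanishing tangential
trace. -/
theorem orthogonal_of_curl_free (ha : 0 < area2 a) {d F : Plane → Plane}
    (hd : MemL2 (openTri a) d)
    (hcf : ∀ φ, ContDiff ℝ ∞ φ → ∫ x in openTri a, (d x 0 * pd 1 φ x - d x 1 * pd 0 φ x) = 0)
    (hF : MemL2 (openTri a) F)
    (hdiv : ∀ φ, IsTest (openTri a) φ → ∫ x in openTri a, (F x 0 * pd 0 φ x + F x 1 * pd 1 φ x) = 0) :
    ∫ x in openTri a, (F x 0 * d x 0 + F x 1 * d x 1) = 0 := by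
  obtain ⟨c, s, δ, φ, hs, hs0, hφ, hsup, hin⟩ := exists_enlargements ha
  set d' : Fin 2 → Plane → ℝ := fun i => (openTri a).indicator fun x => d x i with hd'
  have hd2 : ∀ i, MemLp (d' i) 2 volume := fun i => memLp_indicator (hd.coord i)
  have hl : ∀ i, LocallyIntegrable (d' i) volume := fun i => locallyIntegrable_of_memLp_two (hd2 i)
  have hF2 : ∀ i, MemLp ((openTri a).indicator fun x => F x i) 2 volume := fun i =>
    memLp_indicator (hF.coord i)
  have l := (tendsto_integral_mol (hF2 0) (hd2 0) c hs hφ).add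
    (tendsto_integral_mol (hF2 1) (hd2 1) c hs hφ)
  simp only [hd'] at l
  rw [mul_indicator_integral _ openTri_meas, mul_indicator_integral _ openTri_meas,
    ← integral_add ((hF.coord 0).mul_integrable (hd.coord 0))
      ((hF.coord 1).mul_integrable (hd.coord 1))] at l
  refine tendsto_nhds_unique l ?_
  refine Tendsto.congr (fun n => ?_) tendsto_const_nhds
  have hms : ∀ i, ContDiff ℝ ∞ (mol (φ n) (d' i)) := fun i => mol_contDiff (hl i)
  obtain ⟨Ψ, hΨ, hΨd⟩ := exists_potential (hms 0) (hms 1) (mol_curl_free hd hcf (φ n))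
  have hzero : ∀ x ∈ outside a (δ n), ∀ i, mol (φ n) (d' i) x = 0 := by
    intro x hx i
    by_contra hne
    obtain ⟨y, hy, hxy⟩ := mol_support _ _ hne
    have hy' : y ∈ openTri a := by
      by_contra h
      exact hy (indicator_of_notMem h _)
    exact hsup n y (openTri_subset hy') x hxy hx
  obtain ⟨k, hk⟩ := IsOpen.exists_is_const_of_fderiv_eq_zero (outside_open (a := a) (δ n))
    (outside_preconnected ha (δ n)) (hΨ.differentiable (by simp)).differentiableOn (fun x hx => by
      ext u
      rw [fderiv_eq_pd, (hΨd x).1, (hΨd x).2, hzero x hx, hzero x hx]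
      simp)
  -- Subtracting `k` makes the potential vanish off the enlarged triangle, and `(s n)⁻¹` cancels the
  -- chain rule factor of the dilation. The dilated potential `χ` is a test function whose gradient
  -- is the dilated mollification of `d`.
  set Ψ' : Plane → ℝ := fun x => (s n)⁻¹ * (Ψ x - k) with hΨ'
  have hΨ's : ContDiff ℝ ∞ Ψ' := by simp only [hΨ']; fun_prop
  have hpdΨ' : ∀ i x, pd i Ψ' x = (s n)⁻¹ * pd i Ψ x := by
    intro i x
    simp only [hΨ', pd]
    rw [fderiv_const_mul ((hΨ.differentiable (by simp) x).sub_const k), fderiv_sub_const]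
    rfl
  set χ : Plane → ℝ := fun x => Ψ' (contr c (s n) x) with hχ
  have hχs : ContDiff ℝ ∞ χ := hΨ's.comp (contr_contDiff c (s n))
  have hclosed : IsClosed {x | contr c (s n) x ∉ outside a (δ n)} :=
    (outside_open (a := a) (δ n)).isClosed_compl.preimage (contr_contDiff c (s n)).continuous
  have hts : tsupport χ ⊆ {x | contr c (s n) x ∉ outside a (δ n)} := by
    refine closure_minimal ?_ hclosed
    intro x hx hx'
    exact hx (by simp only [hχ, hΨ', hk _ hx', sub_self, mul_zero])
  have hχt : IsTest (openTri a) χ := by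
    have h1 : tsupport χ ⊆ openTri a := fun x hx => hin n x (hts hx)
    exact ⟨hχs, HasCompactSupport.of_support_subset_isCompact tri_compact
      ((subset_tsupport _).trans (h1.trans openTri_subset)), h1⟩
  have hpdχ : ∀ i x, pd i χ x = pd i Ψ (contr c (s n) x) := by
    intro i x
    rw [hχ, pd_contr hΨ's, hpdΨ', ← mul_assoc, mul_inv_cancel₀ (hs0 n).ne', one_mul]
  have h := hdiv χ hχt
  simp only [hpdχ, (hΨd _).1, (hΨd _).2] at h
  rw [integral_indicator_mul _ openTri_meas, integral_indicator_mul _ openTri_meas,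
    ← integral_add]
  · exact h.symm
  · exact (hF.coord 0).mul_integrable
      (memL2_smooth ((hms 0).comp (contr_contDiff c (s n))))
  · exact (hF.coord 1).mul_integrable
      (memL2_smooth ((hms 1).comp (contr_contDiff c (s n))))

/-- The energy argument: the divergence free field `b d` is orthogonal to `d` by
`orthogonal_of_curl_free`, so the integral of `b |d|²` vanishes. -/
theorem eqAE_zero_of_tangTrace_zero (ha : 0 < area2 a) {d : Plane → Plane} {b : Plane → ℝ}
    {b₀ : ℝ} (hb₀ : 0 < b₀) (hb : ∀ x, b₀ ≤ b x) (hc : IsWeakCurl (openTri a) d fun _ => 0)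
    (ht : IsTangTrace a d fun _ => 0)
    (hdiv : IsWeakDiv (openTri a) (fun x => b x • d x) fun _ => 0) :
    EqAE (openTri a) d fun _ => 0 := by
  have hd := hc.1
  have h := orthogonal_of_curl_free ha hd (F := fun x => b x • d x) (fun φ hφ => by
    have := ht.formula hc φ hφ
    simp only [zero_mul, zero_sub, integral_neg, edgeInt, intervalIntegral.integral_zero, mul_zero,
      Finset.sum_const_zero, neg_eq_zero] at this
    exact this) hdiv.1 (fun φ hφ => by
    have := hdiv.2.2 φ hφ
    simp only [zero_mul, integral_zero, zero_eq_neg] at this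
    exact this)
  have hi : IntegrableOn (fun x => (b x • d x) 0 * d x 0 + (b x • d x) 1 * d x 1) (openTri a) :=
    ((hdiv.1.coord 0).mul_integrable (hd.coord 0)).add
      ((hdiv.1.coord 1).mul_integrable (hd.coord 1))
  have hnn : ∀ x, 0 ≤ (b x • d x) 0 * d x 0 + (b x • d x) 1 * d x 1 := fun x => by
    have := hb₀.le.trans (hb x)
    simp only [PiLp.smul_apply, smul_eq_mul, mul_assoc]
    have h0 := mul_self_nonneg (d x 0)
    have h1 := mul_self_nonneg (d x 1)
    positivity
  have h2 := (integral_eq_zero_iff_of_nonneg hnn hi).1 h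
  filter_upwards [h2] with x hx
  have hbx := hb₀.trans_le (hb x)
  simp only [PiLp.smul_apply, smul_eq_mul, Pi.zero_apply, mul_assoc, ← mul_add] at hx
  have hx' := (mul_eq_zero.1 hx).resolve_left hbx.ne'
  apply plane_ext <;> simp only [PiLp.zero_apply] <;>
    nlinarith [mul_self_nonneg (d x 0), mul_self_nonneg (d x 1)]

/-- With zero trace the extension by zero also has zero gradient in the whole plane. Its
mollifications are constant and vanish far away, so they are zero, and their weak limit is zero. -/
theorem eqAE_zero_of_trace_zero {v : Plane → ℝ}
    (hv : IsWeakGrad (openTri a) v fun _ => 0) (ht : IsTrace a v fun _ => 0) :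
    EqAE (openTri a) v fun _ => 0 := by
  have hf := ht.formula hv
  set F := (openTri a).indicator v with hF
  have hF2 : MemLp F 2 volume := memLp_indicator hv.1
  have hFl := locallyIntegrable_of_memLp_two hF2
  set φ : ℕ → ContDiffBump (0 : Plane) := fun n =>
    ⟨1 / ((n : ℝ) + 1) / 2, 1 / ((n : ℝ) + 1), half_pos (by positivity),
      half_lt_self (by positivity)⟩ with hφ
  have hφ0 : Tendsto (fun n => (φ n).rOut) atTop (𝓝 0) :=
    tendsto_one_div_add_atTop_nhds_zero_nat (𝕜 := ℝ)
  have hpd : ∀ n i x, pd i (mol (φ n) F) x = 0 := by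
    intro n i x
    have hs := (bump_shift_isTest (φ := φ n) (D := univ) (x := x) (subset_univ _)).1
    have h := hf _ hs i
    simp only [zero_mul, edgeInt, intervalIntegral.integral_zero, mul_zero,
      Finset.sum_const_zero, PiLp.zero_apply, add_zero] at h
    rw [pd_mol hFl]
    simp only [mul_comm (pd _ _ _)]
    rw [hF, integral_indicator_mul _ openTri_meas, h, neg_zero]
  have hz : ∀ n x, mol (φ n) F x = 0 := by
    intro n x
    have hd : ∀ x, fderiv ℝ (mol (φ n) F) x = 0 := fun x => by
      ext u; rw [fderiv_eq_pd, hpd, hpd]; simp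
    obtain ⟨R, hR⟩ := (tri_compact (a := a)).isBounded.subset_ball (0 : Plane)
    set y : Plane := EuclideanSpace.single 0 (|R| + (φ n).rOut) with hy
    rw [is_const_of_fderiv_eq_zero ((mol_contDiff hFl).differentiable (by simp)) hd x y]
    by_contra hne
    obtain ⟨z, hz, hyz⟩ := mol_support _ _ hne
    have hz' : z ∈ openTri a := by
      by_contra h
      exact hz (indicator_of_notMem h _)
    have h1 := hR (openTri_subset hz')
    rw [Metric.mem_ball] at h1
    have h2 := dist_triangle y z 0
    have h3 : dist y 0 = |R| + (φ n).rOut := by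
      rw [dist_zero_right, hy, PiLp.norm_single, Real.norm_eq_abs,
        abs_of_nonneg (add_nonneg (abs_nonneg _) (φ n).rOut_pos.le)]
    linarith [le_abs_self R]
  have l := tendsto_integral_mol hF2 hF2 0 (tendsto_const_nhds (x := (1 : ℝ))) hφ0
  simp only [hz, mul_zero, integral_zero] at l
  have h0 := tendsto_nhds_unique tendsto_const_nhds l
  rw [hF, mul_indicator_integral _ openTri_meas] at h0
  have h2 := (integral_eq_zero_iff_of_nonneg (fun x => mul_self_nonneg (v x))
    (hv.1.mul_integrable hv.1)).1 h0.symm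
  filter_upwards [h2] with x hx
  exact mul_self_eq_zero.1 hx

end Core

end IVE

end

noncomputable section

namespace IVE

open MeasureTheory Set Filter

open scoped ContDiff Topology

/-! ### Correction by a function with vanishing trace -/

section Projection

variable {a : Fin 3 → Plane}

/-- The class in `L²(D)` of a square integrable function. -/
def l2 {F : Type} [NormedAddCommGroup F] {D : Set Plane} {f : Plane → F} (hf : MemL2 D f) :
    Lp F 2 (volume.restrict D) := MemLp.toLp f hf

theorem l2_coe {F : Type} [NormedAddCommGroup F] {D : Set Plane} {f : Plane → F}
    (hf : MemL2 D f) : l2 hf =ᵐ[volume.restrict D] f := MemLp.coeFn_toLp hf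

theorem l2_eq {F : Type} [NormedAddCommGroup F] {D : Set Plane} {f : Plane → F}
    (hf : MemL2 D f) {q : Lp F 2 (volume.restrict D)} (h : EqAE D q f) : q = l2 hf :=
  Lp.ext (h.trans (EqAE.symm (l2_coe hf)))

theorem inner_l2 {E : Type} [NormedAddCommGroup E] [InnerProductSpace ℝ E] {D : Set Plane}
    {f g : Plane → E} (hf : MemL2 D f) (hg : MemL2 D g) :
    inner ℝ (l2 hf) (l2 hg) = ∫ x in D, inner ℝ (f x) (g x) := by
  rw [L2.inner_def]
  apply integral_congr_ae
  filter_upwards [l2_coe hf, l2_coe hg] with x h1 h2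
  rw [h1, h2]

theorem inner_l2_left {E : Type} [NormedAddCommGroup E] [InnerProductSpace ℝ E] {D : Set Plane}
    {g : Plane → E} (q : Lp E 2 (volume.restrict D)) (hg : MemL2 D g) :
    inner ℝ q (l2 hg) = ∫ x in D, inner ℝ (q x) (g x) := by
  rw [L2.inner_def]
  apply integral_congr_ae
  filter_upwards [l2_coe hg] with x h2
  rw [h2]

theorem MemL2.inner_integrable {E : Type} [NormedAddCommGroup E] [InnerProductSpace ℝ E]
    {D : Set Plane} {f g : Plane → E} (hf : MemL2 D f) (hg : MemL2 D g) :
    IntegrableOn (fun x => (inner ℝ (f x) (g x) : ℝ)) D := by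
  refine (L2.integrable_inner (𝕜 := ℝ) (l2 hf) (l2 hg)).congr ?_
  filter_upwards [l2_coe hf, l2_coe hg] with x h1 h2
  rw [h1, h2]

theorem plane_inner (u v : Plane) : inner ℝ u v = u 0 * v 0 + u 1 * v 1 := by
  simp [PiLp.inner_apply, Fin.sum_univ_two]
  ring

theorem inner_smul_single (u : Plane) (k t : ℝ) (i : Fin 2) :
    inner ℝ u (k • (t • (EuclideanSpace.single i 1 : Plane))) = k * t * u i := by
  rw [inner_smul_right, inner_smul_right, EuclideanSpace.inner_single_right]
  simp
  ring

theorem memL2_bdd_smul {D : Set Plane} {b : Plane → ℝ} (hbm : Measurable b) {m : ℝ}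
    (hb : ∀ x, |b x| ≤ m) {w : Plane → Plane} (hw : MemL2 D w) :
    MemL2 D fun x => b x • w x := by
  refine MemLp.of_le_mul (c := m) hw (hbm.aestronglyMeasurable.smul hw.1) ?_
  filter_upwards with x
  rw [norm_smul, Real.norm_eq_abs]
  exact mul_le_mul_of_nonneg_right (hb x) (norm_nonneg _)

theorem IsTest.add {D : Set Plane} {φ ψ : Plane → ℝ} (hφ : IsTest D φ) (hψ : IsTest D ψ) :
    IsTest D fun x => φ x + ψ x :=
  ⟨hφ.1.add hψ.1, hφ.2.1.add hψ.2.1,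
    (tsupport_add φ ψ).trans (union_subset hφ.2.2 hψ.2.2)⟩

theorem IsTest.const_mul {D : Set Plane} {φ : Plane → ℝ} (hφ : IsTest D φ) (k : ℝ) :
    IsTest D fun x => k * φ x :=
  ⟨contDiff_const.mul hφ.1, hφ.2.1.mul_left,
    (tsupport_mul_subset_right (f := fun _ => k) (g := φ)).trans hφ.2.2⟩

theorem cgrad_add {f g : Plane → ℝ} (hf : ContDiff ℝ ∞ f) (hg : ContDiff ℝ ∞ g) (x : Plane) :
    cgrad (fun x => f x + g x) x = cgrad f x + cgrad g x := by
  have h : ∀ i, pd i (fun x => f x + g x) x = pd i f x + pd i g x := fun i => by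
    simp only [pd]
    rw [fderiv_fun_add (hf.differentiable (by simp) x) (hg.differentiable (by simp) x)]
    rfl
  apply plane_ext <;> simp only [cgrad_apply, PiLp.add_apply, h]

theorem cgrad_const_mul {f : Plane → ℝ} (hf : ContDiff ℝ ∞ f) (k : ℝ) (x : Plane) :
    cgrad (fun x => k * f x) x = k • cgrad f x := by
  have h : ∀ i, pd i (fun x => k * f x) x = k * pd i f x := fun i => by
    simp only [pd]
    rw [fderiv_const_mul (hf.differentiable (by simp) x)]
    rfl
  apply plane_ext <;> simp only [cgrad_apply, PiLp.smul_apply, h, smul_eq_mul]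

/-- Since the first coordinate has unit derivative, integration by parts gives `∫ φ² = -2 ∫ x₁ φ
∂₁φ`; on the triangle `|x₁| ≤ R`, and Young's inequality absorbs half of `∫ φ²`. -/
theorem exists_poincare (ha : 0 < area2 a) : ∃ C, 0 < C ∧ ∀ φ, IsTest (openTri a) φ →
    ∫ x in openTri a, φ x * φ x
      ≤ C * ∫ x in openTri a, (pd 0 φ x * pd 0 φ x + pd 1 φ x * pd 1 φ x) := by
  obtain ⟨R, hR⟩ := (tri_compact (a := a)).exists_bound_of_continuousOn
    (f := fun x : Plane => x 0) (by fun_prop)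
  refine ⟨4 * (R ^ 2 + 1), by positivity, fun φ hφ => ?_⟩
  have hx : ContDiff ℝ ∞ fun x : Plane => x 0 := by fun_prop
  have hxφ : ContDiff ℝ ∞ fun x : Plane => x 0 * φ x := hx.mul hφ.1
  have h := (smooth_isWeakGrad ha hxφ).2.2 φ hφ 0
  have hpx : ∀ x, pd 0 (fun x : Plane => x 0) x = 1 := fun x => by
    have := (EuclideanSpace.proj (𝕜 := ℝ) (0 : Fin 2) : Plane →L[ℝ] ℝ).hasFDerivAt (x := x)
    have e : fderiv ℝ (fun x : Plane => x 0) x = EuclideanSpace.proj (𝕜 := ℝ) (0 : Fin 2) :=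
      this.fderiv
    simp [pd, e]
  simp only [cgrad_apply, pd_mul hx hφ.1, hpx] at h
  have hs0 := memL2_smooth (a := a) hφ.1
  have hs1 := memL2_smooth (a := a) (pd_contDiff hφ.1 0)
  have hs2 := memL2_smooth (a := a) (pd_contDiff hφ.1 1)
  have i1 : IntegrableOn (fun x => φ x * φ x) (openTri a) := hs0.mul_integrable hs0
  have i2 : IntegrableOn (fun x => x 0 * φ x * pd 0 φ x) (openTri a) :=
    (memL2_smooth hxφ).mul_integrable hs1
  have i3 : IntegrableOn (fun x => (pd 0 φ x * pd 0 φ x + pd 1 φ x * pd 1 φ x)) (openTri a) :=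
    (hs1.mul_integrable hs1).add (hs2.mul_integrable hs2)
  have e : ∫ x in openTri a, (x 0 * pd 0 φ x + 1 * φ x) * φ x
      = (∫ x in openTri a, x 0 * φ x * pd 0 φ x) + ∫ x in openTri a, φ x * φ x := by
    rw [← integral_add i2 i1]
    congr 1; funext x; ring
  rw [e] at h
  have h2 : ∫ x in openTri a, (-2) * (x 0 * φ x * pd 0 φ x)
      ≤ ∫ x in openTri a, ((1 / 2) * (φ x * φ x)
        + 2 * (R ^ 2 + 1) * (pd 0 φ x * pd 0 φ x + pd 1 φ x * pd 1 φ x)) := by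
    refine setIntegral_mono_on (i2.const_mul _) ((i1.const_mul _).add (i3.const_mul _))
      openTri_meas fun x hx => ?_
    have h3 : x 0 ^ 2 ≤ R ^ 2 := sq_le_sq.2 ((hR x (openTri_subset hx)).trans (le_abs_self R))
    have h4 := sq_nonneg (φ x + 2 * x 0 * pd 0 φ x)
    have h5 := mul_nonneg (sub_nonneg.2 h3) (sq_nonneg (pd 0 φ x))
    have h6 := mul_nonneg (sq_nonneg R) (sq_nonneg (pd 1 φ x))
    nlinarith [sq_nonneg (pd 0 φ x), sq_nonneg (pd 1 φ x)]
  rw [integral_add (i1.const_mul _) (i3.const_mul _)] at h2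
  simp only [integral_const_mul] at h2
  linarith

theorem memL2_cgrad {φ : Plane → ℝ} (hφ : IsTest (openTri a) φ) : MemL2 (openTri a) (cgrad φ) :=
  memL2_of_continuous (cgrad_contDiff hφ.1).continuous.continuousOn

theorem memL2_smul_cgrad {r : Plane → ℝ} (hrm : Measurable r) {r₁ : ℝ} (hr1 : ∀ x, |r x| ≤ r₁)
    {φ : Plane → ℝ} (hφ : IsTest (openTri a) φ) : MemL2 (openTri a) fun x => r x • cgrad φ x :=
  memL2_bdd_smul hrm hr1 (memL2_cgrad hφ)

/-- The orthogonal projection to the closure of the gradients of test functions, in a weighted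
space. -/
theorem exists_grad_projection {r : Plane → ℝ} (hrm : Measurable r) {r₁ : ℝ}
    (hr1 : ∀ x, |r x| ≤ r₁) {w : Plane → Plane} (hw : MemL2 (openTri a) w) :
    ∃ (Q : Lp Plane 2 (volume.restrict (openTri a))) (φ : ℕ → Plane → ℝ)
      (hφ : ∀ n, IsTest (openTri a) (φ n)),
      Tendsto (fun n => l2 (memL2_smul_cgrad hrm hr1 (hφ n))) atTop (𝓝 Q) ∧
      ∀ ψ, ∀ hψ : IsTest (openTri a) ψ,
        inner ℝ (l2 hw - Q) (l2 (memL2_smul_cgrad hrm hr1 hψ)) = 0 := by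
  let S : Submodule ℝ (Lp Plane 2 (volume.restrict (openTri a))) :=
    { carrier := {f | ∃ φ, ∃ hφ : IsTest (openTri a) φ, f = l2 (memL2_smul_cgrad hrm hr1 hφ)}
      zero_mem' := by
        have h0 : IsTest (openTri a) fun _ => 0 := ⟨contDiff_const, HasCompactSupport.zero, by
          rw [tsupport_eq_empty_iff.2 (by rfl)]; exact empty_subset _⟩
        refine ⟨_, h0, l2_eq _ ?_⟩
        filter_upwards [Lp.coeFn_zero Plane 2 (volume.restrict (openTri a))] with x hx
        rw [hx]
        apply plane_ext <;> simp [cgrad_apply, pd]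
      add_mem' := by
        rintro _ _ ⟨φ, hφ, rfl⟩ ⟨ψ, hψ, rfl⟩
        refine ⟨_, hφ.add hψ, l2_eq _ ?_⟩
        filter_upwards [Lp.coeFn_add (l2 (memL2_smul_cgrad hrm hr1 hφ)) (l2 (memL2_smul_cgrad hrm hr1 hψ)), l2_coe (memL2_smul_cgrad hrm hr1 hφ),
          l2_coe (memL2_smul_cgrad hrm hr1 hψ)] with x h1 h2 h3
        rw [h1, Pi.add_apply, h2, h3, cgrad_add hφ.1 hψ.1, smul_add]
      smul_mem' := by
        rintro k _ ⟨φ, hφ, rfl⟩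
        refine ⟨_, hφ.const_mul k, l2_eq _ ?_⟩
        filter_upwards [Lp.coeFn_smul k (l2 (memL2_smul_cgrad hrm hr1 hφ)), l2_coe (memL2_smul_cgrad hrm hr1 hφ)] with x h1 h2
        rw [h1, Pi.smul_apply, h2, cgrad_const_mul hφ.1, smul_comm] }
  set U := S.topologicalClosure with hU
  have hUc : IsComplete (U : Set (Lp Plane 2 (volume.restrict (openTri a)))) :=
    S.isClosed_topologicalClosure.isComplete
  obtain ⟨Q, hQU, hQ⟩ : ∃ Q ∈ U, ∀ v ∈ U, inner ℝ (l2 hw - Q) v = 0 := by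
    have : CompleteSpace U := hUc.completeSpace_coe
    refine ⟨U.starProjection (l2 hw), U.starProjection_apply_mem _, fun v hv => ?_⟩
    exact Submodule.starProjection_inner_eq_zero _ v hv
  obtain ⟨f, hfS, hfQ⟩ : ∃ f : ℕ → Lp Plane 2 (volume.restrict (openTri a)),
      (∀ n, f n ∈ S) ∧ Tendsto f atTop (𝓝 Q) := mem_closure_iff_seq_limit.1 hQU
  choose φ hφ hfφ using hfS
  refine ⟨Q, φ, hφ, ?_, fun ψ hψ => hQ _ (S.le_topologicalClosure ⟨ψ, hψ, rfl⟩)⟩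
  simpa only [← hfφ] using hfQ

theorem exists_norm_test_le (ha : 0 < area2 a) {r : Plane → ℝ} (hrm : Measurable r) {r₀ r₁ : ℝ}
    (hr0 : 0 < r₀) (hr : ∀ x, r₀ ≤ r x) (hr1 : ∀ x, |r x| ≤ r₁) :
    ∃ k, 0 ≤ k ∧ ∀ φ, ∀ hφ : IsTest (openTri a) φ,
      ‖l2 (memL2_smooth (a := a) hφ.1)‖ ≤ k * ‖l2 (memL2_smul_cgrad hrm hr1 hφ)‖ := by
  obtain ⟨C, hC, hpoin⟩ := exists_poincare ha
  refine ⟨√(C / r₀ ^ 2), by positivity, fun φ hφ => ?_⟩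
  refine (pow_le_pow_iff_left₀ (norm_nonneg _) (by positivity) two_ne_zero).1 ?_
  rw [mul_pow, Real.sq_sqrt (by positivity), ← real_inner_self_eq_norm_sq,
    ← real_inner_self_eq_norm_sq, inner_l2, inner_l2]
  have h1 : ∀ x, inner ℝ (φ x) (φ x) = φ x * φ x := fun x => rfl
  have h2 : ∀ x, inner ℝ (r x • cgrad φ x) (r x • cgrad φ x)
      = r x ^ 2 * (pd 0 φ x * pd 0 φ x + pd 1 φ x * pd 1 φ x) := fun x => by
    simp only [plane_inner, PiLp.smul_apply, smul_eq_mul, cgrad_apply]; ring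
  have i2 : IntegrableOn (fun x => inner ℝ (r x • cgrad φ x) (r x • cgrad φ x)) (openTri a) :=
    MemL2.inner_integrable (memL2_smul_cgrad hrm hr1 hφ) (memL2_smul_cgrad hrm hr1 hφ)
  simp only [h1]
  simp only [h2] at i2 ⊢
  refine (hpoin φ hφ).trans ?_
  rw [div_mul_eq_mul_div, mul_div_assoc]
  refine mul_le_mul_of_nonneg_left ?_ hC.le
  rw [le_div_iff₀' (pow_pos hr0 2), ← integral_const_mul]
  refine integral_mono (((((memL2_cgrad hφ).coord 0).mul_integrable ((memL2_cgrad hφ).coord 0)).add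
    (((memL2_cgrad hφ).coord 1).mul_integrable ((memL2_cgrad hφ).coord 1))).const_mul _) i2 fun x => ?_
  exact mul_le_mul_of_nonneg_right (pow_le_pow_left₀ hr0.le (hr x) 2) (add_nonneg (mul_self_nonneg _) (mul_self_nonneg _))

/-- By Poincaré's inequality convergence of the weighted gradients makes the test functions
themselves a Cauchy sequence, so the limit of the gradients has a potential. -/
theorem exists_limit_of_test (ha : 0 < area2 a) {r : Plane → ℝ} (hrm : Measurable r) {r₀ r₁ : ℝ}
    (hr0 : 0 < r₀) (hr : ∀ x, r₀ ≤ r x) (hr1 : ∀ x, |r x| ≤ r₁) {φ : ℕ → Plane → ℝ}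
    (hφ : ∀ n, IsTest (openTri a) (φ n)) {Q : Lp Plane 2 (volume.restrict (openTri a))}
    (hfQ : Tendsto (fun n => l2 (memL2_smul_cgrad hrm hr1 (hφ n))) atTop (𝓝 Q)) :
    ∃ p₀ : Lp ℝ 2 (volume.restrict (openTri a)),
      Tendsto (fun n => l2 (memL2_smooth (a := a) (hφ n).1)) atTop (𝓝 p₀) := by
  obtain ⟨k', hk, hnorm⟩ := exists_norm_test_le ha hrm hr0 hr hr1
  have hs : ∀ n, MemL2 (openTri a) (φ n) := fun n => memL2_smooth (hφ n).1
  set f := fun n => l2 (memL2_smul_cgrad hrm hr1 (hφ n)) with hf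
  have hfφ : ∀ n, f n = l2 (memL2_smul_cgrad hrm hr1 (hφ n)) := fun n => rfl
  have hdist : ∀ n k, dist (l2 (hs n)) (l2 (hs k)) ≤ k' * dist (f n) (f k) := fun n k => by
    have ht := (hφ n).add ((hφ k).const_mul (-1))
    have e1 : l2 (hs n) - l2 (hs k) = l2 (memL2_smooth (a := a) ht.1) := l2_eq _ (by
      filter_upwards [Lp.coeFn_sub (l2 (hs n)) (l2 (hs k)), l2_coe (hs n), l2_coe (hs k)]
        with x h1 h2 h3
      rw [h1, Pi.sub_apply, h2, h3]; ring)
    have e2 : f n - f k = l2 (memL2_smul_cgrad hrm hr1 ht) := l2_eq _ (by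
      rw [hfφ n, hfφ k]
      filter_upwards [Lp.coeFn_sub (l2 (memL2_smul_cgrad hrm hr1 (hφ n))) (l2 (memL2_smul_cgrad hrm hr1 (hφ k))),
        l2_coe (memL2_smul_cgrad hrm hr1 (hφ n)), l2_coe (memL2_smul_cgrad hrm hr1 (hφ k))] with x h1 h2 h3
      rw [h1, Pi.sub_apply, h2, h3, cgrad_add (hφ n).1 ((hφ k).const_mul (-1)).1,
        cgrad_const_mul (hφ k).1, ← smul_sub]
      congr 1; rw [neg_one_smul, sub_eq_add_neg])
    rw [dist_eq_norm, dist_eq_norm, e1, e2]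
    exact hnorm _ ht
  have hcau : CauchySeq fun n => l2 (hs n) := by
    rw [Metric.cauchySeq_iff']
    intro ε hε
    obtain ⟨N, hN⟩ := Metric.cauchySeq_iff'.1 hfQ.cauchySeq (ε / (k' + 1)) (by positivity)
    refine ⟨N, fun n hn => (hdist n N).trans_lt ?_⟩
    have h := hN n hn
    rw [lt_div_iff₀ (by positivity)] at h
    nlinarith [dist_nonneg (x := f n) (y := f N)]
  exact cauchySeq_tendsto_of_complete hcau

/-- Green's formula for test functions has no boundary term, and its `L²` limit keeps this property.
As `ψ` need not vanish on the boundary, the identity contains both the weak gradient and the zero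
trace of the limit. -/
theorem limit_of_test_formula (ha : 0 < area2 a) {r : Plane → ℝ} (hrm : Measurable r) {r₁ ri : ℝ}
    (hrp : ∀ x, 0 < r x) (hr1 : ∀ x, |r x| ≤ r₁) (hrib : ∀ x, |(r x)⁻¹| ≤ ri) {φ : ℕ → Plane → ℝ}
    (hφ : ∀ n, IsTest (openTri a) (φ n)) {Q : Lp Plane 2 (volume.restrict (openTri a))}
    (hfQ : Tendsto (fun n => l2 (memL2_smul_cgrad hrm hr1 (hφ n))) atTop (𝓝 Q))
    {p₀ : Lp ℝ 2 (volume.restrict (openTri a))}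
    (hp₀ : Tendsto (fun n => l2 (memL2_smooth (a := a) (hφ n).1)) atTop (𝓝 p₀))
    {ψ : Plane → ℝ} (hψ : ContDiff ℝ ∞ ψ) (i : Fin 2) :
    ∫ x in openTri a, ((-p₀ x) * pd i ψ x + (-((r x)⁻¹ • Q x)) i * ψ x) = 0 := by
  have hs : ∀ n, MemL2 (openTri a) (φ n) := fun n => memL2_smooth (hφ n).1
  have hQ2 : MemL2 (openTri a) Q := Lp.memLp Q
  have hp2 : MemL2 (openTri a) p₀ := Lp.memLp p₀
  set f := fun n => l2 (memL2_smul_cgrad hrm hr1 (hφ n)) with hf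
  have hfφ : ∀ n, f n = l2 (memL2_smul_cgrad hrm hr1 (hφ n)) := fun n => rfl
  have hψ' := memL2_smooth (a := a) (pd_contDiff hψ i)
  have hv : MemL2 (openTri a) fun x => (r x)⁻¹ • (ψ x • (EuclideanSpace.single i 1 : Plane)) :=
    memL2_bdd_smul hrm.inv hrib (memL2_of_continuous
      (hψ.continuous.smul continuous_const).continuousOn)
  have l := (hp₀.inner (𝕜 := ℝ) (tendsto_const_nhds (x := l2 hψ'))).add
    (hfQ.inner (𝕜 := ℝ) (tendsto_const_nhds (x := l2 hv)))
  have hz : ∀ n, inner ℝ (l2 (hs n)) (l2 hψ') + inner ℝ (f n) (l2 hv) = 0 := fun n => by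
    have h := smooth_traceFormula ha (hφ n).1 ψ hψ i
    simp only [cgrad_apply] at h
    rw [hfφ n, inner_l2, inner_l2, ← integral_add (MemL2.inner_integrable (hs n) hψ')
      (MemL2.inner_integrable (memL2_smul_cgrad hrm hr1 (hφ n)) hv)]
    refine Eq.trans ?_ (h.trans (Finset.sum_eq_zero fun j _ => ?_))
    · congr 1; funext x
      have hx := (hrp x).ne'
      rw [inner_smul_single, PiLp.smul_apply, cgrad_apply, smul_eq_mul]
      have h1 : inner ℝ (φ n x) (pd i ψ x) = φ n x * pd i ψ x := mul_comm _ _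
      rw [h1]
      field_simp
    · simp only [mul_comm (φ n _)]
      rw [edgeInt_test_eq_zero ha (hφ n), zero_mul]
  simp only [hz] at l
  have h := tendsto_nhds_unique l tendsto_const_nhds
  rw [inner_l2_left, inner_l2_left, ← integral_add (MemL2.inner_integrable hp2 hψ')
      (MemL2.inner_integrable hQ2 hv)] at h
  rw [← neg_eq_zero, ← integral_neg]
  refine Eq.trans ?_ h
  congr 1; funext x
  have hx := (hrp x).ne'
  have h1 : inner ℝ (p₀ x) (pd i ψ x) = p₀ x * pd i ψ x := mul_comm _ _
  rw [inner_smul_single, h1]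
  simp only [PiLp.neg_apply, PiLp.smul_apply, smul_eq_mul]
  ring

/-- The Dirichlet problem `div (b (w + ∇p)) = 0` with zero boundary values: `-∇p` is the projection
of `w`, in the inner product weighted by `b`, onto the closure of the gradients of test functions.
-/
theorem exists_trace_zero_correction (ha : 0 < area2 a) {b : Plane → ℝ} (hbm : Measurable b)
    {m m' : ℝ} (hm : 0 < m) (hb : ∀ x, m ≤ b x) (hb' : ∀ x, b x ≤ m') {w : Plane → Plane}
    (hw : MemL2 (openTri a) w) :
    ∃ p P, IsWeakGrad (openTri a) p P ∧ IsTrace a p (fun _ => 0) ∧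
      IsTangTrace a P (fun _ => 0) ∧
      IsWeakDiv (openTri a) (fun x => b x • (w x + P x)) (fun _ => 0) := by
  have hb0 : ∀ x, 0 < b x := fun x => hm.trans_le (hb x)
  -- Multiplication of fields by `√b` turns the weighted inner product into that of `L²`.
  set r : Plane → ℝ := fun x => √(b x) with hr
  have hr0 : ∀ x, 0 < r x := fun x => Real.sqrt_pos.2 (hb0 x)
  have hrr : ∀ x, r x * r x = b x := fun x => Real.mul_self_sqrt (hb0 x).le
  have hrm : Measurable r := hbm.sqrt
  have hrl : ∀ x, √m ≤ r x := fun x => Real.sqrt_le_sqrt (hb x)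
  have hrb : ∀ x, |r x| ≤ √m' := fun x => by
    rw [abs_of_pos (hr0 x)]; exact Real.sqrt_le_sqrt (hb' x)
  have hrib : ∀ x, |(r x)⁻¹| ≤ (√m)⁻¹ := fun x => by
    rw [abs_of_pos (inv_pos.2 (hr0 x))]
    exact inv_anti₀ (Real.sqrt_pos.2 hm) (hrl x)
  have hbb : ∀ x, |b x| ≤ m' := fun x => by rw [abs_of_pos (hb0 x)]; exact hb' x
  have hrw := memL2_bdd_smul hrm hrb hw
  obtain ⟨Q, φ, hφ, hfQ, hQ⟩ := exists_grad_projection hrm hrb hrw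
  obtain ⟨p₀, hp₀⟩ := exists_limit_of_test ha hrm (Real.sqrt_pos.2 hm) hrl hrb hφ hfQ
  have hQ2 : MemL2 (openTri a) Q := Lp.memLp Q
  have hp2 : MemL2 (openTri a) p₀ := Lp.memLp p₀
  set P : Plane → Plane := fun x => -((r x)⁻¹ • Q x) with hP
  have hP2 : MemL2 (openTri a) P := (memL2_bdd_smul hrm.inv hrib hQ2).neg
  have lim : ∀ ψ : Plane → ℝ, ContDiff ℝ ∞ ψ → ∀ i,
      ∫ x in openTri a, ((-p₀ x) * pd i ψ x + P x i * ψ x) = 0 := fun ψ hψ i =>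
    limit_of_test_formula ha hrm hr0 hrb hrib hφ hfQ hp₀ hψ i
  have hgrad : IsWeakGrad (openTri a) (fun x => -p₀ x) P := by
    have hp2n : MemL2 (openTri a) fun x => -p₀ x := hp2.neg
    refine ⟨hp2n, hP2, fun ψ hψ i => ?_⟩
    have h : ∫ x in openTri a, ((fun x => -p₀ x) x * pd i ψ x + P x i * ψ x) = 0 := lim ψ hψ.1 i
    rw [integral_add (hp2n.mul_integrable (hψ.pd i).memL2)
      ((hP2.coord i).mul_integrable hψ.memL2)] at h
    exact eq_neg_of_add_eq_zero_left h
  have hint : ∀ i, EdgeIntegrable (a i) (a (i + 1)) fun _ => 0 := fun i =>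
    intervalIntegrable_const
  have htr : IsTrace a (fun x => -p₀ x) fun _ => 0 := by
    refine isTrace_iff.2 ⟨hint, P, hgrad, fun ψ hψ i => ?_⟩
    rw [lim ψ hψ i]
    simp [edgeInt]
  refine ⟨_, P, hgrad, htr, isTangTrace_grad ha hgrad htr hint (fun i s _ => by simp),
    memL2_bdd_smul hbm hbb (hw.add hP2), by simp [MemL2], fun ψ hψ => ?_⟩
  have h := hQ ψ hψ
  have hd : MemL2 (openTri a) fun x => r x • w x - Q x := MemLp.sub hrw hQ2
  have e : l2 hrw - Q = l2 hd := l2_eq _ (by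
    filter_upwards [Lp.coeFn_sub (l2 hrw) Q, l2_coe hrw] with x h1 h2
    rw [h1, Pi.sub_apply, h2])
  rw [e, inner_l2] at h
  simp only [zero_mul, integral_zero, zero_eq_neg]
  refine Eq.trans ?_ h
  congr 1; funext x
  rw [plane_inner]
  have hx := (hr0 x).ne'
  simp only [PiLp.sub_apply, PiLp.smul_apply, PiLp.add_apply, smul_eq_mul, hP,
    PiLp.neg_apply, cgrad_apply, ← hrr x]
  field_simp
  ring

end Projection

end IVE

end

noncomputable section

namespace IVE

open MeasureTheory Set Filter

open scoped ContDiff Topology NNReal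

/-! ### Local problems on a triangle -/

section Local

variable {a : Fin 3 → Plane}

/-- The function on the boundary of a triangle given by functions on its sides. -/
def bdryFun (a : Fin 3 → Plane) (T : Fin 3 → ℝ → ℝ) (x : Plane) : ℝ :=
  open Classical in
  if bary a 2 x = 0 then T 0 (bary a 1 x) else if bary a 0 x = 0 then T 1 (bary a 2 x)
    else T 2 (bary a 0 x)

theorem bdryFun_side (ha : 0 < area2 a) (T : Fin 3 → ℝ → ℝ) (i : Fin 3) {s : ℝ}
    (hs : s ∈ Ioo (0 : ℝ) 1) : bdryFun a T (side a i s) = T i s := by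
  obtain ⟨h1, h2, h3⟩ := side_bary ha i s
  have hs0 := hs.1.ne'
  have hs1 := (sub_pos.2 hs.2).ne'
  obtain ⟨e1, e2, e3, e4, e5, e6⟩ := fin3_add
  rcases fin3_cases i with rfl | rfl | rfl <;> simp only [e1, e2, e3, e4, e5, e6] at h2 h3 <;>
    simp [bdryFun, h1, h2, h3, hs0, hs1]

theorem bdryFun_side_of_compat (ha : 0 < area2 a) {T : Fin 3 → ℝ → ℝ}
    (hT : ∀ i, T i 1 = T (i + 1) 0) (i : Fin 3) (s : ℝ) :
    bdryFun a T (side a i s) = T i s := by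
  obtain ⟨h1, h2, h3⟩ := side_bary ha i s
  have t0 := hT 0
  have t1 := hT 1
  have t2 := hT 2
  obtain ⟨e1, e2, e3, e4, e5, e6⟩ := fin3_add
  simp only [e1, e2, e3] at t0 t1 t2
  rcases fin3_cases i with rfl | rfl | rfl <;> simp only [e1, e2, e3, e4, e5, e6] at h2 h3
  · simp [bdryFun, h2, h3]
  · by_cases hs : s = 0
    · rw [bdryFun, h2, h1, hs]
      simp [t0]
    · simp [bdryFun, h2, h3, hs]
  · by_cases hs : s = 0
    · rw [bdryFun, h1, h2, hs]
      simp [t1]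
    · by_cases hs1 : s = 1
      · rw [bdryFun, h1, h3, hs1]
        simp [t2]
      · have : 1 - s ≠ 0 := sub_ne_zero.2 (Ne.symm hs1)
        simp [bdryFun, h1, h2, hs, this]

theorem exists_bary_lipschitz (a : Fin 3 → Plane) :
    ∃ L, 0 ≤ L ∧ ∀ i x y, |bary a i x - bary a i y| ≤ L * dist x y := by
  choose c p q h using bary_affine (a := a)
  refine ⟨∑ i, (|p i| + |q i|), Finset.sum_nonneg fun i _ => by positivity, fun i x y => ?_⟩
  have h0 : ∀ k : Fin 2, |x k - y k| ≤ dist x y := fun k => by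
    rw [dist_eq_norm]
    exact PiLp.norm_apply_le (x - y) k
  have e : bary a i x - bary a i y = p i * (x 0 - y 0) + q i * (x 1 - y 1) := by
    rw [h, h]; ring
  calc |bary a i x - bary a i y| ≤ |p i| * dist x y + |q i| * dist x y := by
        rw [e]
        refine (abs_add_le _ _).trans ?_
        rw [abs_mul, abs_mul]
        gcongr <;> exact h0 _
    _ = (|p i| + |q i|) * dist x y := by ring
    _ ≤ _ := by
        gcongr
        exact Finset.single_le_sum (f := fun i => |p i| + |q i|) (fun i _ => by positivity)
          (Finset.mem_univ i)

/-- Lipschitz functions on the sides that agree at the vertices extend to a Lipschitz function. -/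
theorem exists_lipschitz_lift (ha : 0 < area2 a) {h : Fin 3 → ℝ → ℝ} {C : ℝ}
    (hC : 0 ≤ C) (hl : ∀ i, ∀ s ∈ Icc (0 : ℝ) 1, ∀ t ∈ Icc (0 : ℝ) 1, |h i s - h i t| ≤ C * |s - t|)
    (hc : ∀ i, h i 1 = h (i + 1) 0) :
    ∃ (C' : ℝ≥0) (f : Plane → ℝ), LipschitzWith C' f ∧
      ∀ i, ∀ s ∈ Icc (0 : ℝ) 1, f (side a i s) = h i s := by
  obtain ⟨L, hL, hb⟩ := exists_bary_lipschitz a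
  -- Points on adjacent sides are compared through the common vertex. The parameter distances `1 -
  -- s` and `t` to it are differences of barycentric coordinates of the two points, hence bounded by
  -- their distance.
  have h1 : ∀ i, ∀ s ∈ Icc (0 : ℝ) 1, ∀ t ∈ Icc (0 : ℝ) 1,
      |h i s - h (i + 1) t| ≤ C * (2 * L) * dist (side a i s) (side a (i + 1) t) := by
    intro i s hs t ht
    have b1 := hb i (side a i s) (side a (i + 1) t)
    have b2 := hb (i + 2) (side a i s) (side a (i + 1) t)
    have e1 := side_bary ha i s
    have e2 := side_bary ha (i + 1) t
    rw [fin3_add_one_one, fin3_add_one_two] at e2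
    rw [e1.1, e2.2.2] at b1
    rw [e1.2.2, e2.2.1] at b2
    have l1 := hl i s hs 1 ⟨zero_le_one, le_rfl⟩
    have l2 := hl (i + 1) 0 ⟨le_rfl, zero_le_one⟩ t ht
    have e : h i s - h (i + 1) t = (h i s - h i 1) + (h (i + 1) 0 - h (i + 1) t) := by
      rw [hc]; ring
    rw [e]
    refine (abs_add_le _ _).trans ((add_le_add l1 l2).trans ?_)
    rw [sub_zero, abs_sub_comm] at b1
    rw [abs_sub_comm s 1, ← mul_add, mul_assoc]
    refine mul_le_mul_of_nonneg_left ?_ hC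
    rw [abs_sub_comm] at b1
    linarith
  have key : ∀ i j, ∀ s ∈ Icc (0 : ℝ) 1, ∀ t ∈ Icc (0 : ℝ) 1,
      |h i s - h j t| ≤ C * (2 * L) * dist (side a i s) (side a j t) := by
    intro i j s hs t ht
    rcases fin3_eq i j with rfl | rfl | rfl
    · refine (hl _ s hs t ht).trans ?_
      have b1 := hb (j + 1) (side a j s) (side a j t)
      rw [(side_bary ha j s).2.1, (side_bary ha j t).2.1] at b1
      rw [mul_assoc]
      refine mul_le_mul_of_nonneg_left ?_ hC
      have := mul_nonneg hL (dist_nonneg (x := side a j s) (y := side a j t))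
      linarith
    · exact h1 i s hs t ht
    · have := h1 (i + 2) t ht s hs
      rw [fin3_add_two_one] at this
      rwa [abs_sub_comm, dist_comm]
  have hlip : LipschitzOnWith (C * (2 * L)).toNNReal (bdryFun a h) (frontier (tri a)) := by
    refine LipschitzOnWith.of_dist_le_mul fun x hx y hy => ?_
    obtain ⟨i, s, hs, rfl⟩ := (mem_frontier_iff_side ha).1 hx
    obtain ⟨j, t, ht, rfl⟩ := (mem_frontier_iff_side ha).1 hy
    rw [bdryFun_side_of_compat ha hc, bdryFun_side_of_compat ha hc,
      Real.coe_toNNReal _ (by positivity), Real.dist_eq]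
    exact key i j s hs t ht
  obtain ⟨f, hf, hfe⟩ := hlip.extend_real
  refine ⟨_, f, hf, fun i s hs => ?_⟩
  rw [← hfe ((mem_frontier_iff_side ha).2 ⟨i, s, hs, rfl⟩), bdryFun_side_of_compat ha hc]

/-- A Lipschitz lift of the boundary values is corrected by a function of zero trace. The field `y`
is zero for nodal functions and carries the curl for edge fields. -/
theorem exists_local_potential (ha : 0 < area2 a) {b : Plane → ℝ} (hbm : Measurable b)
    {m m' : ℝ} (hm : 0 < m) (hb : ∀ x, m ≤ b x) (hb' : ∀ x, b x ≤ m') {h : Fin 3 → ℝ → ℝ} {C : ℝ}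
    (hC : 0 ≤ C) (hl : ∀ i, ∀ s ∈ Icc (0 : ℝ) 1, ∀ t ∈ Icc (0 : ℝ) 1, |h i s - h i t| ≤ C * |s - t|)
    (hc : ∀ i, h i 1 = h (i + 1) 0) {y : Plane → Plane} (hy : MemL2 (openTri a) y) :
    ∃ v G g, IsWeakGrad (openTri a) v G ∧ IsWeakDiv (openTri a) (fun x => b x • (y x + G x))
      (fun _ => 0) ∧ IsTrace a v g ∧ Continuous g ∧
      ∀ i, ∀ s ∈ Icc (0 : ℝ) 1, g (side a i s) = h i s := by
  obtain ⟨C', f, hf, hfe⟩ := exists_lipschitz_lift ha hC hl hc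
  have hfg := lipschitz_isWeakGrad (a := a) hf
  obtain ⟨p, P, hP, hp0, -, hdiv⟩ := exists_trace_zero_correction ha hbm hm hb hb' (hy.add hfg.2.1)
  refine ⟨_, _, _, hfg.add hP, hdiv.congr ?_, (lipschitz_isTrace ha hf).add hp0,
    hf.continuous.add continuous_const, fun i s hs => ?_⟩
  · filter_upwards with x
    rw [Pi.add_apply, add_assoc]
  · simp [hfe i s hs]

/-- The tangential component along the sides of a field. -/
def tangSide (a : Fin 3 → Plane) (y : Plane → Plane) (i : Fin 3) (s : ℝ) : ℝ :=
  (dist (a i) (a (i + 1)))⁻¹ * ((a (i + 1) 0 - a i 0) * y (side a i s) 0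
    + (a (i + 1) 1 - a i 1) * y (side a i s) 1)

theorem ae_Ioo {P : ℝ → Prop} (h : ∀ s ∈ Ioo (0 : ℝ) 1, P s) :
    ∀ᵐ s ∂volume.restrict (Ioc (0 : ℝ) 1), P s := by
  rw [restrict_Ioo_eq_restrict_Ioc.symm]
  filter_upwards [ae_restrict_mem measurableSet_Ioo] with s hs using h s hs

/-- Stokes' formula is the difference of Green's formulas for the two components; the rotated
outward normal is the counterclockwise tangent. -/
theorem isTangTrace_of_isTrace (ha : 0 < area2 a) {y : Plane → Plane} {G₀ G₁ : Plane → Plane}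
    (h0 : IsWeakGrad (openTri a) (fun x => y x 0) G₀) (h1 : IsWeakGrad (openTri a) (fun x => y x 1) G₁)
    (t0 : IsTrace a (fun x => y x 0) fun x => y x 0)
    (t1 : IsTrace a (fun x => y x 1) fun x => y x 1) :
    IsWeakCurl (openTri a) y (fun x => G₁ x 0 - G₀ x 1) ∧
      IsTangTrace a y (bdryFun a (tangSide a y)) := by
  have hy : MemL2 (openTri a) y := memL2_of_coord h0.1 h1.1
  have hc : IsWeakCurl (openTri a) y (fun x => G₁ x 0 - G₀ x 1) := by
    refine ⟨hy, (h1.2.1.coord 0).sub (h0.2.1.coord 1), fun φ hφ => ?_⟩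
    have e0 := h0.2.2 φ hφ 1
    have e1 := h1.2.2 φ hφ 0
    simp only [sub_mul]
    rw [integral_sub ((h1.2.1.coord 0).mul_integrable hφ.memL2)
      ((h0.2.1.coord 1).mul_integrable hφ.memL2),
      integral_sub (h0.1.mul_integrable (hφ.pd 1).memL2) (h1.1.mul_integrable (hφ.pd 0).memL2)]
    linarith
  have hi : ∀ j, EdgeIntegrable (a j) (a (j + 1)) (bdryFun a (tangSide a y)) := fun j => by
    refine EdgeIntegrable.congr_ae (f := fun x => y x 0 * ((dist (a j) (a (j + 1)))⁻¹
      * (a (j + 1) 0 - a j 0)) + y x 1 * ((dist (a j) (a (j + 1)))⁻¹ * (a (j + 1) 1 - a j 1)))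
      (IntervalIntegrable.add ((t0.integrable j).mul_continuous continuous_const)
        ((t1.integrable j).mul_continuous continuous_const)) (ae_Ioo fun s hs => ?_)
    have := bdryFun_side ha (tangSide a y) j hs
    rw [this, tangSide]
    ring
  refine ⟨hc, hi, _, hc, fun φ hφ => ?_⟩
  have e0 := t0.formula h0 φ hφ 1
  have e1 := t1.formula h1 φ hφ 0
  have i0 : IntegrableOn (fun x => y x 0 * pd 1 φ x + G₀ x 1 * φ x) (openTri a) :=
    (h0.1.mul_integrable (memL2_smooth (pd_contDiff hφ 1))).add
      ((h0.2.1.coord 1).mul_integrable (memL2_smooth hφ))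
  have i1 : IntegrableOn (fun x => y x 1 * pd 0 φ x + G₁ x 0 * φ x) (openTri a) :=
    (h1.1.mul_integrable (memL2_smooth (pd_contDiff hφ 0))).add
      ((h1.2.1.coord 0).mul_integrable (memL2_smooth hφ))
  have e : ∫ x in openTri a, ((G₁ x 0 - G₀ x 1) * φ x - (y x 0 * pd 1 φ x - y x 1 * pd 0 φ x))
      = (∫ x in openTri a, (y x 1 * pd 0 φ x + G₁ x 0 * φ x))
        - ∫ x in openTri a, (y x 0 * pd 1 φ x + G₀ x 1 * φ x) := by
    rw [← integral_sub i1 i0]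
    congr 1; funext x; ring
  rw [e, e1, e0, ← Finset.sum_sub_distrib]
  refine Finset.sum_congr rfl fun j _ => ?_
  have i2 : EdgeIntegrable (a j) (a (j + 1)) fun x => y x 1 * φ x
      * rightNormal (a j) (a (j + 1)) 0 :=
    ((t1.integrable j).mul_continuous hφ.continuous).mul_continuous continuous_const
  have i3 : EdgeIntegrable (a j) (a (j + 1)) fun x => -1 * (y x 0 * φ x
      * rightNormal (a j) (a (j + 1)) 1) := IntervalIntegrable.const_mul
    (((t0.integrable j).mul_continuous hφ.continuous).mul_continuous continuous_const) _
  rw [← edgeInt_mul_const, ← edgeInt_mul_const, sub_eq_add_neg, ← neg_one_mul, ← edgeInt_const_mul,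
    ← edgeInt_add i2 i3]
  refine edgeInt_congr_ae (ae_Ioo fun s hs => ?_)
  have := bdryFun_side ha (tangSide a y) j hs
  rw [this, tangSide]
  simp [rightNormal]
  ring

/-! ### Fields with piecewise constant curl and prescribed tangential trace -/

theorem cross_line_null {A B : Plane} (hAB : A ≠ B) :
    ∀ᵐ x ∂(volume : Measure Plane), cross (B - A) (x - A) ≠ 0 := by
  set τ : Plane := B - A with hτ
  let L : Plane →ₗ[ℝ] ℝ :=
    { toFun := fun x => cross τ x
      map_add' := fun u v => by simp [cross]; ring
      map_smul' := fun k v => by simp [cross]; ring }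
  have hL : L.ker ≠ ⊤ := fun h => by
    have h1 : (!₂[-τ 1, τ 0] : Plane) ∈ L.ker := h ▸ Submodule.mem_top
    have h2 : cross τ !₂[-τ 1, τ 0] = 0 := h1
    simp [cross] at h2
    have : τ ≠ 0 := sub_ne_zero.2 hAB.symm
    refine this (plane_ext ?_ ?_) <;> simp only [PiLp.zero_apply] <;>
      nlinarith [sq_nonneg (τ 0), sq_nonneg (τ 1)]
  have h1 := Measure.addHaar_submodule (volume : Measure Plane) _ hL
  have h2 := measure_preimage_add_right (volume : Measure Plane) (-A) (L.ker : Set Plane)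
  rw [ae_iff]
  rw [h1] at h2
  refine measure_mono_null (fun x hx => ?_) h2
  simp only [mem_ofPred_eq, not_not] at hx
  show cross τ (x + -A) = 0
  rw [← sub_eq_add_neg]
  exact hx

/-- The field `-f(ℓ) τ / |τ|²` where `ℓ` is the signed distance times `|τ|` to a line with
direction `τ = B - A`; its curl is `f'(ℓ)`. -/
theorem exists_piecewise_curl (ha : 0 < area2 a) {A B : Plane} (hAB : A ≠ B) (kp km : ℝ) :
    ∃ y, IsWeakCurl (openTri a) y (fun x => if 0 < cross (B - A) (x - A) then kp else km) ∧
      IsTangTrace a y (bdryFun a (tangSide a y)) ∧ Continuous y := by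
  set τ : Plane := B - A with hτ
  set n : ℝ := τ 0 ^ 2 + τ 1 ^ 2 with hn
  have hn0 : 0 < n := by
    have : τ ≠ 0 := sub_ne_zero.2 hAB.symm
    by_contra h
    push Not at h
    refine this (plane_ext ?_ ?_) <;> simp only [PiLp.zero_apply] <;>
      nlinarith [sq_nonneg (τ 0), sq_nonneg (τ 1)]
  set ℓ : Plane → ℝ := fun x => cross τ (x - A) with hℓ
  set f : ℝ → ℝ := fun t => kp * max t 0 + km * min t 0 with hf
  set y : Plane → Plane := fun x => (-(f (ℓ x) / n)) • τ with hy
  have hℓx : ∀ x, ℓ x = τ 0 * (x 1 - A 1) - τ 1 * (x 0 - A 0) := fun x => by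
    simp [hℓ, cross]
  have hfl : LipschitzWith (|kp| + |km|).toNNReal f := by
    refine LipschitzWith.of_dist_le_mul fun s t => ?_
    rw [Real.dist_eq, Real.dist_eq, Real.coe_toNNReal _ (by positivity)]
    have e : f s - f t = kp * (max s 0 - max t 0) + km * (min s 0 - min t 0) := by
      simp only [hf]; ring
    rw [e]
    refine (abs_add_le _ _).trans ?_
    rw [abs_mul, abs_mul, add_mul]
    have h1 := abs_max_sub_max_le_abs s t 0
    have h2 : |min s 0 - min t 0| ≤ |s - t| := (abs_min_sub_min_le_max s 0 t 0).trans (by simp)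
    exact add_le_add (mul_le_mul_of_nonneg_left h1 (abs_nonneg _))
      (mul_le_mul_of_nonneg_left h2 (abs_nonneg _))
  have hℓl : LipschitzWith (|τ 0| + |τ 1|).toNNReal ℓ := by
    refine LipschitzWith.of_dist_le_mul fun u v => ?_
    have h0 : ∀ k : Fin 2, |u k - v k| ≤ dist u v := fun k => by
      rw [dist_eq_norm]
      exact PiLp.norm_apply_le (u - v) k
    rw [Real.dist_eq, Real.coe_toNNReal _ (by positivity)]
    have e : ℓ u - ℓ v = τ 0 * (u 1 - v 1) + (-τ 1) * (u 0 - v 0) := by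
      rw [hℓx, hℓx]; ring
    rw [e]
    refine (abs_add_le _ _).trans ?_
    rw [abs_mul, abs_mul, abs_neg, add_mul]
    gcongr <;> exact h0 _
  have hyk : ∀ k x, y x k = -(τ k / n) * f (ℓ x) := fun k x => by
    simp only [hy, PiLp.smul_apply, smul_eq_mul]; ring
  have hyl : ∀ k, ∃ C, LipschitzWith C fun x => y x k := fun k => by
    simp only [hyk]
    exact ⟨_, (lipschitzWith_smul (-(τ k / n))).comp (hfl.comp hℓl)⟩
  have hfd : ∀ u, u ≠ 0 → HasDerivAt f (if 0 < u then kp else km) u := by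
    intro u hu
    rcases hu.lt_or_gt with h | h
    · rw [if_neg h.not_gt]
      have : HasDerivAt (fun t : ℝ => km * t) (km * 1) u := (hasDerivAt_id u).const_mul km
      rw [mul_one] at this
      refine this.congr_of_eventuallyEq ?_
      filter_upwards [gt_mem_nhds h] with t ht
      simp [hf, max_eq_right ht.le, min_eq_left ht.le]
    · rw [if_pos h]
      have : HasDerivAt (fun t : ℝ => kp * t) (kp * 1) u := (hasDerivAt_id u).const_mul kp
      rw [mul_one] at this
      refine this.congr_of_eventuallyEq ?_
      filter_upwards [lt_mem_nhds h] with t ht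
      simp [hf, max_eq_left ht.le, min_eq_right ht.le]
  have hld : ∀ x, ℓ x ≠ 0 → ∀ k (v : Plane), lineDeriv ℝ (fun x => y x k) x v
      = -(τ k / n) * ((if 0 < ℓ x then kp else km) * cross τ v) := by
    intro x hx k v
    have e : ∀ t : ℝ, ℓ (x + t • v) = ℓ x + t * cross τ v := fun t => by
      simp only [hℓx, cross, PiLp.add_apply, PiLp.smul_apply, smul_eq_mul]; ring
    have h1 : HasDerivAt (fun t : ℝ => ℓ x + t * cross τ v) (1 * cross τ v) 0 :=
      ((hasDerivAt_id (0 : ℝ)).mul_const _).const_add _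
    have h2 : HasDerivAt f (if 0 < ℓ x then kp else km) (ℓ x + 0 * cross τ v) := by
      rw [zero_mul, add_zero]; exact hfd _ hx
    have h3 := (h2.comp (0 : ℝ) h1).const_mul (-(τ k / n))
    rw [lineDeriv]
    simp only [hyk, e]
    rw [one_mul] at h3
    exact h3.deriv
  have hnull : ∀ᵐ x ∂(volume : Measure Plane), ℓ x ≠ 0 := cross_line_null hAB
  obtain ⟨C0, hy0⟩ := hyl 0
  obtain ⟨C1, hy1⟩ := hyl 1
  obtain ⟨hc, ht⟩ := isTangTrace_of_isTrace ha (lipschitz_isWeakGrad hy0) (lipschitz_isWeakGrad hy1)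
    (lipschitz_isTrace ha hy0) (lipschitz_isTrace ha hy1)
  refine ⟨y, hc.congr (Eventually.of_forall fun _ => rfl) ?_, ht, ?_⟩
  · filter_upwards [ae_restrict_of_ae hnull] with x hx
    rw [lgrad_apply, lgrad_apply, hld x hx, hld x hx]
    change _ = if 0 < ℓ x then kp else km
    generalize (if 0 < ℓ x then kp else km) = κ
    simp only [cross, PiLp.single_apply]
    simp
    field_simp
    rw [hn]
    ring
  · exact ((hfl.continuous.comp hℓl.continuous).div_const n).neg.smul continuous_const

theorem edgeIntegrable_bdryFun (ha : 0 < area2 a) {T : Fin 3 → ℝ → ℝ} {i : Fin 3}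
    (hT : IntervalIntegrable (T i) volume 0 1) : EdgeIntegrable (a i) (a (i + 1)) (bdryFun a T) := by
  unfold EdgeIntegrable
  rw [intervalIntegrable_iff, uIoc_of_le zero_le_one] at hT ⊢
  refine hT.congr (ae_Ioo fun s hs => ?_)
  exact (bdryFun_side ha T i hs).symm

theorem integral_bdryFun (ha : 0 < area2 a) (T : Fin 3 → ℝ → ℝ) (i : Fin 3) {s : ℝ}
    (hs : s ∈ Icc (0 : ℝ) 1) :
    ∫ t in (0 : ℝ)..s, bdryFun a T (side a i t) = ∫ t in (0 : ℝ)..s, T i t := by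
  rw [intervalIntegral.integral_of_le hs.1, intervalIntegral.integral_of_le hs.1]
  refine integral_congr_ae (ae_restrict_of_ae_restrict_of_subset (Ioc_subset_Ioc_right hs.2)
    (ae_Ioo fun t ht => bdryFun_side ha T i ht))

/-- Stokes' formula tested with the constant `1`. It fixes the curl in the existence proof, shows
that it vanishes in the uniqueness proof, and yields the commutation with the projection. -/
theorem IsTangTrace.flux {w : Plane → Plane} {c g : Plane → ℝ} (h : IsTangTrace a w g)
    (hc : IsWeakCurl (openTri a) w c) :
    ∫ x in openTri a, c x = ∑ i, edgeInt (a i) (a (i + 1)) g := by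
  have := h.formula hc (fun _ => 1) contDiff_const
  simpa [pd] using this

theorem piecewise_measurable {ℓ : Plane → ℝ} (hℓ : Continuous ℓ) (kp km : ℝ) :
    Measurable fun x => if 0 < ℓ x then kp else km :=
  Measurable.ite (isOpen_lt continuous_const hℓ).measurableSet measurable_const measurable_const

theorem piecewise_integrable {ℓ : Plane → ℝ} (hℓ : Continuous ℓ) (kp km : ℝ) :
    IntegrableOn (fun x => if 0 < ℓ x then kp else km) (openTri a) := by
  have : IsFiniteMeasure (volume.restrict (openTri a)) :=
    ⟨by rw [Measure.restrict_apply_univ]; exact openTri_volume_lt⟩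
  refine Integrable.of_bound (piecewise_measurable hℓ kp km).aestronglyMeasurable (|kp| + |km|)
    (Eventually.of_forall fun x => ?_)
  rw [Real.norm_eq_abs]
  split_ifs
  · linarith [abs_nonneg km]
  · linarith [abs_nonneg kp]

theorem piecewise_integral_pos (ha : 0 < area2 a) {ℓ : Plane → ℝ} (hℓ : Continuous ℓ) {kp km : ℝ}
    (hp : 0 < kp) (hm : 0 < km) : 0 < ∫ x in openTri a, if 0 < ℓ x then kp else km := by
  have h : min kp km * (volume (openTri a)).toReal
      ≤ ∫ x in openTri a, if 0 < ℓ x then kp else km := by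
    have e : ∫ x in openTri a, min kp km = min kp km * (volume (openTri a)).toReal := by
      simp [Measure.real, mul_comm]
    rw [← e]
    refine setIntegral_mono_on (integrableOn_const openTri_volume_lt.ne)
      (piecewise_integrable hℓ kp km) openTri_meas fun x _ => ?_
    split_ifs
    · exact min_le_left _ _
    · exact min_le_right _ _
  have h1 : 0 < (volume (openTri a)).toReal :=
    ENNReal.toReal_pos (openTri_volume_pos ha).ne' openTri_volume_lt.ne
  have := mul_pos (lt_min hp hm) h1
  linarith

theorem cross_line_continuous (A B : Plane) : Continuous fun x => cross (B - A) (x - A) := by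
  unfold cross
  fun_prop

/-- Stokes forces `c₀ = S / σ`, where `S` is the circulation of the data and `σ` the integral of
`1/α`. An explicit field `y` with this curl uses up the circulation; the remaining data `D` are the
derivative of a closed function on the boundary, and the gradient of a potential with these boundary
values makes `b w` divergence free without changing the curl. -/
theorem exists_local_field (ha : 0 < area2 a) {A B : Plane} (hAB : A ≠ B) {αp αm : ℝ}
    (hαp : 0 < αp) (hαm : 0 < αm) {b : Plane → ℝ} (hbm : Measurable b)
    {m m' : ℝ} (hm : 0 < m) (hb : ∀ x, m ≤ b x) (hb' : ∀ x, b x ≤ m') {T : Fin 3 → ℝ → ℝ} {R : ℝ}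
    (hTi : ∀ i, IntervalIntegrable (T i) volume 0 1) (hTb : ∀ i, ∀ s ∈ Icc (0 : ℝ) 1, |T i s| ≤ R) :
    ∃ (w : Plane → Plane) (c₀ : ℝ), IsWeakCurl (openTri a) w
        (fun x => if 0 < cross (B - A) (x - A) then c₀ / αp else c₀ / αm) ∧
      IsWeakDiv (openTri a) (fun x => b x • w x) (fun _ => 0) ∧
      IsTangTrace a w (bdryFun a T) := by
  have hℓ := cross_line_continuous A B
  have hσ := piecewise_integral_pos ha hℓ (inv_pos.2 hαp) (inv_pos.2 hαm)
  set σ := ∫ x in openTri a, if 0 < cross (B - A) (x - A) then αp⁻¹ else αm⁻¹ with hσd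
  set S := ∑ i, edgeInt (a i) (a (i + 1)) (bdryFun a T) with hS
  obtain ⟨y, hyc, hyt, hy⟩ := exists_piecewise_curl ha hAB (S / σ / αp) (S / σ / αm)
  have hyS : ∑ i, edgeInt (a i) (a (i + 1)) (bdryFun a (tangSide a y)) = S := by
    rw [← hyt.flux hyc]
    have e : ∀ x, (if 0 < cross (B - A) (x - A) then S / σ / αp else S / σ / αm)
        = S / σ * (if 0 < cross (B - A) (x - A) then αp⁻¹ else αm⁻¹) := fun x => by
      split_ifs <;> rw [div_eq_mul_inv _ (_ : ℝ)]
    simp only [e]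
    rw [integral_const_mul, ← hσd]
    field_simp
  have hyT : ∀ i, Continuous (tangSide a y i) := fun i => by
    have h1 : Continuous fun s => y (side a i s) := hy.comp (side_contDiff i).continuous
    unfold tangSide
    fun_prop
  obtain ⟨R', hR'⟩ : ∃ R', ∀ i, ∀ s ∈ Icc (0 : ℝ) 1, |tangSide a y i s| ≤ R' := by
    choose R' hR' using fun i => (isCompact_Icc (a := (0 : ℝ)) (b := 1)).exists_bound_of_continuousOn
      (hyT i).continuousOn
    exact ⟨∑ i, |R' i|, fun i s hs => ((hR' i s hs).trans (le_abs_self _)).trans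
      (Finset.single_le_sum (f := fun i => |R' i|) (fun i _ => abs_nonneg _) (Finset.mem_univ i))⟩
  set D : Fin 3 → ℝ → ℝ := fun i s => T i s - tangSide a y i s with hD
  have hDi : ∀ i, IntervalIntegrable (D i) volume 0 1 := fun i =>
    (hTi i).sub ((hyT i).intervalIntegrable 0 1)
  have hDb : ∀ i, ∀ s ∈ Icc (0 : ℝ) 1, |D i s| ≤ R + R' := fun i s hs =>
    (abs_sub _ _).trans (add_le_add (hTb i s hs) (hR' i s hs))
  set J : Fin 3 → ℝ := fun i => dist (a i) (a (i + 1)) * ∫ t in (0 : ℝ)..1, D i t with hJ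
  have hJ0 : J 0 + J 1 + J 2 = 0 := by
    rw [← Fin.sum_univ_three, ← sub_self S]
    nth_rw 2 [← hyS]
    rw [hS, ← Finset.sum_sub_distrib]
    refine Finset.sum_congr rfl fun i _ => ?_
    simp only [hJ, edgeInt]
    rw [integral_bdryFun ha T i ⟨zero_le_one, le_rfl⟩,
      integral_bdryFun ha (tangSide a y) i ⟨zero_le_one, le_rfl⟩, ← mul_sub,
      ← intervalIntegral.integral_sub (hTi i) ((hyT i).intervalIntegrable 0 1)]
  -- Initial values that make the primitives on the three sides agree at the vertices; at the last
  -- vertex they close up by `hJ0`.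
  set k : Fin 3 → ℝ := ![0, J 0, J 0 + J 1] with hk
  set h : Fin 3 → ℝ → ℝ := fun i s =>
    k i + dist (a i) (a (i + 1)) * ∫ t in (0 : ℝ)..s, D i t with hh
  have hR0 : 0 ≤ R + R' := (abs_nonneg _).trans (hDb 0 0 ⟨le_rfl, zero_le_one⟩)
  obtain ⟨v, G, g, hv, hdiv, hg, hgc, hgs⟩ := exists_local_potential ha hbm hm hb hb' (h := h)
    (C := (∑ i, dist (a i) (a (i + 1))) * (R + R')) (by positivity) (fun i s hs t ht => by
      have e : h i s - h i t = dist (a i) (a (i + 1)) * ∫ r in t..s, D i r := by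
        rw [← intervalIntegral.integral_interval_sub_left ((hDi i).mono_set ?_)
          ((hDi i).mono_set ?_)]
        · simp only [hh]; ring
        · rw [uIcc_of_le hs.1, uIcc_of_le zero_le_one]; exact Icc_subset_Icc_right hs.2
        · rw [uIcc_of_le ht.1, uIcc_of_le zero_le_one]; exact Icc_subset_Icc_right ht.2
      have e2 := intervalIntegral.norm_integral_le_of_norm_le_const (a := t) (b := s) (f := D i)
        (C := R + R') (fun r hr => hDb i r (by
          have h1 := uIoc_subset_uIcc hr
          exact (uIcc_subset_Icc ht hs) h1))
      rw [e, abs_mul, abs_of_nonneg dist_nonneg, mul_assoc]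
      refine mul_le_mul (Finset.single_le_sum (f := fun i => dist (a i) (a (i + 1)))
        (fun i _ => dist_nonneg) (Finset.mem_univ i)) e2 (abs_nonneg _) (by positivity))
    (fun i => by
      obtain ⟨e1, e2, e3, -⟩ := fin3_add
      have hi : ∀ i, h i 1 = k i + J i := fun i => rfl
      have hi0 : ∀ i, h i 0 = k i := fun i => by simp [hh]
      rw [hi, hi0]
      rcases fin3_cases i with rfl | rfl | rfl <;> simp only [e1, e2, e3, hk]
      · simp
      · simp
      · simpa using hJ0) hyc.1
  have hGt : IsTangTrace a G (bdryFun a D) := by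
    refine isTangTrace_grad ha hv hg (fun i => edgeIntegrable_bdryFun ha (hDi i)) fun i s hs => ?_
    have h0 := hgs i 0 ⟨le_rfl, zero_le_one⟩
    rw [side, AffineMap.lineMap_apply_zero] at h0
    rw [hgs i s hs, h0, integral_bdryFun ha D i hs]
    simp [hh]
  refine ⟨fun x => y x + G x, S / σ, ?_, hdiv, (hyt.add hGt).congr_side fun i => ae_Ioo fun s hs => ?_⟩
  · have := hyc.add hv.curl
    simpa only [add_zero] using this
  · have e1 := bdryFun_side ha (tangSide a y) i hs
    have e2 := bdryFun_side ha D i hs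
    have e3 := bdryFun_side ha T i hs
    change bdryFun a (tangSide a y) (side a i s) + bdryFun a D (side a i s) = _
    rw [e1, e2, e3]
    simp only [hD]; ring

/-- The lowest order Nédélec fields. -/
def nedelec (p q c : ℝ) (x : Plane) : Plane := !₂[p - c * x 1, q + c * x 0]

theorem affine_contDiff (k l m : ℝ) : ContDiff ℝ ∞ fun x : Plane => k + l * x 0 + m * x 1 := by
  fun_prop

theorem pd_affine (k l m : ℝ) (x : Plane) : pd 0 (fun x => k + l * x 0 + m * x 1) x = l ∧
    pd 1 (fun x => k + l * x 0 + m * x 1) x = m := by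
  have h : HasFDerivAt (fun x : Plane => k + l * x 0 + m * x 1)
      (l • (EuclideanSpace.proj (𝕜 := ℝ) (0 : Fin 2) : Plane →L[ℝ] ℝ)
        + m • (EuclideanSpace.proj (𝕜 := ℝ) (1 : Fin 2) : Plane →L[ℝ] ℝ)) x :=
    (((EuclideanSpace.proj (𝕜 := ℝ) (0 : Fin 2) : Plane →L[ℝ] ℝ).hasFDerivAt.const_mul l).const_add
      k).add ((EuclideanSpace.proj (𝕜 := ℝ) (1 : Fin 2) : Plane →L[ℝ] ℝ).hasFDerivAt.const_mul m)
  simp [pd, h.fderiv]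

theorem affine_isWeakGrad (ha : 0 < area2 a) (k l m : ℝ) :
    IsWeakGrad (openTri a) (fun x => k + l * x 0 + m * x 1) fun _ => !₂[l, m] := by
  refine (smooth_isWeakGrad ha (affine_contDiff k l m)).congr (Eventually.of_forall fun _ => rfl)
    (Eventually.of_forall fun x => ?_)
  apply plane_ext <;> simp [cgrad_apply, (pd_affine k l m x).1, (pd_affine k l m x).2]

theorem affine_isTrace (ha : 0 < area2 a) (k l m : ℝ) :
    IsTrace a (fun x => k + l * x 0 + m * x 1) fun x => k + l * x 0 + m * x 1 :=
  isTrace_of_continuousOn ha (affine_contDiff k l m).continuous.continuousOn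
    (affine_isWeakGrad ha k l m)

theorem nedelec_apply (p q c : ℝ) (x : Plane) : nedelec p q c x 0 = p + 0 * x 0 + (-c) * x 1 ∧
    nedelec p q c x 1 = q + c * x 0 + 0 * x 1 := by
  constructor <;> simp [nedelec, sub_eq_add_neg]

theorem nedelec_isWeakCurl (ha : 0 < area2 a) (p q c : ℝ) :
    IsWeakCurl (openTri a) (nedelec p q c) (fun _ => 2 * c) ∧
      IsTangTrace a (nedelec p q c) (bdryFun a (tangSide a (nedelec p q c))) := by
  have h0 : (fun x => nedelec p q c x 0) = fun x => p + 0 * x 0 + (-c) * x 1 :=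
    funext fun x => (nedelec_apply p q c x).1
  have h1 : (fun x => nedelec p q c x 1) = fun x => q + c * x 0 + 0 * x 1 :=
    funext fun x => (nedelec_apply p q c x).2
  obtain ⟨hc, ht⟩ := isTangTrace_of_isTrace (y := nedelec p q c) ha
    (h0 ▸ affine_isWeakGrad ha p 0 (-c)) (h1 ▸ affine_isWeakGrad ha q c 0)
    (h0 ▸ affine_isTrace ha p 0 (-c)) (h1 ▸ affine_isTrace ha q c 0)
  refine ⟨hc.congr (Eventually.of_forall fun _ => rfl) (Eventually.of_forall fun x => ?_), ht⟩
  simp; ring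

theorem nedelec_isWeakDiv (ha : 0 < area2 a) (p q c : ℝ) :
    IsWeakDiv (openTri a) (nedelec p q c) fun _ => 0 := by
  have h0 : (fun x => nedelec p q c x 0) = fun x => p + 0 * x 0 + (-c) * x 1 :=
    funext fun x => (nedelec_apply p q c x).1
  have h1 : (fun x => nedelec p q c x 1) = fun x => q + c * x 0 + 0 * x 1 :=
    funext fun x => (nedelec_apply p q c x).2
  have g0 : IsWeakGrad (openTri a) (fun x => nedelec p q c x 0) _ :=
    h0 ▸ affine_isWeakGrad ha p 0 (-c)
  have g1 : IsWeakGrad (openTri a) (fun x => nedelec p q c x 1) _ :=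
    h1 ▸ affine_isWeakGrad ha q c 0
  refine ⟨memL2_of_coord g0.1 g1.1, by simp [MemL2], fun φ hφ => ?_⟩
  rw [integral_add (g0.1.mul_integrable (hφ.pd 0).memL2) (g1.1.mul_integrable (hφ.pd 1).memL2),
    g0.2.2 φ hφ 0, g1.2.2 φ hφ 1]
  simp

theorem tangSide_nedelec (p q c : ℝ) (i : Fin 3) (s : ℝ) :
    tangSide a (nedelec p q c) i s = (dist (a i) (a (i + 1)))⁻¹ * ((a (i + 1) 0 - a i 0)
      * (p - c * a i 1) + (a (i + 1) 1 - a i 1) * (q + c * a i 0)) := by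
  have h0 := lineMap_coord (a i) (a (i + 1)) s 0
  have h1 := lineMap_coord (a i) (a (i + 1)) s 1
  rw [tangSide, (nedelec_apply p q c _).1, (nedelec_apply p q c _).2, h0, h1]
  ring

/-- A combination of the Whitney fields `λᵢ ∇λᵢ₊₁ - λᵢ₊₁ ∇λᵢ` of the barycentric coordinates, each
having unit moment on its own side and none on the others; the coefficients are the moments `M i`.
-/
theorem exists_nedelec (ha : 0 < area2 a) (r : Fin 3 → ℝ) :
    ∃ p q c, ∀ i s, tangSide a (nedelec p q c) i s = r i := by
  choose k l m h using bary_affine (a := a)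
  set M : Fin 3 → ℝ := fun i => dist (a i) (a (i + 1)) * r i with hM
  refine ⟨∑ i, M i * (k i * l (i + 1) - k (i + 1) * l i),
    ∑ i, M i * (k i * m (i + 1) - k (i + 1) * m i),
    ∑ i, M i * (l i * m (i + 1) - l (i + 1) * m i), fun i s => ?_⟩
  have hd := (dist_vertex_pos ha i).ne'
  have hv : ∀ j n : Fin 3, bary a j (a n) = k j + l j * a n 0 + m j * a n 1 := fun j n => h j _
  have e00 := hv i i
  have e01 := hv i (i + 1)
  have e10 := hv (i + 1) i
  have e11 := hv (i + 1) (i + 1)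
  have e20 := hv (i + 2) i
  have e21 := hv (i + 2) (i + 1)
  have p1 := bary_prev (a := a) (i + 1)
  have p2 := bary_next (a := a) (i + 2)
  have p3 := bary_prev (a := a) (i + 2)
  rw [fin3_add_one_two] at p1
  rw [fin3_add_two_one] at p2
  have e4 : ∀ i : Fin 3, i + 2 + 2 = i + 1 := by decide
  rw [e4 i] at p3
  rw [bary_self ha] at e00 e11
  rw [bary_next] at e01
  rw [p1] at e10
  rw [p2] at e20
  rw [p3] at e21
  rw [tangSide_nedelec]
  rw [inv_mul_eq_iff_eq_mul₀ hd]
  change _ = M i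
  simp only [sum_fin3 _ i, fin3_add_one_one, fin3_add_two_one]
  generalize k i = k0 at *
  generalize k (i + 1) = k1 at *
  generalize k (i + 2) = k2 at *
  generalize l i = l0 at *
  generalize l (i + 1) = l1 at *
  generalize l (i + 2) = l2 at *
  generalize m i = m0 at *
  generalize m (i + 1) = m1 at *
  generalize m (i + 2) = m2 at *
  generalize a i 0 = x0 at *
  generalize a i 1 = y0 at *
  generalize a (i + 1) 0 = x1 at *
  generalize a (i + 1) 1 = y1 at *
  have f0 : k0 = 1 - l0 * x0 - m0 * y0 := by linarith
  have f1 : k1 = -l1 * x0 - m1 * y0 := by linarith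
  have f2 : k2 = -l2 * x0 - m2 * y0 := by linarith
  have g1 : l1 * (x1 - x0) + m1 * (y1 - y0) = 1 := by linarith
  have g2 : l2 * (x1 - x0) + m2 * (y1 - y0) = 0 := by linarith
  subst f0 f1 f2
  linear_combination M i * g1 - M (i + 2) * g2

theorem exists_affine (ha : 0 < area2 a) (r : Fin 3 → ℝ) :
    ∃ k l m : ℝ, ∀ i, k + l * a i 0 + m * a i 1 = r i := by
  choose k l m h using bary_affine (a := a)
  refine ⟨∑ i, r i * k i, ∑ i, r i * l i, ∑ i, r i * m i, fun i => ?_⟩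
  have e0 := h i (a i)
  have e1 := h (i + 1) (a i)
  have e2 := h (i + 2) (a i)
  have p1 := bary_prev (a := a) (i + 1)
  have p2 := bary_next (a := a) (i + 2)
  rw [fin3_add_one_two] at p1
  rw [fin3_add_two_one] at p2
  rw [bary_self ha] at e0
  rw [p1] at e1
  rw [p2] at e2
  simp only [sum_fin3 _ i]
  linear_combination -r i * e0 - r (i + 1) * e1 - r (i + 2) * e2

end Local

end IVE

end

noncomputable section

namespace IVE

open MeasureTheory Set Filter

open scoped ContDiff Topology NNReal

/-! ### Geometry of the mesh -/

namespace InterfaceMesh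

variable (M : InterfaceMesh)

theorem area_pos (K : Fin M.N) : 0 < area2 (M.vert K) := M.ccw K

/-- By conformity a common point is a convex combination of common vertices, and these all lie on
the side of `K` opposite to the vertex `i`. -/
theorem bary_eq_zero_of_common {K L : Fin M.N} {i : Fin 3} (hi : M.vert K i ∉ range (M.vert L))
    {x : Plane} (hK : x ∈ tri (M.vert K)) (hL : x ∈ tri (M.vert L)) : bary (M.vert K) i x = 0 := by
  have hKL : K ≠ L := fun h => hi (h ▸ mem_range_self i)
  have hx := M.conforming K L hKL ⟨hK, hL⟩
  have hsub : convexHull ℝ (range (M.vert K) ∩ range (M.vert L)) ⊆ {x | bary (M.vert K) i x = 0} := by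
    refine convexHull_min ?_ ?_
    · rintro _ ⟨⟨j, rfl⟩, hj⟩
      rcases fin3_eq i j with rfl | rfl | rfl
      · exact absurd hj hi
      · exact bary_next i
      · exact bary_prev i
    · intro u hu v hv s t hs ht hst
      have := bary_comb_apply (a := M.vert K) i (Finset.univ : Finset (Fin 2)) ![s, t] ![u, v]
        (by simpa using hst)
      simp only [Fin.sum_univ_two, Matrix.cons_val_zero, Matrix.cons_val_one] at this
      simp only [mem_ofPred_eq] at hu hv ⊢
      rw [this, hu, hv]
      simp
  exact hsub hx

theorem exists_not_common {K L : Fin M.N} (h : K ≠ L) : ∃ i, M.vert K i ∉ range (M.vert L) := by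
  by_contra hc
  push Not at hc
  have hsub : range (M.vert K) ⊆ range (M.vert L) := by
    rintro _ ⟨i, rfl⟩; exact hc i
  refine M.distinct K L h (eq_of_subset_of_ncard_le hsub ?_ (finite_range _))
  rw [← image_univ, ← image_univ, ncard_image_of_injective _ (vertex_injective (M.area_pos K)),
    ncard_image_of_injective _ (vertex_injective (M.area_pos L))]

theorem notMem_tri_of_mem_el {K L : Fin M.N} (h : K ≠ L) {x : Plane} (hx : x ∈ M.el K) :
    x ∉ tri (M.vert L) := fun hL => by
  obtain ⟨i, hi⟩ := M.exists_not_common h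
  have h0 := M.bary_eq_zero_of_common hi (openTri_subset hx) hL
  exact ((mem_openTri_iff (M.area_pos K)).1 hx i).ne' h0

theorem el_disjoint {K L : Fin M.N} (h : K ≠ L) : Disjoint (M.el K) (M.el L) :=
  disjoint_left.2 fun _ hK hL => M.notMem_tri_of_mem_el h hK (openTri_subset hL)

theorem eq_of_mem_el {K L : Fin M.N} {x : Plane} (hK : x ∈ M.el K) (hL : x ∈ M.el L) : K = L := by
  by_contra h
  exact disjoint_left.1 (M.el_disjoint h) hK hL

theorem Ω_nonempty : M.Ω.Nonempty := by
  obtain ⟨x, hx⟩ := M.isConnected_Ωp.nonempty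
  have : x ∈ M.Ω \ M.Γ := M.union_sub ▸ Or.inl hx
  exact ⟨x, this.1⟩

theorem interior_closure_Ω : interior (closure M.Ω) = M.Ω := by
  rw [M.convex_Ω.interior_closure_eq_interior_of_nonempty_interior, M.isOpen_Ω.interior_eq]
  rw [M.isOpen_Ω.interior_eq]
  exact M.Ω_nonempty

theorem tri_subset (K : Fin M.N) : tri (M.vert K) ⊆ closure M.Ω := by
  rw [M.cover]; exact subset_iUnion (fun K => tri (M.vert K)) K

theorem subset_Ω_of_isOpen {U : Set Plane} (hU : IsOpen U) (h : U ⊆ closure M.Ω) : U ⊆ M.Ω := by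
  rw [← M.interior_closure_Ω]
  exact interior_maximal h hU

theorem el_subset (K : Fin M.N) : M.el K ⊆ M.Ω :=
  M.subset_Ω_of_isOpen openTri_open (openTri_subset.trans (M.tri_subset K))

theorem el_meas (K : Fin M.N) : MeasurableSet (M.el K) := openTri_meas

theorem ae_mem_el : ∀ᵐ x ∂(volume.restrict M.Ω), ∃ K, x ∈ M.el K := by
  rw [ae_restrict_iff' M.isOpen_Ω.measurableSet]
  have h : ∀ K, ∀ᵐ x ∂(volume : Measure Plane), x ∉ frontier (tri (M.vert K)) := fun K =>
    measure_eq_zero_iff_ae_notMem.1 frontier_null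
  filter_upwards [ae_all_iff.2 h] with x hx hΩ
  have := subset_closure hΩ
  rw [M.cover, mem_iUnion] at this
  obtain ⟨K, hK⟩ := this
  refine ⟨K, ?_⟩
  by_contra hn
  exact hx K ⟨subset_closure hK, hn⟩

/-- Two elements with a common directed side coincide. -/
theorem eq_of_directed_side {K L : Fin M.N} {i j : Fin 3} (h0 : M.vert L j = M.vert K i)
    (h1 : M.vert L (j + 1) = M.vert K (i + 1)) : L = K := by
  by_contra hne
  have haK := M.area_pos K
  have haL := M.area_pos L
  set m : Plane := side (M.vert K) i (1 / 2) with hm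
  have hmL : m = side (M.vert L) j (1 / 2) := by rw [hm, side, side, h0, h1]
  obtain ⟨k0, k1, k2⟩ := side_bary haK i (1 / 2)
  obtain ⟨l0, l1, l2⟩ := side_bary haL j (1 / 2)
  rw [← hm] at k0 k1 k2
  rw [← hmL] at l0 l1 l2
  set r : Plane := M.vert K (i + 2) with hr
  -- Both triangles are counterclockwise and hence lie to the left of the common directed side. A
  -- short step from its midpoint towards the third vertex of `K` enters the interiors of both.
  have hpos : 0 < bary (M.vert L) (j + 2) r := by
    have e : bary (M.vert L) (j + 2) r = area2 (M.vert K) / area2 (M.vert L) := by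
      have e2 : ∀ j : Fin 3, j + 2 + 2 = j + 1 := by decide
      rw [bary, fin3_add_two_one, e2, h0, h1, area2_rot]
    rw [e]; positivity
  have key : ∀ᶠ t in 𝓝[>] (0 : ℝ), AffineMap.lineMap m r t ∈ M.el K ∩ M.el L := by
    have hb : ∀ (a : Fin 3 → Plane) (k : Fin 3), 0 < bary a k m →
        ∀ᶠ t in 𝓝[>] (0 : ℝ), 0 < bary a k (AffineMap.lineMap m r t) := fun a k hk => by
      have hc : Continuous fun t : ℝ => bary a k (AffineMap.lineMap m r t) :=
        (bary_continuous k).comp (by fun_prop)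
      exact nhdsWithin_le_nhds ((hc.continuousAt (x := (0 : ℝ))).eventually
        (lt_mem_nhds (by simpa using hk)))
    have hb2 : ∀ (a : Fin 3 → Plane) (k : Fin 3), bary a k m = 0 → 0 < bary a k r →
        ∀ᶠ t in 𝓝[>] (0 : ℝ), 0 < bary a k (AffineMap.lineMap m r t) := fun a k hk hk' => by
      filter_upwards [self_mem_nhdsWithin] with t ht
      rw [bary_lineMap, hk, mul_zero, zero_add]
      exact mul_pos ht hk'
    filter_upwards [hb _ _ (k0 ▸ by norm_num : 0 < bary (M.vert K) i m),
      hb _ _ (k1 ▸ by norm_num : 0 < bary (M.vert K) (i + 1) m),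
      hb2 (M.vert K) (i + 2) k2 (by rw [hr, bary_self haK]; norm_num),
      hb _ _ (l0 ▸ by norm_num : 0 < bary (M.vert L) j m),
      hb _ _ (l1 ▸ by norm_num : 0 < bary (M.vert L) (j + 1) m),
      hb2 (M.vert L) (j + 2) l2 hpos] with t t0 t1 t2 s0 s1 s2
    refine ⟨(mem_openTri_iff haK).2 fun k => ?_, (mem_openTri_iff haL).2 fun k => ?_⟩
    · rcases fin3_eq i k with rfl | rfl | rfl <;> assumption
    · rcases fin3_eq j k with rfl | rfl | rfl <;> assumption
  obtain ⟨t, ht⟩ := key.exists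
  exact hne (M.eq_of_mem_el ht.2 ht.1)

/-- The sides `(K, i)` and `(L, j)` are the same segment, seen from the elements `K` and `L`. -/
def Nbr (K : Fin M.N) (i : Fin 3) (L : Fin M.N) (j : Fin 3) : Prop :=
  M.vert L j = M.vert K (i + 1) ∧ M.vert L (j + 1) = M.vert K i

variable {M}

theorem Nbr.symm {K L : Fin M.N} {i j : Fin 3} (h : M.Nbr K i L j) : M.Nbr L j K i :=
  ⟨h.2.symm, h.1.symm⟩

theorem Nbr.ne {K L : Fin M.N} {i j : Fin 3} (h : M.Nbr K i L j) : K ≠ L := by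
  rintro rfl
  have e1 := vertex_injective (M.area_pos K) h.1
  have e2 := vertex_injective (M.area_pos K) h.2
  rw [e1, fin3_add_one_one] at e2
  exact (fin3_ne i).2.1 e2.symm

theorem Nbr.unique {K L L' : Fin M.N} {i j j' : Fin 3} (h : M.Nbr K i L j) (h' : M.Nbr K i L' j') :
    L = L' ∧ j = j' := by
  have e := M.eq_of_directed_side (h.1.trans h'.1.symm) (h.2.trans h'.2.symm)
  subst e
  exact ⟨rfl, vertex_injective (M.area_pos L) (h.1.trans h'.1.symm)⟩

theorem Nbr.side_eq {K L : Fin M.N} {i j : Fin 3} (h : M.Nbr K i L j) (s : ℝ) :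
    side (M.vert L) j s = side (M.vert K) i (1 - s) := by
  rw [side, side, h.1, h.2, AffineMap.lineMap_apply_one_sub]

variable (M)

/-- A point of `Ω` on an open side lies on the common side of two elements. -/
theorem exists_nbr {K : Fin M.N} {i : Fin 3} {s : ℝ} (hs : s ∈ Ioo (0 : ℝ) 1)
    (hx : side (M.vert K) i s ∈ M.Ω) : ∃ L j, M.Nbr K i L j := by
  have haK := M.area_pos K
  set x := side (M.vert K) i s with hxd
  obtain ⟨k0, k1, k2⟩ := side_bary haK i s
  rw [← hxd] at k0 k1 k2
  -- Off this closed set, a neighbourhood of `x` in `Ω` would be covered by `K` alone, so `x` would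
  -- be interior to `K`, against the vanishing of one of its barycentric coordinates.
  set F : Set Plane := ⋃ L ∈ {L | L ≠ K}, tri (M.vert L) with hF
  have hFc : IsClosed F := (toFinite _).isClosed_biUnion fun L _ => tri_compact.isClosed
  have hxF : x ∈ F := by
    by_contra hn
    have hU : M.Ω ∩ Fᶜ ⊆ tri (M.vert K) := by
      rintro y ⟨hy, hyF⟩
      have := subset_closure hy
      rw [M.cover, mem_iUnion] at this
      obtain ⟨L, hL⟩ := this
      by_cases hLK : L = K
      · exact hLK ▸ hL
      · exact absurd (mem_biUnion (show L ∈ {L | L ≠ K} from hLK) hL) hyF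
    have := interior_maximal hU (M.isOpen_Ω.inter hFc.isOpen_compl) ⟨hx, hn⟩
    exact ((mem_openTri_iff haK).1 this (i + 2)).ne' k2
  simp only [hF, mem_iUnion] at hxF
  obtain ⟨L, hLK, hxL⟩ := hxF
  have hxK : x ∈ tri (M.vert K) := side_mem (Ioo_subset_Icc_self hs)
  obtain ⟨p, hp⟩ : M.vert K i ∈ range (M.vert L) := by
    by_contra hn
    have := M.bary_eq_zero_of_common hn hxK hxL
    linarith [hs.2]
  obtain ⟨q, hq⟩ : M.vert K (i + 1) ∈ range (M.vert L) := by
    by_contra hn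
    have := M.bary_eq_zero_of_common hn hxK hxL
    linarith [hs.1]
  -- Both end points of the side are vertices of `L`. Either `L` traverses the side backwards, as
  -- wanted, or in the same direction as `K`, which would force `L = K`.
  rcases fin3_eq q p with rfl | rfl | rfl
  · exact absurd (hp.symm.trans hq) (vertex_ne haK i)
  · exact ⟨L, q, hq, hp⟩
  · refine absurd (M.eq_of_directed_side (j := q + 2) hp ?_) hLK
    rw [fin3_add_two_one, hq]

/-- A neighbourhood of the common open side of two elements. -/
def nbhd (K : Fin M.N) (i : Fin 3) (L : Fin M.N) (j : Fin 3) : Set Plane :=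
  {x | 0 < bary (M.vert K) i x ∧ 0 < bary (M.vert K) (i + 1) x ∧
    0 < bary (M.vert L) j x ∧ 0 < bary (M.vert L) (j + 1) x}

theorem nbhd_open (K : Fin M.N) (i : Fin 3) (L : Fin M.N) (j : Fin 3) :
    IsOpen (M.nbhd K i L j) := by
  have h : ∀ (a : Fin 3 → Plane) k, IsOpen {x | 0 < bary a k x} := fun a k =>
    isOpen_lt continuous_const (bary_continuous k)
  exact (h _ _).inter ((h _ _).inter ((h _ _).inter (h _ _)))

variable {M}

theorem Nbr.side_mem_nbhd {K L : Fin M.N} {i j : Fin 3} (h : M.Nbr K i L j) {s : ℝ}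
    (hs : s ∈ Ioo (0 : ℝ) 1) : side (M.vert K) i s ∈ M.nbhd K i L j := by
  obtain ⟨k0, k1, -⟩ := side_bary (M.area_pos K) i s
  obtain ⟨l0, l1, -⟩ := side_bary (M.area_pos L) j (1 - s)
  rw [h.side_eq, sub_sub_cancel] at l0 l1
  refine ⟨?_, ?_, ?_, ?_⟩
  · rw [k0]; linarith [hs.2]
  · rw [k1]; exact hs.1
  · rw [l0]; exact hs.1
  · rw [l1]; linarith [hs.2]

/-- The coordinates of `K` and `L` opposite to the common side are negative multiples of each other,
so the sign of one decides between `K`, the side and `L`. -/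
theorem Nbr.mem_of_nbhd {K L : Fin M.N} {i j : Fin 3} (h : M.Nbr K i L j) {x : Plane}
    (hx : x ∈ M.nbhd K i L j) : x ∈ M.el K ∨
      (∃ s ∈ Ioo (0 : ℝ) 1, x = side (M.vert K) i s) ∨ x ∈ M.el L := by
  obtain ⟨h0, h1, h2, h3⟩ := hx
  have haK := M.area_pos K
  have haL := M.area_pos L
  have e2 : ∀ j : Fin 3, j + 2 + 2 = j + 1 := by decide
  have e : bary (M.vert L) (j + 2) x * area2 (M.vert L)
      = -(bary (M.vert K) (i + 2) x * area2 (M.vert K)) := by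
    rw [bary, bary, div_mul_cancel₀ _ haK.ne', div_mul_cancel₀ _ haL.ne', fin3_add_two_one,
      fin3_add_two_one, e2, e2, h.1, h.2]
    simp only [cross, PiLp.sub_apply]
    ring
  rcases lt_trichotomy 0 (bary (M.vert K) (i + 2) x) with hk | hk | hk
  · refine Or.inl ((mem_openTri_iff haK).2 fun k => ?_)
    rcases fin3_eq i k with rfl | rfl | rfl <;> assumption
  · have hx := eq_side_of_bary haK hk.symm
    have hs := bary_sum haK i x
    exact Or.inr (Or.inl ⟨_, ⟨h1, by linarith⟩, hx⟩)
  · refine Or.inr (Or.inr ((mem_openTri_iff haL).2 fun k => ?_))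
    have : 0 < bary (M.vert L) (j + 2) x := by
      have h4 := mul_pos (neg_pos.2 hk) haK
      by_contra h5
      push Not at h5
      have := mul_nonpos_of_nonpos_of_nonneg h5 haL.le
      linarith
    rcases fin3_eq j k with rfl | rfl | rfl <;> assumption

theorem Nbr.nbhd_subset {K L : Fin M.N} {i j : Fin 3} (h : M.Nbr K i L j) :
    M.nbhd K i L j ⊆ M.Ω := by
  refine M.subset_Ω_of_isOpen (M.nbhd_open K i L j) fun x hx => ?_
  rcases h.mem_of_nbhd hx with hK | ⟨s, hs, rfl⟩ | hL
  · exact M.tri_subset K (openTri_subset hK)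
  · exact M.tri_subset K (side_mem (Ioo_subset_Icc_self hs))
  · exact M.tri_subset L (openTri_subset hL)

/-- `Γ` lies in the closure of both subdomains. A point of `Γ` in the open element would make each
of them meet it in a nonempty open set, which has positive area. -/
theorem notMem_el_of_not_isInterface {L : Fin M.N} (hL : ¬ M.IsInterface L) {x : Plane}
    (hx : x ∈ M.Γ) : x ∉ M.el L := fun hxL => by
  have key : ∀ {D : Set Plane}, IsOpen D → ¬ 0 < volume (tri (M.vert L) ∩ D) → x ∉ closure D := by
    intro D hD hv hc
    obtain ⟨y, hyL, hyD⟩ := mem_closure_iff.1 hc _ openTri_open hxL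
    refine hv (lt_of_lt_of_le ((openTri_open.inter hD).measure_pos volume ⟨y, hyL, hyD⟩)
      (measure_mono (inter_subset_inter_left _ openTri_subset)))
  rcases not_and_or.1 hL with h | h
  · exact key M.isOpen_Ωp h (frontier_subset_closure (M.Γ_frontier_p hx))
  · exact key M.isOpen_Ωm h (frontier_subset_closure (M.Γ_frontier_m hx))

theorem injOn_Ico_of_periodic {γ : ℝ → Plane} (hp : Function.Periodic γ 1)
    (hinj : InjOn γ (Ico 0 1)) (t₀ : ℝ) : InjOn γ (Ico t₀ (t₀ + 1)) := by
  intro x hx y hy hxy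
  have hf : ∀ x, γ (Int.fract x) = γ x := fun x => by
    have := hp.sub_zsmul_eq (x := x) ⌊x⌋
    rw [Int.fract]
    simpa using this
  have h := hinj ⟨Int.fract_nonneg x, Int.fract_lt_one x⟩ ⟨Int.fract_nonneg y, Int.fract_lt_one y⟩
    (by rw [hf, hf, hxy])
  obtain ⟨z, hz⟩ := Int.fract_eq_fract.1 h
  have h1 : (-1 : ℝ) < z := by rw [← hz]; linarith [hx.1, hy.2]
  have h2 : (z : ℝ) < 1 := by rw [← hz]; linarith [hx.2, hy.1]
  have h3 : -1 < z := by exact_mod_cast h1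
  have h4 : z < 1 := by exact_mod_cast h2
  have h5 : z = 0 := by omega
  rw [h5, Int.cast_zero] at hz
  linarith

/-- A closed curve that meets the boundary of a closed set in two points, and that stays in the
set near one of them, is contained in the set. -/
theorem range_subset_of_two_crossings {γ : ℝ → Plane} (hγ : Continuous γ)
    (hp : Function.Periodic γ 1) (hinj : InjOn γ (Ico 0 1)) {S : Set Plane} (hS : IsClosed S)
    {b b' : Plane} (hbb : b ≠ b') (hb' : b' ∈ range γ) (hbS : b ∈ S) (hbS' : b' ∈ S)
    (hf : ∀ t, γ t ∈ frontier S → γ t = b ∨ γ t = b') {t₀ : ℝ} (ht₀ : γ t₀ = b)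
    (hloc : ∀ t₁, γ t₁ = b → ∀ᶠ t in 𝓝 t₁, γ t ∈ S) : range γ ⊆ S := by
  have hinj' := injOn_Ico_of_periodic hp hinj t₀
  obtain ⟨t', rfl⟩ := hb'
  obtain ⟨t₁, ht₁, he⟩ := hp.exists_mem_Ico zero_lt_one t' t₀
  rw [he] at hbb hbS' hf
  have hlt : t₀ < t₁ := lt_of_le_of_ne ht₁.1 (by rintro rfl; exact hbb ht₀.symm)
  have ht₀' : t₀ ∈ Ico t₀ (t₀ + 1) := ⟨le_rfl, by linarith⟩
  -- The points `b` and `b'` split the curve into two open arcs that avoid the frontier of `S`. Such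
  -- an arc is connected, so it lies in `S` as soon as one of its points does, and both arcs start
  -- or end at `b`.
  have arc : ∀ u v, t₀ ≤ u → v ≤ t₀ + 1 → (u = t₀ ∧ v = t₁ ∨ u = t₁ ∧ v = t₀ + 1) →
      (∃ t ∈ Ioo u v, γ t ∈ S) → ∀ t ∈ Ioo u v, γ t ∈ S := by
    rintro u v hu hv huv ⟨t, ht, htS⟩
    have hnot : ∀ t ∈ Ioo u v, γ t ∉ frontier S := by
      intro t ht hfr
      have htI : t ∈ Ico t₀ (t₀ + 1) := ⟨hu.trans ht.1.le, ht.2.trans_le hv⟩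
      rcases hf t hfr with h | h
      · have := hinj' htI ht₀' (h.trans ht₀.symm)
        linarith [ht.1]
      · have := hinj' htI ht₁ h
        rcases huv with ⟨h1, h2⟩ | ⟨h1, h2⟩
        · linarith [ht.2]
        · linarith [ht.1]
    have hpre : IsPreconnected (γ '' Ioo u v) := isPreconnected_Ioo.image γ hγ.continuousOn
    have hint : ∀ t ∈ Ioo u v, γ t ∈ S → γ t ∈ interior S := fun t ht hS' => by
      by_contra hn
      exact hnot t ht ⟨subset_closure hS', hn⟩
    have := hpre.subset_left_of_subset_union isOpen_interior hS.isOpen_compl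
      (disjoint_left.2 fun x h1 h2 => h2 (interior_subset h1))
      (by
        rintro _ ⟨r, hr, rfl⟩
        by_cases h : γ r ∈ S
        · exact Or.inl (hint r hr h)
        · exact Or.inr h) ⟨γ t, mem_image_of_mem _ ht, hint t ht htS⟩
    exact fun r hr => interior_subset (this (mem_image_of_mem _ hr))
  have h1 := arc t₀ t₁ le_rfl ht₁.2.le (Or.inl ⟨rfl, rfl⟩) (by
    have hh : ∀ᶠ t in 𝓝[>] t₀, γ t ∈ S := nhdsWithin_le_nhds (hloc t₀ ht₀)
    obtain ⟨t, h, ht⟩ := (hh.and (Ioo_mem_nhdsGT hlt)).exists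
    exact ⟨t, ht, h⟩)
  have h2 := arc t₁ (t₀ + 1) hlt.le le_rfl (Or.inr ⟨rfl, rfl⟩) (by
    have hh : ∀ᶠ t in 𝓝[<] (t₀ + 1), γ t ∈ S :=
      nhdsWithin_le_nhds (hloc (t₀ + 1) (by rw [hp, ht₀]))
    obtain ⟨t, h, ht⟩ := (hh.and (Ioo_mem_nhdsLT ht₁.2)).exists
    exact ⟨t, ht, h⟩)
  rintro _ ⟨r, rfl⟩
  obtain ⟨t, ht, he'⟩ := hp.exists_mem_Ico zero_lt_one r t₀
  rw [he']
  rcases ht.1.eq_or_lt with rfl | h3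
  · rwa [ht₀]
  · rcases lt_trichotomy t t₁ with h4 | rfl | h4
    · exact h1 t ⟨h3, h4⟩
    · exact hbS'
    · exact h2 t ⟨h4, ht.2⟩

/-- The neighbour across a cut side is an interface element. -/
theorem Nbr.isInterface {K L : Fin M.N} {i j : Fin 3} (h : M.Nbr K i L j) (hK : M.IsInterface K)
    {s : ℝ} (hs : s ∈ Ioo (0 : ℝ) 1) (hΓ : side (M.vert K) i s ∈ M.Γ) : M.IsInterface L := by
  by_contra hL
  obtain ⟨γ, hγ, -, -, hp, hinj, hr⟩ := M.Γ_curve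
  obtain ⟨hAB, hfr, -, hsub⟩ := M.cut K hK.1 hK.2
  have hclosed : IsClosed (tri (M.vert K)) := tri_compact.isClosed
  have hAf : M.cutA K ∈ M.Γ ∩ frontier (tri (M.vert K)) := by rw [hfr]; simp
  have hBf : M.cutB K ∈ M.Γ ∩ frontier (tri (M.vert K)) := by rw [hfr]; simp
  set b := side (M.vert K) i s with hb
  have hbf : b ∈ frontier (tri (M.vert K)) :=
    (mem_frontier_iff_side (M.area_pos K)).2 ⟨i, s, Ioo_subset_Icc_self hs, rfl⟩
  have hb2 : b = M.cutA K ∨ b = M.cutB K := by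
    have : b ∈ M.Γ ∩ frontier (tri (M.vert K)) := ⟨hΓ, hbf⟩
    rw [hfr] at this
    simpa using this
  have hf : ∀ t, γ t ∈ frontier (tri (M.vert K)) → γ t = M.cutA K ∨ γ t = M.cutB K := fun t ht => by
    have : γ t ∈ M.Γ ∩ frontier (tri (M.vert K)) := ⟨hr ▸ mem_range_self t, ht⟩
    rw [hfr] at this
    simpa using this
  -- Near `b` there are only `K`, the common side and `L`, and `Γ` does not enter a non-interface
  -- element. So `Γ` stays in `K` near `b`, hence everywhere, contradicting `hsub`.
  have hloc : ∀ t₁, γ t₁ = b → ∀ᶠ t in 𝓝 t₁, γ t ∈ tri (M.vert K) := fun t₁ ht₁ => by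
    have hU : M.nbhd K i L j ∈ 𝓝 (γ t₁) := by
      rw [ht₁]; exact (M.nbhd_open K i L j).mem_nhds (h.side_mem_nbhd hs)
    filter_upwards [hγ.continuous.continuousAt.preimage_mem_nhds hU] with t ht
    rcases h.mem_of_nbhd ht with h1 | ⟨r, hr', h1⟩ | h1
    · exact openTri_subset h1
    · rw [h1]; exact side_mem (Ioo_subset_Icc_self hr')
    · exact absurd h1 (notMem_el_of_not_isInterface hL (hr ▸ mem_range_self t))
  obtain ⟨t₀, ht₀⟩ : b ∈ range γ := hr ▸ hΓ
  refine hsub (hr ▸ ?_)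
  rcases hb2 with h1 | h1
  · exact range_subset_of_two_crossings hγ.continuous hp hinj hclosed (h1 ▸ hAB) (hr ▸ hBf.1)
      (hclosed.frontier_subset hbf) (hclosed.frontier_subset hBf.2)
      (fun t ht => h1 ▸ hf t ht) ht₀ hloc
  · exact range_subset_of_two_crossings hγ.continuous hp hinj hclosed (h1 ▸ hAB.symm) (hr ▸ hAf.1)
      (hclosed.frontier_subset hbf) (hclosed.frontier_subset hAf.2)
      (fun t ht => h1 ▸ (hf t ht).symm) ht₀ hloc

end InterfaceMesh

end IVE

end

noncomputable section

namespace IVE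

open MeasureTheory Set Filter

open scoped ContDiff Topology NNReal

/-! ### Nodes and edges -/

namespace InterfaceMesh

variable (M : InterfaceMesh)

theorem side_injective {a : Fin 3 → Plane} (ha : 0 < area2 a) (i : Fin 3) :
    Function.Injective (side a i) := fun s t h => by
  rw [← (side_bary ha i s).2.1, ← (side_bary ha i t).2.1]
  exact congrArg (bary a (i + 1)) h

theorem side_zero (a : Fin 3 → Plane) (i : Fin 3) : side a i 0 = a i := by simp [side]

theorem side_one (a : Fin 3 → Plane) (i : Fin 3) : side a i 1 = a (i + 1) := by simp [side]

theorem side_eq_of_mem_Ioo {a : Fin 3 → Plane} (ha : 0 < area2 a) {i j : Fin 3} {s t : ℝ}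
    (hs : s ∈ Ioo (0 : ℝ) 1) (h : side a i s = side a j t) :
    i = j ∧ s = t := by
  obtain ⟨k0, k1, k2⟩ := side_bary ha i s
  rw [h] at k0 k1 k2
  rcases fin3_eq i j with rfl | rfl | rfl
  · exact ⟨rfl, side_injective ha _ h⟩
  · have := (side_bary ha (i + 1) t).2.2
    rw [fin3_add_one_two, k0] at this
    linarith [hs.2]
  · have := (side_bary ha (i + 2) t).2.2
    have e2 : ∀ j : Fin 3, j + 2 + 2 = j + 1 := by decide
    rw [e2, k1] at this
    exact absurd this hs.1.ne'

theorem cut_mem_Γ {K : Fin M.N} (hK : M.IsInterface K) {x : Plane}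
    (hx : x ∈ frontier (tri (M.vert K))) : x ∈ M.Γ ↔ x = M.cutA K ∨ x = M.cutB K := by
  have hfr := (M.cut K hK.1 hK.2).2.1
  constructor
  · intro h
    have : x ∈ M.Γ ∩ frontier (tri (M.vert K)) := ⟨h, hx⟩
    rw [hfr] at this
    simpa using this
  · intro h
    have : x ∈ M.Γ ∩ frontier (tri (M.vert K)) := by rw [hfr]; simpa using h
    exact this.1

theorem vertex_mem_nodes (K : Fin M.N) (i : Fin 3) : M.vert K i ∈ M.nodes K :=
  Or.inl (mem_range_self i)

/-- Describes the nodes inside a side through `Γ` instead of the cut points named by `K`; this form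
can be compared between neighbours. -/
theorem side_mem_nodes_iff {K : Fin M.N} {i : Fin 3} {s : ℝ} (hs : s ∈ Ioo (0 : ℝ) 1) :
    side (M.vert K) i s ∈ M.nodes K ↔ M.IsInterface K ∧ side (M.vert K) i s ∈ M.Γ := by
  have ha := M.area_pos K
  have hfr : side (M.vert K) i s ∈ frontier (tri (M.vert K)) :=
    (mem_frontier_iff_side ha).2 ⟨i, s, Ioo_subset_Icc_self hs, rfl⟩
  constructor
  · rintro (⟨j, hj⟩ | ⟨hK, h⟩)
    · exfalso
      have h0 := side_eq_of_mem_Ioo ha (j := j) (t := 0) hs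
        (by rw [side_zero]; exact hj.symm)
      exact hs.1.ne' h0.2
    · exact ⟨hK, (M.cut_mem_Γ hK hfr).2 h⟩
  · rintro ⟨hK, h⟩
    exact Or.inr ⟨hK, (M.cut_mem_Γ hK hfr).1 h⟩

/-- The two cut points lie on different sides, and a point inside a side lies on no other side. -/
theorem interior_node_unique {K : Fin M.N} {i : Fin 3} {s t : ℝ} (hs : s ∈ Ioo (0 : ℝ) 1)
    (ht : t ∈ Ioo (0 : ℝ) 1) (hns : side (M.vert K) i s ∈ M.nodes K)
    (hnt : side (M.vert K) i t ∈ M.nodes K) : s = t := by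
  have ha := M.area_pos K
  obtain ⟨hK, hs'⟩ := (M.side_mem_nodes_iff hs).1 hns
  obtain ⟨-, ht'⟩ := (M.side_mem_nodes_iff ht).1 hnt
  obtain ⟨-, -, ⟨p, q, hpq, hp, hq⟩, -⟩ := M.cut K hK.1 hK.2
  have hfr : ∀ {s}, s ∈ Ioo (0 : ℝ) 1 → side (M.vert K) i s ∈ frontier (tri (M.vert K)) :=
    fun hs => (mem_frontier_iff_side ha).2 ⟨i, _, Ioo_subset_Icc_self hs, rfl⟩
  rw [segment_eq_image_lineMap] at hp hq
  obtain ⟨u, hu, hpu⟩ := hp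
  obtain ⟨v, hv, hqv⟩ := hq
  have hA : ∀ {s}, s ∈ Ioo (0 : ℝ) 1 → side (M.vert K) i s = M.cutA K → i = p := fun hs h =>
    (side_eq_of_mem_Ioo ha hs (h.trans hpu.symm)).1
  have hB : ∀ {s}, s ∈ Ioo (0 : ℝ) 1 → side (M.vert K) i s = M.cutB K → i = q := fun hs h =>
    (side_eq_of_mem_Ioo ha hs (h.trans hqv.symm)).1
  rcases (M.cut_mem_Γ hK (hfr hs)).1 hs' with h1 | h1 <;>
    rcases (M.cut_mem_Γ hK (hfr ht)).1 ht' with h2 | h2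
  · exact side_injective ha i (h1.trans h2.symm)
  · exact absurd ((hA hs h1).symm.trans (hB ht h2)) hpq
  · exact absurd ((hA ht h2).symm.trans (hB hs h1)) hpq
  · exact side_injective ha i (h1.trans h2.symm)

theorem exists_brk (K : Fin M.N) (i : Fin 3) : ∃ θ : ℝ, 0 < θ ∧ θ ≤ 1 ∧
    ∀ s ∈ Ioo (0 : ℝ) 1, side (M.vert K) i s ∈ M.nodes K ↔ s = θ := by
  by_cases h : ∃ s ∈ Ioo (0 : ℝ) 1, side (M.vert K) i s ∈ M.nodes K
  · obtain ⟨θ, hθ, hn⟩ := h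
    refine ⟨θ, hθ.1, hθ.2.le, fun s hs => ⟨fun h => M.interior_node_unique hs hθ h hn, ?_⟩⟩
    rintro rfl
    exact hn
  · push Not at h
    exact ⟨1, one_pos, le_rfl, fun s hs => ⟨fun h' => absurd h' (h s hs), fun h' => absurd h' hs.2.ne⟩⟩

/-- The parameter of the node in the interior of a side, and `1` if there is none. -/
def brk (K : Fin M.N) (i : Fin 3) : ℝ := (M.exists_brk K i).choose

theorem brk_pos (K : Fin M.N) (i : Fin 3) : 0 < M.brk K i := (M.exists_brk K i).choose_spec.1

theorem brk_le (K : Fin M.N) (i : Fin 3) : M.brk K i ≤ 1 := (M.exists_brk K i).choose_spec.2.1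

theorem side_mem_nodes_iff_brk {K : Fin M.N} {i : Fin 3} {s : ℝ} (hs : s ∈ Ioo (0 : ℝ) 1) :
    side (M.vert K) i s ∈ M.nodes K ↔ s = M.brk K i := (M.exists_brk K i).choose_spec.2.2 s hs

theorem brk_mem_nodes (K : Fin M.N) (i : Fin 3) : side (M.vert K) i (M.brk K i) ∈ M.nodes K := by
  rcases (M.brk_le K i).lt_or_eq with h | h
  · exact (M.side_mem_nodes_iff_brk ⟨M.brk_pos K i, h⟩).2 rfl
  · rw [h, side_one]
    exact M.vertex_mem_nodes K _

theorem brk_eq_one {K : Fin M.N} (hK : ¬ M.IsInterface K) (i : Fin 3) : M.brk K i = 1 := by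
  by_contra h
  have hs : M.brk K i ∈ Ioo (0 : ℝ) 1 := ⟨M.brk_pos K i, lt_of_le_of_ne (M.brk_le K i) h⟩
  exact hK ((M.side_mem_nodes_iff hs).1 (M.brk_mem_nodes K i)).1

variable {M}

theorem Nbr.mem_nodes {K L : Fin M.N} {i j : Fin 3} (h : M.Nbr K i L j) {s : ℝ}
    (hs : s ∈ Ioo (0 : ℝ) 1) (hn : side (M.vert K) i s ∈ M.nodes K) :
    side (M.vert K) i s ∈ M.nodes L := by
  obtain ⟨hK, hΓ⟩ := (M.side_mem_nodes_iff hs).1 hn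
  have e := h.side_eq (1 - s)
  rw [sub_sub_cancel] at e
  rw [← e]
  have hs' : 1 - s ∈ Ioo (0 : ℝ) 1 := ⟨by linarith [hs.2], by linarith [hs.1]⟩
  exact (M.side_mem_nodes_iff hs').2 ⟨h.isInterface hK hs hΓ, e ▸ hΓ⟩

/-- Neighbours cut their common side at the same point. -/
theorem Nbr.brk {K L : Fin M.N} {i j : Fin 3} (h : M.Nbr K i L j) :
    (M.brk K i = 1 ∧ M.brk L j = 1) ∨ (M.brk K i < 1 ∧ M.brk L j = 1 - M.brk K i) := by
  have key : ∀ {K L : Fin M.N} {i j : Fin 3}, M.Nbr K i L j → M.brk K i < 1 →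
      M.brk L j = 1 - M.brk K i := by
    intro K L i j h hK
    have hs : M.brk K i ∈ Ioo (0 : ℝ) 1 := ⟨M.brk_pos K i, hK⟩
    have hn := h.mem_nodes hs (M.brk_mem_nodes K i)
    have e := h.side_eq (1 - M.brk K i)
    rw [sub_sub_cancel] at e
    rw [← e] at hn
    exact ((M.side_mem_nodes_iff_brk ⟨by linarith [hs.2], by linarith [hs.1]⟩).1 hn).symm
  rcases (M.brk_le K i).lt_or_eq with h1 | h1
  · exact Or.inr ⟨h1, key h h1⟩
  · refine Or.inl ⟨h1, ?_⟩
    by_contra h2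
    have h3 := key h.symm (lt_of_le_of_ne (M.brk_le L j) h2)
    linarith [M.brk_pos L j]

variable (M)

theorem lineMap_side (a : Fin 3 → Plane) (i : Fin 3) (s t r : ℝ) :
    (AffineMap.lineMap (side a i s) (side a i t) r : Plane) = side a i ((1 - r) * s + r * t) := by
  apply plane_ext <;> simp only [side, lineMap_coord] <;> ring

theorem openSegment_side {a : Fin 3 → Plane} {i : Fin 3} {s t : ℝ} (hst : s < t) :
    openSegment ℝ (side a i s) (side a i t) = side a i '' Ioo s t := by
  rw [openSegment_eq_image_lineMap]
  ext x
  constructor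
  · rintro ⟨r, hr, rfl⟩
    refine ⟨(1 - r) * s + r * t, ⟨?_, ?_⟩, (lineMap_side a i s t r).symm⟩
    · nlinarith [mul_pos hr.1 (sub_pos.2 hst)]
    · nlinarith [mul_pos (sub_pos.2 hr.2) (sub_pos.2 hst)]
  · rintro ⟨u, hu, rfl⟩
    have h0 := sub_pos.2 hst
    refine ⟨(u - s) / (t - s), ⟨div_pos (sub_pos.2 hu.1) h0, ?_⟩, ?_⟩
    · rw [div_lt_one h0]; linarith [hu.2]
    · rw [lineMap_side]
      congr 1
      field_simp
      ring

/-- The edges of an element. -/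
theorem mem_edges_iff {K : Fin M.N} {e : Plane × Plane} : e ∈ M.edges K ↔ ∃ i,
    e = (side (M.vert K) i 0, side (M.vert K) i (M.brk K i)) ∨
    (M.brk K i < 1 ∧ e = (side (M.vert K) i (M.brk K i), side (M.vert K) i 1)) := by
  have ha := M.area_pos K
  constructor
  · rintro ⟨h1, h2, hne, ⟨i, hs1, hs2, hray⟩, hno⟩
    rw [segment_eq_image_lineMap] at hs1 hs2
    obtain ⟨s, hs, hse⟩ := hs1
    obtain ⟨t, ht, hte⟩ := hs2
    change side (M.vert K) i s = e.1 at hse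
    change side (M.vert K) i t = e.2 at hte
    have hst : s < t := by
      have hd : M.vert K (i + 1) - M.vert K i ≠ 0 := sub_ne_zero.2 (vertex_ne ha i).symm
      obtain ⟨r, hr, hre⟩ := hray.symm.exists_nonneg_left hd
      have e : side (M.vert K) i t - side (M.vert K) i s
          = (t - s) • (M.vert K (i + 1) - M.vert K i) := by
        apply plane_ext <;> simp only [side, PiLp.sub_apply, PiLp.smul_apply, lineMap_coord,
          smul_eq_mul] <;> ring
      rw [← hse, ← hte, e] at hre
      have h3 := smul_left_injective ℝ hd hre
      refine lt_of_le_of_ne (by linarith) fun h => hne ?_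
      rw [← hse, ← hte, h]
    have hno' : ∀ r ∈ Ioo s t, side (M.vert K) i r ∉ M.nodes K := fun r hr hn =>
      hno _ hn (by rw [← hse, ← hte, openSegment_side hst]; exact mem_image_of_mem _ hr)
    have hb : M.brk K i ∉ Ioo s t := fun h => hno' _ h (M.brk_mem_nodes K i)
    have hnode : ∀ r ∈ Icc (0 : ℝ) 1, side (M.vert K) i r ∈ M.nodes K →
        r = 0 ∨ r = 1 ∨ r = M.brk K i := fun r hr hn => by
      rcases hr.1.eq_or_lt with h | h
      · exact Or.inl h.symm
      · rcases hr.2.eq_or_lt with h' | h'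
        · exact Or.inr (Or.inl h')
        · exact Or.inr (Or.inr ((M.side_mem_nodes_iff_brk ⟨h, h'⟩).1 hn))
    have hb0 := M.brk_pos K i
    have hb1 := M.brk_le K i
    refine ⟨i, ?_⟩
    have he : e = (side (M.vert K) i s, side (M.vert K) i t) := Prod.ext hse.symm hte.symm
    rcases hnode s hs (hse ▸ h1) with h | h | h
    · left
      rcases hnode t ht (hte ▸ h2) with h' | h' | h'
      · linarith
      · have : M.brk K i = 1 := by
          by_contra hn
          exact hb ⟨by linarith, by rw [h']; exact lt_of_le_of_ne hb1 hn⟩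
        rw [he, h, h', this]
      · rw [he, h, h']
    · linarith [ht.2]
    · right
      have ht1 : t = 1 := by
        rcases hnode t ht (hte ▸ h2) with h' | h' | h'
        · linarith
        · exact h'
        · linarith
      exact ⟨by linarith, by rw [he, h, ht1]⟩
  · have hmk : ∀ (i : Fin 3) (s t : ℝ), s ∈ Icc (0 : ℝ) 1 → t ∈ Icc (0 : ℝ) 1 → s < t →
        side (M.vert K) i s ∈ M.nodes K → side (M.vert K) i t ∈ M.nodes K →
        M.brk K i ∉ Ioo s t → (side (M.vert K) i s, side (M.vert K) i t) ∈ M.edges K := by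
      intro i s t hs ht hst hns hnt hb
      refine ⟨hns, hnt, fun h => hst.ne (side_injective ha i h), ⟨i, ?_, ?_, ?_⟩, ?_⟩
      · rw [segment_eq_image_lineMap]; exact mem_image_of_mem _ hs
      · rw [segment_eq_image_lineMap]; exact mem_image_of_mem _ ht
      · have e : side (M.vert K) i t - side (M.vert K) i s
            = (t - s) • (M.vert K (i + 1) - M.vert K i) := by
          apply plane_ext <;> simp only [side, PiLp.sub_apply, PiLp.smul_apply, lineMap_coord,
            smul_eq_mul] <;> ring
        rw [e]
        exact SameRay.sameRay_nonneg_smul_left _ (sub_nonneg.2 hst.le)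
      · intro r hr hmem
        rw [openSegment_side hst] at hmem
        obtain ⟨u, hu, rfl⟩ := hmem
        have hu' : u ∈ Ioo (0 : ℝ) 1 := ⟨hs.1.trans_lt hu.1, hu.2.trans_le ht.2⟩
        exact hb ((M.side_mem_nodes_iff_brk hu').1 hr ▸ hu)
    have hb0 := M.brk_pos K
    have hb1 := M.brk_le K
    have n0 : ∀ i, side (M.vert K) i 0 ∈ M.nodes K := fun i => by
      rw [side_zero]; exact M.vertex_mem_nodes K i
    have n1 : ∀ i, side (M.vert K) i 1 ∈ M.nodes K := fun i => by
      rw [side_one]; exact M.vertex_mem_nodes K _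
    rintro ⟨i, rfl | ⟨h, rfl⟩⟩
    · exact hmk i _ _ ⟨le_rfl, zero_le_one⟩ ⟨(hb0 i).le, hb1 i⟩ (hb0 i) (n0 i)
        (M.brk_mem_nodes K i) fun h => lt_irrefl _ h.2
    · exact hmk i _ _ ⟨(hb0 i).le, hb1 i⟩ ⟨zero_le_one, le_rfl⟩ h (M.brk_mem_nodes K i) (n1 i)
        fun h => lt_irrefl _ h.1

end InterfaceMesh

end IVE

end

noncomputable section

namespace IVE

open MeasureTheory Set Filter

open scoped ContDiff Topology NNReal Manifold

/-! ### Gluing and splitting over the elements -/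

theorem edgeInt_symm (p q : Plane) (f : Plane → ℝ) : edgeInt p q f = edgeInt q p f := by
  have h := intervalIntegral.integral_comp_sub_left (a := (0 : ℝ)) (b := 1)
    (fun s => f (AffineMap.lineMap p q s)) 1
  simp only [AffineMap.lineMap_apply_one_sub, sub_self, sub_zero] at h
  rw [edgeInt, edgeInt, dist_comm, h]

theorem rightNormal_symm (p q : Plane) (i : Fin 2) : rightNormal q p i = -rightNormal p q i := by
  rw [rightNormal, rightNormal, dist_comm]
  fin_cases i <;> simp <;> ring

theorem exists_smooth_cutoff {C U : Set Plane} (hC : IsCompact C) (hU : IsOpen U) (h : C ⊆ U) :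
    ∃ χ : Plane → ℝ, IsTest U χ ∧ ∀ x ∈ C, χ x = 1 := by
  obtain ⟨K, hK, hCK, hKU⟩ := exists_compact_between hC hU h
  obtain ⟨f, hf0, hf1, -⟩ := exists_contMDiffMap_zero_one_of_isClosed (n := (⊤ : ℕ∞)) 𝓘(ℝ, Plane)
    isOpen_interior.isClosed_compl hC.isClosed (s := (interior K)ᶜ) (t := C)
    (disjoint_left.2 fun x h1 h2 => h1 (hCK h2))
  have hs : Function.support f ⊆ K := fun x hx => by
    by_contra hn
    exact hx (hf0 fun h' => hn (interior_subset h'))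
  refine ⟨f, ⟨f.contMDiff.contDiff, HasCompactSupport.of_support_subset_isCompact hK hs,
    (closure_minimal hs hK.isClosed).trans hKU⟩, fun x hx => hf1 hx⟩

namespace InterfaceMesh

variable (M : InterfaceMesh)

theorem Ω_ae_eq : M.Ω =ᵐ[volume] ⋃ K, M.el K := by
  have h := (ae_restrict_iff' M.isOpen_Ω.measurableSet).1 M.ae_mem_el
  filter_upwards [h] with x hx
  refine propext ⟨fun hΩ => mem_iUnion.2 (hx hΩ), fun hU => ?_⟩
  obtain ⟨K, hK⟩ := mem_iUnion.1 hU
  exact M.el_subset K hK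

theorem integral_Ω {f : Plane → ℝ} (hf : IntegrableOn f M.Ω) :
    ∫ x in M.Ω, f x = ∑ K, ∫ x in M.el K, f x := by
  rw [setIntegral_congr_set M.Ω_ae_eq]
  exact integral_iUnion_fintype M.el_meas (fun K L h => M.el_disjoint h)
    fun K => hf.mono_set (M.el_subset K)

theorem memL2_Ω {F : Type} [NormedAddCommGroup F] {f : Plane → F} (h : ∀ K, MemL2 (M.el K) f) :
    MemL2 M.Ω f := by
  have h1 : MemLp (fun x => ∑ K, (M.el K).indicator f x) 2 volume :=
    memLp_finsetSum _ fun K _ => (memLp_indicator_iff_restrict (M.el_meas K)).2 (h K)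
  refine (h1.restrict M.Ω).ae_eq ?_
  filter_upwards [M.ae_mem_el] with x ⟨K, hK⟩
  rw [Finset.sum_eq_single K]
  · exact indicator_of_mem hK f
  · intro L _ hLK
    exact indicator_of_notMem (fun hL => hLK (M.eq_of_mem_el hL hK)) f
  · intro hn; exact absurd (Finset.mem_univ K) hn

theorem eqAE_Ω {F : Type} {f g : Plane → F} (h : ∀ K, EqAE (M.el K) f g) : EqAE M.Ω f g := by
  have h1 : ∀ K, ∀ᵐ x ∂(volume : Measure Plane), x ∈ M.el K → f x = g x := fun K =>
    (ae_restrict_iff' (M.el_meas K)).1 (h K)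
  filter_upwards [M.ae_mem_el, ae_restrict_of_ae (ae_all_iff.2 h1)] with x ⟨K, hK⟩ hx
  exact hx K hK

open Classical in
/-- The function with given restrictions to the elements. -/
def glue {F : Type} [Zero F] (w : Fin M.N → Plane → F) (x : Plane) : F :=
  if h : ∃ K, x ∈ M.el K then w h.choose x else 0

theorem glue_eq {F : Type} [Zero F] (w : Fin M.N → Plane → F) {K : Fin M.N} {x : Plane}
    (hx : x ∈ M.el K) : M.glue w x = w K x := by
  have h : ∃ K, x ∈ M.el K := ⟨K, hx⟩
  rw [glue, dif_pos h, M.eq_of_mem_el h.choose_spec hx]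

theorem glue_eqAE {F : Type} [Zero F] (w : Fin M.N → Plane → F) (K : Fin M.N) :
    EqAE (M.el K) (w K) (M.glue w) := by
  filter_upwards [ae_restrict_mem (M.el_meas K)] with x hx
  rw [M.glue_eq w hx]

-- Passing to the neighbour across a side is an involution on the pairs of an element and a side,
-- fixing those without neighbour; the terms cancel in its orbits.
open Classical in
theorem sum_sides_eq_zero {f : Fin M.N → Fin 3 → ℝ}
    (h1 : ∀ K i L j, M.Nbr K i L j → f K i + f L j = 0)
    (h2 : ∀ K i, (¬ ∃ L j, M.Nbr K i L j) → f K i = 0) : ∑ K, ∑ i, f K i = 0 := by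
  rw [← Finset.sum_product']
  set σ : Fin M.N × Fin 3 → Fin M.N × Fin 3 := fun p =>
    if h : ∃ q : Fin M.N × Fin 3, M.Nbr p.1 p.2 q.1 q.2 then h.choose else p with hσ
  have hσ1 : ∀ p, (∃ q : Fin M.N × Fin 3, M.Nbr p.1 p.2 q.1 q.2) →
      M.Nbr p.1 p.2 (σ p).1 (σ p).2 := fun p h => by
    simp only [hσ, dif_pos h]
    exact h.choose_spec
  have hσ2 : ∀ p, (¬ ∃ q : Fin M.N × Fin 3, M.Nbr p.1 p.2 q.1 q.2) → σ p = p := fun p h => by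
    simp only [hσ, dif_neg h]
  refine Finset.sum_ninvolution σ (fun p => ?_) (fun p hp => ?_)
    (fun _ => Finset.mem_product.2 ⟨Finset.mem_univ _, Finset.mem_univ _⟩) (fun p => ?_)
  · by_cases h : ∃ q : Fin M.N × Fin 3, M.Nbr p.1 p.2 q.1 q.2
    · exact h1 _ _ _ _ (hσ1 p h)
    · have := h2 p.1 p.2 fun ⟨L, j, hn⟩ => h ⟨(L, j), hn⟩
      rw [hσ2 p h, this, add_zero]
  · by_cases h : ∃ q : Fin M.N × Fin 3, M.Nbr p.1 p.2 q.1 q.2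
    · intro he
      have := (hσ1 p h).ne
      rw [he] at this
      exact this rfl
    · exact absurd (h2 p.1 p.2 fun ⟨L, j, hn⟩ => h ⟨(L, j), hn⟩) hp
  · by_cases h : ∃ q : Fin M.N × Fin 3, M.Nbr p.1 p.2 q.1 q.2
    · have n1 := hσ1 p h
      have n2 := hσ1 (σ p) ⟨p, n1.symm⟩
      obtain ⟨e1, e2⟩ := n1.symm.unique n2
      exact (Prod.ext e1 e2).symm
    · rw [hσ2 p h, hσ2 p h]

/-- By `exists_nbr` the interior of such a side does not meet `Ω`, so test functions in `Ω` vanish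
on it. -/
theorem edgeInt_eq_zero_of_not_nbr {K : Fin M.N} {i : Fin 3} (h : ¬ ∃ L j, M.Nbr K i L j)
    {φ : Plane → ℝ} (hφ : IsTest M.Ω φ) (g : Plane → ℝ) :
    edgeInt (M.vert K i) (M.vert K (i + 1)) (fun x => g x * φ x) = 0 := by
  rw [edgeInt_congr_ae (g := fun _ => 0)]
  · simp [edgeInt]
  · refine ae_Ioo fun s hs => ?_
    change _ * φ (side (M.vert K) i s) = 0
    rw [hφ.eq_zero fun hx => h (M.exists_nbr hs hx), mul_zero]

/-- Green's formulas are summed over the elements; on a common side the normals are opposite, so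
equal traces cancel. -/
theorem isWeakGrad_of_elements {v : Plane → ℝ} {G : Plane → Plane} {g : Fin M.N → Plane → ℝ}
    (hv : ∀ K, IsWeakGrad (M.el K) v G) (ht : ∀ K, IsTrace (M.vert K) v (g K))
    (hm : ∀ K i L j, M.Nbr K i L j → ∀ᵐ s ∂volume.restrict (Ioc (0 : ℝ) 1),
      g K (side (M.vert K) i s) = g L (side (M.vert K) i s)) : IsWeakGrad M.Ω v G := by
  have h1 : MemL2 M.Ω v := M.memL2_Ω fun K => (hv K).1
  have h2 : MemL2 M.Ω G := M.memL2_Ω fun K => (hv K).2.1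
  refine ⟨h1, h2, fun φ hφ i => ?_⟩
  have i1 : IntegrableOn (fun x => v x * pd i φ x) M.Ω := h1.mul_integrable (hφ.pd i).memL2
  have i2 : IntegrableOn (fun x => G x i * φ x) M.Ω := (h2.coord i).mul_integrable hφ.memL2
  have i3 : IntegrableOn (fun x => v x * pd i φ x + G x i * φ x) M.Ω := i1.add i2
  rw [eq_neg_iff_add_eq_zero, ← integral_add i1 i2, M.integral_Ω i3]
  have e : ∀ K, ∫ x in M.el K, (v x * pd i φ x + G x i * φ x) = ∑ j,
      edgeInt (M.vert K j) (M.vert K (j + 1)) (fun x => g K x * φ x)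
        * rightNormal (M.vert K j) (M.vert K (j + 1)) i := fun K => (ht K).formula (hv K) φ hφ.1 i
  simp only [e]
  refine M.sum_sides_eq_zero (fun K k L j hn => ?_) (fun K k hn => ?_)
  · rw [hn.1, hn.2, edgeInt_symm (M.vert K (k + 1)), rightNormal_symm (M.vert K k), mul_neg,
      edgeInt_congr_ae (f := fun x => g L x * φ x) (g := fun x => g K x * φ x), add_neg_cancel]
    filter_upwards [hm K k L j hn] with s hs
    rw [← hs]
  · rw [M.edgeInt_eq_zero_of_not_nbr hn hφ, zero_mul]

/-- Counterclockwise tangents of neighbours are opposite on the common side, and the sign is part of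
the trace. Matching therefore means opposite traces. -/
theorem isWeakCurl_of_elements {w : Plane → Plane} {c : Plane → ℝ} {g : Fin M.N → Plane → ℝ}
    (hw : ∀ K, IsWeakCurl (M.el K) w c) (ht : ∀ K, IsTangTrace (M.vert K) w (g K))
    (hm : ∀ K i L j, M.Nbr K i L j → ∀ᵐ s ∂volume.restrict (Ioc (0 : ℝ) 1),
      g L (side (M.vert K) i s) = -g K (side (M.vert K) i s)) : IsWeakCurl M.Ω w c := by
  have h1 : MemL2 M.Ω w := M.memL2_Ω fun K => (hw K).1
  have h2 : MemL2 M.Ω c := M.memL2_Ω fun K => (hw K).2.1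
  refine ⟨h1, h2, fun φ hφ => ?_⟩
  have i1 : IntegrableOn (fun x => w x 0 * pd 1 φ x - w x 1 * pd 0 φ x) M.Ω :=
    ((h1.coord 0).mul_integrable (hφ.pd 1).memL2).sub ((h1.coord 1).mul_integrable (hφ.pd 0).memL2)
  have i2 : IntegrableOn (fun x => c x * φ x) M.Ω := h2.mul_integrable hφ.memL2
  have i3 : IntegrableOn (fun x => c x * φ x - (w x 0 * pd 1 φ x - w x 1 * pd 0 φ x)) M.Ω :=
    i2.sub i1
  rw [← sub_eq_zero, ← integral_sub i2 i1, M.integral_Ω i3]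
  have e : ∀ K, ∫ x in M.el K, (c x * φ x - (w x 0 * pd 1 φ x - w x 1 * pd 0 φ x)) = ∑ j,
      edgeInt (M.vert K j) (M.vert K (j + 1)) (fun x => g K x * φ x) := fun K =>
    (ht K).formula (hw K) φ hφ.1
  simp only [e]
  refine M.sum_sides_eq_zero (fun K k L j hn => ?_) (fun K k hn => ?_)
  · rw [hn.1, hn.2, edgeInt_symm (M.vert K (k + 1)),
      edgeInt_congr_ae (f := fun x => g L x * φ x) (g := fun x => (-1) * (g K x * φ x)),
      edgeInt_const_mul]
    · ring
    · filter_upwards [hm K k L j hn] with s hs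
      rw [hs]; ring
  · exact M.edgeInt_eq_zero_of_not_nbr hn hφ _

variable {M}

/-- A test function supported in `nbhd` meets no elements except `K` and `L` and vanishes on their
other sides, so the sum of Stokes' formulas reduces to the common side. -/
theorem Nbr.edgeInt_add_eq_zero {K L : Fin M.N} {i j : Fin 3} (h : M.Nbr K i L j)
    {u : Plane → Plane} {c : Plane → ℝ} (hu : IsWeakCurl M.Ω u c) {gK gL : Plane → ℝ}
    (hK : IsTangTrace (M.vert K) u gK) (hL : IsTangTrace (M.vert L) u gL) {φ : Plane → ℝ}
    (hφ : IsTest (M.nbhd K i L j) φ) :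
    edgeInt (M.vert K i) (M.vert K (i + 1)) (fun x => gK x * φ x)
      + edgeInt (M.vert L j) (M.vert L (j + 1)) (fun x => gL x * φ x) = 0 := by
  have hΩm := M.isOpen_Ω.measurableSet
  have hφΩ := hφ.mono h.nbhd_subset
  have i1 : IntegrableOn (fun x => u x 0 * pd 1 φ x - u x 1 * pd 0 φ x) M.Ω :=
    ((hu.1.coord 0).mul_integrable (hφΩ.pd 1).memL2).sub
      ((hu.1.coord 1).mul_integrable (hφΩ.pd 0).memL2)
  have i2 : IntegrableOn (fun x => c x * φ x) M.Ω := hu.2.1.mul_integrable hφΩ.memL2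
  have h0 := hu.2.2 φ hφΩ
  have i3 : IntegrableOn (fun x => c x * φ x - (u x 0 * pd 1 φ x - u x 1 * pd 0 φ x)) M.Ω :=
    i2.sub i1
  rw [← sub_eq_zero, ← integral_sub i2 i1, M.integral_Ω i3] at h0
  rw [Finset.sum_eq_add K L h.ne ?_ (fun hn => absurd (Finset.mem_univ _) hn)
    (fun hn => absurd (Finset.mem_univ _) hn)] at h0
  · have eK : ∫ x in M.el K, (c x * φ x - (u x 0 * pd 1 φ x - u x 1 * pd 0 φ x))
        = ∑ k, edgeInt (M.vert K k) (M.vert K (k + 1)) (fun x => gK x * φ x) :=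
      hK.formula (hu.mono hΩm (M.el_subset K)) φ hφ.1
    have eL : ∫ x in M.el L, (c x * φ x - (u x 0 * pd 1 φ x - u x 1 * pd 0 φ x))
        = ∑ k, edgeInt (M.vert L k) (M.vert L (k + 1)) (fun x => gL x * φ x) :=
      hL.formula (hu.mono hΩm (M.el_subset L)) φ hφ.1
    have hz : ∀ (a : Fin 3 → Plane), 0 < area2 a → ∀ (i k : Fin 3) (g : Plane → ℝ), k ≠ i →
        (∀ x, φ x ≠ 0 → 0 < bary a i x ∧ 0 < bary a (i + 1) x) →
        edgeInt (a k) (a (k + 1)) (fun x => g x * φ x) = 0 := by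
      intro a ha i k g hki hsupp
      rw [edgeInt_congr_ae (g := fun _ => 0)]
      · simp [edgeInt]
      · refine ae_Ioo fun s hs => ?_
        change _ * φ (side a k s) = 0
        by_cases hx : φ (side a k s) = 0
        · rw [hx, mul_zero]
        · exfalso
          obtain ⟨p0, p1⟩ := hsupp _ hx
          have hk := (side_bary ha k s).2.2
          rcases fin3_eq i k with rfl | rfl | rfl
          · exact hki rfl
          · rw [fin3_add_one_two] at hk; exact p0.ne' hk
          · have e2 : ∀ j : Fin 3, j + 2 + 2 = j + 1 := by decide
            rw [e2] at hk; exact p1.ne' hk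
    have hsup : ∀ x, φ x ≠ 0 → x ∈ M.nbhd K i L j := fun x hx => by
      by_contra hn
      exact hx (hφ.eq_zero hn)
    rw [eK, eL, Finset.sum_eq_single i, Finset.sum_eq_single j] at h0
    · exact h0
    · exact fun k _ hk => hz _ (M.area_pos L) j k gL hk fun x hx => ⟨(hsup x hx).2.2.1, (hsup x hx).2.2.2⟩
    · exact fun hn => absurd (Finset.mem_univ _) hn
    · exact fun k _ hk => hz _ (M.area_pos K) i k gK hk fun x hx => ⟨(hsup x hx).1, (hsup x hx).2.1⟩
    · exact fun hn => absurd (Finset.mem_univ _) hn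
  · rintro K' - ⟨hK', hL'⟩
    refine setIntegral_eq_zero_of_forall_eq_zero fun x hx => ?_
    have hx' : x ∉ M.nbhd K i L j := fun hn => by
      rcases h.mem_of_nbhd hn with h1 | ⟨s, hs, rfl⟩ | h1
      · exact hK' (M.eq_of_mem_el hx h1)
      · exact M.notMem_tri_of_mem_el hK' hx (side_mem (Ioo_subset_Icc_self hs))
      · exact hL' (M.eq_of_mem_el hx h1)
    rw [hφ.eq_zero hx', hφ.pd_eq_zero hx', hφ.pd_eq_zero hx']
    ring

/-- The tangential traces of a field in `H(curl; Ω)` from both sides of a common side cancel. -/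
theorem Nbr.tangTrace_eq {K L : Fin M.N} {i j : Fin 3} (h : M.Nbr K i L j)
    {u : Plane → Plane} {c : Plane → ℝ} (hu : IsWeakCurl M.Ω u c) {gK gL : Plane → ℝ}
    (hK : IsTangTrace (M.vert K) u gK) (hL : IsTangTrace (M.vert L) u gL) :
    ∀ᵐ s ∂volume.restrict (Ioc (0 : ℝ) 1),
      gL (side (M.vert K) i s) = -gK (side (M.vert K) i s) := by
  have ha := M.area_pos K
  set f : ℝ → ℝ := fun s => gK (side (M.vert K) i s) + gL (side (M.vert K) i s) with hf
  have hLi : EdgeIntegrable (M.vert K i) (M.vert K (i + 1)) gL := by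
    have h1 := hL.1 j
    rw [h.1, h.2] at h1
    unfold EdgeIntegrable at h1 ⊢
    have h2 := (h1.comp_sub_left 1).symm
    simp only [AffineMap.lineMap_apply_one_sub, sub_self, sub_zero] at h2
    exact h2
  have hfi : IntervalIntegrable f volume 0 1 := IntervalIntegrable.add (hK.1 i) hLi
  have hfo : IntegrableOn f (Ioo (0 : ℝ) 1) := by
    rw [intervalIntegrable_iff_integrableOn_Ioo_of_le zero_le_one] at hfi
    exact hfi
  have key := isOpen_Ioo.ae_eq_zero_of_integral_contDiff_smul_eq_zero
    (hfo.locallyIntegrableOn) (fun ψ hψ hψc hψs => ?_)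
  · rw [restrict_Ioo_eq_restrict_Ioc.symm, ae_restrict_iff' measurableSet_Ioo]
    filter_upwards [key] with s hs hs'
    have := hs hs'
    simp only [hf] at this
    linarith
  · obtain ⟨χ, hχ, hχ1⟩ := exists_smooth_cutoff (C := side (M.vert K) i '' tsupport ψ)
      (hψc.isCompact.image (side_contDiff i).continuous) (M.nbhd_open K i L j) (by
        rintro _ ⟨s, hs, rfl⟩
        exact h.side_mem_nbhd (hψs hs))
    -- The barycentric coordinate is the parameter along the side, so this extends `ψ` off the side;
    -- the cutoff confines it to the neighbourhood of the side.
    set φ : Plane → ℝ := fun x => χ x * ψ (bary (M.vert K) (i + 1) x) with hφ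
    have hφt : IsTest (M.nbhd K i L j) φ :=
      ⟨hχ.1.mul (hψ.comp (bary_contDiff (i + 1))), hχ.2.1.mul_right,
        (tsupport_mul_subset_left (f := χ)).trans hχ.2.2⟩
    have hφs : ∀ s, φ (side (M.vert K) i s) = ψ s := fun s => by
      simp only [hφ]
      rw [(side_bary ha i s).2.1]
      by_cases hs : s ∈ tsupport ψ
      · rw [hχ1 _ (mem_image_of_mem _ hs), one_mul]
      · rw [image_eq_zero_of_notMem_tsupport hs, mul_zero]
    have h0 := h.edgeInt_add_eq_zero hu hK hL hφt
    rw [h.1, h.2, edgeInt_symm (M.vert K (i + 1)),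
      ← edgeInt_add ((hK.1 i).mul_continuous hφt.1.continuous)
        (EdgeIntegrable.mul_continuous hLi hφt.1.continuous), edgeInt] at h0
    have h1 := (mul_eq_zero.1 h0).resolve_left (dist_vertex_pos ha i).ne'
    rw [← setIntegral_eq_integral_of_forall_compl_eq_zero (s := Ioc (0 : ℝ) 1),
      ← intervalIntegral.integral_of_le zero_le_one]
    · refine Eq.trans ?_ h1
      congr 1; funext s
      have := hφs s
      simp only [side] at this
      rw [this]
      simp only [hf, smul_eq_mul]; ring
    · intro s hs
      have : s ∉ tsupport ψ := fun h' => hs (Ioo_subset_Ioc_self (hψs h'))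
      rw [image_eq_zero_of_notMem_tsupport this, zero_smul]

end InterfaceMesh

end IVE

end

noncomputable section

namespace IVE

open MeasureTheory Set Filter

open scoped ContDiff Topology NNReal

variable {a : Fin 3 → Plane}

/-! ### Integrals over parts of a side -/

theorem dist_side (a : Fin 3 → Plane) (i : Fin 3) {s t : ℝ} (h : s ≤ t) :
    dist (side a i s) (side a i t) = (t - s) * dist (a i) (a (i + 1)) := by
  rw [side, side, dist_lineMap_lineMap, dist_comm, Real.dist_eq, abs_of_nonneg (sub_nonneg.2 h)]

theorem edgeInt_side (a : Fin 3 → Plane) (i : Fin 3) {s t : ℝ} (h : s ≤ t) (f : Plane → ℝ) :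
    edgeInt (side a i s) (side a i t) f
      = dist (a i) (a (i + 1)) * ∫ r in s..t, f (side a i r) := by
  have h1 := intervalIntegral.mul_integral_comp_mul_add (a := (0 : ℝ)) (b := 1)
    (f := fun r => f (side a i r)) (t - s) s
  have e : ∀ r : ℝ, (1 - r) * s + r * t = (t - s) * r + s := fun r => by ring
  have e1 : (t - s) * 1 + s = t := by ring
  rw [mul_zero, zero_add, e1] at h1
  rw [edgeInt, dist_side a i h]
  simp only [InterfaceMesh.lineMap_side, e]
  rw [mul_comm (t - s), mul_assoc, h1]

theorem edgeInt_full (a : Fin 3 → Plane) (i : Fin 3) (f : Plane → ℝ) :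
    edgeInt (a i) (a (i + 1)) f = dist (a i) (a (i + 1)) * ∫ r in (0 : ℝ)..1, f (side a i r) :=
  rfl

/-- The function with value `r` up to `θ` and `r'` after `θ`. -/
def step (θ r r' s : ℝ) : ℝ := if s ≤ θ then r else r'

theorem abs_step_le (θ r r' s : ℝ) : |step θ r r' s| ≤ max |r| |r'| := by
  unfold step
  split_ifs
  exacts [le_max_left _ _, le_max_right _ _]

theorem step_intervalIntegrable (θ r r' s t : ℝ) :
    IntervalIntegrable (step θ r r') volume s t := by
  have hm : Measurable (step θ r r') :=
    Measurable.ite measurableSet_Iic measurable_const measurable_const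
  refine (intervalIntegrable_const (c := max |r| |r'|)).mono_fun hm.aestronglyMeasurable
    (Eventually.of_forall fun x => ?_)
  exact (abs_step_le θ r r' x).trans (le_abs_self _)

theorem integral_step_left {θ s : ℝ} (h : 0 ≤ s) (hs : s ≤ θ) (r r' : ℝ) :
    ∫ t in (0 : ℝ)..s, step θ r r' t = s * r := by
  rw [intervalIntegral.integral_congr (g := fun _ => r)]
  · simp
  · intro t ht
    rw [uIcc_of_le h] at ht
    exact if_pos (ht.2.trans hs)

theorem integral_step_right {θ s : ℝ} (h : θ ≤ s) (r r' : ℝ) :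
    ∫ t in θ..s, step θ r r' t = (s - θ) * r' := by
  rw [intervalIntegral.integral_of_le h, setIntegral_congr_fun (g := fun _ => r') measurableSet_Ioc]
  · rw [← intervalIntegral.integral_of_le h]; simp
  · intro t ht
    exact if_neg (not_le.2 ht.1)

theorem SideAE.integral_eq {f g : Plane → ℝ} (h : SideAE a f g) (i : Fin 3) {s t : ℝ} (hs : 0 ≤ s)
    (hst : s ≤ t) (ht : t ≤ 1) :
    ∫ r in s..t, f (side a i r) = ∫ r in s..t, g (side a i r) := by
  rw [intervalIntegral.integral_of_le hst, intervalIntegral.integral_of_le hst]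
  exact integral_congr_ae (ae_restrict_of_ae_restrict_of_subset (Ioc_subset_Ioc hs ht) (h i))

theorem ae_ne (θ : ℝ) : ∀ᵐ s ∂volume.restrict (Ioc (0 : ℝ) 1), s ≠ θ :=
  ae_restrict_of_ae (Measure.ae_ne volume θ)

theorem EdgeIntegrable.part {f : Plane → ℝ} {i : Fin 3} (h : EdgeIntegrable (a i) (a (i + 1)) f)
    {s t : ℝ} (hs : 0 ≤ s) (hst : s ≤ t) (ht : t ≤ 1) :
    IntervalIntegrable (fun r => f (side a i r)) volume s t := by
  refine IntervalIntegrable.mono_set h ?_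
  rw [uIcc_of_le hst, uIcc_of_le zero_le_one]
  exact Icc_subset_Icc hs ht

namespace InterfaceMesh

variable {M : InterfaceMesh}

/-- On an uncut side `brk` is `1` and the second condition is void, so cut and uncut sides are
treated alike from here on. -/
theorem edgeInt_eq_iff {K : Fin M.N} {f g : Plane → ℝ} :
    (∀ e ∈ M.edges K, edgeInt e.1 e.2 f = edgeInt e.1 e.2 g) ↔ ∀ i,
      (∫ s in (0 : ℝ)..M.brk K i, f (side (M.vert K) i s)
        = ∫ s in (0 : ℝ)..M.brk K i, g (side (M.vert K) i s)) ∧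
      (∫ s in M.brk K i..1, f (side (M.vert K) i s)
        = ∫ s in M.brk K i..1, g (side (M.vert K) i s)) := by
  constructor
  · intro h i
    have hd := (dist_vertex_pos (M.area_pos K) i).ne'
    refine ⟨?_, ?_⟩
    · have h1 := h _ (M.mem_edges_iff.2 ⟨i, Or.inl rfl⟩)
      simp only [edgeInt_side _ _ (M.brk_pos K i).le] at h1
      exact mul_left_cancel₀ hd h1
    · rcases (M.brk_le K i).lt_or_eq with hl | he
      · have h1 := h _ (M.mem_edges_iff.2 ⟨i, Or.inr ⟨hl, rfl⟩⟩)
        simp only [edgeInt_side _ _ hl.le] at h1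
        exact mul_left_cancel₀ hd h1
      · rw [he]; simp
  · intro h e he
    obtain ⟨i, rfl | ⟨hl, rfl⟩⟩ := M.mem_edges_iff.1 he
    · simp only [edgeInt_side _ _ (M.brk_pos K i).le, (h i).1]
    · simp only [edgeInt_side _ _ hl.le, (h i).2]

theorem edgeConst_iff {K : Fin M.N} {g : Plane → ℝ} :
    (∀ e ∈ M.edges K, ∃ r : ℝ, ∀ x ∈ openSegment ℝ e.1 e.2, g x = r) ↔ ∀ i, ∃ r r' : ℝ,
      (∀ s ∈ Ioo 0 (M.brk K i), g (side (M.vert K) i s) = r) ∧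
      ∀ s ∈ Ioo (M.brk K i) 1, g (side (M.vert K) i s) = r' := by
  constructor
  · intro h i
    obtain ⟨r, hr⟩ := h _ (M.mem_edges_iff.2 ⟨i, Or.inl rfl⟩)
    rw [openSegment_side (M.brk_pos K i)] at hr
    rcases (M.brk_le K i).lt_or_eq with hl | he
    · obtain ⟨r', hr'⟩ := h _ (M.mem_edges_iff.2 ⟨i, Or.inr ⟨hl, rfl⟩⟩)
      rw [openSegment_side hl] at hr'
      exact ⟨r, r', fun s hs => hr _ (mem_image_of_mem _ hs), fun s hs => hr' _ (mem_image_of_mem _ hs)⟩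
    · refine ⟨r, 0, fun s hs => hr _ (mem_image_of_mem _ hs), fun s hs => ?_⟩
      rw [he] at hs
      exact absurd (hs.1.trans hs.2) (lt_irrefl _)
  · intro h e he
    obtain ⟨i, rfl | ⟨hl, rfl⟩⟩ := M.mem_edges_iff.1 he
    · obtain ⟨r, r', h1, h2⟩ := h i
      refine ⟨r, ?_⟩
      rw [openSegment_side (M.brk_pos K i)]
      rintro _ ⟨s, hs, rfl⟩
      exact h1 s hs
    · obtain ⟨r, r', h1, h2⟩ := h i
      refine ⟨r', ?_⟩
      rw [openSegment_side hl]
      rintro _ ⟨s, hs, rfl⟩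
      exact h2 s hs

/-- A function that is constant on the edges and has vanishing edge integrals vanishes. -/
theorem sideAE_zero_of_edgeConst {K : Fin M.N} {g : Plane → ℝ}
    (hc : ∀ e ∈ M.edges K, ∃ r : ℝ, ∀ x ∈ openSegment ℝ e.1 e.2, g x = r)
    (h0 : ∀ e ∈ M.edges K, edgeInt e.1 e.2 g = 0) : SideAE (M.vert K) g fun _ => 0 := by
  have h1 : ∀ e ∈ M.edges K, edgeInt e.1 e.2 g = edgeInt e.1 e.2 fun _ => 0 := fun e he => by
    rw [h0 e he]; simp [edgeInt]
  rw [edgeInt_eq_iff] at h1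
  rw [edgeConst_iff] at hc
  intro i
  obtain ⟨r, r', hr, hr'⟩ := hc i
  obtain ⟨e1, e2⟩ := h1 i
  have hp := M.brk_pos K i
  have hle := M.brk_le K i
  have hconst : ∀ {s t k : ℝ}, s ≤ t → (∀ x ∈ Ioo s t, g (side (M.vert K) i x) = k) →
      ∫ x in s..t, g (side (M.vert K) i x) = (t - s) * k := fun {s t k} hst hk => by
    rw [intervalIntegral.integral_of_le hst, integral_Ioc_eq_integral_Ioo,
      setIntegral_congr_fun measurableSet_Ioo hk, ← integral_Ioc_eq_integral_Ioo,
      ← intervalIntegral.integral_of_le hst]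
    simp
  rw [hconst hp.le hr, intervalIntegral.integral_zero] at e1
  rw [hconst hle hr', intervalIntegral.integral_zero] at e2
  have hr0 : r = 0 := (mul_eq_zero.1 e1).resolve_left (by linarith)
  filter_upwards [ae_Ioo (P := fun s => s ∈ Ioo (0 : ℝ) 1) (fun s hs => hs), ae_ne (M.brk K i)]
    with s hs hne
  rcases lt_or_gt_of_ne hne with h | h
  · rw [hr s ⟨hs.1, h⟩, hr0]
  · rw [hr' s ⟨h, hs.2⟩]
    exact (mul_eq_zero.1 e2).resolve_left (by linarith [hs.2])

/-! ### The coefficients -/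

theorem mem_Ωhp_of_isInterface {K : Fin M.N} (hK : M.IsInterface K) {x : Plane} (hx : x ∈ M.el K) :
    x ∈ M.Ωhp ↔ 0 < cross (M.cutB K - M.cutA K) (x - M.cutA K) := by
  constructor
  · rintro ⟨L, ⟨-, h⟩ | ⟨hL, -, h⟩⟩
    · obtain rfl := M.eq_of_mem_el hx h.1
      exact h.2
    · obtain rfl := M.eq_of_mem_el hx h
      exact absurd hK hL
  · intro h
    exact ⟨K, Or.inl ⟨hK, hx, h⟩⟩

theorem mem_Ωhp_of_not_isInterface {K : Fin M.N} (hK : ¬ M.IsInterface K) {x : Plane}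
    (hx : x ∈ M.el K) : x ∈ M.Ωhp ↔ 0 < volume (tri (M.vert K) ∩ M.Ωp) := by
  constructor
  · rintro ⟨L, ⟨hL, h⟩ | ⟨-, hv, h⟩⟩
    · obtain rfl := M.eq_of_mem_el hx h.1
      exact absurd hL hK
    · obtain rfl := M.eq_of_mem_el hx h
      exact hv
  · intro h
    exact ⟨K, Or.inr ⟨hK, h, hx⟩⟩

theorem measurableSet_Ωhp : MeasurableSet M.Ωhp := by
  have e : M.Ωhp = ⋃ K, {x | (M.IsInterface K ∧ x ∈ M.elp K) ∨
      (¬ M.IsInterface K ∧ 0 < volume (tri (M.vert K) ∩ M.Ωp) ∧ x ∈ M.el K)} := by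
    ext x; simp [Ωhp]
  rw [e]
  refine MeasurableSet.iUnion fun K => ?_
  have h1 : MeasurableSet (M.elp K) := (M.el_meas K).inter
    (measurableSet_lt measurable_const (cross_line_continuous _ _).measurable)
  refine MeasurableSet.union ?_ ?_
  · exact (MeasurableSet.const _).inter h1
  · exact (MeasurableSet.const _).inter ((MeasurableSet.const _).inter (M.el_meas K))

theorem measurable_αh : Measurable M.αh :=
  Measurable.ite measurableSet_Ωhp measurable_const measurable_const

theorem measurable_βh : Measurable M.βh :=
  Measurable.ite measurableSet_Ωhp measurable_const measurable_const

variable (M) in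
theorem αh_pos (x : Plane) : 0 < M.αh x := by
  unfold αh; split_ifs
  exacts [M.αp_pos, M.αm_pos]

variable (M) in
theorem βh_min_pos : 0 < min M.βp M.βm := lt_min M.βp_pos M.βm_pos

variable (M) in
theorem min_le_βh (x : Plane) : min M.βp M.βm ≤ M.βh x := by
  unfold βh; split_ifs
  exacts [min_le_left _ _, min_le_right _ _]

variable (M) in
theorem βh_le_max (x : Plane) : M.βh x ≤ max M.βp M.βm := by
  unfold βh; split_ifs
  exacts [le_max_left _ _, le_max_right _ _]

theorem αh_of_isInterface {K : Fin M.N} (hK : M.IsInterface K) {x : Plane} (hx : x ∈ M.el K) :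
    M.αh x = if 0 < cross (M.cutB K - M.cutA K) (x - M.cutA K) then M.αp else M.αm := by
  unfold αh
  simp only [mem_Ωhp_of_isInterface hK hx]

theorem αh_of_not_isInterface {K : Fin M.N} (hK : ¬ M.IsInterface K) :
    ∃ k, 0 < k ∧ ∀ x ∈ M.el K, M.αh x = k := by
  by_cases h : 0 < volume (tri (M.vert K) ∩ M.Ωp)
  · exact ⟨M.αp, M.αp_pos, fun x hx => if_pos ((mem_Ωhp_of_not_isInterface hK hx).2 h)⟩
  · exact ⟨M.αm, M.αm_pos, fun x hx => if_neg fun h' => h ((mem_Ωhp_of_not_isInterface hK hx).1 h')⟩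

theorem βh_of_not_isInterface {K : Fin M.N} (hK : ¬ M.IsInterface K) :
    ∃ k, ∀ x ∈ M.el K, M.βh x = k := by
  by_cases h : 0 < volume (tri (M.vert K) ∩ M.Ωp)
  · exact ⟨M.βp, fun x hx => if_pos ((mem_Ωhp_of_not_isInterface hK hx).2 h)⟩
  · exact ⟨M.βm, fun x hx => if_neg fun h' => h ((mem_Ωhp_of_not_isInterface hK hx).1 h')⟩

variable (M) in
theorem integrableOn_αh_inv (K : Fin M.N) : IntegrableOn (fun x => (M.αh x)⁻¹) (M.el K) := by
  have hfin : volume (M.el K) ≠ ⊤ := openTri_volume_lt.ne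
  refine Measure.integrableOn_of_bounded hfin measurable_αh.inv.aestronglyMeasurable
    (M := max M.αp⁻¹ M.αm⁻¹) (Eventually.of_forall fun x => ?_)
  rw [Real.norm_eq_abs, abs_of_pos (inv_pos.2 (M.αh_pos x))]
  unfold αh; split_ifs
  exacts [le_max_left _ _, le_max_right _ _]

variable (M) in
theorem integral_αh_inv_pos (K : Fin M.N) : 0 < ∫ x in M.el K, (M.αh x)⁻¹ := by
  have hpos : 0 < volume (M.el K) := openTri_volume_pos (M.area_pos K)
  rw [setIntegral_pos_iff_support_of_nonneg_ae (Eventually.of_forall fun x =>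
    (inv_pos.2 (M.αh_pos x)).le) (M.integrableOn_αh_inv K)]
  have : Function.support (fun x => (M.αh x)⁻¹) = univ :=
    eq_univ_of_forall fun x => (inv_pos.2 (M.αh_pos x)).ne'
  rw [this, univ_inter]
  exact hpos

end InterfaceMesh

end IVE

end

noncomputable section

namespace IVE

open MeasureTheory Set Filter

open scoped ContDiff Topology NNReal

namespace InterfaceMesh

variable {M : InterfaceMesh} {K : Fin M.N}

/-! ### The local edge spaces -/

theorem MemVeLoc.congr {w w' : Plane → Plane} (h : M.MemVeLoc K w) (e : EqAE (M.el K) w w') :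
    M.MemVeLoc K w' := by
  obtain ⟨⟨c, hc, hc₀⟩, hd, g, hg, hge⟩ := h
  refine ⟨⟨c, hc.congr e (Eventually.of_forall fun _ => rfl), hc₀⟩, hd.congr ?_, g, hg.congr e, hge⟩
  filter_upwards [e] with x hx
  rw [hx]

theorem MemVeLoc.add {w w' : Plane → Plane} (h : M.MemVeLoc K w) (h' : M.MemVeLoc K w') :
    M.MemVeLoc K fun x => w x + w' x := by
  obtain ⟨⟨c, hc, c₀, hc₀⟩, hd, g, hg, hge⟩ := h
  obtain ⟨⟨c', hc', c₀', hc₀'⟩, hd', g', hg', hge'⟩ := h'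
  refine ⟨⟨_, hc.add hc', c₀ + c₀', ?_⟩, (hd.add hd').congr ?_, _, hg.add hg', fun e he => ?_⟩
  · filter_upwards [hc₀, hc₀'] with x h1 h2
    rw [mul_add, h1, h2]
  · exact Eventually.of_forall fun x => (smul_add _ _ _).symm
  · obtain ⟨r, hr⟩ := hge e he
    obtain ⟨r', hr'⟩ := hge' e he
    exact ⟨r + r', fun x hx => by rw [hr x hx, hr' x hx]⟩

theorem MemVeLoc.smul {w : Plane → Plane} (h : M.MemVeLoc K w) (k : ℝ) :
    M.MemVeLoc K fun x => k • w x := by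
  obtain ⟨⟨c, hc, c₀, hc₀⟩, hd, g, hg, hge⟩ := h
  refine ⟨⟨_, hc.smul k, k * c₀, ?_⟩, (hd.smul k).congr ?_, _, hg.smul k, fun e he => ?_⟩
  · filter_upwards [hc₀] with x h1
    rw [mul_left_comm, h1]
  · exact Eventually.of_forall fun x => smul_comm _ _ _
  · obtain ⟨r, hr⟩ := hge e he
    exact ⟨k * r, fun x hx => by rw [hr x hx]⟩

theorem eqAE_of_αh_mul {c : Plane → ℝ} {c₀ : ℝ}
    (h : EqAE (M.el K) (fun x => M.αh x * c x) fun _ => c₀) :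
    EqAE (M.el K) c fun x => c₀ * (M.αh x)⁻¹ := by
  filter_upwards [h] with x hx
  rw [← hx, mul_comm (M.αh x), mul_assoc, mul_inv_cancel₀ (M.αh_pos x).ne', mul_one]

/-- Where the coefficients are constant, Nédélec fields satisfy the conditions imposed on interface
elements. All elements thus share one uniqueness argument. -/
theorem memVeLoc_nedelec (hK : ¬ M.IsInterface K) (p q c : ℝ) : M.MemVeLoc K (nedelec p q c) := by
  have ha := M.area_pos K
  obtain ⟨k, -, hk⟩ := αh_of_not_isInterface hK
  obtain ⟨l, hl⟩ := βh_of_not_isInterface hK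
  obtain ⟨hc, ht⟩ := nedelec_isWeakCurl ha p q c
  refine ⟨⟨_, hc, k * (2 * c), ?_⟩, ((nedelec_isWeakDiv ha p q c).smul l).congr ?_, _, ht, ?_⟩
  · filter_upwards [ae_restrict_mem (M.el_meas K)] with x hx
    rw [hk x hx]
  · filter_upwards [ae_restrict_mem (M.el_meas K)] with x hx
    rw [hl x hx]
  · rw [edgeConst_iff]
    have hT : ∀ i, ∀ s ∈ Ioo (0 : ℝ) 1,
        bdryFun (M.vert K) (tangSide (M.vert K) (nedelec p q c)) (side (M.vert K) i s)
          = tangSide (M.vert K) (nedelec p q c) i 0 := fun i s hs => by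
      rw [bdryFun_side ha _ i hs, tangSide_nedelec, tangSide_nedelec]
    exact fun i => ⟨_, _, fun s hs => hT i s ⟨hs.1, hs.2.trans_le (M.brk_le K i)⟩,
      fun s hs => hT i s ⟨(M.brk_pos K i).trans hs.1, hs.2⟩⟩

theorem MemVe.loc {w : Plane → Plane} (h : M.MemVe w) (K : Fin M.N) : M.MemVeLoc K w := by
  by_cases hK : M.IsInterface K
  · exact h.2.1 K hK
  · obtain ⟨p, q, c, e⟩ := h.2.2 K hK
    exact (memVeLoc_nedelec hK p q c).congr e.symm

theorem edgeInt_congr_sideAE {f g : Plane → ℝ} (h : SideAE (M.vert K) f g) :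
    ∀ e ∈ M.edges K, edgeInt e.1 e.2 f = edgeInt e.1 e.2 g :=
  edgeInt_eq_iff.2 fun i => ⟨h.integral_eq i le_rfl (M.brk_pos K i).le (M.brk_le K i),
    h.integral_eq i (M.brk_pos K i).le (M.brk_le K i) le_rfl⟩

/-- Unisolvence: edgewise constants with zero moments vanish, Stokes gives `c₀ ∫ 1/α_h = 0` and
hence zero curl, and the energy argument applies. -/
theorem MemVeLoc.eqAE_zero {w : Plane → Plane} {g : Plane → ℝ} (h : M.MemVeLoc K w)
    (hg : IsTangTrace (M.vert K) w g) (h0 : ∀ e ∈ M.edges K, edgeInt e.1 e.2 g = 0) :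
    EqAE (M.el K) w fun _ => 0 := by
  have ha := M.area_pos K
  obtain ⟨⟨c, hc, c₀, hc₀⟩, hd, gw, hgw, hge⟩ := h
  have hz := sideAE_zero_of_edgeConst hge fun e he =>
    (edgeInt_congr_sideAE (hgw.unique ha hg) e he).trans (h0 e he)
  have ht := hgw.congr_side hz
  have hf := ht.flux hc
  have e1 := eqAE_of_αh_mul hc₀
  have h1 : c₀ * ∫ x in M.el K, (M.αh x)⁻¹ = 0 := by
    rw [← integral_const_mul]
    refine (integral_congr_eqAE e1).symm.trans (hf.trans ?_)
    simp [edgeInt]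
  have h2 := (mul_eq_zero.1 h1).resolve_right (M.integral_αh_inv_pos K).ne'
  refine eqAE_zero_of_tangTrace_zero ha M.βh_min_pos M.min_le_βh
    (hc.congr (Eventually.of_forall fun _ => rfl) ?_) ht hd
  filter_upwards [e1] with x hx
  rw [hx, h2, zero_mul]

theorem MemVeLoc.eqAE_of_edgeInt_eq {w w' : Plane → Plane} {g g' : Plane → ℝ}
    (h : M.MemVeLoc K w) (h' : M.MemVeLoc K w') (hg : IsTangTrace (M.vert K) w g)
    (hg' : IsTangTrace (M.vert K) w' g')
    (h0 : ∀ e ∈ M.edges K, edgeInt e.1 e.2 g = edgeInt e.1 e.2 g') : EqAE (M.el K) w w' := by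
  have h1 := (h.add (h'.smul (-1))).eqAE_zero (hg.add (hg'.smul (-1))) ?_
  · filter_upwards [h1] with x hx
    simp only [neg_smul, one_smul] at hx
    exact add_neg_eq_zero.1 hx
  · have h2 : ∀ e ∈ M.edges K, edgeInt e.1 e.2 (fun x => g x + -1 * g' x)
        = edgeInt e.1 e.2 fun _ => 0 := by
      rw [edgeInt_eq_iff] at h0 ⊢
      intro i
      have i1 : ∀ {s t : ℝ}, 0 ≤ s → s ≤ t → t ≤ 1 →
          ∫ r in s..t, (g (side (M.vert K) i r) + -1 * g' (side (M.vert K) i r))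
            = (∫ r in s..t, g (side (M.vert K) i r)) + -1 * ∫ r in s..t, g' (side (M.vert K) i r) :=
        fun hs hst ht => by
          rw [intervalIntegral.integral_add (EdgeIntegrable.part (hg.1 i) hs hst ht)
            ((EdgeIntegrable.part (hg'.1 i) hs hst ht).const_mul _),
            intervalIntegral.integral_const_mul]
      have hp := (M.brk_pos K i).le
      have hl := M.brk_le K i
      rw [i1 le_rfl hp hl, i1 hp hl le_rfl, (h0 i).1, (h0 i).2]
      simp
    intro e he
    rw [h2 e he]; simp [edgeInt]

theorem exists_memVeLoc (K : Fin M.N) (r r' : Fin 3 → ℝ) : ∃ w c, M.MemVeLoc K w ∧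
    IsWeakCurl (M.el K) w c ∧ IsTangTrace (M.vert K) w
      (bdryFun (M.vert K) fun i => step (M.brk K i) (r i) (r' i)) ∧
    (¬ M.IsInterface K → ∃ p q c, w = nedelec p q c) := by
  have ha := M.area_pos K
  by_cases hK : M.IsInterface K
  · obtain ⟨w, c₀, hc, hd, ht⟩ := exists_local_field ha (M.cut K hK.1 hK.2).1 M.αp_pos M.αm_pos
      measurable_βh M.βh_min_pos M.min_le_βh M.βh_le_max
      (T := fun i => step (M.brk K i) (r i) (r' i)) (R := ∑ i, max |r i| |r' i|)
      (fun i => step_intervalIntegrable _ _ _ _ _) (fun i s _ => (abs_step_le _ _ _ _).trans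
        (Finset.single_le_sum (f := fun i => max |r i| |r' i|)
          (fun j _ => (abs_nonneg _).trans (le_max_left _ _)) (Finset.mem_univ i)))
    refine ⟨w, _, ⟨⟨_, hc, c₀, ?_⟩, hd, _, ht, ?_⟩, hc, ht, fun h => absurd hK h⟩
    · filter_upwards [ae_restrict_mem (M.el_meas K)] with x hx
      rw [αh_of_isInterface hK hx]
      split_ifs
      exacts [mul_div_cancel₀ _ M.αp_pos.ne', mul_div_cancel₀ _ M.αm_pos.ne']
    · rw [edgeConst_iff]
      refine fun i => ⟨r i, r' i, fun s hs => ?_, fun s hs => ?_⟩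
      · rw [bdryFun_side ha _ i ⟨hs.1, hs.2.trans_le (M.brk_le K i)⟩]
        exact if_pos hs.2.le
      · rw [bdryFun_side ha _ i ⟨(M.brk_pos K i).trans hs.1, hs.2⟩]
        exact if_neg (not_le.2 hs.1)
  -- No side is cut here, so `brk` is `1` and the values `r'` are never attained.
  · obtain ⟨p, q, c, hT⟩ := exists_nedelec ha r
    obtain ⟨hc, ht⟩ := nedelec_isWeakCurl ha p q c
    refine ⟨_, _, memVeLoc_nedelec hK p q c, hc, ht.congr_side fun i => ?_, fun _ => ⟨p, q, c, rfl⟩⟩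
    refine ae_Ioo fun s hs => ?_
    rw [bdryFun_side ha _ i hs, bdryFun_side ha _ i hs, hT, step, M.brk_eq_one hK, if_pos hs.2.le]

/-! ### Edge interpolation -/

variable (M) in
/-- The mean values of `f` over the edges contained in a side. -/
def edgeMean (K : Fin M.N) (f : Plane → ℝ) (i : Fin 3) : ℝ → ℝ :=
  step (M.brk K i) ((∫ r in (0 : ℝ)..M.brk K i, f (side (M.vert K) i r)) / M.brk K i)
    ((∫ r in M.brk K i..1, f (side (M.vert K) i r)) / (1 - M.brk K i))

theorem edgeInt_edgeMean (f : Plane → ℝ) : ∀ e ∈ M.edges K,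
    edgeInt e.1 e.2 (bdryFun (M.vert K) (M.edgeMean K f)) = edgeInt e.1 e.2 f := by
  have ha := M.area_pos K
  refine edgeInt_eq_iff.2 fun i => ?_
  have hp := M.brk_pos K i
  have hl := M.brk_le K i
  have hT : ∀ s t : ℝ, IntervalIntegrable (M.edgeMean K f i) volume s t :=
    step_intervalIntegrable _ _ _
  have e0 := integral_bdryFun ha (M.edgeMean K f) i ⟨hp.le, hl⟩
  have e1 := integral_bdryFun ha (M.edgeMean K f) i ⟨zero_le_one, le_rfl⟩
  have hb : EdgeIntegrable (M.vert K i) (M.vert K (i + 1)) (bdryFun (M.vert K) (M.edgeMean K f)) :=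
    edgeIntegrable_bdryFun ha (hT 0 1)
  rw [← intervalIntegral.integral_add_adjacent_intervals (hT 0 (M.brk K i)) (hT _ 1),
    ← intervalIntegral.integral_add_adjacent_intervals (hb.part le_rfl hp.le hl)
      (hb.part hp.le hl le_rfl), e0] at e1
  have e2 := add_left_cancel e1
  rw [e0, e2]
  unfold edgeMean
  rw [integral_step_left hp.le le_rfl, integral_step_right hl]
  refine ⟨mul_div_cancel₀ _ hp.ne', ?_⟩
  rcases hl.lt_or_eq with h | h
  · exact mul_div_cancel₀ _ (sub_pos.2 h).ne'
  · rw [h]; simp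

/-- Neighbours run through the side in opposite directions but break it at the same point. That
point is excluded because `step` takes the value of the preceding edge there, which is a different
edge for `L`. -/
theorem Nbr.edgeMean_eq {L : Fin M.N} {i j : Fin 3} (h : M.Nbr K i L j) {f f' : Plane → ℝ}
    (hf : ∀ᵐ s ∂volume.restrict (Ioc (0 : ℝ) 1),
      f' (side (M.vert K) i s) = -f (side (M.vert K) i s)) {s : ℝ} (hs : s ∈ Ioo (0 : ℝ) 1)
    (hne : s ≠ M.brk K i) : M.edgeMean L f' j (1 - s) = -M.edgeMean K f i s := by
  have e : ∀ {x y : ℝ}, 0 ≤ x → x ≤ y → y ≤ 1 → ∫ r in x..y, f' (side (M.vert L) j r)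
      = -∫ r in (1 - y)..(1 - x), f (side (M.vert K) i r) := fun {x y} hx hxy hy => by
    simp only [h.side_eq]
    rw [intervalIntegral.integral_comp_sub_left (fun r => f' (side (M.vert K) i r)) 1,
      ← intervalIntegral.integral_neg, intervalIntegral.integral_of_le (by linarith),
      intervalIntegral.integral_of_le (by linarith)]
    exact integral_congr_ae (ae_restrict_of_ae_restrict_of_subset
      (Ioc_subset_Ioc (by linarith) (by linarith)) hf)
  have hp := M.brk_pos K i
  have hl := M.brk_le K i
  have hp' := M.brk_pos L j
  have hl' := M.brk_le L j
  unfold edgeMean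
  rw [e le_rfl hp'.le hl', e hp'.le hl' le_rfl]
  rcases h.brk with ⟨h1, h2⟩ | ⟨h1, h2⟩
  · rw [h1, h2, step, step, if_pos (by linarith [hs.1]), if_pos hs.2.le]
    simp
  · rw [h2]
    rcases lt_or_gt_of_ne hne with h3 | h3
    · rw [step, step, if_neg (by linarith), if_pos h3.le]
      simp [neg_div]
    · rw [step, step, if_pos (by linarith), if_neg (by linarith)]
      simp [neg_div]

/-- The local fields take the edge means of the tangential traces of `u`. These traces cancel across
common sides, so the means do, and the glued field is in `H(curl; Ω)`. -/
theorem exists_isEdgeInterp {u : Plane → Plane} (hu : MemHcurl M.Ω u) (hm : M.HasEdgeMoments u) :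
    ∃ w, M.IsEdgeInterp u w := by
  obtain ⟨c, hc⟩ := hu
  choose g hg using hm
  choose w k hw hk ht hn using fun K => exists_memVeLoc (M := M) K
    (fun i => (∫ r in (0 : ℝ)..M.brk K i, g K (side (M.vert K) i r)) / M.brk K i)
    (fun i => (∫ r in M.brk K i..1, g K (side (M.vert K) i r)) / (1 - M.brk K i))
  have ht' : ∀ K, IsTangTrace (M.vert K) (M.glue w) (bdryFun (M.vert K) (M.edgeMean K (g K))) :=
    fun K => (ht K).congr (M.glue_eqAE w K)
  refine ⟨M.glue w, ⟨⟨M.glue k, M.isWeakCurl_of_elements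
    (fun K => (hk K).congr (M.glue_eqAE w K) (M.glue_eqAE k K)) ht' ?_⟩,
    fun K _ => (hw K).congr (M.glue_eqAE w K), fun K hK => ?_⟩,
    fun K => ⟨g K, _, hg K, ht' K, edgeInt_edgeMean (g K)⟩⟩
  · intro K i L j h
    filter_upwards [ae_Ioo (P := fun s => s ∈ Ioo (0 : ℝ) 1) (fun s hs => hs), ae_ne (M.brk K i)]
      with s hs hne
    have e : side (M.vert K) i s = side (M.vert L) j (1 - s) := by
      rw [h.side_eq, sub_sub_cancel]
    rw [bdryFun_side (M.area_pos K) _ i hs, e,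
      bdryFun_side (M.area_pos L) _ j ⟨by linarith [hs.2], by linarith [hs.1]⟩]
    exact h.edgeMean_eq (h.tangTrace_eq hc (hg K) (hg L)) hs hne
  · obtain ⟨p, q, c, e⟩ := hn K hK
    refine ⟨p, q, c, ?_⟩
    have := (M.glue_eqAE w K).symm
    rw [e] at this
    exact this

theorem IsEdgeInterp.unique {u w w' : Plane → Plane} (h : M.IsEdgeInterp u w)
    (h' : M.IsEdgeInterp u w') : EqAE M.Ω w' w := by
  refine M.eqAE_Ω fun K => ?_
  obtain ⟨g, gw, hg, hgw, e⟩ := h.2 K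
  obtain ⟨g', gw', hg', hgw', e'⟩ := h'.2 K
  refine (h'.1.loc K).eqAE_of_edgeInt_eq (h.1.loc K) hgw' hgw fun s hs => ?_
  rw [e s hs, e' s hs]
  exact edgeInt_congr_sideAE (hg'.unique (M.area_pos K) hg) s hs

/-! ### The projection onto `Q^{α_h}_h` and the curl -/

/-- The condition `α⁺c⁺ = α⁻c⁻` says that `α_h q` is one constant. The cutting line, belonging to
neither part, is a null set. -/
theorem memQLoc_iff {q : Plane → ℝ} :
    M.MemQLoc K q ↔ ∃ k : ℝ, EqAE (M.el K) q fun x => k * (M.αh x)⁻¹ := by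
  by_cases hK : M.IsInterface K
  · have hnull := cross_line_null (M.cut K hK.1 hK.2).1
    have hp : MeasurableSet (M.elp K) := (M.el_meas K).inter
      (measurableSet_lt measurable_const (cross_line_continuous _ _).measurable)
    have hm : MeasurableSet (M.elm K) := (M.el_meas K).inter
      (measurableSet_lt (cross_line_continuous _ _).measurable measurable_const)
    constructor
    · rintro ⟨h, -⟩
      obtain ⟨cp, cm, hc, h1, h2⟩ := h hK
      refine ⟨M.αp * cp, ?_⟩
      filter_upwards [ae_restrict_of_ae ((ae_restrict_iff' hp).1 h1),
        ae_restrict_of_ae ((ae_restrict_iff' hm).1 h2), ae_restrict_of_ae hnull,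
        ae_restrict_mem (M.el_meas K)] with x h3 h4 h5 h6
      rw [αh_of_isInterface hK h6]
      split_ifs with h7
      · rw [h3 ⟨h6, h7⟩]; field_simp [M.αp_pos.ne']
      · rw [h4 ⟨h6, lt_of_le_of_ne (not_lt.1 h7) h5⟩, hc]
        field_simp [M.αm_pos.ne']
    · rintro ⟨k, hk⟩
      refine ⟨fun _ => ⟨k * M.αp⁻¹, k * M.αm⁻¹, ?_, ?_, ?_⟩, fun h => absurd hK h⟩
      · field_simp [M.αp_pos.ne', M.αm_pos.ne']
      · filter_upwards [hk.mono (sep_subset _ _), ae_restrict_mem hp] with x h1 h2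
        rw [h1, αh_of_isInterface hK h2.1, if_pos h2.2]
      · filter_upwards [hk.mono (sep_subset _ _), ae_restrict_mem hm] with x h1 h2
        rw [h1, αh_of_isInterface hK h2.1, if_neg (not_lt.2 h2.2.le)]
  · obtain ⟨l, hl0, hl⟩ := αh_of_not_isInterface hK
    constructor
    · rintro ⟨-, h⟩
      obtain ⟨c, hc⟩ := h hK
      refine ⟨c * l, ?_⟩
      filter_upwards [hc, ae_restrict_mem (M.el_meas K)] with x h1 h2
      rw [h1, hl x h2, mul_assoc, mul_inv_cancel₀ hl0.ne', mul_one]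
    · rintro ⟨k, hk⟩
      refine ⟨fun h => absurd h hK, fun _ => ⟨k * l⁻¹, ?_⟩⟩
      filter_upwards [hk, ae_restrict_mem (M.el_meas K)] with x h1 h2
      rw [h1, hl x h2]

/-- All admissible test functions are multiples of `1/α_h`, which cancels the weight; the projection
merely preserves the integral over each element. -/
theorem isProj_iff {z q : Plane → ℝ} : M.IsProj z q ↔ ∀ K,
    EqAE (M.el K) q fun x => (∫ y in M.el K, z y) / (∫ y in M.el K, (M.αh y)⁻¹) * (M.αh x)⁻¹ := by
  have key : ∀ K k (f v : Plane → ℝ), EqAE (M.el K) v (fun x => k * (M.αh x)⁻¹) →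
      ∫ x in M.el K, M.αh x * f x * v x = k * ∫ x in M.el K, f x := fun K k f v hv => by
    rw [← integral_const_mul]
    refine integral_congr_eqAE ?_
    filter_upwards [hv] with x hx
    rw [hx]
    have := (M.αh_pos x).ne'
    field_simp
  have hI := fun K => (M.integral_αh_inv_pos K).ne'
  refine forall_congr' fun K => ?_
  constructor
  · rintro ⟨h1, h2⟩
    obtain ⟨k, hk⟩ := memQLoc_iff.1 h1
    have h3 := h2 (fun x => 1 * (M.αh x)⁻¹) (memQLoc_iff.2 ⟨1, Eventually.of_forall fun _ => rfl⟩)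
    rw [key K 1 q _ (Eventually.of_forall fun _ => rfl),
      key K 1 z _ (Eventually.of_forall fun _ => rfl), one_mul, one_mul, integral_congr_eqAE hk,
      integral_const_mul] at h3
    rw [← h3, mul_div_cancel_right₀ _ (hI K)]
    exact hk
  · intro h
    refine ⟨memQLoc_iff.2 ⟨_, h⟩, fun v hv => ?_⟩
    obtain ⟨k, hk⟩ := memQLoc_iff.1 hv
    rw [key K k q v hk, key K k z v hk, integral_congr_eqAE h, integral_const_mul,
      div_mul_cancel₀ _ (hI K)]

theorem exists_isProj (z : Plane → ℝ) : ∃ q, M.IsProj z q := by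
  refine ⟨M.glue fun K x => (∫ y in M.el K, z y) / (∫ y in M.el K, (M.αh y)⁻¹) * (M.αh x)⁻¹,
    isProj_iff.2 fun K => (M.glue_eqAE _ K).symm⟩

theorem IsProj.unique {z q q' : Plane → ℝ} (h : M.IsProj z q) (h' : M.IsProj z q') :
    EqAE M.Ω q' q :=
  M.eqAE_Ω fun K => (isProj_iff.1 h' K).trans (isProj_iff.1 h K).symm

theorem sum_edgeInt_eq {f g : Plane → ℝ}
    (hf : ∀ i, EdgeIntegrable (M.vert K i) (M.vert K (i + 1)) f)
    (hg : ∀ i, EdgeIntegrable (M.vert K i) (M.vert K (i + 1)) g)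
    (h : ∀ e ∈ M.edges K, edgeInt e.1 e.2 f = edgeInt e.1 e.2 g) (i : Fin 3) :
    edgeInt (M.vert K i) (M.vert K (i + 1)) f = edgeInt (M.vert K i) (M.vert K (i + 1)) g := by
  obtain ⟨h1, h2⟩ := edgeInt_eq_iff.1 h i
  have hp := (M.brk_pos K i).le
  have hl := M.brk_le K i
  rw [edgeInt_full, edgeInt_full,
    ← intervalIntegral.integral_add_adjacent_intervals ((hf i).part le_rfl hp hl)
      ((hf i).part hp hl le_rfl),
    ← intervalIntegral.integral_add_adjacent_intervals ((hg i).part le_rfl hp hl)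
      ((hg i).part hp hl le_rfl), h1, h2]

/-- On each element the curl of `w` and the projection are both multiples of `1/α_h`. By Stokes and
equality of the edge moments they have the same integral, so they coincide. -/
theorem IsEdgeInterp.curl {u w : Plane → Plane} {c q : Plane → ℝ} (hu : IsWeakCurl M.Ω u c)
    (hw : M.IsEdgeInterp u w) (hq : M.IsProj c q) : IsWeakCurl M.Ω w q := by
  obtain ⟨k, hk⟩ := hw.1.1
  refine hk.congr (Eventually.of_forall fun _ => rfl) (M.eqAE_Ω fun K => ?_)
  have hΩ := M.isOpen_Ω.measurableSet
  obtain ⟨⟨k', hk', c₀, hc₀⟩, -, -⟩ := hw.1.loc K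
  obtain ⟨g, gw, hg, hgw, e⟩ := hw.2 K
  have f1 := hg.flux (hu.mono hΩ (M.el_subset K))
  have f2 := hgw.flux hk'
  rw [Finset.sum_congr rfl fun i _ => sum_edgeInt_eq hgw.1 hg.1 e i, ← f1] at f2
  have e1 := eqAE_of_αh_mul hc₀
  have f3 : c₀ * ∫ x in M.el K, (M.αh x)⁻¹ = ∫ x in M.el K, c x := by
    rw [← integral_const_mul]
    exact (integral_congr_eqAE e1).symm.trans f2
  refine ((hk.mono hΩ (M.el_subset K)).unique isOpen_interior hk').trans
    (e1.trans ((isProj_iff.1 hq K).trans ?_).symm)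
  rw [← f3, mul_div_cancel_right₀ _ (M.integral_αh_inv_pos K).ne']
  exact Eventually.of_forall fun _ => rfl

end InterfaceMesh

end IVE

end

/-! ### Piecewise affine functions on the unit interval, and nodal interpolation -/

noncomputable section

namespace IVE

open MeasureTheory Set Filter

open scoped ContDiff Topology NNReal

/-- The continuous function on `[0, 1]` that is affine on `[0, θ]` and on `[θ, 1]` and has the
values `u₀, u₁, u₂` at `0, θ, 1`. -/
def interp (θ u₀ u₁ u₂ s : ℝ) : ℝ :=
  u₀ + (u₁ - u₀) / θ * min s θ + (u₂ - u₁) / (1 - θ) * max (s - θ) 0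

theorem interp_left {θ u₀ u₁ u₂ s : ℝ} (h : s ≤ θ) :
    interp θ u₀ u₁ u₂ s = u₀ + (u₁ - u₀) / θ * s := by
  rw [interp, min_eq_left h, max_eq_right (sub_nonpos.2 h), mul_zero, add_zero]

theorem interp_right {θ u₀ u₁ u₂ s : ℝ} (h0 : 0 < θ) (h : θ ≤ s) :
    interp θ u₀ u₁ u₂ s = u₁ + (u₂ - u₁) / (1 - θ) * (s - θ) := by
  rw [interp, min_eq_right h, max_eq_left (sub_nonneg.2 h), div_mul_cancel₀ _ h0.ne',
    add_sub_cancel]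

theorem interp_zero {θ u₀ u₁ u₂ : ℝ} (h0 : 0 < θ) : interp θ u₀ u₁ u₂ 0 = u₀ := by
  rw [interp_left h0.le, mul_zero, add_zero]

theorem interp_self {θ u₀ u₁ u₂ : ℝ} (h0 : 0 < θ) : interp θ u₀ u₁ u₂ θ = u₁ := by
  rw [interp_right h0 le_rfl, sub_self, mul_zero, add_zero]

theorem interp_one {θ u₀ u₁ u₂ : ℝ} (h0 : 0 < θ) (h1 : θ ≤ 1) (h : θ = 1 → u₁ = u₂) :
    interp θ u₀ u₁ u₂ 1 = u₂ := by
  rw [interp_right h0 h1]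
  rcases h1.lt_or_eq with h2 | h2
  · rw [div_mul_cancel₀ _ (sub_pos.2 h2).ne', add_sub_cancel]
  · rw [h h2, h2]; simp

theorem interp_lipschitz (θ u₀ u₁ u₂ s t : ℝ) : |interp θ u₀ u₁ u₂ s - interp θ u₀ u₁ u₂ t|
    ≤ (|(u₁ - u₀) / θ| + |(u₂ - u₁) / (1 - θ)|) * |s - t| := by
  have h1 := abs_min_sub_min_le_max s θ t θ
  have h2 := abs_max_sub_max_le_max (s - θ) 0 (t - θ) 0
  rw [sub_self, abs_zero, max_eq_left (abs_nonneg (s - t))] at h1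
  rw [sub_self, abs_zero, sub_sub_sub_cancel_right, max_eq_left (abs_nonneg (s - t))] at h2
  have e : interp θ u₀ u₁ u₂ s - interp θ u₀ u₁ u₂ t = (u₁ - u₀) / θ * (min s θ - min t θ)
      + (u₂ - u₁) / (1 - θ) * (max (s - θ) 0 - max (t - θ) 0) := by
    unfold interp; ring
  rw [e, add_mul]
  refine (abs_add_le _ _).trans (add_le_add ?_ ?_) <;> rw [abs_mul]
  exacts [mul_le_mul_of_nonneg_left h1 (abs_nonneg _), mul_le_mul_of_nonneg_left h2 (abs_nonneg _)]

theorem interp_eq_integral {θ u₀ u₁ u₂ s : ℝ} (h0 : 0 < θ) (hs : 0 ≤ s) :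
    interp θ u₀ u₁ u₂ s
      = u₀ + ∫ t in (0 : ℝ)..s, step θ ((u₁ - u₀) / θ) ((u₂ - u₁) / (1 - θ)) t := by
  rcases le_total s θ with h | h
  · rw [interp_left h, integral_step_left hs h, mul_comm]
  · rw [interp_right h0 h, ← intervalIntegral.integral_add_adjacent_intervals
      (step_intervalIntegrable _ _ _ 0 θ) (step_intervalIntegrable _ _ _ θ s),
      integral_step_left h0.le le_rfl, integral_step_right h, mul_div_cancel₀ _ h0.ne']
    ring

theorem interp_symm {θ u₀ u₁ u₂ s : ℝ} (h0 : 0 < θ) (h1 : θ < 1) :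
    interp (1 - θ) u₂ u₁ u₀ (1 - s) = interp θ u₀ u₁ u₂ s := by
  have h2 : (1 - θ) ≠ 0 := (sub_pos.2 h1).ne'
  rcases le_total s θ with h | h
  · have h3 := h0.ne'
    rw [interp_left h, interp_right (sub_pos.2 h1) (by linarith), sub_sub_cancel]
    field_simp
    ring
  · rw [interp_right h0 h, interp_left (by linarith)]
    field_simp
    ring

/-- Continuous traces are unique. -/
theorem IsTrace.eqOn {a : Fin 3 → Plane} (ha : 0 < area2 a) {v : Plane → ℝ} {g g' : Plane → ℝ}
    (h : IsTrace a v g) (h' : IsTrace a v g') (hg : ContinuousOn g (frontier (tri a)))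
    (hg' : ContinuousOn g' (frontier (tri a))) (i : Fin 3) :
    ∀ s ∈ Icc (0 : ℝ) 1, g (side a i s) = g' (side a i s) := by
  have hm : MapsTo (side a i) (Icc 0 1) (frontier (tri a)) := fun s hs =>
    (mem_frontier_iff_side ha).2 ⟨i, s, hs, rfl⟩
  have hc : ContinuousOn (fun s : ℝ => side a i s) (Icc 0 1) :=
    (side_contDiff i).continuous.continuousOn
  refine Measure.eqOn_Icc_of_ae_eq (volume : Measure ℝ) zero_ne_one ?_ (hg.comp hc hm)
    (hg'.comp hc hm)
  have h1 := h.unique ha h' i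
  rw [← restrict_Ioc_eq_restrict_Icc]
  exact h1

namespace InterfaceMesh

variable {M : InterfaceMesh} {K : Fin M.N}

/-! ### The local nodal spaces -/

theorem side_mem_frontier {i : Fin 3} {s : ℝ} (hs : s ∈ Icc (0 : ℝ) 1) :
    side (M.vert K) i s ∈ frontier (tri (M.vert K)) :=
  (mem_frontier_iff_side (M.area_pos K)).2 ⟨i, s, hs, rfl⟩

theorem brk_mem_Icc (i : Fin 3) : M.brk K i ∈ Icc (0 : ℝ) 1 := ⟨(M.brk_pos K i).le, M.brk_le K i⟩

theorem edgeAffine_iff {g : Plane → ℝ} :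
    (∀ e ∈ M.edges K, ∀ s ∈ Icc (0 : ℝ) 1,
      g (AffineMap.lineMap e.1 e.2 s) = (1 - s) * g e.1 + s * g e.2) ↔
    ∀ i, ∀ s ∈ Icc (0 : ℝ) 1, g (side (M.vert K) i s) = interp (M.brk K i)
      (g (side (M.vert K) i 0)) (g (side (M.vert K) i (M.brk K i))) (g (side (M.vert K) i 1)) s := by
  constructor
  · intro h i s hs
    have hp := M.brk_pos K i
    rcases le_or_gt s (M.brk K i) with hl | hl
    · have h1 := h _ (M.mem_edges_iff.2 ⟨i, Or.inl rfl⟩) (s / M.brk K i)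
        ⟨div_nonneg hs.1 hp.le, (div_le_one hp).2 hl⟩
      simp only [lineMap_side] at h1
      rw [mul_zero, zero_add, div_mul_cancel₀ _ hp.ne'] at h1
      rw [h1, interp_left hl]
      ring
    · have h2 : 0 < 1 - M.brk K i := by linarith [hs.2]
      have h1 := h _ (M.mem_edges_iff.2 ⟨i, Or.inr ⟨sub_pos.1 h2, rfl⟩⟩)
        ((s - M.brk K i) / (1 - M.brk K i))
        ⟨div_nonneg (by linarith) h2.le, (div_le_one h2).2 (by linarith [hs.2])⟩
      have e : (1 - (s - M.brk K i) / (1 - M.brk K i)) * M.brk K i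
          + (s - M.brk K i) / (1 - M.brk K i) * 1 = s := by
        field_simp; ring
      simp only [lineMap_side, e] at h1
      rw [h1, interp_right hp hl.le]
      ring
  · intro h e he s hs
    obtain ⟨i, rfl | ⟨hl, rfl⟩⟩ := M.mem_edges_iff.1 he
    · have hp := M.brk_pos K i
      have hle : s * M.brk K i ≤ M.brk K i := mul_le_of_le_one_left hp.le hs.2
      simp only [lineMap_side, mul_zero, zero_add]
      rw [h i _ ⟨mul_nonneg hs.1 hp.le, hle.trans (M.brk_le K i)⟩, interp_left hle]
      field_simp
      ring
    · have hp := M.brk_pos K i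
      have h2 : 0 < 1 - M.brk K i := sub_pos.2 hl
      have hge : M.brk K i ≤ (1 - s) * M.brk K i + s * 1 := by nlinarith [hs.1]
      simp only [lineMap_side]
      rw [h i _ ⟨hp.le.trans hge, by nlinarith [hs.2]⟩, interp_right hp hge]
      field_simp
      ring

theorem MemVnLoc.congr {v v' : Plane → ℝ} (h : M.MemVnLoc K v) (e : EqAE (M.el K) v v') :
    M.MemVnLoc K v' := by
  obtain ⟨G, g, hG, hd, hg, hr⟩ := h
  exact ⟨G, g, hG.congr e (Eventually.of_forall fun _ => rfl), hd, hg.congr e, hr⟩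

theorem memVnLoc_affine (hK : ¬ M.IsInterface K) (k l m : ℝ) :
    M.MemVnLoc K fun x => k + l * x 0 + m * x 1 := by
  have ha := M.area_pos K
  obtain ⟨b, hb⟩ := βh_of_not_isInterface hK
  refine ⟨_, _, affine_isWeakGrad ha k l m, ((nedelec_isWeakDiv ha l m 0).smul b).congr ?_,
    affine_isTrace ha k l m, (affine_contDiff k l m).continuous.continuousOn, ?_⟩
  · filter_upwards [ae_restrict_mem (M.el_meas K)] with x hx
    rw [hb x hx]
    congr 1
    refine plane_ext ?_ ?_ <;> simp [nedelec]
  · intro e _ s _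
    simp only [lineMap_coord]
    ring

theorem MemVn.loc {v : Plane → ℝ} (h : M.MemVn v) (K : Fin M.N) : M.MemVnLoc K v := by
  by_cases hK : M.IsInterface K
  · exact h.2.1 K hK
  · obtain ⟨k, l, m, e⟩ := h.2.2 K hK
    exact (memVnLoc_affine hK k l m).congr e.symm

theorem exists_side_of_mem_nodes {x : Plane} (hx : x ∈ M.nodes K) :
    ∃ i s, x = side (M.vert K) i s ∧ (s = 0 ∨ s = M.brk K i) := by
  have hf : x ∈ frontier (tri (M.vert K)) := by
    rcases hx with ⟨i, rfl⟩ | ⟨hK, h⟩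
    · rw [← side_zero (M.vert K) i]
      exact side_mem_frontier ⟨le_rfl, zero_le_one⟩
    · have h1 : x ∈ M.Γ ∩ frontier (tri (M.vert K)) := by
        rw [(M.cut K hK.1 hK.2).2.1]
        exact h
      exact h1.2
  obtain ⟨i, s, hs, rfl⟩ := (mem_frontier_iff_side (M.area_pos K)).1 hf
  rcases hs.1.eq_or_lt with h0 | h0
  · exact ⟨i, s, rfl, Or.inl h0.symm⟩
  · rcases hs.2.lt_or_eq with h1 | h1
    · exact ⟨i, s, rfl, Or.inr ((M.side_mem_nodes_iff_brk ⟨h0, h1⟩).1 hx)⟩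
    · exact ⟨i + 1, 0, by rw [h1, side_one, side_zero], Or.inl rfl⟩

/-! ### Nodal interpolation -/

variable (M) in
/-- The boundary values on a side of the nodal interpolant. -/
def nodalSide (K : Fin M.N) (u : Plane → ℝ) (i : Fin 3) : ℝ → ℝ :=
  interp (M.brk K i) (u (M.vert K i)) (u (side (M.vert K) i (M.brk K i))) (u (M.vert K (i + 1)))

theorem nodalSide_zero (u : Plane → ℝ) (i : Fin 3) : M.nodalSide K u i 0 = u (M.vert K i) :=
  interp_zero (M.brk_pos K i)

theorem nodalSide_brk (u : Plane → ℝ) (i : Fin 3) :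
    M.nodalSide K u i (M.brk K i) = u (side (M.vert K) i (M.brk K i)) :=
  interp_self (M.brk_pos K i)

theorem nodalSide_one (u : Plane → ℝ) (i : Fin 3) :
    M.nodalSide K u i 1 = u (M.vert K (i + 1)) :=
  interp_one (M.brk_pos K i) (M.brk_le K i) fun h => by rw [h, side_one]

theorem Nbr.nodalSide_eq {L : Fin M.N} {i j : Fin 3} (h : M.Nbr K i L j) (u : Plane → ℝ) (s : ℝ)
    (hs : s ∈ Icc (0 : ℝ) 1) : M.nodalSide L u j (1 - s) = M.nodalSide K u i s := by
  unfold nodalSide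
  rw [h.side_eq, h.1, h.2]
  rcases h.brk with ⟨h1, h2⟩ | ⟨h1, h2⟩
  · rw [h1, h2, interp_left (by linarith [hs.1]), interp_left hs.2, sub_self, side_zero, side_one]
    ring
  · rw [h2, sub_sub_cancel, interp_symm (M.brk_pos K i) h1]

theorem memVnLoc_of_trace {v : Plane → ℝ} {G : Plane → Plane} {g u : Plane → ℝ}
    (hG : IsWeakGrad (M.el K) v G) (hd : IsWeakDiv (M.el K) (fun x => M.βh x • G x) fun _ => 0)
    (hg : IsTrace (M.vert K) v g) (hgc : Continuous g)
    (h : ∀ i, ∀ s ∈ Icc (0 : ℝ) 1, g (side (M.vert K) i s) = M.nodalSide K u i s) :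
    M.MemVnLoc K v := by
  refine ⟨G, g, hG, hd, hg, hgc.continuousOn, edgeAffine_iff.2 fun i s hs => ?_⟩
  rw [h i s hs, h i 0 ⟨le_rfl, zero_le_one⟩, h i 1 ⟨zero_le_one, le_rfl⟩, h i _ (brk_mem_Icc i),
    nodalSide_zero, nodalSide_brk, nodalSide_one]
  rfl

theorem exists_memVnLoc (K : Fin M.N) (u : Plane → ℝ) : ∃ v G g, M.MemVnLoc K v ∧
    IsWeakGrad (M.el K) v G ∧ IsTrace (M.vert K) v g ∧ Continuous g ∧
    (∀ i, ∀ s ∈ Icc (0 : ℝ) 1, g (side (M.vert K) i s) = M.nodalSide K u i s) ∧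
    (¬ M.IsInterface K → ∃ k l m : ℝ, v = fun x => k + l * x 0 + m * x 1) := by
  have ha := M.area_pos K
  by_cases hK : M.IsInterface K
  · set C : Fin 3 → ℝ := fun i =>
      |(u (side (M.vert K) i (M.brk K i)) - u (M.vert K i)) / M.brk K i|
        + |(u (M.vert K (i + 1)) - u (side (M.vert K) i (M.brk K i))) / (1 - M.brk K i)| with hC
    have hC0 : ∀ i, 0 ≤ C i := fun i => add_nonneg (abs_nonneg _) (abs_nonneg _)
    obtain ⟨v, G, g, hG, hd, hg, hgc, hgs⟩ := exists_local_potential ha (b := M.βh) measurable_βh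
      M.βh_min_pos M.min_le_βh M.βh_le_max (h := M.nodalSide K u) (C := ∑ i, C i)
      (Finset.sum_nonneg fun i _ => hC0 i)
      (fun i s _ t _ => (interp_lipschitz _ _ _ _ s t).trans (mul_le_mul_of_nonneg_right
        (Finset.single_le_sum (fun j _ => hC0 j) (Finset.mem_univ i)) (abs_nonneg _)))
      (fun i => by rw [nodalSide_zero, nodalSide_one]) (y := fun _ => 0)
      (memL2_of_continuous continuousOn_const)
    simp only [zero_add] at hd
    exact ⟨v, G, g, memVnLoc_of_trace hG hd hg hgc hgs, hG, hg, hgc, hgs, fun h => absurd hK h⟩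
  · obtain ⟨k, l, m, hr⟩ := exists_affine ha fun i => u (M.vert K i)
    refine ⟨_, _, _, memVnLoc_affine hK k l m, affine_isWeakGrad ha k l m, affine_isTrace ha k l m,
      (affine_contDiff k l m).continuous, fun i s hs => ?_, fun _ => ⟨k, l, m, rfl⟩⟩
    unfold nodalSide
    rw [M.brk_eq_one hK, interp_left hs.2, side_one, ← hr i, ← hr (i + 1)]
    simp only [side, lineMap_coord]
    ring

theorem exists_isNodalInterp (u : Plane → ℝ) : ∃ v, M.IsNodalInterp u v := by
  choose v G g hv hG hg hgc hgs hn using fun K => exists_memVnLoc (M := M) K u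
  have ht : ∀ K, IsTrace (M.vert K) (M.glue v) (g K) := fun K => (hg K).congr (M.glue_eqAE v K)
  refine ⟨M.glue v, ⟨⟨M.glue G, M.isWeakGrad_of_elements
    (fun K => (hG K).congr (M.glue_eqAE v K) (M.glue_eqAE G K)) ht ?_⟩,
    fun K _ => (hv K).congr (M.glue_eqAE v K), fun K hK => ?_⟩,
    fun K => ⟨g K, ht K, (hgc K).continuousOn, fun x hx => ?_⟩⟩
  · intro K i L j h
    refine ae_Ioo fun s hs => ?_
    have e : side (M.vert K) i s = side (M.vert L) j (1 - s) := by
      rw [h.side_eq, sub_sub_cancel]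
    rw [hgs K i s (Ioo_subset_Icc_self hs), e,
      hgs L j (1 - s) ⟨by linarith [hs.2], by linarith [hs.1]⟩,
      h.nodalSide_eq u s (Ioo_subset_Icc_self hs)]
  · obtain ⟨k, l, m, e⟩ := hn K hK
    refine ⟨k, l, m, ?_⟩
    have := (M.glue_eqAE v K).symm
    rw [e] at this
    exact this
  · obtain ⟨i, s, rfl, rfl | rfl⟩ := exists_side_of_mem_nodes hx
    · rw [hgs K i 0 ⟨le_rfl, zero_le_one⟩, nodalSide_zero, side_zero]
    · rw [hgs K i _ (brk_mem_Icc i), nodalSide_brk]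

/-- The space provides an edgewise affine trace, the interpolation condition one with the nodal
values. Continuous traces are unique, so the two agree on the boundary and are determined by `u`. -/
theorem IsNodalInterp.exists_trace {u v : Plane → ℝ} (h : M.IsNodalInterp u v) (K : Fin M.N) :
    ∃ G g, IsWeakGrad (M.el K) v G ∧ IsWeakDiv (M.el K) (fun x => M.βh x • G x) (fun _ => 0) ∧
      IsTrace (M.vert K) v g ∧
      ∀ i, ∀ s ∈ Icc (0 : ℝ) 1, g (side (M.vert K) i s) = M.nodalSide K u i s := by
  obtain ⟨G, g, hG, hd, hg, hgc, hga⟩ := h.1.loc K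
  obtain ⟨g', hg', hgc', hn⟩ := h.2 K
  refine ⟨G, g, hG, hd, hg, fun i s hs => ?_⟩
  have e := hg.eqOn (M.area_pos K) hg' hgc hgc' i
  rw [edgeAffine_iff.1 hga i s hs, e 0 ⟨le_rfl, zero_le_one⟩, e 1 ⟨zero_le_one, le_rfl⟩,
    e _ (brk_mem_Icc i), hn _ (M.brk_mem_nodes K i), side_zero, side_one,
    hn _ (M.vertex_mem_nodes K i), hn _ (M.vertex_mem_nodes K (i + 1))]
  rfl

/-- On each element the difference has zero trace, so its gradient has zero tangential trace and
vanishes by the energy argument; then the difference itself vanishes. -/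
theorem IsNodalInterp.unique {u v v' : Plane → ℝ} (h : M.IsNodalInterp u v)
    (h' : M.IsNodalInterp u v') : EqAE M.Ω v' v := by
  refine M.eqAE_Ω fun K => ?_
  have ha := M.area_pos K
  obtain ⟨G, g, hG, hd, hg, hs⟩ := h.exists_trace K
  obtain ⟨G', g', hG', hd', hg', hs'⟩ := h'.exists_trace K
  have kG := hG'.add (hG.smul (-1))
  have kd : IsWeakDiv (M.el K) (fun x => M.βh x • (G' x + (-1 : ℝ) • G x)) fun _ => 0 :=
    (hd'.add (hd.smul (-1))).congr (Eventually.of_forall fun x => by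
      change _ = M.βh x • (G' x + (-1 : ℝ) • G x)
      rw [smul_add, smul_comm (M.βh x)])
  have kg := (hg'.add (hg.smul (-1))).congr_side (g' := fun _ => 0) fun i => ae_Ioo fun s hs₀ => by
    change g' (side (M.vert K) i s) + -1 * g (side (M.vert K) i s) = 0
    rw [hs' i s (Ioo_subset_Icc_self hs₀), hs i s (Ioo_subset_Icc_self hs₀)]
    ring
  have kt := isTangTrace_grad (τ := fun _ => 0) ha kG kg
    (fun i => EdgeIntegrable.of_continuousOn continuousOn_const) (fun i s _ => by simp)
  have kz := eqAE_zero_of_tangTrace_zero ha M.βh_min_pos M.min_le_βh kG.curl kt kd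
  have kv := eqAE_zero_of_trace_zero (kG.congr (Eventually.of_forall fun _ => rfl) kz) kg
  filter_upwards [kv] with x hx
  linarith

/-! ### The gradient of the nodal interpolant -/

/-- The discrete gradient lies in the edge space because the derivative of an edgewise affine trace
is edgewise constant. Its edge moments and those of `G` are both differences of values of `u` at the
same nodes. -/
theorem IsNodalInterp.isEdgeInterp_grad {u v : Plane → ℝ} {G H : Plane → Plane}
    (h : M.IsNodalInterp u v) (hu : IsWeakGrad M.Ω u G) (huc : ContinuousOn u (closure M.Ω))
    (hm : M.HasEdgeMoments G) (hH : IsWeakGrad M.Ω v H) : M.IsEdgeInterp G H := by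
  have hΩ := M.isOpen_Ω.measurableSet
  have key : ∀ K, ∃ τ, IsTangTrace (M.vert K) H τ ∧
      IsWeakDiv (M.el K) (fun x => M.βh x • H x) (fun _ => 0) ∧
      (∀ e ∈ M.edges K, ∃ r : ℝ, ∀ x ∈ openSegment ℝ e.1 e.2, τ x = r) ∧
      ∀ i, ∀ s ∈ Icc (0 : ℝ) 1, M.nodalSide K u i s = u (M.vert K i)
        + dist (M.vert K i) (M.vert K (i + 1)) * ∫ t in (0 : ℝ)..s, τ (side (M.vert K) i t) := by
    intro K
    have ha := M.area_pos K
    obtain ⟨G₀, g, hG₀, hd, hg, hs⟩ := h.exists_trace K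
    have eH := hG₀.unique isOpen_interior (hH.mono hΩ (M.el_subset K))
    set d : Fin 3 → ℝ := fun i => dist (M.vert K i) (M.vert K (i + 1)) with hd'
    set r : Fin 3 → ℝ := fun i => (u (side (M.vert K) i (M.brk K i)) - u (M.vert K i)) / M.brk K i
    set r' : Fin 3 → ℝ := fun i =>
      (u (M.vert K (i + 1)) - u (side (M.vert K) i (M.brk K i))) / (1 - M.brk K i)
    -- The derivative of the nodal boundary values; `(d i)⁻¹` converts the parameter of the side to
    -- arc length.
    set T : Fin 3 → ℝ → ℝ := fun i s => (d i)⁻¹ * step (M.brk K i) (r i) (r' i) s with hT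
    have hprim : ∀ i, ∀ s ∈ Icc (0 : ℝ) 1, M.nodalSide K u i s = u (M.vert K i)
        + d i * ∫ t in (0 : ℝ)..s, bdryFun (M.vert K) T (side (M.vert K) i t) := fun i s hs => by
      rw [integral_bdryFun ha T i hs]
      simp only [hT]
      rw [intervalIntegral.integral_const_mul, mul_inv_cancel_left₀ (dist_vertex_pos ha i).ne']
      exact interp_eq_integral (M.brk_pos K i) hs.1
    have ht : IsTangTrace (M.vert K) G₀ (bdryFun (M.vert K) T) :=
      isTangTrace_grad ha hG₀ hg (fun i => edgeIntegrable_bdryFun ha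
        ((step_intervalIntegrable _ _ _ _ _).const_mul _)) fun i s hs₀ => by
          have h0 := hs i 0 ⟨le_rfl, zero_le_one⟩
          rw [side_zero, nodalSide_zero] at h0
          rw [hs i s hs₀, h0]
          exact hprim i s hs₀
    refine ⟨_, ht.congr eH, hd.congr ?_, ?_, hprim⟩
    · filter_upwards [eH] with x hx
      rw [hx]
    · rw [edgeConst_iff]
      refine fun i => ⟨(d i)⁻¹ * r i, (d i)⁻¹ * r' i, fun s hs => ?_, fun s hs => ?_⟩
      · rw [bdryFun_side ha _ i ⟨hs.1, hs.2.trans_le (M.brk_le K i)⟩]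
        simp only [hT]
        rw [step, if_pos hs.2.le]
      · rw [bdryFun_side ha _ i ⟨(M.brk_pos K i).trans hs.1, hs.2⟩]
        simp only [hT]
        rw [step, if_neg (not_le.2 hs.1)]
  refine ⟨⟨⟨_, hH.curl⟩, fun K _ => ?_, fun K hK => ?_⟩, fun K => ?_⟩
  · obtain ⟨τ, ht, hd, hc, -⟩ := key K
    refine ⟨⟨_, (hH.mono hΩ (M.el_subset K)).curl, 0, Eventually.of_forall fun x => ?_⟩, hd, τ, ht, hc⟩
    exact mul_zero _
  · obtain ⟨k, l, m, e⟩ := h.1.2.2 K hK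
    refine ⟨l, m, 0, ?_⟩
    have e1 := ((hH.mono hΩ (M.el_subset K)).congr e (Eventually.of_forall fun _ => rfl)).unique
      isOpen_interior (affine_isWeakGrad (M.area_pos K) k l m)
    filter_upwards [e1] with x hx
    rw [hx]
    simp
  · have ha := M.area_pos K
    obtain ⟨τ, ht, -, -, hp⟩ := key K
    obtain ⟨g, hg⟩ := hm K
    refine ⟨g, τ, hg, ht, edgeInt_eq_iff.2 fun i => ?_⟩
    have huK := huc.mono (M.tri_subset K)
    have hG := hu.mono hΩ (M.el_subset K)
    -- By continuity `u` is its own trace, hence a primitive of the tangential trace of `G`.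
    -- Comparing with `hp` at the break point and at the end of the side gives the two moment
    -- identities.
    have hq := trace_eq_primitive ha hG (isTrace_of_continuousOn ha huK hG) hg i
      (huK.comp (side_contDiff i).continuous.continuousOn fun s hs => side_mem hs)
    have hd := (dist_vertex_pos ha i).ne'
    have hb := brk_mem_Icc (K := K) i
    have h1 : (1 : ℝ) ∈ Icc (0 : ℝ) 1 := ⟨zero_le_one, le_rfl⟩
    have p1 := hp i _ hb
    have p2 := hp i 1 h1
    have q1 := hq _ hb
    have q2 := hq 1 h1
    rw [nodalSide_brk, q1] at p1
    rw [side_one] at q2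
    rw [nodalSide_one, q2] at p2
    have e1 := (mul_left_cancel₀ hd (add_left_cancel p1)).symm
    have e2 := (mul_left_cancel₀ hd (add_left_cancel p2)).symm
    refine ⟨e1, ?_⟩
    rw [← intervalIntegral.integral_add_adjacent_intervals
      (EdgeIntegrable.part (ht.1 i) le_rfl hb.1 hb.2) (EdgeIntegrable.part (ht.1 i) hb.1 hb.2 le_rfl),
      ← intervalIntegral.integral_add_adjacent_intervals
      (EdgeIntegrable.part (hg.1 i) le_rfl hb.1 hb.2) (EdgeIntegrable.part (hg.1 i) hb.1 hb.2 le_rfl),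
      e1] at e2
    exact add_left_cancel e2

end InterfaceMesh

end IVE

end

/-! ### The commuting diagram -/

theorem lemma3p5 (M : IVE.InterfaceMesh) :
    (∀ (u : IVE.Plane → ℝ) (G : IVE.Plane → IVE.Plane),
      M.MemH2β u → ContinuousOn u (closure M.Ω) →
      IVE.IsWeakGrad M.Ω u G → M.HasEdgeMoments G →
        (∃ uI, M.IsNodalInterp u uI ∧ ∀ v, M.IsNodalInterp u v → IVE.EqAE M.Ω v uI) ∧
        (∃ w, M.IsEdgeInterp G w ∧ ∀ w', M.IsEdgeInterp G w' → IVE.EqAE M.Ω w' w) ∧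
        (∀ uI w, M.IsNodalInterp u uI → M.IsEdgeInterp G w → IVE.IsWeakGrad M.Ω uI w)) ∧
    (∀ (u : IVE.Plane → IVE.Plane) (c : IVE.Plane → ℝ),
      M.MemH1curlαβ u → IVE.IsWeakCurl M.Ω u c → M.HasEdgeMoments u →
        (∃ w, M.IsEdgeInterp u w ∧ ∀ w', M.IsEdgeInterp u w' → IVE.EqAE M.Ω w' w) ∧
        (∃ q, M.IsProj c q ∧ ∀ q', M.IsProj c q' → IVE.EqAE M.Ω q' q) ∧
        (∀ w q, M.IsEdgeInterp u w → M.IsProj c q → IVE.IsWeakCurl M.Ω w q)) := by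
  refine ⟨fun u G _ huc hu hm => ⟨?_, ?_, fun uI w hI hw => ?_⟩,
    fun u c _ hu hm => ⟨?_, ?_, fun w q hw hq => hw.curl hu hq⟩⟩
  · obtain ⟨v, hv⟩ := IVE.InterfaceMesh.exists_isNodalInterp (M := M) u
    exact ⟨v, hv, fun v' hv' => hv.unique hv'⟩
  · obtain ⟨w, hw⟩ := IVE.InterfaceMesh.exists_isEdgeInterp ⟨_, hu.curl⟩ hm
    exact ⟨w, hw, fun w' hw' => hw.unique hw'⟩
  -- The weak gradient `H` of the nodal interpolant is an edge interpolant of `G`, so it agrees with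
  -- `w` by uniqueness.
  · obtain ⟨H, hH⟩ := hI.1.1
    exact hH.congr (Filter.Eventually.of_forall fun _ => rfl)
      (hw.unique (hI.isEdgeInterp_grad hu huc hm hH))
  · obtain ⟨w, hw⟩ := IVE.InterfaceMesh.exists_isEdgeInterp ⟨_, hu⟩ hm
    exact ⟨w, hw, fun w' hw' => hw.unique hw'⟩
  · obtain ⟨q, hq⟩ := IVE.InterfaceMesh.exists_isProj (M := M) c
    exact ⟨q, hq, fun q' hq' => hq.unique hq'⟩
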